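/- **Conventions.** $\tau$ is in the upper half-plane $\mathbb H$, $y=\pi\,\mathrm{Im}\,\tau$; $k,k_i$ run over even integers $\ge 4$ and $0\le j_i\le k_i-2$; $\mathrm G_k(\tau)=\sum_{(m,n)\neq(0,0)}(m\tau+n)^{-k}$; $\Delta$ runs over the normalised Hecke eigenforms among the cusp forms of level one, and for $\Delta$ of weight $k$ also $0\le j\le k-2$. For functions $a,b$ on $\mathbb H$, $\int_\tau^{i\infty}(a\,d\tau+b\,d\bar\tau)$ denotes the function $K$ with $dK=-(a\,d\tau+b\,d\bar\tau)$ for which there is a polynomial $P$ with $P(0)=0$ and $K(it)-P(t)\to0$ as $t\to\infty$ (unique if it exists; $\int_{\bar\tau}^{-i\infty}\bar h\,d\bar\tau$ is the case $a=0$, $b=\bar h$). Put $$\nu[j;k]=(2\pi i)^{1+j-k}\tau^j\mathrm G_k\,d\tau,\qquad \nu[j;\Delta]=(2\pi i)^{1+j}\tau^j\Delta\,d\tau,$$ $$\mathcal E[j_1\ldots j_\ell;\tau]=\int_\tau^{i\infty}\nu[j_\ell](\tau_\ell)\,\mathcal E[j_1\ldots j_{\ell-1};\tau_\ell],\qquad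 \widetilde{\mathcal E}[j_1\ldots j_\ell]=(-1)^{j_1+\cdots+j_\ell}\,\overline{\mathcal E[j_1\ldots j_\ell]},$$ where each $j_i$ carries its lower label $k_i$ or $\Delta$. **Generating series.** In non-commuting letters $e_k^{(j)}$ let $W[j_1\ldots j_\ell;k_1\ldots k_\ell]=\prod_i\frac{(-1)^{j_i}(k_i-1)}{j_i!}\,e_{k_1}^{(j_1)}\cdots e_{k_\ell}^{(j_\ell)}$, and let $\mathrm{ad}_{e_0}$, $\mathrm{ad}_{e_0^\vee}$ be the derivations with $\mathrm{ad}_{e_0}e_k^{(j)}=e_k^{(j+1)}$ ($=0$ if $j=k-2$) and $\mathrm{ad}_{e_0^\vee}e_k^{(j)}=j(k-1-j)e_k^{(j-1)}$. Let the following be given. * A change of alphabet $\hat\psi$, i.e. a multiplicative linear map commuting with $\mathrm{ad}_{e_0}$ and $\mathrm{ad}_{e_0^\vee}$, with $$\hat\psi(W[j;k])=W[j;k]+\sum_{|w|\ge2}\chi^j_k[w]\,W[w],\qquad \chi^j_k[w]\in\mathbb R.$$ * Series $e_{\Delta^\pm}$ with real coefficients in words of length $\ge2$ such that, with $k$ the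 weight of $\Delta$ and $e^{(j)}_{\Delta^\pm}=\mathrm{ad}_{e_0}^j e_{\Delta^\pm}$, one has $e^{(k-1)}_{\Delta^\pm}=0$ and $\mathrm{ad}_{e_0^\vee}e^{(j)}_{\Delta^\pm}=j(k-1-j)e^{(j-1)}_{\Delta^\pm}$. Write $W[j;\Delta^\pm]=\frac{(-1)^j(k-1)}{j!}e^{(j)}_{\Delta^\pm}$, expanded as $W[j;\Delta^+]=\sum_w\xi^j_\Delta[w]W[w]$ and $W[j;\Delta^-]=\sum_w\eta^j_\Delta[w]W[w]$. * A constant series $\mathbb C^{\rm sv}=\sum_P W[P]\,c^{\rm sv}[P]$ with $c^{\rm sv}[\emptyset]=1$. Let $\mathbb I_+=\sum_P W[P]\,\mathcal E[P;\tau]$ and $\widetilde{\mathbb I}_-=\sum_P W[P]\,\widetilde{\mathcal E}[P^{\rm rev};\tau]$, the sums running over words in the letters $(j;k)$ and $(j;\Delta)$, where $W[j;\Delta]$ is replaced by $W[j;\Delta^+]$ in $\mathbb I_+$ and by $W[j;\Delta^-]$ in $\widetilde{\mathbb I}_-$. Put $$\mathbb I^{\rm eqv}=\hat\psi(\widetilde{\mathbb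 I}_-)\,\mathbb C^{\rm sv}\,\mathbb I_+,\qquad \mathbb J^{\rm eqv}=R\big[\exp(-\tfrac{1}{4y}\mathrm{ad}_{e_0^\vee})\exp(2\pi i\bar\tau\,\mathrm{ad}_{e_0})\,\mathbb I^{\rm eqv}\big],$$ where $R$ is the linear map $e_{k_1}^{(j_1)}\cdots e_{k_\ell}^{(j_\ell)}\mapsto\prod_i\frac{j_i!}{(k_i-j_i-2)!}\,e_{k_\ell}^{(k_\ell-j_\ell-2)}\cdots e_{k_1}^{(k_1-j_1-2)}$, and let $\beta^{\rm eqv}$ be the coefficients in $$\mathbb J^{\rm eqv}=\sum\beta^{\rm eqv}[j_1\ldots j_\ell;k_1\ldots k_\ell;\tau]\prod_i\tfrac{(-1)^{j_i}(k_i-1)}{(k_i-j_i-2)!}\;e_{k_\ell}^{(k_\ell-j_\ell-2)}\cdots e_{k_1}^{(k_1-j_1-2)}.$$ Assume that $\mathbb J^{\rm eqv}$ is equivariant up to words of length three, i.e. for all $\ell\le3$ and all $\begin{pmatrix}a&b\\c&d\end{pmatrix}\in SL(2,\mathbb Z)$, $$\beta^{\rm eqv}\big[\ldots;\tfrac{a\tau+b}{c\tau+d}\big]=\prod_i(c\bar\tau+d)^{k_i-2j_i-2}\,\beta^{\rm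 eqv}[\ldots;\tau].$$ **Equivariant integrals.** With real variables $X_i,Y_i$ put $$\underline{\mathrm G}_k[X,Y;\tau]=\tfrac{(k-1)!}{2(2\pi i)^{k-1}}(X-\tau Y)^{k-2}\mathrm G_k(\tau)\,d\tau,\quad c_k=-\tfrac{(k-2)!\,\zeta(k-1)}{2(2\pi i)^{k-2}}Y^{k-2},\quad M_k=-\tfrac12\int_\tau^{i\infty}\underline{\mathrm G}_k-\tfrac12\int_{\bar\tau}^{-i\infty}\overline{\underline{\mathrm G}_k}-c_k.$$ A completion at depth $n$ and weights $k_1,\ldots,k_n$ is a triple $(c,f,g)$, where $c$ is a polynomial and $f(\tau)\,d\tau$, $g(\tau)\,d\tau$ are forms with polynomial values, all homogeneous of degree $k_i-2$ in $(X_i,Y_i)$ for each $i$, such that all projections of $f$ ($\delta^{\ell}f$ for $n=2$, $\delta^{\ell_1,\ell_2}f$ for $n=3$) are a cusp form of weight $m+2$ times $(X_1-\tau Y_1)^m$, and the same holds for $g$ with modular forms of level one in place of cusp forms. Here $m\ge 0$ is $k_1+k_2-4-2\ell$ resp. $k_1+k_2+k_3-6-2\ell_1-2\ell_2$, $\delta^\ell_{a,b}$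 is $(\partial_{X_a}\partial_{Y_b}-\partial_{Y_a}\partial_{X_b})^\ell$ followed by $(X_b,Y_b)\to(X_a,Y_a)$, $\delta^\ell=\delta^\ell_{1,2}$ and $\delta^{\ell_1,\ell_2}=\delta^{\ell_1}_{1,2}\circ\delta^{\ell_2}_{2,3}$. Put $$D_{k_1,k_2}=-\tfrac12(\underline{\mathrm G}_{k_1}M_{k_2}+M_{k_1}\overline{\underline{\mathrm G}_{k_2}}),\qquad D_{k_1,k_2,k_3}=-\tfrac12(\underline{\mathrm G}_{k_1}M_{k_2,k_3}+M_{k_1,k_2}\overline{\underline{\mathrm G}_{k_3}}+\underline f_{k_1,k_2}M_{k_3}+M_{k_1}\overline{\underline g_{k_2,k_3}}),$$ and for index strings $K=\int_\tau^{i\infty}D$ and $$M=K-c-\tfrac12\Big(\int_\tau^{i\infty}\underline f+\int_{\bar\tau}^{-i\infty}\overline{\underline g}\Big).$$ $M$ is called equivariant if it is invariant under $\tau\mapsto\frac{a\tau+b}{c\tau+d}$, $(X_i,Y_i)\mapsto(aX_i+bY_i,cX_i+dY_i)$ for $SL(2,\mathbb Z)$. Write $\sum_{\vec\jmath}\mathcal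 B_{\vec\jmath}\,(\ldots)$ for the sum over all $0\le j_i\le k_i-2$ with $$\mathcal B_{\vec\jmath}=\prod_i(k_i-1)!\,(-1)^{j_i}\tbinom{k_i-2}{j_i}\Big(\frac{Y_i}{2\pi i}\Big)^{j_i}X_i^{k_i-2-j_i}.$$ The completion is called preferred if $M$ is equivariant and the $SL(2)$-invariant part of $c$, which equivariance leaves free, is normalised by $c^{\rm sv}$: the $m=0$ projections of $c$ agree with those of $$c_{k_1,k_2}:\ -\tfrac1{16}\sum_{\vec\jmath}\mathcal B_{\vec\jmath}\,c^{\rm sv}[j_2j_1;k_2k_1],\qquad c_{k_1,k_2,k_3}:\ \tfrac1{64}\sum_{\vec\jmath}\mathcal B_{\vec\jmath}\,c^{\rm sv}[j_3j_2j_1;k_3k_2k_1].$$ **Theorem.** For each word $w$ only finitely many of the $\chi^j_k[w]$, $\xi^j_\Delta[w]$, $\eta^j_\Delta[w]$ are non-zero, so that all sums below are finite. Preferred depth-two completions exist for all $k_1,k_2$. Fix any choice of them, for all $k_1,k_2$. Then for all $k_1,k_2,k_3$: (a) The integral $K_{k_1,k_2,k_3}=\int_\tau^{i\infty}D_{k_1,k_2,k_3}$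 exists, so $dK_{k_1,k_2,k_3}=-D_{k_1,k_2,k_3}$, and there is exactly one preferred completion $(c_{k_1,k_2,k_3},f_{k_1,k_2,k_3},g_{k_1,k_2,k_3})$ at depth three. (b) A depth-three completion is preferred if and only if its $M_{k_1,k_2,k_3}$ equals the expansion from the generating series, $$M_{k_1,k_2,k_3}=-\frac{\prod_i(k_i-1)!}{64}\sum_{j_1,j_2,j_3}\ \prod_{i=1}^3\frac{\binom{k_i-2}{j_i}}{(-4y)^{j_i}}(X_i-\tau Y_i)^{j_i}(X_i-\bar\tau Y_i)^{k_i-2-j_i}\ \beta^{\rm eqv}[j_3j_2j_1;k_3k_2k_1;\tau]$$ for all $X_i,Y_i$ and $\tau$. (c) For a depth-three completion the equality in (b) holds if and only if $$c_{k_1,k_2,k_3}=\tfrac1{64}\sum_{\vec\jmath}\mathcal B_{\vec\jmath}\,c^{\rm sv}[j_3j_2j_1;k_3k_2k_1],\qquad \int_\tau^{i\infty}\underline f_{k_1,k_2,k_3}=\tfrac1{32}\sum_{\vec\jmath}\mathcal B_{\vec\jmath}\sum_{\Delta,j}\xi^j_\Delta[j_3j_2j_1;k_3k_2k_1]\,\mathcal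 E[j;\Delta;\tau],$$ $$\int_{\bar\tau}^{-i\infty}\overline{\underline g_{k_1,k_2,k_3}}=\tfrac1{32}\sum_{\vec\jmath}\mathcal B_{\vec\jmath}\Big\{\sum_{k,j}\chi^j_k[j_3j_2j_1;k_3k_2k_1]\,\widetilde{\mathcal E}[j;k;\tau]+\sum_{\Delta,j}\widetilde{\mathcal E}[j;\Delta;\tau]\Big(\eta^j_\Delta[j_3j_2j_1;k_3k_2k_1]$$ $$\qquad+\sum_{k',j'}\big(\eta^j_\Delta[j'j_1;k'k_1]\,\chi^{j'}_{k'}[j_3j_2;k_3k_2]+\eta^j_\Delta[j_3j';k_3k']\,\chi^{j'}_{k'}[j_2j_1;k_2k_1]\big)\Big)\Big\}$$ for all $X_i,Y_i$ and $\tau$. -/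

import Mathlib

open scoped MatrixGroups UpperHalfPlane ComplexConjugate Topology

noncomputable section

namespace EqvInt

/-! ### Regularised integrals to the cusp -/

/-- `K(τ)` is the regularised integral from `τ` to `i∞` of the one-form `a dτ + b dτ̄`:
`dK = -(a dτ + b dτ̄)`, and `K` has at the cusp a polynomial asymptotics without constant term
(tangential base point, i.e. `∫_τ^{i∞} t^j dt = -τ^{j+1}/(j+1)`). -/
structure IsRegPrimitive (a b K : ℍ → ℂ) : Prop where
  hasFDerivAt : ∀ τ : ℍ, HasFDerivAt (fun z : ℂ => K (UpperHalfPlane.ofComplex z))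
    (-(a τ • ContinuousLinearMap.id ℝ ℂ + b τ • (Complex.conjCLE : ℂ →L[ℝ] ℂ))) (τ : ℂ)
  cusp : ∃ P : Polynomial ℂ, P.eval 0 = 0 ∧
    Filter.Tendsto
      (fun t : ℝ => K (UpperHalfPlane.ofComplex (t * Complex.I)) - P.eval (t : ℂ))
      Filter.atTop (𝓝 0)

open Classical in
/-- The regularised integral `∫_τ^{i∞} (a dτ + b dτ̄)` as a function of `τ`; it is unique when it
exists. -/
def regInt (a b : ℍ → ℂ) : ℍ → ℂ :=
  if h : ∃ K, IsRegPrimitive a b K then h.choose else 0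

/-! ### Letters and integration kernels -/

/-- The weights of the holomorphic Eisenstein series. -/
abbrev EisWt : Type := {k : ℕ // Even k ∧ 4 ≤ k}

/-- `⟨k, j⟩` stands for the letter `e_k^{(j)}`, `0 ≤ j ≤ k - 2`. -/
abbrev Letter : Type := Σ k : EisWt, Fin (k.1 - 1)

/-- The Fourier coefficient of `q^n`. -/
def fourierCoeff {k : ℤ} (f : CuspForm 𝒮ℒ k) (n : ℕ) : ℂ :=
  (UpperHalfPlane.qExpansion 1 f).coeff n

/-- Normalised Hecke eigenforms among the cusp forms of level one. The Hecke operator `T_n` is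
written through its action on Fourier coefficients. -/
structure Eigenform where
  wt : ℕ
  form : CuspForm 𝒮ℒ (wt : ℤ)
  normalised : fourierCoeff form 1 = 1
  eigen : ∀ n : ℕ, 1 ≤ n → ∃ ev : ℂ, ∀ m : ℕ, 1 ≤ m →
    ∑ d ∈ (Nat.gcd m n).divisors, (d : ℂ) ^ (wt - 1) * fourierCoeff form (m * n / d ^ 2)
      = ev * fourierCoeff form m

/-- `⟨Δ, j⟩` stands for a letter `e_Δ^{(j)}`, `0 ≤ j ≤ k - 2`, with `k` the weight of `Δ`. -/
abbrev CuspLetter : Type := Σ Δ : Eigenform, Fin (Δ.wt - 1)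

/-- Letters of the extended alphabet. -/
abbrev XLetter : Type := Letter ⊕ CuspLetter

/-- Weight of a letter. -/
def XLetter.wt : XLetter → ℕ
  | .inl a => a.1.1
  | .inr d => d.1.wt

/-- Superscript of a letter. -/
def XLetter.idx : XLetter → ℕ
  | .inl a => a.2
  | .inr d => d.2

/-- `G_k(τ) = ∑_{(m,n) ≠ (0,0)} (mτ+n)^{-k}`; the summand at `(0,0)` is `0 ^ (-k) = 0`. -/
def eisG (k : ℕ) (τ : ℍ) : ℂ := ∑' v : Fin 2 → ℤ, EisensteinSeries.eisSummand (k : ℤ) v τ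

/-- `2πi`. -/
def twoPiI : ℂ := 2 * Real.pi * Complex.I

/-- The kernels `(2πi)^{1+j-k} τ^j G_k(τ)` and `(2πi)^{1+j} τ^j Δ(τ)`. -/
def kernel : XLetter → ℍ → ℂ
  | .inl a, τ => twoPiI ^ (1 + (a.2.1 : ℤ) - (a.1.1 : ℤ)) * (τ : ℂ) ^ a.2.1 * eisG a.1.1 τ
  | .inr d, τ => twoPiI ^ (1 + d.2.1) * (τ : ℂ) ^ d.2.1 * d.1.form τ

/-- Iterated integral of a word, the first letter carrying the outermost integration. -/
def iterIntAux : List XLetter → ℍ → ℂ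
  | [] => fun _ => 1
  | x :: w => regInt (fun τ => kernel x τ * iterIntAux w τ) 0

/-- The iterated integrals
`ℰ[j_1 … j_ℓ; k_1 … k_ℓ; τ] = ∫_τ^{i∞} ν[j_ℓ; k_ℓ; τ_ℓ] ℰ[j_1 … j_{ℓ-1}; k_1 … k_{ℓ-1}; τ_ℓ]`. -/
def iterInt (w : List XLetter) : ℍ → ℂ := iterIntAux w.reverse

/-- `ℰ̃ = (-1)^{j_1+…+j_ℓ}` times the complex conjugate of `ℰ`. -/
def iterIntTilde (w : List XLetter) (τ : ℍ) : ℂ :=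
  (-1) ^ (w.map XLetter.idx).sum * conj (iterInt w τ)

/-! ### Formal series in the non-commuting letters `e_k^{(j)}` -/

/-- A series, given by the coefficients of the words in the `e_k^{(j)}`. -/
abbrev Series (R : Type) : Type := List Letter → R

section Series

variable {R : Type} [CommRing R]

open Classical in
/-- The series consisting of one letter. -/
def single (R : Type) [CommRing R] (a : Letter) : Series R := fun w => if w = [a] then 1 else 0

open Classical in
/-- The unit series. -/
def unit (R : Type) [CommRing R] : Series R := fun w => if w = [] then 1 else 0

/-- The concatenation product. -/
def conc (S T : Series R) : Series R := fun w =>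
  ∑ i ∈ Finset.range (w.length + 1), S (w.take i) * T (w.drop i)

/-- The derivation `ad_{e_0}` with `ad_{e_0} e_k^{(j)} = e_k^{(j+1)}` for `j < k - 2` and
`ad_{e_0} e_k^{(k-2)} = 0`, on coefficients. -/
def adE0 : Series R → Series R
  | _, [] => 0
  | S, a :: w =>
    (if 0 < a.2.1 then S (⟨a.1, ⟨a.2.1 - 1, lt_of_le_of_lt (Nat.sub_le _ _) a.2.2⟩⟩ :: w) else 0)
      + adE0 (fun u => S (a :: u)) w

/-- The derivation `ad_{e_0^∨}` with `ad_{e_0^∨} e_k^{(j)} = j (k-1-j) e_k^{(j-1)}`, on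
coefficients. -/
def adE0v : Series R → Series R
  | _, [] => 0
  | S, a :: w =>
    (if h : a.2.1 + 1 < a.1.1 - 1 then
        ((a.2.1 + 1 : ℕ) : R) * ((a.1.1 - 2 - a.2.1 : ℕ) : R) * S (⟨a.1, ⟨a.2.1 + 1, h⟩⟩ :: w)
      else 0)
      + adE0v (fun u => S (a :: u)) w

/-- The multiplicative substitution of the letters `x` of an alphabet `A` by series `σ x`
(without constant term) in a series with coefficients `T`. -/
def subst {A : Type} (σ : A → Series R) (T : List A → R) : Series R := fun w =>
  ∑ᶠ u : List A, T u * ((u.map σ).foldr conc (unit R)) w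

end Series

/-- Passage from real to complex coefficients. -/
def toC (S : Series ℝ) : Series ℂ := fun w => ((S w : ℝ) : ℂ)

/-- The letter-wise normalisation of `W[j_1 … ; k_1 …] = ∏ (-1)^{j_i} (k_i-1)/j_i! e_{k_1}^{(j_1)} …`. -/
def wfac (x : XLetter) : ℝ := (-1) ^ x.idx * ((x.wt : ℝ) - 1) / (x.idx.factorial : ℝ)

/-- `∏ (-1)^{j_i} (k_i-1)/j_i!`. -/
def wordFac (w : List Letter) : ℝ := (w.map fun a => wfac (.inl a)).prod

/-! ### The generating series -/

/-- The ingredients that turn iterated integrals into equivariant ones: the change of alphabet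
`ψ̂` (through the images of the letters), the series substituted for the cuspidal letters
`e_{Δ⁺}`, `e_{Δ⁻}`, and the coefficients of the constant series `ℂ = ∑ W[P] c[P]`. -/
structure SeriesData where
  psi : Letter → Series ℝ
  ePlus : Eigenform → Series ℝ
  eMinus : Eigenform → Series ℝ
  csv : List Letter → ℂ
  /-- `ψ̂(e_k^{(j)}) = e_k^{(j)} +` words of length at least two -/
  psi_nil : ∀ a, psi a [] = 0
  psi_self : ∀ a, psi a [a] = 1
  psi_ne : ∀ a b, b ≠ a → psi a [b] = 0
  /-- `ψ̂` commutes with `ad_{e_0}` and `ad_{e_0^∨}` -/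
  psi_adE0 : ∀ (k : EisWt) (j : Fin (k.1 - 1)),
    adE0 (psi ⟨k, j⟩) = if h : j.1 + 1 < k.1 - 1 then psi ⟨k, ⟨j.1 + 1, h⟩⟩ else 0
  psi_adE0v : ∀ (k : EisWt) (j : Fin (k.1 - 1)),
    adE0v (psi ⟨k, j⟩) =
      ((j.1 : ℝ) * ((k.1 : ℝ) - 1 - j.1)) •
        psi ⟨k, ⟨j.1 - 1, lt_of_le_of_lt (Nat.sub_le _ _) j.2⟩⟩
  /-- the cuspidal letters consist of words of length at least two -/
  ePlus_short : ∀ Δ w, w.length ≤ 1 → ePlus Δ w = 0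
  eMinus_short : ∀ Δ w, w.length ≤ 1 → eMinus Δ w = 0
  /-- the `ad_{e_0}^j e_{Δ^±}` form a multiplet like the `e_k^{(j)}`, `k` the weight of `Δ` -/
  ePlus_top : ∀ Δ, (adE0 (R := ℝ))^[Δ.wt - 1] (ePlus Δ) = 0
  eMinus_top : ∀ Δ, (adE0 (R := ℝ))^[Δ.wt - 1] (eMinus Δ) = 0
  ePlus_adE0v : ∀ Δ (j : ℕ), adE0v ((adE0 (R := ℝ))^[j] (ePlus Δ)) =
    ((j : ℝ) * ((Δ.wt : ℝ) - 1 - j)) • (adE0 (R := ℝ))^[j - 1] (ePlus Δ)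
  eMinus_adE0v : ∀ Δ (j : ℕ), adE0v ((adE0 (R := ℝ))^[j] (eMinus Δ)) =
    ((j : ℝ) * ((Δ.wt : ℝ) - 1 - j)) • (adE0 (R := ℝ))^[j - 1] (eMinus Δ)
  csv_nil : csv [] = 1

namespace SeriesData

variable (D : SeriesData)

/-- Letters of the extended alphabet as series in the `e_k^{(j)}`, given the series `e Δ` of the
lowest cuspidal letters. -/
def cuspSubst (e : Eigenform → Series ℝ) : XLetter → Series ℂ
  | .inl a => single ℂ a
  | .inr d => toC ((adE0 (R := ℝ))^[d.2.1] (e d.1))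

/-- The series `𝕀_+ = ∑ W[P] ℰ[P; τ]`, with the cuspidal letters `e_{Δ⁺}` substituted. -/
def iPlus (τ : ℍ) : Series ℂ :=
  subst (cuspSubst D.ePlus) fun u => (((u.map wfac).prod : ℝ) : ℂ) * iterInt u τ

/-- The series `𝕀̃_- = ∑ W[P] ℰ̃[P reversed; τ]`, with the cuspidal letters `e_{Δ⁻}`
substituted. -/
def iMinus (τ : ℍ) : Series ℂ :=
  subst (cuspSubst D.eMinus) fun u => (((u.map wfac).prod : ℝ) : ℂ) * iterIntTilde u.reverse τ

/-- The constant series. -/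
def cSeries : Series ℂ := fun w => (wordFac w : ℂ) * D.csv w

/-- `𝕀^eqv = ψ̂(𝕀̃_-) ℂ 𝕀_+`. -/
def iEqv (τ : ℍ) : Series ℂ :=
  conc (conc (subst (fun a => toC (D.psi a)) (D.iMinus τ)) D.cSeries) (D.iPlus τ)

/-- `U 𝕀^eqv U⁻¹` with `U = exp(-e_0^∨/(4y)) exp(2πi τ̄ e_0)` and `y = π Im τ`, the exponentials
acting through the adjoint action. -/
def uConj (τ : ℍ) : Series ℂ := fun w =>
  ∑ᶠ p : ℕ × ℕ, (-1 / (4 * Real.pi * τ.im : ℂ)) ^ p.1 * (twoPiI * conj (τ : ℂ)) ^ p.2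
    / ((p.1.factorial : ℂ) * (p.2.factorial : ℂ))
    * (adE0v (R := ℂ))^[p.1] ((adE0 (R := ℂ))^[p.2] (D.iEqv τ)) w

end SeriesData

/-- `e_k^{(j)} ↦ e_k^{(k-2-j)}`. -/
def Letter.flip (a : Letter) : Letter := ⟨a.1, a.2.rev⟩

/-- Reversal of words combined with the flip of the letters. -/
def flipWord (w : List Letter) : List Letter := (w.map Letter.flip).reverse

/-- The linear involution `e_{k_1}^{(j_1)} … e_{k_ℓ}^{(j_ℓ)} ↦
∏ j_i!/(k_i-j_i-2)! e_{k_ℓ}^{(k_ℓ-j_ℓ-2)} … e_{k_1}^{(k_1-j_1-2)}`. -/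
def reversal (S : Series ℂ) : Series ℂ := fun w =>
  ((flipWord w).map fun a =>
    ((a.2.1.factorial : ℂ) / ((a.1.1 - a.2.1 - 2).factorial : ℂ))).prod * S (flipWord w)

/-- `𝕁^eqv`, the image of `U 𝕀^eqv U⁻¹` under the reversal. -/
def SeriesData.jEqv (D : SeriesData) (τ : ℍ) : Series ℂ := reversal (D.uConj τ)

/-- `β^eqv[j_1 … j_ℓ; k_1 … k_ℓ; τ]`, the coefficient in `𝕁^eqv` of
`∏ (-1)^{j_i} (k_i-1)/(k_i-j_i-2)! e_{k_ℓ}^{(k_ℓ-j_ℓ-2)} … e_{k_1}^{(k_1-j_1-2)}`. -/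
def SeriesData.betaEqv (D : SeriesData) (P : List Letter) (τ : ℍ) : ℂ :=
  D.jEqv τ (flipWord P) /
    (P.map fun a => (-1 : ℂ) ^ a.2.1 * ((a.1.1 : ℂ) - 1)
      / ((a.1.1 - a.2.1 - 2).factorial : ℂ)).prod

/-- Modularity of the coefficients of `𝕁^eqv` up to words of length three:
`β^eqv` has the modular weights `(0, ∑ (k_i - 2 j_i - 2))`. -/
def SeriesData.Equivariant (D : SeriesData) : Prop :=
  ∀ P : List Letter, P.length ≤ 3 → ∀ (γ : SL(2, ℤ)) (τ : ℍ),
    D.betaEqv P (γ • τ) =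
      (P.map fun a => (((γ 1 0 : ℤ) : ℂ) * conj (τ : ℂ) + ((γ 1 1 : ℤ) : ℂ))
        ^ ((a.1.1 : ℤ) - 2 * (a.2.1 : ℤ) - 2)).prod * D.betaEqv P τ

/-- The coefficient of `W[w]` in `ψ̂(W[a])`. -/
def SeriesData.chi (D : SeriesData) (a : Letter) (w : List Letter) : ℝ :=
  wfac (.inl a) * D.psi a w / wordFac w

/-- The coefficient of `W[w]` in `W[j; Δ⁺]`. -/
def SeriesData.xi (D : SeriesData) (d : CuspLetter) (w : List Letter) : ℝ :=
  wfac (.inr d) * (adE0 (R := ℝ))^[d.2.1] (D.ePlus d.1) w / wordFac w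

/-- The coefficient of `W[w]` in `W[j; Δ⁻]`. -/
def SeriesData.eta (D : SeriesData) (d : CuspLetter) (w : List Letter) : ℝ :=
  wfac (.inr d) * (adE0 (R := ℝ))^[d.2.1] (D.eMinus d.1) w / wordFac w

/-! ### Bookkeeping variables -/

/-- Polynomials in `X_i`, `Y_i` (the variables `(i, 0)` and `(i, 1)`). -/
abbrev BPoly (n : ℕ) : Type := MvPolynomial (Fin n × Fin 2) ℂ

/-- Evaluation at real `X_i = v i 0` and `Y_i = v i 1`. -/
def BPoly.at {n : ℕ} (p : BPoly n) (v : Fin n → Fin 2 → ℝ) : ℂ :=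
  MvPolynomial.eval (fun i => ((v i.1 i.2 : ℝ) : ℂ)) p

/-- Homogeneity of degree `k_i - 2` in `(X_i, Y_i)` for each `i`. -/
def BPoly.IsHom {n : ℕ} (p : BPoly n) (k : Fin n → EisWt) : Prop :=
  ∀ m ∈ p.support, ∀ i, m (i, 0) + m (i, 1) = (k i).1 - 2

/-- `(∂_{X_a} ∂_{Y_b} - ∂_{Y_a} ∂_{X_b})^ℓ` followed by `(X_b, Y_b) → (X_a, Y_a)`. -/
def transvect {n : ℕ} (a b : Fin n) (l : ℕ) (p : BPoly n) : BPoly n :=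
  MvPolynomial.rename (fun i => (if i.1 = b then a else i.1, i.2))
    ((fun q : BPoly n =>
      MvPolynomial.pderiv (a, 0) (MvPolynomial.pderiv (b, 1) q)
        - MvPolynomial.pderiv (a, 1) (MvPolynomial.pderiv (b, 0) q))^[l] p)

/-- The projection `δ^ℓ` of polynomials in two pairs of variables. -/
def delta2 (l : ℕ) (p : BPoly 2) : BPoly 2 := transvect 0 1 l p

/-- The projections `δ^{ℓ_1,ℓ_2}` of polynomials in three pairs of variables. -/
def delta3 (l₁ l₂ : ℕ) (p : BPoly 3) : BPoly 3 := transvect 0 1 l₁ (transvect 1 2 l₂ p)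

/-- `(X_1 - τ Y_1)^m`. -/
def highest {n : ℕ} [NeZero n] (m : ℕ) (τ : ℍ) : BPoly n :=
  (MvPolynomial.X (0, 0) - MvPolynomial.C (τ : ℂ) * MvPolynomial.X (0, 1)) ^ m

/-- Action of `SL(2, ℤ)` on a pair `(X, Y)`. -/
def actXY (γ : SL(2, ℤ)) (v : Fin 2 → ℝ) : Fin 2 → ℝ :=
  ![(γ 0 0 : ℝ) * v 0 + (γ 0 1 : ℝ) * v 1, (γ 1 0 : ℝ) * v 0 + (γ 1 1 : ℝ) * v 1]

/-- Equivariance, i.e. invariance under simultaneous transformations of the `(X_i, Y_i)` and `τ`. -/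
def IsEquivariant {n : ℕ} (M : (Fin n → Fin 2 → ℝ) → ℍ → ℂ) : Prop :=
  ∀ (γ : SL(2, ℤ)) (v : Fin n → Fin 2 → ℝ) (τ : ℍ),
    M (fun i => actXY γ (v i)) (γ • τ) = M v τ

/-! ### Equivariant integrals -/

/-- The form `G_k[X, Y; τ] = (k-1)!/(2 (2πi)^{k-1}) (X - τ Y)^{k-2} G_k(τ)` (times `dτ`). -/
def formG (k : EisWt) (v : Fin 2 → ℝ) (τ : ℍ) : ℂ :=
  ((k.1 - 1).factorial : ℂ) / (2 * twoPiI ^ (k.1 - 1))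
    * ((v 0 : ℂ) - τ * (v 1 : ℂ)) ^ (k.1 - 2) * eisG k.1 τ

/-- `c_k[X, Y] = -(k-2)! ζ(k-1)/(2 (2πi)^{k-2}) Y^{k-2}`. -/
def const1 (k : EisWt) (v : Fin 2 → ℝ) : ℂ :=
  -(((k.1 - 2).factorial : ℂ) * riemannZeta ((k.1 : ℂ) - 1) / (2 * twoPiI ^ (k.1 - 2)))
    * (v 1 : ℂ) ^ (k.1 - 2)

/-- `M_k = -½ ∫_τ^{i∞} G_k - ½ ∫_{τ̄}^{-i∞} Ḡ_k - c_k`. -/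
def intM1 (k : EisWt) (v : Fin 2 → ℝ) (τ : ℍ) : ℂ :=
  -(1 / 2) * regInt (formG k v) 0 τ - (1 / 2) * regInt 0 (fun t => conj (formG k v t)) τ
    - const1 k v

/-- The constant `c` and the forms `f dτ` and `g dτ` used to complete `n`-fold integrals. -/
structure Completion (n : ℕ) where
  c : BPoly n
  f : ℍ → BPoly n
  g : ℍ → BPoly n

/-- `-c - ½ (∫_τ^{i∞} f + ∫_{τ̄}^{-i∞} ḡ)`. -/
def Completion.corr {n : ℕ} (C : Completion n) (v : Fin n → Fin 2 → ℝ) (τ : ℍ) : ℂ :=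
  -C.c.at v - (1 / 2) * (regInt (fun t => (C.f t).at v) 0 τ
    + regInt 0 (fun t => conj ((C.g t).at v)) τ)

/-- Shape of depth-two completions: all projections of `f` (of `g`) to weight `m + 2` are
cusp forms (modular forms) times `(X_1 - τ Y_1)^m`. -/
structure Completion.IsType2 (C : Completion 2) (k₁ k₂ : EisWt) : Prop where
  hom_c : C.c.IsHom ![k₁, k₂]
  hom_f : ∀ τ, (C.f τ).IsHom ![k₁, k₂]
  hom_g : ∀ τ, (C.g τ).IsHom ![k₁, k₂]
  cusp_f : ∀ l m : ℕ, m + 2 * l + 4 = k₁.1 + k₂.1 →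
    ∃ φ : CuspForm 𝒮ℒ ((m + 2 : ℕ) : ℤ), ∀ τ,
      delta2 l (C.f τ) = MvPolynomial.C (φ τ) * highest m τ
  modular_g : ∀ l m : ℕ, m + 2 * l + 4 = k₁.1 + k₂.1 →
    ∃ φ : ModularForm 𝒮ℒ ((m + 2 : ℕ) : ℤ), ∀ τ,
      delta2 l (C.g τ) = MvPolynomial.C (φ τ) * highest m τ

/-- Shape of depth-three completions. -/
structure Completion.IsType3 (C : Completion 3) (k : Fin 3 → EisWt) : Prop where
  hom_c : C.c.IsHom k
  hom_f : ∀ τ, (C.f τ).IsHom k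
  hom_g : ∀ τ, (C.g τ).IsHom k
  cusp_f : ∀ l₁ l₂ m : ℕ, m + 2 * l₁ + 2 * l₂ + 6 = (k 0).1 + (k 1).1 + (k 2).1 →
    ∃ φ : CuspForm 𝒮ℒ ((m + 2 : ℕ) : ℤ), ∀ τ,
      delta3 l₁ l₂ (C.f τ) = MvPolynomial.C (φ τ) * highest m τ
  modular_g : ∀ l₁ l₂ m : ℕ, m + 2 * l₁ + 2 * l₂ + 6 = (k 0).1 + (k 1).1 + (k 2).1 →
    ∃ φ : ModularForm 𝒮ℒ ((m + 2 : ℕ) : ℤ), ∀ τ,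
      delta3 l₁ l₂ (C.g τ) = MvPolynomial.C (φ τ) * highest m τ

/-- `K_{k_1,k_2} = ∫_τ^{i∞} D_{k_1,k_2}` with
`D_{k_1,k_2} = -½ (G_{k_1} M_{k_2} + M_{k_1} Ḡ_{k_2})`. -/
def intK2 (k₁ k₂ : EisWt) (v : Fin 2 → Fin 2 → ℝ) : ℍ → ℂ :=
  regInt (fun τ => -(1 / 2) * (formG k₁ (v 0) τ * intM1 k₂ (v 1) τ))
    (fun τ => -(1 / 2) * (intM1 k₁ (v 0) τ * conj (formG k₂ (v 1) τ)))

/-- `M_{k_1,k_2} = K_{k_1,k_2} - c_{k_1,k_2} - ½ (∫ f_{k_1,k_2} + ∫ ḡ_{k_1,k_2})`. -/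
def intM2 (k₁ k₂ : EisWt) (C : Completion 2) (v : Fin 2 → Fin 2 → ℝ) (τ : ℍ) : ℂ :=
  intK2 k₁ k₂ v τ + C.corr v τ

/-- The `dτ`-component of `D_{k_1,k_2,k_3} = -½ (G_{k_1} M_{k_2,k_3} + M_{k_1,k_2} Ḡ_{k_3}
+ f_{k_1,k_2} M_{k_3} + M_{k_1} ḡ_{k_2,k_3})`. -/
def formD3 (C2 : EisWt → EisWt → Completion 2) (k : Fin 3 → EisWt) (v : Fin 3 → Fin 2 → ℝ)
    (τ : ℍ) : ℂ :=
  -(1 / 2) * (formG (k 0) (v 0) τ * intM2 (k 1) (k 2) (C2 (k 1) (k 2)) ![v 1, v 2] τ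
    + ((C2 (k 0) (k 1)).f τ).at ![v 0, v 1] * intM1 (k 2) (v 2) τ)

/-- The `dτ̄`-component of `D_{k_1,k_2,k_3}`. -/
def formD3bar (C2 : EisWt → EisWt → Completion 2) (k : Fin 3 → EisWt) (v : Fin 3 → Fin 2 → ℝ)
    (τ : ℍ) : ℂ :=
  -(1 / 2) * (intM2 (k 0) (k 1) (C2 (k 0) (k 1)) ![v 0, v 1] τ * conj (formG (k 2) (v 2) τ)
    + intM1 (k 0) (v 0) τ * conj (((C2 (k 1) (k 2)).g τ).at ![v 1, v 2]))

/-- `K_{k_1,k_2,k_3} = ∫_τ^{i∞} D_{k_1,k_2,k_3}`. -/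
def intK3 (C2 : EisWt → EisWt → Completion 2) (k : Fin 3 → EisWt) (v : Fin 3 → Fin 2 → ℝ) :
    ℍ → ℂ :=
  regInt (formD3 C2 k v) (formD3bar C2 k v)

/-- `M_{k_1,k_2,k_3} = K_{k_1,k_2,k_3} - c_{k_1,k_2,k_3} - ½ (∫ f_{k_1,k_2,k_3} + ∫ ḡ_{k_1,k_2,k_3})`. -/
def intM3 (C2 : EisWt → EisWt → Completion 2) (k : Fin 3 → EisWt) (C : Completion 3)
    (v : Fin 3 → Fin 2 → ℝ) (τ : ℍ) : ℂ :=
  intK3 C2 k v τ + C.corr v τ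

/-! ### The expansions to be compared -/

/-- The word with columns `(j_n, k_n), …, (j_1, k_1)`. -/
def revWord {n : ℕ} (k : Fin n → EisWt) (j : ∀ i, Fin ((k i).1 - 1)) : List Letter :=
  (List.ofFn fun i => (⟨k i, j i⟩ : Letter)).reverse

/-- `∏_i (k_i-1)! (-1)^{j_i} binom(k_i-2, j_i) (Y_i/(2πi))^{j_i} X_i^{k_i-2-j_i}`. -/
def basisPoly {n : ℕ} (k : Fin n → EisWt) (j : ∀ i, Fin ((k i).1 - 1)) : BPoly n :=
  ∏ i, MvPolynomial.C ((((k i).1 - 1).factorial : ℂ) * (-1) ^ (j i).1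
      * (((k i).1 - 2).choose (j i).1 : ℂ) / twoPiI ^ (j i).1)
    * MvPolynomial.X (i, 1) ^ (j i).1 * MvPolynomial.X (i, 0) ^ ((k i).1 - 2 - (j i).1)

/-- The polynomial with coefficients `c^sv[j_n … j_1; k_n … k_1]`, up to the factor `r`. -/
def SeriesData.csvPoly (D : SeriesData) (r : ℂ) {n : ℕ} (k : Fin n → EisWt) : BPoly n :=
  MvPolynomial.C r * ∑ j : ∀ i, Fin ((k i).1 - 1),
    MvPolynomial.C (D.csv (revWord k j)) * basisPoly k j

/-- The expansion
`-∏ (k_i-1)!/64 ∑_j ∏ binom(k_i-2, j_i) (-4y)^{-j_i} (X_i-τY_i)^{j_i} (X_i-τ̄Y_i)^{k_i-2-j_i}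
β^eqv[j_3 j_2 j_1; k_3 k_2 k_1; τ]`, with `y = π Im τ`. -/
def SeriesData.betaExpansion (D : SeriesData) (k : Fin 3 → EisWt) (v : Fin 3 → Fin 2 → ℝ)
    (τ : ℍ) : ℂ :=
  -(1 / 64) * (∏ i, (((k i).1 - 1).factorial : ℂ)) * ∑ j : ∀ i, Fin ((k i).1 - 1),
    (∏ i, (((k i).1 - 2).choose (j i).1 : ℂ) / (-4 * (Real.pi * τ.im : ℂ)) ^ (j i).1
        * ((v i 0 : ℂ) - τ * (v i 1 : ℂ)) ^ (j i).1
        * ((v i 0 : ℂ) - conj (τ : ℂ) * (v i 1 : ℂ)) ^ ((k i).1 - 2 - (j i).1))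
      * D.betaEqv (revWord k j) τ

/-- The holomorphic cuspidal part `∑ ξ^j_Δ[x y z] ℰ[j; Δ; τ]`. -/
def SeriesData.holPart (D : SeriesData) (w : List Letter) (τ : ℍ) : ℂ :=
  ∑ᶠ d : CuspLetter, (D.xi d w : ℂ) * iterInt [.inr d] τ

/-- The antiholomorphic part `∑ χ^j_k[x y z] ℰ̃[j; k; τ] + ∑ ℰ̃[j; Δ; τ] (η^j_Δ[x y z]
+ ∑ (η^j_Δ[b z] χ_b[x y] + η^j_Δ[x b] χ_b[y z]))`, where `b` runs over the letters
`(j', k')`. -/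
def SeriesData.antiholPart (D : SeriesData) (x y z : Letter) (τ : ℍ) : ℂ :=
  (∑ᶠ a : Letter, (D.chi a [x, y, z] : ℂ) * iterIntTilde [.inl a] τ)
    + ∑ᶠ d : CuspLetter, iterIntTilde [.inr d] τ *
      ((D.eta d [x, y, z] : ℂ) + ∑ᶠ b : Letter,
        ((D.eta d [b, z] : ℂ) * (D.chi b [x, y] : ℂ)
          + (D.eta d [x, b] : ℂ) * (D.chi b [y, z] : ℂ)))

/-- The completions of all double integrals: `M_{k_1,k_2}` is equivariant, and the
`SL(2)`-invariant part of `c_{k_1,k_2}`, which equivariance leaves free, is the one given by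
`c^sv`. -/
def SeriesData.IsDepthTwo (D : SeriesData) (C2 : EisWt → EisWt → Completion 2) : Prop :=
  ∀ k₁ k₂ : EisWt, (C2 k₁ k₂).IsType2 k₁ k₂ ∧ IsEquivariant (intM2 k₁ k₂ (C2 k₁ k₂)) ∧
    ∀ l : ℕ, 2 * l + 4 = k₁.1 + k₂.1 →
      delta2 l (C2 k₁ k₂).c = delta2 l (D.csvPoly (-(1 / 16)) ![k₁, k₂])

/-- A completion of the triple integral: `M_{k_1,k_2,k_3}` is equivariant, and the
`SL(2)`-invariant part of `c_{k_1,k_2,k_3}`, which equivariance leaves free, is the one given by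
`c^sv`. -/
def SeriesData.IsDepthThree (D : SeriesData) (C2 : EisWt → EisWt → Completion 2)
    (k : Fin 3 → EisWt) (C : Completion 3) : Prop :=
  IsEquivariant (intM3 C2 k C) ∧
    ∀ l₁ l₂ : ℕ, 2 * l₁ + 2 * l₂ + 6 = (k 0).1 + (k 1).1 + (k 2).1 →
      delta3 l₁ l₂ C.c = delta3 l₁ l₂ (D.csvPoly (1 / 64) k)

end EqvInt

end

/-!
The theorem compares iterated integrals, completed depth by depth, with the expansion of one
generating series whose equivariance is given. The comparison rests on three facts.

*The generating series satisfies a differential equation.* The linear maps `Psi` replace the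
letters `e_k^{(j)}` in words of a fixed shape by monomials in the variables `X_i, Y_i`, in such a
way that `ad_{e_0}` and `ad_{e_0^∨}` become infinitesimal shifts of `X` and `Y`. The two
exponentials in the definition of `𝕁^eqv` then only change the point at which `Psi (𝕀^eqv)` is
evaluated (`Psi_uConj`). Hence the expansion in `β^eqv` is a multiple of `Psi (𝕀^eqv)`
(`betaExpansion_eq`), and the equivariance of `β^eqv` says that `Psi (𝕀^eqv)` is invariant under
`SL(2, ℤ)` (`Equivariant.isEquivariant`). On the other hand `𝕀^eqv` satisfies
`d𝕀^eqv = -𝕀^eqv ω₊ dτ - ω_ψ 𝕀^eqv dτ̄` (`hasDD_iEqv`), with the constant term `ℂ^sv` at the cusp (`cuspVal_iEqv`). In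
words of length at most three this is exactly the recursion defining `D_{k₁,k₂}` and
`D_{k₁,k₂,k₃}`, provided that the constant and the forms of a completion are taken to be the
coefficients of `ℂ^sv`, `ω₊` and `ω_ψ` in words of full length (`completion`, `depthTwo`,
`depthThree`). The recursion starts in depth one, where the constant of `𝕀^eqv` is forced by
equivariance: under translation it must be a multiple of `Y^{k-2}`, and under `τ ↦ -1/τ` the
multiple is the zeta value in `M_k`, by the period of the Eichler integral of `G_k`
(`eichlerS_zero_one`, `Psi_singleton_cSeries`).

*The completion read off from the series is admissible.* The images of the letters under `ψ̂` and
the series `e_{Δ^±}^{(j)}` form multiplets of `sl(2)`. The lowest vector of a multiplet is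
invariant under a unipotent subgroup and is an eigenvector of the torus, so that each
`SL(2)`-equivariant projection maps it to a multiple of `X₁^m`, which vanishes unless the weights
match (`Multiplet.proj_lowest`). The forms, being unipotent translates of lowest vectors with
(anti)holomorphic modular coefficients, therefore project to modular forms of weight `m + 2` times
`(X₁ - τY₁)^m` (`completion_isTypeF`). The same `sl(2)`-weights bound `k` and `j` in terms of a
word in the image of a letter, and there are only finitely many normalised eigenforms of bounded
weight; this gives the finiteness of the coefficients (`finite_coeffs`).

*Completions are unique.* The corrections of two preferred completions differ by an equivariant
function of the shape constant plus integrals of modular forms. The projections `δ^ℓ`, resp.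
`δ^{ℓ₁,ℓ₂}`, are jointly injective by Capelli's identity (`eq_zero_of_transvect`), so that it
suffices to look at each projection. For `m = 0` there are no modular forms of weight two, and the
constants agree by the normalisation. For `m > 0` the Eichler–Shimura map is injective
(`eichlerShimura_injective`): the middle coefficient of an equivariant primitive, in the basis
`X - τY`, `X - τ̄Y`, is an invariant eigenfunction of the Laplacian with positive eigenvalue which tends
to zero at the cusp, and it vanishes by the maximum principle (`eq_zero_of_laplace_pos`).

Thus a completion is preferred if and only if it is the one read off from the series
(`isDepthTwo_iff`, `isDepthThree_iff`). The explicit formulas follow by expanding `ψ̂` on words of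
length three (`subst_psi_triple`), since a completion is determined by its constant and the
integrals of its forms (`IsTypeF.eq_of_corr`).
-/

noncomputable section

namespace EqvInt

open Filter Asymptotics

/-! ### One-forms on the upper half-plane and their primitives -/

/-- `dK = a dτ + b dτ̄` on the upper half-plane. -/
def HasDD (K a b : ℍ → ℂ) : Prop :=
  ∀ τ : ℍ, HasFDerivAt (fun z : ℂ => K (UpperHalfPlane.ofComplex z))
    (a τ • ContinuousLinearMap.id ℝ ℂ + b τ • (Complex.conjCLE : ℂ →L[ℝ] ℂ)) (τ : ℂ)

lemma ofComplex_im_pos {z : ℂ} (hz : 0 < z.im) :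
    UpperHalfPlane.ofComplex z = ⟨z, hz⟩ := UpperHalfPlane.ofComplex_apply_of_im_pos hz

lemma HasDD.congr {K a b K' a' b' : ℍ → ℂ} (h : HasDD K a b) (hK : ∀ τ, K' τ = K τ)
    (ha : ∀ τ, a' τ = a τ) (hb : ∀ τ, b' τ = b τ) : HasDD K' a' b' := by
  rwa [funext hK, funext ha, funext hb]

lemma HasDD.const (c : ℂ) : HasDD (fun _ => c) (fun _ => 0) (fun _ => 0) := by
  intro τ
  refine (hasFDerivAt_const c (τ : ℂ)).congr_fderiv ?_
  ext1; simp

lemma HasDD.add {K a b K' a' b' : ℍ → ℂ} (h : HasDD K a b) (h' : HasDD K' a' b') :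
    HasDD (fun τ => K τ + K' τ) (fun τ => a τ + a' τ) (fun τ => b τ + b' τ) := by
  intro τ
  refine ((h τ).add (h' τ)).congr_fderiv ?_
  ext1; simp; ring

lemma HasDD.mul {K a b K' a' b' : ℍ → ℂ} (h : HasDD K a b) (h' : HasDD K' a' b') :
    HasDD (fun τ => K τ * K' τ) (fun τ => a τ * K' τ + K τ * a' τ)
      (fun τ => b τ * K' τ + K τ * b' τ) := by
  intro τ
  refine ((h τ).mul (h' τ)).congr_fderiv ?_
  ext1; simp; ring

lemma HasDD.const_mul {K a b : ℍ → ℂ} (c : ℂ) (h : HasDD K a b) :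
    HasDD (fun τ => c * K τ) (fun τ => c * a τ) (fun τ => c * b τ) := by
  refine ((HasDD.const c).mul h).congr ?_ ?_ ?_ <;> intro τ <;> simp

lemma HasDD.neg {K a b : ℍ → ℂ} (h : HasDD K a b) :
    HasDD (fun τ => - K τ) (fun τ => - a τ) (fun τ => - b τ) := by
  refine (h.const_mul (-1)).congr ?_ ?_ ?_ <;> intro τ <;> ring

lemma HasDD.sub {K a b K' a' b' : ℍ → ℂ} (h : HasDD K a b) (h' : HasDD K' a' b') :
    HasDD (fun τ => K τ - K' τ) (fun τ => a τ - a' τ) (fun τ => b τ - b' τ) := by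
  refine (h.add h'.neg).congr ?_ ?_ ?_ <;> intro τ <;> ring

lemma HasDD.conj {K a b : ℍ → ℂ} (h : HasDD K a b) :
    HasDD (fun τ => conj (K τ)) (fun τ => conj (b τ)) (fun τ => conj (a τ)) := by
  intro τ
  refine ((Complex.conjCLE.toContinuousLinearMap.hasFDerivAt).comp (τ : ℂ) (h τ)).congr_fderiv ?_
  ext1; simp; ring

lemma HasDD.sum {ι : Type*} (s : Finset ι) {K a b : ι → ℍ → ℂ}
    (h : ∀ i ∈ s, HasDD (K i) (a i) (b i)) :
    HasDD (fun τ => ∑ i ∈ s, K i τ) (fun τ => ∑ i ∈ s, a i τ) (fun τ => ∑ i ∈ s, b i τ) := by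
  classical
  induction s using Finset.induction_on with
  | empty => simpa using HasDD.const 0
  | insert i s hi ih =>
    simp only [Finset.sum_insert hi]
    exact (h i (Finset.mem_insert_self i s)).add
      (ih fun j hj => h j (Finset.mem_insert_of_mem hj))

lemma finsum_eq_sum_of_zero {ι : Type*} {c : ι → ℂ} (hc : {i | c i ≠ 0}.Finite)
    (F : ι → ℂ) (hF : ∀ i, c i = 0 → F i = 0) : ∑ᶠ i, F i = ∑ i ∈ hc.toFinset, F i :=
  finsum_eq_sum_of_support_subset _ fun i hi => by
    simp only [Set.Finite.coe_toFinset, Set.mem_ofPred_eq]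
    exact fun h => hi (hF i h)

lemma HasDD.of_hasDerivAt {f f' : ℍ → ℂ}
    (h : ∀ τ : ℍ, HasDerivAt (fun z : ℂ => f (UpperHalfPlane.ofComplex z)) (f' τ) (τ : ℂ)) :
    HasDD f f' (fun _ => 0) := by
  intro τ
  refine ((h τ).hasFDerivAt.restrictScalars ℝ).congr_fderiv ?_
  ext1; simp [mul_comm]

lemma HasDD.coe : HasDD (fun τ => (τ : ℂ)) (fun _ => 1) (fun _ => 0) := by
  refine HasDD.of_hasDerivAt fun τ => ?_
  refine (hasDerivAt_id (τ : ℂ)).congr_of_eventuallyEq ?_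
  filter_upwards [UpperHalfPlane.isOpen_upperHalfPlaneSet.mem_nhds τ.2] with z hz
  rw [ofComplex_im_pos hz]; rfl

lemma HasDD.pow {K a b : ℍ → ℂ} (h : HasDD K a b) (n : ℕ) :
    HasDD (fun τ => K τ ^ n) (fun τ => n * K τ ^ (n - 1) * a τ)
      (fun τ => n * K τ ^ (n - 1) * b τ) := by
  induction n with
  | zero => simpa using HasDD.const 1
  | succ n ih =>
    refine (ih.mul h).congr ?_ ?_ ?_ <;> intro τ
    · ring
    all_goals
      rcases n with _ | n
      · simp
      · simp only [Nat.add_sub_cancel]; push_cast; ring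

lemma HasDD.hasDerivAt {f f' : ℍ → ℂ} (h : HasDD f f' (fun _ => 0)) (τ : ℍ) :
    HasDerivAt (fun z : ℂ => f (UpperHalfPlane.ofComplex z)) (f' τ) (τ : ℂ) := by
  have := h τ
  rw [hasDerivAt_iff_hasFDerivAt]
  refine hasFDerivAt_of_restrictScalars ℝ this ?_
  ext1; simp [mul_comm]

/-- The coefficients of `dK` are determined by `K`. -/
lemma HasDD.unique {K a b a' b' : ℍ → ℂ} (h : HasDD K a b) (h' : HasDD K a' b') (τ : ℍ) :
    a τ = a' τ ∧ b τ = b' τ := by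
  have := (h τ).unique (h' τ)
  have h1 := DFunLike.congr_fun this 1
  have h2 := DFunLike.congr_fun this Complex.I
  simp at h1 h2
  have h3 : (a τ - b τ) * Complex.I = (a' τ - b' τ) * Complex.I := by linear_combination h2
  have h4 := mul_right_cancel₀ Complex.I_ne_zero h3
  constructor
  · linear_combination (h1 + h4) / 2
  · linear_combination (h1 - h4) / 2

lemma convex_uhp : Convex ℝ {z : ℂ | 0 < z.im} :=
  convex_halfSpace_im_gt 0

lemma HasDD.eq_const {K : ℍ → ℂ} (h : HasDD K (fun _ => 0) (fun _ => 0)) (τ σ : ℍ) :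
    K τ = K σ := by
  have := UpperHalfPlane.isOpen_upperHalfPlaneSet.is_const_of_fderiv_eq_zero (𝕜 := ℝ)
    (f := fun z : ℂ => K (UpperHalfPlane.ofComplex z)) convex_uhp.isPreconnected
    (fun z hz => ((h ⟨z, hz⟩).differentiableAt).differentiableWithinAt)
    (fun z hz => by rw [(h ⟨z, hz⟩).fderiv]; ext1; simp) τ.2 σ.2
  simpa using this

lemma isRegPrimitive_iff {a b K : ℍ → ℂ} : IsRegPrimitive a b K ↔
    HasDD K (fun τ => -a τ) (fun τ => -b τ) ∧ ∃ P : Polynomial ℂ, P.eval 0 = 0 ∧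
      Tendsto (fun t : ℝ => K (UpperHalfPlane.ofComplex (t * Complex.I)) - P.eval (t : ℂ))
        atTop (𝓝 0) := by
  have : ∀ τ : ℍ, (-(a τ • ContinuousLinearMap.id ℝ ℂ + b τ • (Complex.conjCLE : ℂ →L[ℝ] ℂ)))
      = ((-a τ) • ContinuousLinearMap.id ℝ ℂ + (-b τ) • (Complex.conjCLE : ℂ →L[ℝ] ℂ)) := by
    intro τ; ext1; simp; ring
  constructor
  · rintro ⟨h, h'⟩
    exact ⟨fun τ => by rw [← this]; exact h τ, h'⟩
  · rintro ⟨h, h'⟩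
    exact ⟨fun τ => by rw [this]; exact h τ, h'⟩

lemma IsRegPrimitive.hasDD {a b K : ℍ → ℂ} (h : IsRegPrimitive a b K) :
    HasDD K (fun τ => -a τ) (fun τ => -b τ) := (isRegPrimitive_iff.1 h).1

lemma eval_limit_eq_zero {P : Polynomial ℂ} (h0 : P.eval 0 = 0) {L : ℂ}
    (h : Tendsto (fun t : ℝ => P.eval (t : ℂ)) atTop (𝓝 L)) : P = 0 := by
  by_contra hP
  have hd : 0 < P.degree := by
    by_contra hd
    have := Polynomial.eq_C_of_degree_le_zero (not_lt.1 hd)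
    rw [this] at h0 hP
    simp at h0; simp [h0] at hP
  have := P.tendsto_norm_atTop hd (z := fun t : ℝ => (t : ℂ)) (l := atTop)
    (by simpa using tendsto_abs_atTop_atTop)
  exact not_tendsto_nhds_of_tendsto_atTop this _ h.norm

lemma IsRegPrimitive.unique {a b K K' : ℍ → ℂ} (h : IsRegPrimitive a b K)
    (h' : IsRegPrimitive a b K') : K = K' := by
  obtain ⟨h1, P, hP, hl⟩ := isRegPrimitive_iff.1 h
  obtain ⟨h1', P', hP', hl'⟩ := isRegPrimitive_iff.1 h'
  have hc : ∀ τ, K τ - K' τ = K UpperHalfPlane.I - K' UpperHalfPlane.I := fun τ =>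
    ((h1.sub h1').congr (fun _ => rfl) (fun _ => by simp) (fun _ => by simp)).eq_const τ _
  have hl2 : Tendsto (fun t : ℝ => (P' - P).eval (t : ℂ)) atTop
      (𝓝 (0 - 0 - (K UpperHalfPlane.I - K' UpperHalfPlane.I))) := by
    refine ((hl.sub hl').sub_const _).congr fun t => ?_
    rw [← hc (UpperHalfPlane.ofComplex (t * Complex.I)), Polynomial.eval_sub]; ring
  have hz := eval_limit_eq_zero (by simp [hP, hP']) hl2
  rw [hz] at hl2
  simp only [Polynomial.eval_zero] at hl2
  have := tendsto_nhds_unique hl2 tendsto_const_nhds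
  funext τ
  have h2 := hc τ
  have h3 : K τ - K' τ = 0 := by rw [h2]; linear_combination -this
  exact sub_eq_zero.1 h3

lemma IsRegPrimitive.regInt_eq {a b K : ℍ → ℂ} (h : IsRegPrimitive a b K) :
    regInt a b = K := by
  have hex : ∃ K, IsRegPrimitive a b K := ⟨K, h⟩
  rw [regInt, dif_pos hex]
  exact hex.choose_spec.unique h

lemma IsRegPrimitive.regInt {a b K : ℍ → ℂ} (h : IsRegPrimitive a b K) :
    IsRegPrimitive a b (regInt a b) := by rwa [h.regInt_eq]

lemma IsRegPrimitive.congr {a b K a' b' K' : ℍ → ℂ} (h : IsRegPrimitive a b K)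
    (hK : ∀ τ, K' τ = K τ) (ha : ∀ τ, a' τ = a τ) (hb : ∀ τ, b' τ = b τ) :
    IsRegPrimitive a' b' K' := by rwa [funext hK, funext ha, funext hb]

lemma IsRegPrimitive.const_mul {a b K : ℍ → ℂ} (c : ℂ) (h : IsRegPrimitive a b K) :
    IsRegPrimitive (fun τ => c * a τ) (fun τ => c * b τ) (fun τ => c * K τ) := by
  obtain ⟨h1, P, hP, hl⟩ := isRegPrimitive_iff.1 h
  refine isRegPrimitive_iff.2 ⟨(h1.const_mul c).congr (fun _ => rfl) (fun _ => by ring)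
    (fun _ => by ring), Polynomial.C c * P, by simp [hP], ?_⟩
  have := hl.const_mul c
  simp only [mul_zero] at this
  refine this.congr fun t => ?_
  simp; ring

lemma IsRegPrimitive.add {a b K a' b' K' : ℍ → ℂ} (h : IsRegPrimitive a b K)
    (h' : IsRegPrimitive a' b' K') :
    IsRegPrimitive (fun τ => a τ + a' τ) (fun τ => b τ + b' τ) (fun τ => K τ + K' τ) := by
  obtain ⟨h1, P, hP, hl⟩ := isRegPrimitive_iff.1 h
  obtain ⟨h1', P', hP', hl'⟩ := isRegPrimitive_iff.1 h'
  refine isRegPrimitive_iff.2 ⟨(h1.add h1').congr (fun _ => rfl) (fun _ => by ring)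
    (fun _ => by ring), P + P', by simp [hP, hP'], ?_⟩
  have := hl.add hl'
  simp only [add_zero] at this
  refine this.congr fun t => ?_
  simp; ring

lemma IsRegPrimitive.zero : IsRegPrimitive (fun _ => 0) (fun _ => 0) (fun _ => 0) :=
  isRegPrimitive_iff.2 ⟨(HasDD.const 0).congr (fun _ => rfl) (fun _ => by simp)
    (fun _ => by simp), 0, by simp, by simp⟩

lemma IsRegPrimitive.sum {ι : Type*} (s : Finset ι) {K a b : ι → ℍ → ℂ}
    (h : ∀ i ∈ s, IsRegPrimitive (a i) (b i) (K i)) :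
    IsRegPrimitive (fun τ => ∑ i ∈ s, a i τ) (fun τ => ∑ i ∈ s, b i τ)
      (fun τ => ∑ i ∈ s, K i τ) := by
  classical
  induction s using Finset.induction_on with
  | empty => simpa using IsRegPrimitive.zero
  | insert i s hi ih =>
    simp only [Finset.sum_insert hi]
    exact (h i (Finset.mem_insert_self i s)).add
      (ih fun j hj => h j (Finset.mem_insert_of_mem hj))

lemma IsRegPrimitive.finsum {ι : Type*} {c : ι → ℂ} (hc : {i | c i ≠ 0}.Finite)
    {K a b : ι → ℍ → ℂ} (h : ∀ i, IsRegPrimitive (a i) (b i) (K i)) :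
    IsRegPrimitive (fun τ => ∑ᶠ i, c i * a i τ) (fun τ => ∑ᶠ i, c i * b i τ)
      (fun τ => ∑ᶠ i, c i * K i τ) := by
  refine (IsRegPrimitive.sum hc.toFinset fun i _ => (h i).const_mul (c i)).congr ?_ ?_ ?_ <;>
  exact fun τ => finsum_eq_sum_of_zero hc _ fun i hi => by simp [hi]

lemma tendsto_conj_zero {f : ℝ → ℂ} (h : Tendsto f atTop (𝓝 0)) :
    Tendsto (fun t => conj (f t)) atTop (𝓝 0) := by
  have := (Complex.continuous_conj.tendsto 0).comp h
  rwa [map_zero] at this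

lemma conj_eval_ofReal (P : Polynomial ℂ) (t : ℝ) :
    conj (P.eval (t : ℂ)) = (P.map (starRingEnd ℂ)).eval (t : ℂ) := by
  rw [Polynomial.eval_map, Polynomial.eval, Polynomial.hom_eval₂]
  simp

lemma IsRegPrimitive.conj {a b K : ℍ → ℂ} (h : IsRegPrimitive a b K) :
    IsRegPrimitive (fun τ => conj (b τ)) (fun τ => conj (a τ)) (fun τ => conj (K τ)) := by
  obtain ⟨h1, P, hP, hl⟩ := isRegPrimitive_iff.1 h
  refine isRegPrimitive_iff.2 ⟨h1.conj.congr (fun _ => rfl) (fun _ => by simp)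
    (fun _ => by simp), P.map (starRingEnd ℂ), ?_, ?_⟩
  · have := conj_eval_ofReal P 0
    simp only [Complex.ofReal_zero, hP, map_zero] at this
    exact this.symm
  · refine (tendsto_conj_zero hl).congr fun t => ?_
    rw [map_sub, conj_eval_ofReal]

/-! ### Functions with polynomial behaviour at the cusp -/

section PolyExp

variable {α : Type*} {l : Filter α} {y : α → ℝ} {x : α → ℂ}

/-- Along the filter `l`, where `y → ∞`, the function `K` is a polynomial in `x` up to an error
which is exponentially small in `y`. -/
def PolyExp (l : Filter α) (y : α → ℝ) (x : α → ℂ) (K : α → ℂ) (P : Polynomial ℂ) : Prop :=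
  ∃ c : ℝ, 0 < c ∧ (fun a => K a - P.eval (x a)) =O[l] fun a => Real.exp (-c * y a)

lemma eval_isBigO_exp (hy : Tendsto y l atTop) (hx : x =O[l] y) (P : Polynomial ℂ) {ε : ℝ}
    (hε : 0 < ε) : (fun a => P.eval (x a)) =O[l] fun a => Real.exp (ε * y a) := by
  induction P using Polynomial.induction_on' with
  | add p q hp hq => simpa using hp.add hq
  | monomial n a =>
    simp only [Polynomial.eval_monomial]
    refine ((hx.pow n).trans ?_).const_mul_left a
    exact ((isLittleO_pow_exp_pos_mul_atTop n hε).comp_tendsto hy).isBigO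

lemma exp_isBigO_exp (hy : Tendsto y l atTop) {a b : ℝ} (h : a ≤ b) :
    (fun t => Real.exp (a * y t)) =O[l] fun t => Real.exp (b * y t) := by
  refine IsBigO.of_bound 1 ((hy.eventually_ge_atTop 0).mono fun t ht => ?_)
  rw [one_mul, Real.norm_of_nonneg (Real.exp_pos _).le, Real.norm_of_nonneg (Real.exp_pos _).le]
  exact Real.exp_le_exp.2 (mul_le_mul_of_nonneg_right h ht)

lemma PolyExp.add (hy : Tendsto y l atTop) {K L : α → ℂ} {P Q : Polynomial ℂ}
    (h : PolyExp l y x K P) (h' : PolyExp l y x L Q) :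
    PolyExp l y x (fun τ => K τ + L τ) (P + Q) := by
  obtain ⟨c, hc, h⟩ := h
  obtain ⟨d, hd, h'⟩ := h'
  refine ⟨min c d, lt_min hc hd, ?_⟩
  refine ((h.trans (exp_isBigO_exp hy ?_)).add (h'.trans (exp_isBigO_exp hy ?_))).congr_left
    fun τ => ?_
  · exact neg_le_neg (min_le_left _ _)
  · exact neg_le_neg (min_le_right _ _)
  · simp; ring

lemma PolyExp.poly (P : Polynomial ℂ) : PolyExp l y x (fun τ => P.eval (x τ)) P :=
  ⟨1, one_pos, by simpa using isBigO_zero _ _⟩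

lemma PolyExp.mul (hy : Tendsto y l atTop) (hx : x =O[l] y) {K L : α → ℂ} {P Q : Polynomial ℂ}
    (h : PolyExp l y x K P) (h' : PolyExp l y x L Q) :
    PolyExp l y x (fun τ => K τ * L τ) (P * Q) := by
  obtain ⟨c, hc, h⟩ := h
  obtain ⟨d, hd, h'⟩ := h'
  set e := min c d / 2 with he
  have hm : 0 < min c d := lt_min hc hd
  have hepos : 0 < e := by linarith
  have h1 : (fun τ => K τ - P.eval (x τ)) =O[l] fun τ => Real.exp (-(min c d) * y τ) :=
    h.trans (exp_isBigO_exp hy (neg_le_neg (min_le_left _ _)))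
  have h2 : (fun τ => L τ - Q.eval (x τ)) =O[l] fun τ => Real.exp (-(min c d) * y τ) :=
    h'.trans (exp_isBigO_exp hy (neg_le_neg (min_le_right _ _)))
  have h3 : L =O[l] fun τ => Real.exp (e * y τ) := by
    refine ((h2.trans (exp_isBigO_exp hy (b := e) (by linarith))).add
      (eval_isBigO_exp hy hx Q hepos)).congr_left fun τ => by ring
  have hexp : ∀ τ, Real.exp (-(min c d) * y τ) * Real.exp (e * y τ)
      = Real.exp (-e * y τ) := fun τ => by
    rw [← Real.exp_add, he]; congr 1; ring
  have h4 := (h1.mul h3).congr_right hexp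
  have h5 := ((eval_isBigO_exp hy hx P hepos).mul h2).congr_right
    fun τ => (mul_comm _ _).trans (hexp τ)
  refine ⟨e, hepos, (h4.add h5).congr_left fun τ => ?_⟩
  rw [Polynomial.eval_mul]; ring

end PolyExp

/-- The approach to the cusp inside the vertical strip `|Re τ| ≤ 1`. -/
def stripInf : Filter ℍ := comap UpperHalfPlane.im atTop ⊓ 𝓟 {τ | |τ.re| ≤ 1}

/-- `K` is a polynomial in `τ` up to an exponentially small error, in the strip `|Re τ| ≤ 1`. -/
def Tame (K : ℍ → ℂ) (P : Polynomial ℂ) : Prop :=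
  PolyExp stripInf UpperHalfPlane.im (fun τ : ℍ => (τ : ℂ)) K P

/-- On the imaginary axis, `K(it)` is a polynomial in `t` up to an exponentially small error. -/
def RayTame (K : ℍ → ℂ) (P : Polynomial ℂ) : Prop :=
  PolyExp atTop (fun t : ℝ => t) (fun t : ℝ => (t : ℂ))
    (fun t : ℝ => K (UpperHalfPlane.ofComplex (t * Complex.I))) P

lemma tendsto_im_stripInf : Tendsto UpperHalfPlane.im stripInf atTop :=
  tendsto_comap.mono_left inf_le_left

lemma eventually_stripInf {p : ℍ → Prop} :
    (∀ᶠ τ in stripInf, p τ) ↔ ∃ A : ℝ, ∀ τ : ℍ, A ≤ τ.im → |τ.re| ≤ 1 → p τ := by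
  rw [stripInf, eventually_inf_principal, eventually_comap, eventually_atTop]
  constructor
  · rintro ⟨A, hA⟩; exact ⟨A, fun τ h1 h2 => hA _ h1 τ rfl h2⟩
  · rintro ⟨A, hA⟩; exact ⟨A, fun b hb τ hτ h2 => hA τ (hτ ▸ hb) h2⟩

lemma coe_isBigO_im : (fun τ : ℍ => (τ : ℂ)) =O[stripInf] UpperHalfPlane.im := by
  refine IsBigO.of_bound 2 (eventually_stripInf.2 ⟨1, fun τ h1 h2 => ?_⟩)
  have := Complex.norm_le_abs_re_add_abs_im (τ : ℂ)
  rw [Real.norm_eq_abs]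
  have h3 : (1 : ℝ) ≤ |τ.im| := h1.trans (le_abs_self _)
  simp only [UpperHalfPlane.coe_re, UpperHalfPlane.coe_im] at this
  linarith

lemma Tame.add {K L : ℍ → ℂ} {P Q : Polynomial ℂ} (h : Tame K P) (h' : Tame L Q) :
    Tame (fun τ => K τ + L τ) (P + Q) := PolyExp.add tendsto_im_stripInf h h'

lemma Tame.poly (P : Polynomial ℂ) : Tame (fun τ => P.eval (τ : ℂ)) P := PolyExp.poly P

lemma Tame.mul {K L : ℍ → ℂ} {P Q : Polynomial ℂ} (h : Tame K P) (h' : Tame L Q) :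
    Tame (fun τ => K τ * L τ) (P * Q) := PolyExp.mul tendsto_im_stripInf coe_isBigO_im h h'

lemma Tame.const_mul {K : ℍ → ℂ} {P : Polynomial ℂ} (a : ℂ) (h : Tame K P) :
    Tame (fun τ => a * K τ) (Polynomial.C a * P) := by
  simpa using (Tame.poly (Polynomial.C a)).mul h

lemma RayTame.add {K L : ℍ → ℂ} {P Q : Polynomial ℂ} (h : RayTame K P) (h' : RayTame L Q) :
    RayTame (fun τ => K τ + L τ) (P + Q) := PolyExp.add tendsto_id h h'

lemma RayTame.const (a : ℂ) : RayTame (fun _ => a) (Polynomial.C a) := by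
  simpa [RayTame] using PolyExp.poly (l := atTop) (y := fun t : ℝ => t)
    (x := fun t : ℝ => (t : ℂ)) (Polynomial.C a)

lemma RayTame.mul {K L : ℍ → ℂ} {P Q : Polynomial ℂ} (h : RayTame K P) (h' : RayTame L Q) :
    RayTame (fun τ => K τ * L τ) (P * Q) :=
  PolyExp.mul tendsto_id (Complex.isBigO_ofReal_left.2 (isBigO_refl _ _)) h h'

lemma RayTame.conj {K : ℍ → ℂ} {P : Polynomial ℂ} (h : RayTame K P) :
    RayTame (fun τ => conj (K τ)) (P.map (starRingEnd ℂ)) := by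
  obtain ⟨c, hc, h⟩ := h
  refine ⟨c, hc, (h.norm_left.congr_left fun t => ?_).of_norm_left⟩
  rw [← conj_eval_ofReal, ← map_sub, Complex.norm_conj]

lemma tendsto_ray_stripInf :
    Tendsto (fun t : ℝ => UpperHalfPlane.ofComplex (t * Complex.I)) atTop stripInf := by
  rw [stripInf, tendsto_inf, tendsto_principal, tendsto_comap_iff]
  constructor
  · refine tendsto_id.congr' ?_
    filter_upwards [eventually_gt_atTop 0] with t ht
    simp [ofComplex_im_pos (show 0 < ((t : ℂ) * Complex.I).im by simpa using ht),
      UpperHalfPlane.im]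
  · filter_upwards [eventually_gt_atTop 0] with t ht
    simp [ofComplex_im_pos (show 0 < ((t : ℂ) * Complex.I).im by simpa using ht),
      UpperHalfPlane.re]

lemma Tame.rayTame {K : ℍ → ℂ} {P : Polynomial ℂ} (h : Tame K P) :
    RayTame K (P.comp (Polynomial.X * Polynomial.C Complex.I)) := by
  obtain ⟨c, hc, h⟩ := h
  refine ⟨c, hc, (h.comp_tendsto tendsto_ray_stripInf).congr' ?_ ?_⟩
  all_goals
    filter_upwards [eventually_gt_atTop 0] with t ht
    rw [Function.comp_apply, ofComplex_im_pos (show 0 < ((t : ℂ) * Complex.I).im by simpa using ht)]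
  · simp only [Polynomial.eval_comp, Polynomial.eval_mul, Polynomial.eval_X, Polynomial.eval_C]
  · simp only [← UpperHalfPlane.coe_im, Complex.im_ofReal_mul, Complex.I_im, mul_one]

lemma RayTame.cusp {K : ℍ → ℂ} {P : Polynomial ℂ} (h : RayTame K P) :
    Tendsto (fun t : ℝ => K (UpperHalfPlane.ofComplex (t * Complex.I)) - P.eval (t : ℂ))
      atTop (𝓝 0) := by
  obtain ⟨c, hc, h⟩ := h
  refine h.trans_tendsto ?_
  have : Tendsto (fun t : ℝ => c * t) atTop atTop := tendsto_id.const_mul_atTop hc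
  refine (Real.tendsto_exp_neg_atTop_nhds_zero.comp this).congr fun t => ?_
  simp

lemma RayTame.isReg {K a b : ℍ → ℂ} {P : Polynomial ℂ} (h : RayTame K P) (h0 : P.eval 0 = 0)
    (hK : HasDD K (fun τ => -a τ) (fun τ => -b τ)) : IsRegPrimitive a b K :=
  isRegPrimitive_iff.2 ⟨hK, P, h0, h.cusp⟩

/-! ### Primitives of holomorphic functions with polynomial behaviour -/

/-- Holomorphic functions on the upper half-plane. -/
def Hol (f : ℍ → ℂ) : Prop :=
  DifferentiableOn ℂ (fun z : ℂ => f (UpperHalfPlane.ofComplex z)) {z | 0 < z.im}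

lemma HasDD.hol {f f' : ℍ → ℂ} (h : HasDD f f' (fun _ => 0)) : Hol f := fun z hz =>
  (h.hasDerivAt ⟨z, hz⟩).differentiableAt.differentiableWithinAt

lemma Hol.mul {f g : ℍ → ℂ} (hf : Hol f) (hg : Hol g) : Hol (fun τ => f τ * g τ) :=
  DifferentiableOn.mul hf hg

lemma Hol.const_mul {f : ℍ → ℂ} (c : ℂ) (hf : Hol f) : Hol (fun τ => c * f τ) :=
  DifferentiableOn.const_mul hf c

lemma hol_pow (n : ℕ) : Hol (fun τ => (τ : ℂ) ^ n) :=
  ((HasDD.coe.pow n).congr (fun _ => rfl) (fun _ => rfl) (fun _ => by simp)).hol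

lemma hasDD_eval (Q : Polynomial ℂ) : HasDD (fun τ => Q.eval (τ : ℂ))
    (fun τ => (Polynomial.derivative Q).eval (τ : ℂ)) (fun _ => 0) := by
  refine HasDD.of_hasDerivAt fun τ => ?_
  refine (Q.hasDerivAt (τ : ℂ)).congr_of_eventuallyEq ?_
  filter_upwards [UpperHalfPlane.isOpen_upperHalfPlaneSet.mem_nhds τ.2] with z hz
  rw [ofComplex_im_pos hz]

lemma exists_antiderivative (P : Polynomial ℂ) :
    ∃ Q : Polynomial ℂ, Polynomial.derivative Q = P ∧ Q.eval 0 = 0 := by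
  induction P using Polynomial.induction_on' with
  | add p q hp hq =>
    obtain ⟨a, ha, ha'⟩ := hp
    obtain ⟨b, hb, hb'⟩ := hq
    exact ⟨a + b, by simp [ha, hb], by simp [ha', hb']⟩
  | monomial n a =>
    refine ⟨Polynomial.monomial (n + 1) (a / (n + 1)), ?_, by simp⟩
    rw [Polynomial.derivative_monomial]
    have : (n + 1 : ℂ) ≠ 0 := by exact_mod_cast Nat.succ_ne_zero n
    simp [this]

/-- A function on a half-line with exponentially decaying derivative converges exponentially
fast. -/
lemma exists_tendsto_of_deriv_exp {h h' : ℝ → ℂ} {A C c : ℝ} (hc : 0 < c) (hC : 0 ≤ C)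
    (hd : ∀ t, A ≤ t → HasDerivAt h (h' t) t)
    (hb : ∀ t, A ≤ t → ‖h' t‖ ≤ C * Real.exp (-c * t)) :
    ∃ L : ℂ, ∀ t, A ≤ t → ‖h t - L‖ ≤ C / c * Real.exp (-c * t) := by
  have key : ∀ t s, A ≤ t → t ≤ s → ‖h s - h t‖ ≤ C / c * Real.exp (-c * t) := by
    intro t s hAt hts
    have := image_norm_le_of_norm_deriv_right_le_deriv_boundary (a := t) (b := s)
      (f := fun u => h u - h t) (f' := h')
      (B := fun u => C / c * (Real.exp (-c * t) - Real.exp (-c * u)))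
      (B' := fun u => C * Real.exp (-c * u))
      (fun u hu => ((hd u (hAt.trans hu.1)).continuousAt.sub continuousAt_const).continuousWithinAt)
      (fun u hu => ((hd u (hAt.trans hu.1)).sub_const _).hasDerivWithinAt)
      (by simp) (fun u => by
        have h1 : HasDerivAt (fun u : ℝ => -c * u) (-c) u := by
          simpa using (hasDerivAt_id u).const_mul (-c)
        refine ((h1.exp.const_sub (Real.exp (-c * t))).const_mul (C / c)).congr_deriv ?_
        field_simp)
      (fun u hu => hb u (hAt.trans hu.1)) (x := s) ⟨hts, le_rfl⟩
    refine this.trans ?_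
    have h2 := Real.exp_pos (-c * s)
    have h3 : 0 ≤ C / c := by positivity
    nlinarith
  have hcau : Cauchy (map h atTop) := by
    rw [Metric.cauchy_iff]
    refine ⟨inferInstance, fun ε hε => ?_⟩
    have hlim : Tendsto (fun t : ℝ => C / c * Real.exp (-c * t)) atTop (𝓝 (C / c * 0)) := by
      refine Tendsto.const_mul _ ?_
      refine (Real.tendsto_exp_neg_atTop_nhds_zero.comp
        (tendsto_id.const_mul_atTop hc)).congr fun t => by simp
    rw [mul_zero] at hlim
    obtain ⟨t, ht, hAt⟩ := ((hlim.eventually_lt_const (half_pos hε)).and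
      (eventually_ge_atTop A)).exists
    refine ⟨h '' Set.Ici t, image_mem_map (Ici_mem_atTop t), ?_⟩
    rintro _ ⟨u, hu, rfl⟩ _ ⟨v, hv, rfl⟩
    have h1 := key t u hAt hu
    have h2 := key t v hAt hv
    rw [← dist_eq_norm] at h1 h2
    have := dist_triangle_right (h u) (h v) (h t)
    linarith
  obtain ⟨L, hL⟩ := CompleteSpace.complete hcau
  refine ⟨L, fun t ht => ?_⟩
  have h1 : Tendsto (fun s => ‖h t - h s‖) atTop (𝓝 ‖h t - L‖) :=
    (tendsto_const_nhds.sub hL).norm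
  refine le_of_tendsto h1 ((eventually_ge_atTop t).mono fun s hs => ?_)
  rw [norm_sub_rev]
  exact key t s ht hs

/-- A holomorphic function with polynomial behaviour at the cusp has a primitive of the same
kind. -/
lemma Tame.exists_primitive {f : ℍ → ℂ} (hf : Hol f) {P : Polynomial ℂ} (h : Tame f P) :
    ∃ (K : ℍ → ℂ) (Q : Polynomial ℂ), HasDD K (fun τ => - f τ) (fun _ => 0) ∧ Tame K Q ∧
      Q.eval 0 = 0 ∧ Polynomial.derivative Q = -P := by
  obtain ⟨Q, hQ, hQ0⟩ := exists_antiderivative P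
  obtain ⟨g, hg⟩ := convex_uhp.exists_forall_hasDerivWithinAt hf
  have hg' : ∀ z : ℂ, 0 < z.im → HasDerivAt g (f (UpperHalfPlane.ofComplex z)) z := fun z hz =>
    (hg z hz).hasDerivAt (UpperHalfPlane.isOpen_upperHalfPlaneSet.mem_nhds hz)
  obtain ⟨c, hc, h⟩ := h
  obtain ⟨C, hCpos, hC⟩ := h.exists_pos
  obtain ⟨A, hA⟩ := eventually_stripInf.1 hC.bound
  set B := max A 1
  set r : ℂ → ℂ := fun z => g z - Q.eval z with hr
  have hrd : ∀ z : ℂ, 0 < z.im →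
      HasDerivAt r (f (UpperHalfPlane.ofComplex z) - P.eval z) z := fun z hz => by
    have := (hg' z hz).sub (Q.hasDerivAt z)
    rwa [hQ] at this
  have hrb : ∀ z : ℂ, B ≤ z.im → |z.re| ≤ 1 →
      ‖f (UpperHalfPlane.ofComplex z) - P.eval z‖ ≤ C * Real.exp (-c * z.im) := fun z h1 h2 => by
    have hz : 0 < z.im := lt_of_lt_of_le one_pos ((le_max_right _ _).trans h1)
    have := hA ⟨z, hz⟩ ((le_max_left _ _).trans h1) h2
    rw [Real.norm_of_nonneg (Real.exp_pos _).le] at this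
    rw [ofComplex_im_pos hz]; exact this
  -- The constant of integration is the limit on the imaginary axis.
  obtain ⟨L, hL⟩ := exists_tendsto_of_deriv_exp (h := fun t : ℝ => r (t * Complex.I))
    (h' := fun t : ℝ => (f (UpperHalfPlane.ofComplex (t * Complex.I)) - P.eval (t * Complex.I))
      * Complex.I) (A := B) hc hCpos.le
    (fun t ht => by
      have h1 : HasDerivAt (fun u : ℂ => u * Complex.I) Complex.I (t : ℂ) := by
        simpa using (hasDerivAt_id (t : ℂ)).mul_const Complex.I
      have hz : 0 < ((t : ℂ) * Complex.I).im := by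
        simpa using lt_of_lt_of_le one_pos ((le_max_right _ _).trans ht)
      exact ((hrd _ hz).comp (t : ℂ) h1).comp_ofReal)
    (fun t ht => by
      have := hrb (t * Complex.I) (by simpa using ht) (by simp)
      simpa using this)
  refine ⟨fun τ => L - g τ, -Q, ?_, ?_, by simp [hQ0], by simp [hQ]⟩
  · refine HasDD.of_hasDerivAt fun τ => ?_
    have := (hg' τ τ.2).const_sub L
    rw [UpperHalfPlane.ofComplex_apply] at this
    refine this.congr_of_eventuallyEq ?_
    filter_upwards [UpperHalfPlane.isOpen_upperHalfPlaneSet.mem_nhds τ.2] with z hz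
    rw [ofComplex_im_pos hz]
  · refine ⟨c, hc, IsBigO.of_bound (C / c + C) (eventually_stripInf.2 ⟨B, fun τ h1 h2 => ?_⟩)⟩
    rw [Real.norm_of_nonneg (Real.exp_pos _).le]
    have e1 : L - g τ - (-Q).eval (τ : ℂ) = (L - r (τ.im * Complex.I))
        - (r τ - r (τ.im * Complex.I)) := by simp [hr]; ring
    rw [e1]
    -- The rest of the strip is reached along horizontal segments, on which the derivative of the
    -- remainder is exponentially small.
    have hh := (convex_uhp.inter ((convex_halfSpace_im_ge τ.im).inter
      ((convex_halfSpace_im_le τ.im).inter ((convex_halfSpace_re_ge (-1)).inter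
        (convex_halfSpace_re_le 1))))).norm_image_sub_le_of_norm_hasDerivWithin_le (𝕜 := ℂ)
        (f := r) (C := C * Real.exp (-c * τ.im)) (x := τ.im * Complex.I) (y := (τ : ℂ))
        (fun z hz => (hrd z hz.1).hasDerivWithinAt)
        (fun z hz => by
          obtain ⟨_, h3, h4, h5, h6⟩ := hz
          have h7 : z.im = τ.im := le_antisymm h4 h3
          have := hrb z (h7 ▸ h1) (abs_le.2 ⟨h5, h6⟩)
          rwa [h7] at this)
        (by simpa using τ.im_pos)
        (by
          have := abs_le.1 h2
          simpa using ⟨τ.im_pos, this.1, this.2⟩)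
    have e2 : ‖(τ : ℂ) - τ.im * Complex.I‖ ≤ 1 := by
      have : (τ : ℂ) - τ.im * Complex.I = (τ.re : ℂ) := by
        apply Complex.ext <;> simp
      rw [this, Complex.norm_real]; exact h2
    have e3 := hL τ.im h1
    rw [norm_sub_rev] at e3
    have e4 : 0 ≤ C * Real.exp (-c * τ.im) := by positivity
    calc _ ≤ _ := norm_sub_le _ _
      _ ≤ C / c * Real.exp (-c * τ.im) + C * Real.exp (-c * τ.im) * 1 :=
        add_le_add e3 (hh.trans (mul_le_mul_of_nonneg_left e2 e4))
      _ = _ := by ring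

/-- The regularised integral of a holomorphic function with polynomial behaviour at the cusp. -/
lemma Tame.regInt {f : ℍ → ℂ} (hf : Hol f) {P : Polynomial ℂ} (h : Tame f P) :
    IsRegPrimitive f (fun _ => 0) (regInt f (fun _ => 0)) ∧ ∃ Q : Polynomial ℂ,
      Tame (EqvInt.regInt f (fun _ => 0)) Q ∧ Q.eval 0 = 0 ∧ Polynomial.derivative Q = -P := by
  obtain ⟨K, Q, hK, hT, hQ, hQ'⟩ := h.exists_primitive hf
  have : IsRegPrimitive f (fun _ => 0) K := hT.rayTame.isReg (by simp [hQ])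
    (hK.congr (fun _ => rfl) (fun _ => rfl) (fun _ => by simp))
  rw [this.regInt_eq]
  exact ⟨this, Q, hT, hQ, hQ'⟩

/-! ### Modular forms and Eisenstein series at the cusp -/

lemma hol_of_modularFormClass {F : Type*} [FunLike F ℍ ℂ] {k : ℤ} [ModularFormClass F 𝒮ℒ k]
    (f : F) : Hol f := fun z hz =>
  (UpperHalfPlane.mdifferentiableAt_iff.1 (ModularFormClass.holo f ⟨z, hz⟩)).differentiableWithinAt

lemma tame_of_modularFormClass {F : Type*} [FunLike F ℍ ℂ] {k : ℤ} [ModularFormClass F 𝒮ℒ k]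
    (f : F) : Tame f (Polynomial.C (UpperHalfPlane.valueAtInfty f)) := by
  obtain ⟨c, hc, h⟩ := ModularFormClass.exp_decay_sub_atImInfty' f
  refine ⟨c, hc, ?_⟩
  simp only [Polynomial.eval_C]
  exact h.mono inf_le_left

lemma tame_of_cuspForm {k : ℤ} (f : CuspForm 𝒮ℒ k) : Tame f 0 := by
  have := tame_of_modularFormClass f
  rwa [(CuspFormClass.zero_at_infty f).valueAtInfty_eq_zero, map_zero] at this

lemma eisG_eq {k : ℕ} (hk : 3 ≤ k) (τ : ℍ) :
    eisG k τ = 2 * riemannZeta k * ModularForm.E hk τ := by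
  rw [eisG, tsum_eisSummand_eq_riemannZeta_mul_eisensteinSeries hk]
  have : ModularForm.E hk τ = (1 / 2 : ℂ) * eisensteinSeries (N := 1) 0 k τ := rfl
  rw [this]; ring

/-- `G_k` as a modular form. -/
def eisForm (k : EisWt) : ModularForm 𝒮ℒ (k.1 : ℤ) :=
  (2 * riemannZeta k.1) • ModularForm.E (k := k.1) (by have := k.2.2; omega)

lemma eisForm_apply (k : EisWt) (τ : ℍ) : eisForm k τ = eisG k.1 τ := by
  rw [eisG_eq (by have := k.2.2; omega)]; rfl

lemma eisForm_coe (k : EisWt) : (eisForm k : ℍ → ℂ) = eisG k.1 := funext (eisForm_apply k)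

lemma hol_eisG (k : EisWt) : Hol (eisG k.1) := by
  rw [← eisForm_coe]; exact hol_of_modularFormClass _

lemma tame_eisG (k : EisWt) :
    Tame (eisG k.1) (Polynomial.C (UpperHalfPlane.valueAtInfty (eisG k.1))) := by
  rw [← eisForm_coe]; exact tame_of_modularFormClass _

/-! ### Iterated integrals -/

lemma hol_kernel (x : XLetter) : Hol (kernel x) := by
  rcases x with a | d
  · exact ((hol_pow _).const_mul _).mul (hol_eisG a.1)
  · exact ((hol_pow _).const_mul _).mul (hol_of_modularFormClass _)

lemma tame_pow (n : ℕ) : Tame (fun τ => (τ : ℂ) ^ n) (Polynomial.X ^ n) := by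
  simpa using Tame.poly (Polynomial.X ^ n)

lemma tame_kernel (x : XLetter) : ∃ P, Tame (kernel x) P := by
  rcases x with a | d
  · exact ⟨_, ((tame_pow _).const_mul _).mul (tame_eisG a.1)⟩
  · exact ⟨_, ((tame_pow _).const_mul _).mul (tame_of_modularFormClass _)⟩

lemma iterIntAux_prop (w : List XLetter) : Hol (iterIntAux w) ∧ ∃ P, Tame (iterIntAux w) P := by
  induction w with
  | nil => 
    refine ⟨differentiableOn_const _, Polynomial.C 1, ?_⟩
    have := Tame.poly (Polynomial.C 1)
    simp only [Polynomial.eval_C] at this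
    exact this
  | cons x w ih =>
    obtain ⟨h1, P, hP⟩ := ih
    obtain ⟨R, hR⟩ := tame_kernel x
    obtain ⟨h3, Q, hQ, -⟩ := (hR.mul hP).regInt ((hol_kernel x).mul h1)
    refine ⟨?_, Q, hQ⟩
    exact (h3.hasDD.congr (fun _ => rfl) (fun _ => rfl) (fun _ => by simp)).hol

lemma iterIntAux_cons_isReg (x : XLetter) (w : List XLetter) :
    IsRegPrimitive (fun τ => kernel x τ * iterIntAux w τ) (fun _ => 0) (iterIntAux (x :: w)) := by
  obtain ⟨h1, P, hP⟩ := iterIntAux_prop w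
  obtain ⟨R, hR⟩ := tame_kernel x
  exact ((hR.mul hP).regInt ((hol_kernel x).mul h1)).1

lemma iterIntAux_cons_rayTame (x : XLetter) (w : List XLetter) :
    ∃ P : Polynomial ℂ, RayTame (iterIntAux (x :: w)) P ∧ P.eval 0 = 0 := by
  obtain ⟨h1, P, hP⟩ := iterIntAux_prop w
  obtain ⟨R, hR⟩ := tame_kernel x
  obtain ⟨-, Q, hQ, hQ0, -⟩ := (hR.mul hP).regInt ((hol_kernel x).mul h1)
  exact ⟨_, hQ.rayTame, by simp [hQ0]⟩

lemma iterInt_nil (τ : ℍ) : iterInt [] τ = 1 := rfl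

lemma iterInt_concat_hasDD (w : List XLetter) (x : XLetter) :
    HasDD (iterInt (w ++ [x])) (fun τ => -(kernel x τ * iterInt w τ)) (fun _ => 0) := by
  have := (iterIntAux_cons_isReg x w.reverse).hasDD
  rw [iterInt, List.reverse_append]
  exact this.congr (fun _ => rfl) (fun _ => rfl) (fun _ => by simp)

lemma iterInt_rayTame (w : List XLetter) :
    ∃ P : Polynomial ℂ, RayTame (iterInt w) P ∧ (w ≠ [] → P.eval 0 = 0) ∧
      (w = [] → P.eval 0 = 1) := by
  rcases List.eq_nil_or_concat w with rfl | ⟨u, x, rfl⟩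
  · exact ⟨Polynomial.C 1, RayTame.const 1, by simp, by simp⟩
  · obtain ⟨P, h1, h2⟩ := iterIntAux_cons_rayTame x u.reverse
    refine ⟨P, ?_, fun _ => h2, by simp⟩
    rw [iterInt, List.concat_eq_append, List.reverse_append]
    exact h1

lemma iterInt_singleton_isReg (x : XLetter) :
    IsRegPrimitive (kernel x) (fun _ => 0) (iterInt [x]) :=
  (iterIntAux_cons_isReg x []).congr (fun _ => rfl) (fun _ => by simp [iterIntAux])
    (fun _ => rfl)

/-! ### A maximum principle for eigenfunctions of the hyperbolic Laplacian -/

lemma second_deriv_nonpos_of_isLocalMax {f f' : ℝ → ℝ} {c : ℝ}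
    (hf : ∀ᶠ x in 𝓝 0, HasDerivAt f (f' x) x) (hf' : HasDerivAt f' c 0)
    (hmax : IsLocalMax f 0) : c ≤ 0 := by
  by_contra hc
  push Not at hc
  have he : deriv f =ᶠ[𝓝 0] f' := hf.mono fun x hx => hx.deriv
  have h2 : deriv (deriv f) 0 = c := (hf'.congr_of_eventuallyEq he).deriv
  have h1 : deriv f 0 = 0 := hmax.deriv_eq_zero
  have hmin := isLocalMin_of_deriv_deriv_pos (h2 ▸ hc) h1 hf.self_of_nhds.continuousAt
  have hconst : f =ᶠ[𝓝 0] fun _ => f 0 := by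
    filter_upwards [hmax, hmin] with x h3 h4 using le_antisymm h3 h4
  have h5 : deriv f =ᶠ[𝓝 0] fun _ => 0 := by
    filter_upwards [hconst.eventuallyEq_nhds] with x hx
    rw [hx.deriv_eq]; simp
  have h6 : deriv (deriv f) 0 = 0 := by rw [h5.deriv_eq]; simp
  linarith

lemma HasDD.hasDerivAt_line {h A B : ℍ → ℂ} (hh : HasDD h A B) (τ : ℍ) (v : ℂ) :
    ∀ᶠ x : ℝ in 𝓝 0, HasDerivAt (fun x : ℝ => h (UpperHalfPlane.ofComplex (τ + x * v)))
      (A (UpperHalfPlane.ofComplex (τ + x * v)) * v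
        + B (UpperHalfPlane.ofComplex (τ + x * v)) * conj v) x := by
  have hcont : Continuous fun x : ℝ => (τ : ℂ) + x * v := by fun_prop
  have hmem : (fun x : ℝ => (τ : ℂ) + x * v) ⁻¹' {z | 0 < z.im} ∈ 𝓝 (0 : ℝ) :=
    hcont.continuousAt.preimage_mem_nhds
      (UpperHalfPlane.isOpen_upperHalfPlaneSet.mem_nhds (by simpa using τ.2))
  filter_upwards [hmem] with x hx
  have h1 : HasDerivAt (fun x : ℝ => (τ : ℂ) + x * v) v x := by
    simpa using ((Complex.ofRealCLM.hasDerivAt (x := x)).mul_const v).const_add (τ : ℂ)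
  have h2 := (hh ⟨(τ : ℂ) + x * v, hx⟩).comp_hasDerivAt x h1
  rw [ofComplex_im_pos hx]
  simpa [Function.comp_def] using h2

/-- At a maximum of `Re (ω h)` the second derivative in the direction `v` is not positive. -/
lemma re_second_deriv_nonpos {h A B A1 A2 B1 B2 : ℍ → ℂ} (hh : HasDD h A B) (hA : HasDD A A1 A2)
    (hB : HasDD B B1 B2) {ω : ℂ} {τ : ℍ} (hmax : ∀ σ, (ω * h σ).re ≤ (ω * h τ).re) (v : ℂ) :
    (ω * ((A1 τ * v + A2 τ * conj v) * v + (B1 τ * v + B2 τ * conj v) * conj v)).re ≤ 0 := by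
  have hre : ∀ {f : ℝ → ℂ} {f' : ℂ} {x : ℝ}, HasDerivAt f f' x →
      HasDerivAt (fun x => (ω * f x).re) (ω * f').re x := fun {f f' x} hf => by
    have := Complex.reCLM.hasFDerivAt.comp_hasDerivAt x (hf.const_mul ω)
    simpa [Function.comp_def] using this
  have e0 : UpperHalfPlane.ofComplex ((τ : ℂ) + (0 : ℝ) * v) = τ := by simp
  refine second_deriv_nonpos_of_isLocalMax
    (f := fun x : ℝ => (ω * h (UpperHalfPlane.ofComplex (τ + x * v))).re)
    (f' := fun x : ℝ => (ω * (A (UpperHalfPlane.ofComplex (τ + x * v)) * v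
        + B (UpperHalfPlane.ofComplex (τ + x * v)) * conj v)).re)
    ((hh.hasDerivAt_line τ v).mono fun x hx => hre hx) ?_
    (Eventually.of_forall fun x => by simp only [e0]; exact hmax _)
  have h1 := ((hA.hasDerivAt_line τ v).self_of_nhds.mul_const v).add
    ((hB.hasDerivAt_line τ v).self_of_nhds.mul_const (conj v))
  have := hre h1
  simp only [e0] at this
  exact this

lemma HasDD.continuousOn {h A B : ℍ → ℂ} (hh : HasDD h A B) :
    ContinuousOn (fun z : ℂ => h (UpperHalfPlane.ofComplex z)) {z | 0 < z.im} :=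
  fun z hz => (hh ⟨z, hz⟩).continuousAt.continuousWithinAt

/-- An `SL(2, ℤ)`-invariant function which tends to zero at the cusp and is somewhere positive
attains its maximum. -/
lemma exists_max_of_invariant {u : ℍ → ℝ}
    (hc : ContinuousOn (fun z : ℂ => u (UpperHalfPlane.ofComplex z)) {z | 0 < z.im})
    (hinv : ∀ (γ : SL(2, ℤ)) τ, u (γ • τ) = u τ) (hcusp : Tendsto u stripInf (𝓝 0))
    {τ₀ : ℍ} (h0 : 0 < u τ₀) : ∃ τ, (∀ σ, u σ ≤ u τ) ∧ 0 < u τ := by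
  obtain ⟨A, hA⟩ := eventually_stripInf.1 (hcusp.eventually_lt_const h0)
  set K : Set ℂ := Set.Icc (-(1 / 2)) (1 / 2) ×ℂ Set.Icc (1 / 2) (max A 1)
  have hK : IsCompact K := isCompact_Icc.reProdIm isCompact_Icc
  have hsub : K ⊆ {z | 0 < z.im} := fun z hz => by
    have := (Complex.mem_reProdIm.1 hz).2.1
    exact lt_of_lt_of_le (by norm_num) this
  -- It suffices to look at the fundamental domain, where only a compact part is not close to the
  -- cusp.
  have key : ∀ σ, u σ < u τ₀ ∨ ∃ σ' : ℍ, u σ' = u σ ∧ (σ' : ℂ) ∈ K := by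
    intro σ
    obtain ⟨g, hg⟩ := ModularGroup.exists_smul_mem_fd σ
    have him := ModularGroup.three_le_four_mul_im_sq_of_mem_fd hg
    have hre : |(g • σ).re| ≤ 1 / 2 := hg.2
    rcases le_or_gt A (g • σ).im with h | h
    · left; rw [← hinv g]; exact hA _ h (hre.trans (by norm_num))
    · right
      refine ⟨g • σ, hinv _ _, Complex.mem_reProdIm.2 ⟨abs_le.1 hre, ?_, h.le.trans (le_max_left _ _)⟩⟩
      have := (g • σ).im_pos
      rw [UpperHalfPlane.coe_im]
      nlinarith
  obtain ⟨σ₀, hσ₀, hσ₀K⟩ := (key τ₀).resolve_left (lt_irrefl _)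
  obtain ⟨z, hz, hzmax⟩ := hK.exists_isMaxOn ⟨_, hσ₀K⟩ (hc.mono hsub)
  have hmax : ∀ σ : ℍ, (σ : ℂ) ∈ K → u σ ≤ u (UpperHalfPlane.ofComplex z) := fun σ hσ => by
    have := hzmax hσ
    simpa using this
  have h1 : u τ₀ ≤ u (UpperHalfPlane.ofComplex z) := hσ₀ ▸ hmax _ hσ₀K
  refine ⟨UpperHalfPlane.ofComplex z, fun σ => ?_, h0.trans_le h1⟩
  rcases key σ with h | ⟨σ', h, h'⟩
  · exact h.le.trans h1
  · exact h ▸ hmax _ h'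

/-- An invariant function `h` with `∂∂̄h = λ h`, `λ > 0`, which tends to zero at the cusp,
vanishes. -/
lemma eq_zero_of_laplace_pos {h A B A1 A2 B1 B2 : ℍ → ℂ} (hh : HasDD h A B) (hA : HasDD A A1 A2)
    (hB : HasDD B B1 B2) {lam : ℍ → ℝ} (hlam : ∀ τ, 0 < lam τ) (hA2 : ∀ τ, A2 τ = lam τ * h τ)
    (hB1 : ∀ τ, B1 τ = lam τ * h τ) (hinv : ∀ (γ : SL(2, ℤ)) τ, h (γ • τ) = h τ)
    (hcusp : Tendsto h stripInf (𝓝 0)) (τ : ℍ) : h τ = 0 := by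
  have key : ∀ ω : ℂ, ∀ τ, (ω * h τ).re ≤ 0 := by
    intro ω τ₀
    by_contra hpos
    push Not at hpos
    obtain ⟨τ, hmax, hτ⟩ := exists_max_of_invariant (u := fun τ => (ω * h τ).re)
      (Complex.continuous_re.comp_continuousOn (continuousOn_const.mul hh.continuousOn))
      (fun γ τ => by simp only [hinv]) (by
        have := (Complex.continuous_re.tendsto _).comp (hcusp.const_mul ω)
        simpa [Function.comp_def] using this) hpos
    have h1 := re_second_deriv_nonpos hh hA hB hmax 1
    have h2 := re_second_deriv_nonpos hh hA hB hmax Complex.I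
    -- The Laplacian is the sum of the second derivatives in the directions `1` and `i`.
    have h3 : (ω * ((A1 τ * 1 + A2 τ * conj 1) * 1 + (B1 τ * 1 + B2 τ * conj 1) * conj 1)).re
        + (ω * ((A1 τ * Complex.I + A2 τ * conj Complex.I) * Complex.I
          + (B1 τ * Complex.I + B2 τ * conj Complex.I) * conj Complex.I)).re
        = 4 * lam τ * (ω * h τ).re := by
      rw [← Complex.add_re, ← Complex.re_ofReal_mul]
      congr 1
      rw [hA2, hB1]
      simp only [map_one, Complex.conj_I]
      push_cast
      linear_combination (ω * (A1 τ - 2 * (lam τ * h τ) + B2 τ)) * Complex.I_sq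
    have h4 := mul_pos (mul_pos (by norm_num : (0 : ℝ) < 4) (hlam τ)) hτ
    linarith
  -- A number whose multiples by the fourth roots of unity have non-positive real part is zero.
  have h1 := key 1 τ
  have h2 := key (-1) τ
  have h3 := key Complex.I τ
  have h4 := key (-Complex.I) τ
  simp at h1 h2 h3 h4
  apply Complex.ext <;> simp <;> linarith

/-! ### Polynomial-valued functions -/

/-- `d` of a polynomial-valued function, coefficientwise. -/
def PolyDD (P A B : ℍ → Polynomial ℂ) : Prop :=
  ∀ r, HasDD (fun τ => (P τ).coeff r) (fun τ => (A τ).coeff r) (fun τ => (B τ).coeff r)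

lemma PolyDD.mul {P A B P' A' B' : ℍ → Polynomial ℂ} (h : PolyDD P A B) (h' : PolyDD P' A' B') :
    PolyDD (fun τ => P τ * P' τ) (fun τ => A τ * P' τ + P τ * A' τ)
      (fun τ => B τ * P' τ + P τ * B' τ) := by
  intro r
  refine (HasDD.sum (Finset.HasAntidiagonal.antidiagonal r) fun i _ => (h i.1).mul (h' i.2)).congr ?_ ?_ ?_ <;>
  intro τ
  · rw [Polynomial.coeff_mul]
  · rw [Polynomial.coeff_add, Polynomial.coeff_mul, Polynomial.coeff_mul, Finset.sum_add_distrib]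
  · rw [Polynomial.coeff_add, Polynomial.coeff_mul, Polynomial.coeff_mul, Finset.sum_add_distrib]

lemma PolyDD.C {K a b : ℍ → ℂ} (h : HasDD K a b) : PolyDD (fun τ => Polynomial.C (K τ))
    (fun τ => Polynomial.C (a τ)) (fun τ => Polynomial.C (b τ)) := by
  intro r
  simp only [Polynomial.coeff_C]
  split_ifs
  · exact h
  · exact HasDD.const 0

lemma PolyDD.const (P : Polynomial ℂ) : PolyDD (fun _ => P) (fun _ => 0) (fun _ => 0) :=
  fun r => by simpa using HasDD.const (P.coeff r)

lemma PolyDD.congr {K a b K' a' b' : ℍ → Polynomial ℂ} (h : PolyDD K a b)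
    (hK : ∀ τ, K' τ = K τ) (ha : ∀ τ, a' τ = a τ) (hb : ∀ τ, b' τ = b τ) : PolyDD K' a' b' := by
  rwa [funext hK, funext ha, funext hb]

lemma PolyDD.sum {ι : Type*} (s : Finset ι) {K a b : ι → ℍ → Polynomial ℂ}
    (h : ∀ i ∈ s, PolyDD (K i) (a i) (b i)) :
    PolyDD (fun τ => ∑ i ∈ s, K i τ) (fun τ => ∑ i ∈ s, a i τ) (fun τ => ∑ i ∈ s, b i τ) := by
  intro r
  simp only [Polynomial.finsetSum_coeff]
  exact HasDD.sum s fun i hi => h i hi r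

lemma PolyDD.pow {P A B : ℍ → Polynomial ℂ} (h : PolyDD P A B) (n : ℕ) :
    PolyDD (fun τ => P τ ^ n) (fun τ => n * P τ ^ (n - 1) * A τ)
      (fun τ => n * P τ ^ (n - 1) * B τ) := by
  induction n with
  | zero => simpa using PolyDD.const 1
  | succ n ih =>
    refine (ih.mul h).congr ?_ ?_ ?_ <;> intro τ
    · ring
    all_goals
      rcases n with _ | n
      · simp
      · simp only [Nat.add_sub_cancel]; push_cast; ring

/-- Growth slower than any exponential at the cusp. -/
def SubExp (f : ℍ → ℂ) : Prop :=
  ∀ ε : ℝ, 0 < ε → f =O[stripInf] fun τ : ℍ => Real.exp (ε * τ.im)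

lemma SubExp.add {f g : ℍ → ℂ} (hf : SubExp f) (hg : SubExp g) : SubExp (fun τ => f τ + g τ) :=
  fun ε hε => (hf ε hε).add (hg ε hε)

lemma SubExp.mul {f g : ℍ → ℂ} (hf : SubExp f) (hg : SubExp g) : SubExp (fun τ => f τ * g τ) :=
  fun ε hε => ((hf (ε / 2) (half_pos hε)).mul (hg (ε / 2) (half_pos hε))).congr_right fun τ => by
    rw [← Real.exp_add]; congr 1; ring

lemma SubExp.poly (P : Polynomial ℂ) : SubExp (fun τ => P.eval (τ : ℂ)) :=
  fun _ hε => eval_isBigO_exp tendsto_im_stripInf coe_isBigO_im P hε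

lemma SubExp.const (a : ℂ) : SubExp (fun _ => a) := by simpa using SubExp.poly (Polynomial.C a)

lemma SubExp.coe : SubExp (fun τ => (τ : ℂ)) := by simpa using SubExp.poly Polynomial.X

lemma SubExp.conj {f : ℍ → ℂ} (hf : SubExp f) : SubExp (fun τ => conj (f τ)) :=
  fun ε hε => ((hf ε hε).norm_left.congr_left fun τ => by simp).of_norm_left

lemma SubExp.sum {ι : Type*} (s : Finset ι) {K : ι → ℍ → ℂ} (h : ∀ i ∈ s, SubExp (K i)) :
    SubExp (fun τ => ∑ i ∈ s, K i τ) := by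
  classical
  induction s using Finset.induction_on with
  | empty => simpa using SubExp.const 0
  | insert i s hi ih =>
    simp only [Finset.sum_insert hi]
    exact (h i (Finset.mem_insert_self i s)).add
      (ih fun j hj => h j (Finset.mem_insert_of_mem hj))

lemma SubExp.coeff_mul {P Q : ℍ → Polynomial ℂ} (hP : ∀ r, SubExp (fun τ => (P τ).coeff r))
    (hQ : ∀ r, SubExp (fun τ => (Q τ).coeff r)) (r : ℕ) :
    SubExp (fun τ => (P τ * Q τ).coeff r) := by
  simp only [Polynomial.coeff_mul]
  exact SubExp.sum _ fun i _ => (hP i.1).mul (hQ i.2)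

lemma SubExp.coeff_pow {P : ℍ → Polynomial ℂ} (hP : ∀ r, SubExp (fun τ => (P τ).coeff r))
    (n r : ℕ) : SubExp (fun τ => (P τ ^ n).coeff r) := by
  induction n generalizing r with
  | zero => simpa using SubExp.const _
  | succ n ih => simpa only [pow_succ] using SubExp.coeff_mul ih hP r

lemma PolyExp.mul_subExp_tendsto {f g : ℍ → ℂ} (hf : Tame f 0) (hg : SubExp g) :
    Tendsto (fun τ => f τ * g τ) stripInf (𝓝 0) := by
  obtain ⟨c, hc, h⟩ := hf
  simp only [Polynomial.eval_zero, sub_zero] at h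
  have h1 := (h.mul (hg (c / 2) (half_pos hc))).congr_right
    (g₂ := fun τ : ℍ => Real.exp (-(c / 2 * τ.im))) fun τ => by
      rw [← Real.exp_add]; congr 1; ring
  refine h1.trans_tendsto ?_
  exact Real.tendsto_exp_neg_atTop_nhds_zero.comp
    (tendsto_im_stripInf.const_mul_atTop (half_pos hc))

/-! ### The imaginary part -/

/-- `τ - τ̄`. -/
def eta (τ : ℍ) : ℂ := (τ : ℂ) - conj (τ : ℂ)

lemma eta_eq (τ : ℍ) : eta τ = 2 * τ.im * Complex.I := by
  rw [eta, Complex.sub_conj]; push_cast; simp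

lemma eta_ne_zero (τ : ℍ) : eta τ ≠ 0 := by
  rw [eta_eq]
  simp [Complex.I_ne_zero, τ.im_pos.ne']

lemma hasDD_conj_coe : HasDD (fun τ => conj (τ : ℂ)) (fun _ => 0) (fun _ => 1) :=
  HasDD.coe.conj.congr (fun _ => rfl) (fun _ => by simp) (fun _ => by simp)

lemma hasDD_eta : HasDD eta (fun _ => 1) (fun _ => -1) :=
  (HasDD.coe.sub hasDD_conj_coe).congr (fun _ => rfl) (fun _ => by simp) (fun _ => by simp)

lemma hasDD_eta_inv : HasDD (fun τ => (eta τ)⁻¹) (fun τ => -((eta τ)⁻¹) ^ 2)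
    (fun τ => ((eta τ)⁻¹) ^ 2) := by
  intro τ
  have h1 := hasDD_eta τ
  have h2 : HasFDerivAt (𝕜 := ℝ) (fun z : ℂ => z⁻¹) _
      (eta (UpperHalfPlane.ofComplex (τ : ℂ))) :=
    (hasDerivAt_inv (by simpa using eta_ne_zero τ)).hasFDerivAt.restrictScalars ℝ
  refine (h2.comp (τ : ℂ) h1).congr_fderiv ?_
  ext1
  simp
  ring

lemma hasDD_eta_inv_pow (n : ℕ) : HasDD (fun τ => ((eta τ)⁻¹) ^ n)
    (fun τ => -(n * ((eta τ)⁻¹) ^ (n + 1))) (fun τ => n * ((eta τ)⁻¹) ^ (n + 1)) := by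
  refine (hasDD_eta_inv.pow n).congr (fun _ => rfl) ?_ ?_ <;> intro τ <;> rcases n with _ | n
  · simp
  · simp only [Nat.add_sub_cancel]; ring
  · simp
  · simp only [Nat.add_sub_cancel]; ring

lemma denom_conj (γ : SL(2, ℤ)) (τ : ℍ) : conj (((γ 1 0 : ℤ) : ℂ) * (τ : ℂ) + ((γ 1 1 : ℤ) : ℂ))
    = ((γ 1 0 : ℤ) : ℂ) * conj (τ : ℂ) + ((γ 1 1 : ℤ) : ℂ) := by simp

lemma denom_ne (γ : SL(2, ℤ)) (τ : ℍ) :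
    ((γ 1 0 : ℤ) : ℂ) * (τ : ℂ) + ((γ 1 1 : ℤ) : ℂ) ≠ 0 := by
  have := UpperHalfPlane.denom_ne_zero γ τ
  simpa [UpperHalfPlane.denom] using this

lemma denom_conj_ne (γ : SL(2, ℤ)) (τ : ℍ) :
    ((γ 1 0 : ℤ) : ℂ) * conj (τ : ℂ) + ((γ 1 1 : ℤ) : ℂ) ≠ 0 := by
  rw [← denom_conj]
  exact (map_ne_zero _).2 (denom_ne γ τ)

lemma smul_mul_denom (γ : SL(2, ℤ)) (τ : ℍ) :
    ((γ • τ : ℍ) : ℂ) * (((γ 1 0 : ℤ) : ℂ) * (τ : ℂ) + ((γ 1 1 : ℤ) : ℂ))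
      = ((γ 0 0 : ℤ) : ℂ) * (τ : ℂ) + ((γ 0 1 : ℤ) : ℂ) := by
  rw [UpperHalfPlane.specialLinearGroup_apply]
  have := denom_ne γ τ
  simp only [algebraMap_int_eq, eq_intCast, Complex.ofReal_intCast] at this ⊢
  exact div_mul_cancel₀ _ this

lemma smul_conj_mul_denom (γ : SL(2, ℤ)) (τ : ℍ) :
    conj ((γ • τ : ℍ) : ℂ) * (((γ 1 0 : ℤ) : ℂ) * conj (τ : ℂ) + ((γ 1 1 : ℤ) : ℂ))
      = ((γ 0 0 : ℤ) : ℂ) * conj (τ : ℂ) + ((γ 0 1 : ℤ) : ℂ) := by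
  rw [← denom_conj, ← map_mul, smul_mul_denom]; simp

lemma det_complex (γ : SL(2, ℤ)) : ((γ 0 0 : ℤ) : ℂ) * ((γ 1 1 : ℤ) : ℂ)
    - ((γ 0 1 : ℤ) : ℂ) * ((γ 1 0 : ℤ) : ℂ) = 1 := by
  have := Matrix.SpecialLinearGroup.det_coe γ
  rw [Matrix.det_fin_two] at this
  exact_mod_cast this

lemma eta_smul (γ : SL(2, ℤ)) (τ : ℍ) :
    eta (γ • τ) * ((((γ 1 0 : ℤ) : ℂ) * (τ : ℂ) + ((γ 1 1 : ℤ) : ℂ))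
      * (((γ 1 0 : ℤ) : ℂ) * conj (τ : ℂ) + ((γ 1 1 : ℤ) : ℂ))) = eta τ := by
  have h1 := smul_mul_denom γ τ
  have h2 := smul_conj_mul_denom γ τ
  have h3 := det_complex γ
  unfold eta
  set j := ((γ 1 0 : ℤ) : ℂ) * (τ : ℂ) + ((γ 1 1 : ℤ) : ℂ) with hj
  set j' := ((γ 1 0 : ℤ) : ℂ) * conj (τ : ℂ) + ((γ 1 1 : ℤ) : ℂ) with hj'
  have : (((γ • τ : ℍ) : ℂ) - conj ((γ • τ : ℍ) : ℂ)) * (j * j')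
      = (((γ • τ : ℍ) : ℂ) * j) * j' - (conj ((γ • τ : ℍ) : ℂ) * j') * j := by ring
  rw [this, h1, h2, hj, hj']
  linear_combination ((τ : ℂ) - conj (τ : ℂ)) * h3

/-! ### Injectivity of the Eichler–Shimura map -/

section QPoly

open Polynomial

/-- For `F = ∑ b_r X^{m-r} Y^r`, the polynomial `F(τ - τ̄x, 1 - x)` in `x`. Up to the factor
`(τ - τ̄)^m`, its coefficients are those of `F` in the basis `(X - τY)^r (X - τ̄Y)^{m-r}`. -/
def qPoly (m : ℕ) (b : ℕ → ℍ → ℂ) (τ : ℍ) : ℂ[X] :=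
  ∑ r ∈ Finset.range (m + 1),
    C (b r τ) * ((C (τ : ℂ) - C (conj (τ : ℂ)) * X) ^ (m - r) * (1 - X) ^ r)

lemma polyDD_base : PolyDD (fun τ => C (τ : ℂ) - C (conj (τ : ℂ)) * X) (fun _ => 1)
    (fun _ => -X) := by
  intro r
  refine (((PolyDD.C HasDD.coe) r).sub
    (((PolyDD.C hasDD_conj_coe).mul (PolyDD.const X)) r)).congr ?_ ?_ ?_ <;> intro τ <;> simp

lemma eta_mul_term (τ : ℍ) (n r : ℕ) :
    C (eta τ) * ((n : ℂ[X]) * (C (τ : ℂ) - C (conj (τ : ℂ)) * X) ^ (n - 1) * (1 - X) ^ r)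
      = ((n + r : ℕ) : ℂ[X]) * ((C (τ : ℂ) - C (conj (τ : ℂ)) * X) ^ n * (1 - X) ^ r)
        + (1 - X) * derivative ((C (τ : ℂ) - C (conj (τ : ℂ)) * X) ^ n * (1 - X) ^ r) := by
  simp only [eta, derivative_mul, derivative_pow, derivative_C, derivative_X,
    derivative_one, map_sub, map_natCast]
  rcases n with _ | n <;> rcases r with _ | r
  · simp
  · simp only [Nat.add_sub_cancel]; push_cast; ring
  · simp only [Nat.add_sub_cancel]; push_cast; ring
  · simp only [Nat.add_sub_cancel]; push_cast; ring

lemma eta_mul_sum (m : ℕ) (b : ℕ → ℍ → ℂ) (τ : ℍ) :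
    C (eta τ) * ∑ r ∈ Finset.range (m + 1), C (b r τ) * (((m - r : ℕ) : ℂ[X])
        * (C (τ : ℂ) - C (conj (τ : ℂ)) * X) ^ (m - r - 1) * (1 - X) ^ r)
      = (m : ℂ[X]) * qPoly m b τ + (1 - X) * derivative (qPoly m b τ) := by
  simp only [qPoly, derivative_sum, Finset.mul_sum, ← Finset.sum_add_distrib]
  refine Finset.sum_congr rfl fun r hr => ?_
  have h := eta_mul_term τ (m - r) r
  rw [Nat.sub_add_cancel (Nat.lt_succ_iff.1 (Finset.mem_range.1 hr))] at h
  rw [derivative_C_mul]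
  linear_combination C (b r τ) * h

lemma binomial_sum (m : ℕ) (σ : ℂ) (A B : ℂ[X]) :
    ∑ r ∈ Finset.range (m + 1), C ((m.choose r : ℂ) * (-σ) ^ r) * (A ^ (m - r) * B ^ r)
      = (A - C σ * B) ^ m := by
  have := add_pow (-(C σ * B)) A m
  rw [show A - C σ * B = -(C σ * B) + A by ring, this]
  refine Finset.sum_congr rfl fun r _ => ?_
  rw [← neg_mul, mul_pow, ← map_neg, ← map_pow, map_mul, map_natCast]
  ring

lemma qPoly_polyDD {m : ℕ} {b : ℕ → ℍ → ℂ} {α β : ℍ → ℂ}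
    (hb : ∀ r, HasDD (b r) (fun τ => α τ * (m.choose r * (-(τ : ℂ)) ^ r))
      (fun τ => β τ * (m.choose r * (-conj (τ : ℂ)) ^ r))) :
    PolyDD (qPoly m b)
      (fun τ => C (α τ * eta τ ^ m) * X ^ m + C (eta τ)⁻¹ *
        ((m : ℂ[X]) * qPoly m b τ + (1 - X) * derivative (qPoly m b τ)))
      (fun τ => C (β τ * eta τ ^ m) - C (eta τ)⁻¹ * X *
        ((m : ℂ[X]) * qPoly m b τ + (1 - X) * derivative (qPoly m b τ))) := by
  refine (PolyDD.sum (Finset.range (m + 1)) fun r _ => (PolyDD.C (hb r)).mul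
    ((polyDD_base.pow (m - r)).mul (PolyDD.const ((1 - X) ^ r)))).congr (fun τ => rfl) ?_ ?_ <;>
  intro τ <;> have hη : C (eta τ)⁻¹ * C (eta τ) = 1 := by
    rw [← map_mul, inv_mul_cancel₀ (eta_ne_zero τ), map_one]
  · rw [← eta_mul_sum, ← mul_assoc, hη, one_mul, Finset.sum_add_distrib]
    congr 1
    · have h1 := binomial_sum m (τ : ℂ) (C (τ : ℂ) - C (conj (τ : ℂ)) * X) (1 - X)
      rw [show C (τ : ℂ) - C (conj (τ : ℂ)) * X - C (τ : ℂ) * (1 - X) = C (eta τ) * X by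
        simp [eta]; ring, mul_pow, ← map_pow] at h1
      rw [map_mul, mul_assoc, ← h1, Finset.mul_sum]
      refine Finset.sum_congr rfl fun r _ => ?_
      simp only [map_mul]; ring
    · refine Finset.sum_congr rfl fun r _ => ?_
      ring
  · rw [mul_right_comm, ← eta_mul_sum, ← mul_assoc, hη, one_mul, Finset.sum_add_distrib,
      sub_eq_add_neg]
    congr 1
    · have h1 := binomial_sum m (conj (τ : ℂ)) (C (τ : ℂ) - C (conj (τ : ℂ)) * X) (1 - X)
      rw [show C (τ : ℂ) - C (conj (τ : ℂ)) * X - C (conj (τ : ℂ)) * (1 - X) = C (eta τ) by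
        simp [eta]; ring, ← map_pow] at h1
      rw [map_mul, ← h1, Finset.mul_sum]
      refine Finset.sum_congr rfl fun r _ => ?_
      simp only [map_mul]; ring
    · rw [Finset.sum_mul, ← Finset.sum_neg_distrib]
      refine Finset.sum_congr rfl fun r _ => ?_
      ring

/-- Coefficients of the differential operator `m + (1 - x) d/dx`, in terms of which `qPoly` is
differentiated. -/
lemma coeff_lowering (m : ℕ) (Q : ℂ[X]) (r : ℕ) :
    ((m : ℂ[X]) * Q + (1 - X) * derivative Q).coeff r
      = ((m : ℂ) - r) * Q.coeff r + (r + 1) * Q.coeff (r + 1) := by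
  rw [coeff_add, ← C_eq_natCast, coeff_C_mul, sub_mul, one_mul, coeff_sub, coeff_derivative]
  rcases r with _ | r
  · simp
  · rw [mul_comm X, coeff_mul_X, coeff_derivative]; push_cast; ring

/-- The differentials of the coefficients of `qPoly` involve only the neighbouring coefficients,
apart from the forms `α` and `β` at the two ends. -/
lemma qPoly_coeff_hasDD {m : ℕ} {b : ℕ → ℍ → ℂ} {α β : ℍ → ℂ}
    (hb : ∀ r, HasDD (b r) (fun τ => α τ * (m.choose r * (-(τ : ℂ)) ^ r))
      (fun τ => β τ * (m.choose r * (-conj (τ : ℂ)) ^ r))) (r : ℕ) :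
    HasDD (fun τ => (qPoly m b τ).coeff r)
      (fun τ => (if r = m then α τ * eta τ ^ m else 0) + (eta τ)⁻¹ *
        (((m : ℂ) - r) * (qPoly m b τ).coeff r + (r + 1) * (qPoly m b τ).coeff (r + 1)))
      (fun τ => (if r = 0 then β τ * eta τ ^ m else 0) - (eta τ)⁻¹ *
        (if r = 0 then 0 else ((m : ℂ) - (r - 1 : ℕ)) * (qPoly m b τ).coeff (r - 1)
          + r * (qPoly m b τ).coeff r)) := by
  refine (qPoly_polyDD hb r).congr (fun _ => rfl) ?_ ?_ <;> intro τ
  · rw [coeff_add, coeff_C_mul, coeff_C_mul, coeff_X_pow, coeff_lowering]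
    split_ifs <;> simp
  · rw [coeff_sub, coeff_C, mul_assoc, coeff_C_mul, mul_comm X]
    rcases r with _ | r
    · simp
    · rw [coeff_mul_X, coeff_lowering]; simp

lemma qPoly_coeff_of_lt {m : ℕ} {b : ℕ → ℍ → ℂ} (τ : ℍ) {r : ℕ} (hr : m < r) :
    (qPoly m b τ).coeff r = 0 := by
  refine coeff_eq_zero_of_natDegree_lt (lt_of_le_of_lt ?_ hr)
  refine natDegree_sum_le_of_forall_le _ _ fun i hi => ?_
  have him := Nat.lt_succ_iff.1 (Finset.mem_range.1 hi)
  have h1 : (C (τ : ℂ) - C (conj (τ : ℂ)) * X).natDegree ≤ 1 := by compute_degree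
  have h2 : (1 - X : ℂ[X]).natDegree ≤ 1 := by compute_degree
  refine (natDegree_C_mul_le _ _).trans (natDegree_mul_le.trans ?_)
  have h3 := natDegree_pow_le_of_le (m - i) h1
  have h4 := natDegree_pow_le_of_le i h2
  omega

lemma qPoly_eval (m : ℕ) (b : ℕ → ℍ → ℂ) (τ : ℍ) (x : ℂ) :
    (qPoly m b τ).eval x = ∑ r ∈ Finset.range (m + 1),
      b r τ * (((τ : ℂ) - conj (τ : ℂ) * x) ^ (m - r) * (1 - x) ^ r) := by
  simp [qPoly, eval_finsetSum]

/-- For an equivariant polynomial the `s`-th coefficient of `qPoly` is a non-holomorphic modular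
form of weight `(s - m, -s)`. -/
lemma qPoly_coeff_smul {m : ℕ} {b : ℕ → ℍ → ℂ}
    (hequiv : ∀ (γ : SL(2, ℤ)) (τ : ℍ) (x y : ℂ),
      ∑ r ∈ Finset.range (m + 1), b r (γ • τ) *
          ((((γ 0 0 : ℤ) : ℂ) * x + ((γ 0 1 : ℤ) : ℂ) * y) ^ (m - r)
            * (((γ 1 0 : ℤ) : ℂ) * x + ((γ 1 1 : ℤ) : ℂ) * y) ^ r)
        = ∑ r ∈ Finset.range (m + 1), b r τ * (x ^ (m - r) * y ^ r))
    (γ : SL(2, ℤ)) (τ : ℍ) (s : ℕ) (hs : s ≤ m) :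
    (qPoly m b τ).coeff s = (((γ 1 0 : ℤ) : ℂ) * (τ : ℂ) + ((γ 1 1 : ℤ) : ℂ)) ^ (m - s)
      * (((γ 1 0 : ℤ) : ℂ) * conj (τ : ℂ) + ((γ 1 1 : ℤ) : ℂ)) ^ s
      * (qPoly m b (γ • τ)).coeff s := by
  have h1 := smul_mul_denom γ τ
  have h2 := smul_conj_mul_denom γ τ
  have hj0 := denom_ne γ τ
  set j := ((γ 1 0 : ℤ) : ℂ) * (τ : ℂ) + ((γ 1 1 : ℤ) : ℂ) with hj
  set j' := ((γ 1 0 : ℤ) : ℂ) * conj (τ : ℂ) + ((γ 1 1 : ℤ) : ℂ) with hj'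
  have key : qPoly m b τ = C (j ^ m) * (qPoly m b (γ • τ)).comp (C (j' / j) * X) := by
    refine Polynomial.funext fun x => ?_
    rw [qPoly_eval, eval_mul, eval_C, eval_comp, qPoly_eval, ← hequiv γ τ, Finset.mul_sum]
    refine Finset.sum_congr rfl fun r hr => ?_
    have hrm := Nat.lt_succ_iff.1 (Finset.mem_range.1 hr)
    have e1 : ((γ 0 0 : ℤ) : ℂ) * ((τ : ℂ) - conj (τ : ℂ) * x) + ((γ 0 1 : ℤ) : ℂ) * (1 - x)
        = j * (((γ • τ : ℍ) : ℂ) - conj ((γ • τ : ℍ) : ℂ) * (j' / j * x)) := by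
      have : j * (((γ • τ : ℍ) : ℂ) - conj ((γ • τ : ℍ) : ℂ) * (j' / j * x))
        = ((γ • τ : ℍ) : ℂ) * j - conj ((γ • τ : ℍ) : ℂ) * j' * x := by field_simp
      rw [this, h1, h2]; ring
    have e2 : ((γ 1 0 : ℤ) : ℂ) * ((τ : ℂ) - conj (τ : ℂ) * x) + ((γ 1 1 : ℤ) : ℂ) * (1 - x)
        = j * (1 - j' / j * x) := by
      have : j * (1 - j' / j * x) = j - j' * x := by field_simp
      rw [this, hj, hj']; ring
    rw [e1, e2, mul_pow, mul_pow]
    have e3 : j ^ m = j ^ (m - r) * j ^ r := by rw [← pow_add, Nat.sub_add_cancel hrm]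
    rw [e3]
    simp only [eval_mul, eval_C, eval_X]
    ring
  conv_lhs => rw [key]
  rw [coeff_C_mul, comp_C_mul_X_coeff, div_pow]
  have e3 : j ^ m = j ^ (m - s) * j ^ s := by rw [← pow_add, Nat.sub_add_cancel hs]
  rw [e3]
  have : j ^ s ≠ 0 := pow_ne_zero _ hj0
  field_simp

end QPoly

/-- The middle coefficient of an equivariant `F = ∑ b_r X^{2s-r} Y^r` with
`dF = α (X - τY)^{2s} dτ + β (X - τ̄Y)^{2s} dτ̄` is an eigenfunction of the Laplacian with positive
eigenvalue, so that it vanishes when it tends to zero at the cusp. The other coefficients follow,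
the forms being first-order differential expressions in them. -/
lemma equivariant_primitive_eq_zero {s : ℕ} (hs : 0 < s) {b : ℕ → ℍ → ℂ} {α β : ℍ → ℂ}
    (hb : ∀ r, HasDD (b r) (fun τ => α τ * ((2 * s).choose r * (-(τ : ℂ)) ^ r))
      (fun τ => β τ * ((2 * s).choose r * (-conj (τ : ℂ)) ^ r)))
    (hequiv : ∀ (γ : SL(2, ℤ)) (τ : ℍ) (x y : ℂ),
      ∑ r ∈ Finset.range (2 * s + 1), b r (γ • τ) *
          ((((γ 0 0 : ℤ) : ℂ) * x + ((γ 0 1 : ℤ) : ℂ) * y) ^ (2 * s - r)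
            * (((γ 1 0 : ℤ) : ℂ) * x + ((γ 1 1 : ℤ) : ℂ) * y) ^ r)
        = ∑ r ∈ Finset.range (2 * s + 1), b r τ * (x ^ (2 * s - r) * y ^ r))
    (hcusp : Tendsto (fun τ => ((eta τ)⁻¹) ^ s * (qPoly (2 * s) b τ).coeff s) stripInf (𝓝 0)) :
    (∀ τ r, (qPoly (2 * s) b τ).coeff r = 0) ∧ (∀ τ, α τ = 0) ∧ ∀ τ, β τ = 0 := by
  set q : ℕ → ℍ → ℂ := fun r τ => (qPoly (2 * s) b τ).coeff r with hq
  have hD := qPoly_coeff_hasDD hb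
  obtain ⟨t, rfl⟩ : ∃ t, s = t + 1 := ⟨s - 1, by omega⟩
  -- Divided by `(τ - τ̄)^s`, the middle coefficient is invariant and an eigenfunction of `∂∂̄`.
  have h0 : ∀ τ, ((eta τ)⁻¹) ^ (t + 1) * q (t + 1) τ = 0 := by
    refine eq_zero_of_laplace_pos
      (A := fun τ => ((t + 1 : ℂ) + 1) * (((eta τ)⁻¹) ^ (t + 2) * q (t + 2) τ))
      (B := fun τ => -((t + 1 : ℂ) + 1) * (((eta τ)⁻¹) ^ (t + 2) * q t τ))
      (lam := fun τ => (t + 1) * (t + 2) / (4 * τ.im ^ 2))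
      (((hasDD_eta_inv_pow (t + 1)).mul (hD (t + 1))).congr (fun _ => rfl) ?_ ?_)
      (((hasDD_eta_inv_pow (t + 2)).mul (hD (t + 2))).const_mul _)
      (((hasDD_eta_inv_pow (t + 2)).mul (hD t)).const_mul _) ?_ ?_ ?_ ?_ hcusp
    · intro τ
      rw [if_neg (by omega)]
      simp only [hq]
      push_cast
      ring
    · intro τ
      rw [if_neg (by omega), if_neg (by omega)]
      simp only [hq, Nat.add_sub_cancel]
      push_cast
      ring
    · intro τ
      have := τ.im_pos
      positivity
    · intro τ
      have e : (((t + 1) * (t + 2) / (4 * τ.im ^ 2) : ℝ) : ℂ)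
          = -((t + 1) * (t + 2)) * ((eta τ)⁻¹) ^ 2 := by
        rw [eta_eq]; push_cast
        have := τ.im_pos.ne'
        rw [inv_pow, mul_pow, Complex.I_sq]
        field_simp
        norm_num
        ring
      rw [e, if_neg (by omega), if_neg (by omega)]
      simp only [hq, Nat.add_succ_sub_one]
      push_cast
      ring
    · intro τ
      have e : (((t + 1) * (t + 2) / (4 * τ.im ^ 2) : ℝ) : ℂ)
          = -((t + 1) * (t + 2)) * ((eta τ)⁻¹) ^ 2 := by
        rw [eta_eq]; push_cast
        have := τ.im_pos.ne'
        rw [inv_pow, mul_pow, Complex.I_sq]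
        field_simp
        norm_num
        ring
      rw [e, if_neg (by omega)]
      simp only [hq]
      push_cast
      ring
    · intro γ τ
      have h1 := qPoly_coeff_smul hequiv γ τ (t + 1) (by omega)
      have h2 := eta_smul γ τ
      rw [show 2 * (t + 1) - (t + 1) = t + 1 by omega, ← mul_pow] at h1
      simp only [hq]
      rw [h1, ← h2, mul_inv, mul_pow, mul_assoc _ _ (_ * _), ← mul_assoc _ _ (Polynomial.coeff _ _),
        ← mul_pow, inv_mul_cancel₀ (mul_ne_zero (denom_ne γ τ) (denom_conj_ne γ τ)), one_pow,
        one_mul]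
  have hmid : ∀ τ, q (t + 1) τ = 0 := fun τ =>
    (mul_eq_zero.1 (h0 τ)).resolve_left (pow_ne_zero _ (inv_ne_zero (eta_ne_zero τ)))
  -- The differential of a vanishing coefficient vanishes, so that its neighbours vanish too.
  have hz : ∀ r, (∀ τ, q r τ = 0) → ∀ τ,
      ((if r = 2 * (t + 1) then α τ * eta τ ^ (2 * (t + 1)) else 0) + (eta τ)⁻¹ *
        (((2 * (t + 1) : ℕ) - r : ℂ) * q r τ + (r + 1) * q (r + 1) τ) = 0) ∧
      ((if r = 0 then β τ * eta τ ^ (2 * (t + 1)) else 0) - (eta τ)⁻¹ *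
        (if r = 0 then 0 else ((2 * (t + 1) : ℕ) - (r - 1 : ℕ) : ℂ) * q (r - 1) τ
          + r * q r τ) = 0) := fun r hr τ =>
    ((hD r).congr (fun τ => (hr τ).symm) (fun _ => rfl) (fun _ => rfl)).unique (HasDD.const 0) τ
  have hup : ∀ i, i ≤ t + 1 → ∀ τ, q (t + 1 + i) τ = 0 := by
    intro i
    induction i with
    | zero => exact fun _ => hmid
    | succ i ih =>
      intro hi τ
      have := (hz _ (ih (by omega)) τ).1
      rw [if_neg (by omega), ih (by omega) τ, mul_zero, zero_add, zero_add] at this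
      have h3 : ((t + 1 + i : ℕ) + 1 : ℂ) ≠ 0 := Nat.cast_add_one_ne_zero _
      exact (mul_eq_zero.1 ((mul_eq_zero.1 this).resolve_left
        (inv_ne_zero (eta_ne_zero τ)))).resolve_left h3
  have hdown : ∀ i, i ≤ t + 1 → ∀ τ, q (t + 1 - i) τ = 0 := by
    intro i
    induction i with
    | zero => exact fun _ => hmid
    | succ i ih =>
      intro hi τ
      have := (hz _ (ih (by omega)) τ).2
      rw [if_neg (by omega), if_neg (by omega), ih (by omega) τ, mul_zero, add_zero, zero_sub,
        neg_eq_zero] at this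
      have h3 : ((2 * (t + 1) : ℕ) - (t + 1 - i - 1 : ℕ) : ℂ) ≠ 0 := by
        rw [sub_ne_zero]; norm_cast; omega
      exact (mul_eq_zero.1 ((mul_eq_zero.1 this).resolve_left
        (inv_ne_zero (eta_ne_zero τ)))).resolve_left h3
  have hall : ∀ r τ, q r τ = 0 := by
    intro r τ
    rcases le_or_gt r (t + 1) with h | h
    · have := hdown (t + 1 - r) (by omega) τ
      rwa [show t + 1 - (t + 1 - r) = r by omega] at this
    · rcases le_or_gt r (2 * (t + 1)) with h' | h'
      · have := hup (r - (t + 1)) (by omega) τ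
        rwa [show t + 1 + (r - (t + 1)) = r by omega] at this
      · exact qPoly_coeff_of_lt τ h'
  refine ⟨fun τ r => hall r τ, fun τ => ?_, fun τ => ?_⟩
  · have := (hz (2 * (t + 1)) (hall _) τ).1
    simpa [hall, eta_ne_zero τ] using this
  · have := (hz 0 (hall _) τ).2
    simpa [eta_ne_zero τ] using this

lemma periodic_polynomial_eq_const {p : Polynomial ℂ} (h : ∀ x : ℂ, p.eval (x + 1) = p.eval x) :
    p = Polynomial.C (p.eval 0) := by
  rw [← sub_eq_zero]
  refine Polynomial.eq_zero_of_infinite_isRoot _ (Set.infinite_of_injective_forall_mem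
    (f := fun n : ℕ => (n : ℂ)) Nat.cast_injective fun n => ?_)
  have : ∀ n : ℕ, p.eval (n : ℂ) = p.eval 0 := by
    intro n
    induction n with
    | zero => simp
    | succ n ih => rw [Nat.cast_succ, h, ih]
  simp [Polynomial.IsRoot, this]

lemma T_entries : ((ModularGroup.T 0 0 : ℤ) : ℂ) = 1 ∧ ((ModularGroup.T 0 1 : ℤ) : ℂ) = 1 ∧
    ((ModularGroup.T 1 0 : ℤ) : ℂ) = 0 ∧ ((ModularGroup.T 1 1 : ℤ) : ℂ) = 1 := by
  simp [ModularGroup.T]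

lemma tendsto_T_ray_stripInf :
    Tendsto (fun t : ℝ => ModularGroup.T • UpperHalfPlane.ofComplex (t * Complex.I)) atTop
      stripInf := by
  rw [stripInf, tendsto_inf, tendsto_principal, tendsto_comap_iff]
  have h1 : ∀ (t : ℝ) (ht : 0 < t), UpperHalfPlane.ofComplex (t * Complex.I)
      = ⟨t * Complex.I, by simpa using ht⟩ := fun t ht => ofComplex_im_pos _
  constructor
  · refine tendsto_id.congr' ?_
    filter_upwards [eventually_gt_atTop 0] with t ht
    rw [Function.comp_apply, h1 t ht, UpperHalfPlane.modular_T_smul, UpperHalfPlane.vadd_im,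
      ← UpperHalfPlane.coe_im]
    simp
  · filter_upwards [eventually_gt_atTop 0] with t ht
    rw [h1 t ht, UpperHalfPlane.modular_T_smul, UpperHalfPlane.vadd_re,
      ← UpperHalfPlane.coe_re]
    simp

lemma coe_T_smul (τ : ℍ) : ((ModularGroup.T • τ : ℍ) : ℂ) = τ + 1 := by
  rw [UpperHalfPlane.modular_T_smul]; simp [add_comm]

lemma regInt_conj {f : ℍ → ℂ} (hf : Hol f) {P : Polynomial ℂ} (h : Tame f P) :
    IsRegPrimitive (fun _ => 0) (fun t => conj (f t)) (regInt 0 (fun t => conj (f t))) ∧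
    ∀ τ, regInt 0 (fun t => conj (f t)) τ = conj (regInt f (fun _ => 0) τ) := by
  have h1 := (h.regInt hf).1.conj
  have h2 : IsRegPrimitive 0 (fun t => conj (f t)) _ :=
    h1.congr (fun _ => rfl) (fun _ => by simp) (fun _ => rfl)
  refine ⟨h2.regInt, fun τ => by rw [h2.regInt_eq]⟩

lemma Tame.regInt_zero {f : ℍ → ℂ} (hf : Hol f) (h : Tame f 0) :
    Tame (EqvInt.regInt f (fun _ => 0)) 0 := by
  obtain ⟨-, Q, hQ, hQ0, hQ'⟩ := h.regInt hf
  rw [neg_zero] at hQ'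
  have := Polynomial.eq_C_of_derivative_eq_zero hQ'
  rw [this] at hQ0 hQ
  simp only [Polynomial.eval_C] at hQ0
  rwa [hQ0, map_zero] at hQ

lemma SubExp.eta_inv : SubExp (fun τ => (eta τ)⁻¹) := by
  intro ε hε
  refine IsBigO.of_bound 1 (eventually_stripInf.2 ⟨1, fun τ h1 _ => ?_⟩)
  rw [Real.norm_of_nonneg (Real.exp_pos _).le, one_mul, eta_eq]
  have h2 : ‖(2 * τ.im * Complex.I : ℂ)⁻¹‖ ≤ 1 := by
    rw [norm_inv]
    apply inv_le_one_of_one_le₀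
    simp only [norm_mul, Complex.norm_ofNat, Complex.norm_real, Complex.norm_I, mul_one]
    rw [Real.norm_of_nonneg τ.im_pos.le]
    linarith
  exact h2.trans (Real.one_le_exp (mul_pos hε τ.im_pos).le)

lemma SubExp.pow {f : ℍ → ℂ} (hf : SubExp f) (n : ℕ) : SubExp (fun τ => f τ ^ n) := by
  induction n with
  | zero => simpa using SubExp.const 1
  | succ n ih => simpa only [pow_succ] using ih.mul hf

lemma tendsto_eta_inv : Tendsto (fun τ => (eta τ)⁻¹) stripInf (𝓝 0) := by
  rw [tendsto_zero_iff_norm_tendsto_zero]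
  have h1 : Tendsto (fun τ : ℍ => (2 * τ.im)⁻¹) stripInf (𝓝 0) :=
    tendsto_inv_atTop_zero.comp (tendsto_im_stripInf.const_mul_atTop two_pos)
  refine h1.congr fun τ => ?_
  rw [eta_eq, norm_inv]
  simp only [norm_mul, Complex.norm_ofNat, Complex.norm_real, Complex.norm_I, mul_one]
  rw [Real.norm_of_nonneg τ.im_pos.le]

lemma Tame.tendsto_zero {f : ℍ → ℂ} (hf : Tame f 0) : Tendsto f stripInf (𝓝 0) := by
  simpa using PolyExp.mul_subExp_tendsto hf (SubExp.const 1)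

lemma Tame.conj_zero {f : ℍ → ℂ} (hf : Tame f 0) : Tame (fun τ => conj (f τ)) 0 := by
  obtain ⟨c, hc, h⟩ := hf
  exact ⟨c, hc, (h.norm_left.congr_left fun τ => by simp).of_norm_left⟩

lemma Tame.sub_poly {f : ℍ → ℂ} {P : Polynomial ℂ} (hf : Tame f P) :
    Tame (fun τ => f τ - P.eval (τ : ℂ)) 0 := by
  obtain ⟨c, hc, h⟩ := hf
  exact ⟨c, hc, by simpa using h⟩

lemma regInt_zero (τ : ℍ) : regInt (fun _ => 0) (fun _ => 0) τ = 0 := by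
  rw [IsRegPrimitive.zero.regInt_eq]

/-- When all constants but the last vanish, the middle coefficient divided by `(τ - τ̄)^s` is of
order `(τ - τ̄)^{-s}` at the cusp. -/
lemma tendsto_qPoly_coeff {s : ℕ} (hs : 0 < s) {b : ℕ → ℍ → ℂ} {c : ℕ → ℂ}
    (hb : ∀ r, Tame (fun τ => b r τ - c r) 0) (hc : ∀ r < 2 * s, c r = 0) :
    Tendsto (fun τ => ((eta τ)⁻¹) ^ s * (qPoly (2 * s) b τ).coeff s) stripInf (𝓝 0) := by
  have hsub : ∀ r, SubExp (fun τ : ℍ => (((Polynomial.C (τ : ℂ)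
      - Polynomial.C (conj (τ : ℂ)) * Polynomial.X) ^ (2 * s - r)
      * (1 - Polynomial.X) ^ r).coeff s)) := by
    intro r
    refine SubExp.coeff_mul (SubExp.coeff_pow (fun i => ?_) _) (fun i => SubExp.const _) s
    simp only [Polynomial.coeff_sub, Polynomial.coeff_C, Polynomial.coeff_C_mul]
    simp only [sub_eq_add_neg, ← mul_neg]
    refine SubExp.add ?_ (SubExp.coe.conj.mul (SubExp.const _))
    split_ifs
    · exact SubExp.coe
    · exact SubExp.const 0
  have h1 : ∀ r ∈ Finset.range (2 * s + 1), Tendsto (fun τ : ℍ => ((eta τ)⁻¹) ^ s *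
      (b r τ * ((Polynomial.C (τ : ℂ) - Polynomial.C (conj (τ : ℂ)) * Polynomial.X) ^ (2 * s - r)
      * (1 - Polynomial.X) ^ r).coeff s)) stripInf (𝓝 0) := by
    intro r hr
    have h2 := PolyExp.mul_subExp_tendsto (hb r) ((SubExp.eta_inv.pow s).mul (hsub r))
    rcases (Nat.lt_succ_iff.1 (Finset.mem_range.1 hr)).lt_or_eq with h | h
    · refine h2.congr fun τ => ?_
      rw [hc r h]; ring
    · have h3 : Tendsto (fun τ : ℍ => ((eta τ)⁻¹) ^ s *
          (c r * ((1 - Polynomial.X : Polynomial ℂ) ^ r).coeff s)) stripInf (𝓝 0) := by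
        have := (tendsto_eta_inv.pow s).mul_const
          (c r * ((1 - Polynomial.X : Polynomial ℂ) ^ r).coeff s)
        rwa [zero_pow hs.ne', zero_mul] at this
      have h4 := h2.add h3
      rw [add_zero] at h4
      refine h4.congr fun τ => ?_
      rw [h, Nat.sub_self, pow_zero, one_mul]; ring
  have h2 := tendsto_finsetSum _ h1
  rw [Finset.sum_const_zero] at h2
  refine h2.congr fun τ => ?_
  rw [qPoly, Polynomial.finsetSum_coeff, Finset.mul_sum]
  exact Finset.sum_congr rfl fun r _ => by rw [Polynomial.coeff_C_mul]

/-- Injectivity of the Eichler–Shimura map in weight at least four: a cusp form, the complex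
conjugate of a modular form and a polynomial whose period cocycles add up to zero all vanish. -/
theorem eichlerShimura_injective {s : ℕ} (hs : 0 < s) (φ : CuspForm 𝒮ℒ ((2 * s + 2 : ℕ) : ℤ))
    (ψ : ModularForm 𝒮ℒ ((2 * s + 2 : ℕ) : ℤ)) {c : ℕ → ℂ} {b : ℕ → ℍ → ℂ}
    (hb : ∀ r τ, b r τ = c r + (1 / 2) *
      (regInt (fun t => φ t * ((2 * s).choose r * (-(t : ℂ)) ^ r)) 0 τ
        + regInt 0 (fun t => conj (ψ t * ((2 * s).choose r * (-(t : ℂ)) ^ r))) τ))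
    (hequiv : ∀ (γ : SL(2, ℤ)) (τ : ℍ) (x y : ℂ),
      ∑ r ∈ Finset.range (2 * s + 1), b r (γ • τ) *
          ((((γ 0 0 : ℤ) : ℂ) * x + ((γ 0 1 : ℤ) : ℂ) * y) ^ (2 * s - r)
            * (((γ 1 0 : ℤ) : ℂ) * x + ((γ 1 1 : ℤ) : ℂ) * y) ^ r)
        = ∑ r ∈ Finset.range (2 * s + 1), b r τ * (x ^ (2 * s - r) * y ^ r)) :
    (∀ τ, φ τ = 0) ∧ (∀ τ, ψ τ = 0) ∧ ∀ r ≤ 2 * s, c r = 0 := by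
  set κ : ℕ → Polynomial ℂ := fun r => Polynomial.C ((2 * s).choose r : ℂ) * (-Polynomial.X) ^ r
    with hκ
  have hκe : ∀ r (t : ℂ), (κ r).eval t = ((2 * s).choose r : ℂ) * (-t) ^ r := by
    intro r t; simp [hκ]
  have hκh : ∀ r, Hol (fun t : ℍ => ((2 * s).choose r : ℂ) * (-(t : ℂ)) ^ r) := by
    intro r
    simp only [← hκe]
    exact (hasDD_eval (κ r)).hol
  have hκt : ∀ r, Tame (fun t : ℍ => ((2 * s).choose r : ℂ) * (-(t : ℂ)) ^ r) (κ r) := by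
    intro r
    simp only [← hκe]
    exact Tame.poly (κ r)
  have hφt : ∀ r, Tame (fun t => φ t * ((2 * s).choose r * (-(t : ℂ)) ^ r)) 0 := fun r => by
    have := (tame_of_cuspForm φ).mul (hκt r)
    rwa [zero_mul] at this
  have hφh : ∀ r, Hol (fun t => φ t * ((2 * s).choose r * (-(t : ℂ)) ^ r)) := fun r =>
    (hol_of_modularFormClass φ).mul (hκh r)
  have hψh : ∀ r, Hol (fun t => ψ t * ((2 * s).choose r * (-(t : ℂ)) ^ r)) := fun r =>
    (hol_of_modularFormClass ψ).mul (hκh r)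
  have hφ0 := fun r => Tame.regInt_zero (hφh r) (hφt r)
  -- The invariance of `b 0` under translation kills the constant term of `ψ`.
  have hval : UpperHalfPlane.valueAtInfty ψ = 0 := by
    have h0 := (tame_of_modularFormClass ψ)
    have hh0 := hol_of_modularFormClass (k := ((2 * s + 2 : ℕ) : ℤ)) ψ
    obtain ⟨-, Q, hQ, hQ0, hQ'⟩ := h0.regInt hh0
    have hT : ∀ τ, b 0 (ModularGroup.T • τ) = b 0 τ := by
      intro τ
      have := hequiv ModularGroup.T τ 1 0
      obtain ⟨e1, e2, e3, e4⟩ := T_entries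
      rw [e1, e2, e3, e4, Finset.sum_eq_single 0 (by intro i _ hi; simp [hi]) (by simp),
        Finset.sum_eq_single 0 (by intro i _ hi; simp [hi]) (by simp)] at this
      simpa using this
    have hb0 : ∀ τ, b 0 τ = c 0 + (1 / 2) * (regInt (fun t => φ t *
        ((2 * s).choose 0 * (-(t : ℂ)) ^ 0)) (fun _ => 0) τ + conj (regInt ψ (fun _ => 0) τ)) := by
      intro τ
      rw [hb, ← (regInt_conj hh0 h0).2]
      simp only [Nat.choose_zero_right, Nat.cast_one, pow_zero, mul_one]
      rfl
    have hQe : Q = Polynomial.C (-UpperHalfPlane.valueAtInfty ψ) * Polynomial.X := by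
      have : Polynomial.derivative (Q - Polynomial.C (-UpperHalfPlane.valueAtInfty ψ)
          * Polynomial.X) = 0 := by simp [hQ']
      have h2 := Polynomial.eq_C_of_derivative_eq_zero this
      have h3 := congrArg (Polynomial.eval 0) h2
      simp only [Polynomial.eval_sub, hQ0, Polynomial.eval_C, Polynomial.eval_mul,
        Polynomial.eval_X, mul_zero, sub_zero] at h3
      rw [← h3, map_zero, sub_eq_zero] at h2
      exact h2
    set G : ℍ → ℂ := fun τ => regInt (fun t => φ t *
        ((2 * s).choose 0 * (-(t : ℂ)) ^ 0)) (fun _ => 0) τ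
        + conj (regInt ψ (fun _ => 0) τ - Q.eval (τ : ℂ)) with hG
    have hG0 : Tendsto G stripInf (𝓝 0) := by
      have := (hφ0 0).tendsto_zero.add hQ.sub_poly.conj_zero.tendsto_zero
      rwa [add_zero] at this
    have h1 := (hG0.comp tendsto_T_ray_stripInf).sub (hG0.comp tendsto_ray_stripInf)
    have h2 : ∀ τ, G (ModularGroup.T • τ) - G τ = conj (UpperHalfPlane.valueAtInfty ψ) := by
      intro τ
      have := hT τ
      rw [hb0, hb0] at this
      simp only [hG, hQe, Polynomial.eval_mul, Polynomial.eval_C, Polynomial.eval_X, coe_T_smul,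
        Polynomial.eval_neg, map_sub, map_mul, map_neg, map_add, map_one]
      linear_combination 2 * this
    have h3 := tendsto_nhds_unique (h1.congr fun t => h2 _) tendsto_const_nhds
    rw [sub_zero] at h3
    exact (map_eq_zero _).1 h3.symm
  have hψt : ∀ r, Tame (fun t => ψ t * ((2 * s).choose r * (-(t : ℂ)) ^ r)) 0 := fun r => by
    have := (tame_of_modularFormClass ψ).mul (hκt r)
    rwa [hval, map_zero, zero_mul] at this
  have hψ0 := fun r => Tame.regInt_zero (hψh r) (hψt r)
  have hbc : ∀ r, Tame (fun τ => b r τ - c r) 0 := by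
    intro r
    have h1 := ((hφ0 r).add (hψ0 r).conj_zero).const_mul (1 / 2)
    rw [add_zero, mul_zero] at h1
    have : (fun τ => b r τ - c r) = fun τ => 1 / 2 * (regInt (fun t => φ t *
        ((2 * s).choose r * (-(t : ℂ)) ^ r)) (fun _ => 0) τ + conj (regInt (fun t => ψ t *
        ((2 * s).choose r * (-(t : ℂ)) ^ r)) (fun _ => 0) τ)) := by
      funext τ
      rw [hb, (regInt_conj (hψh r) (hψt r)).2, add_sub_cancel_left]
      rfl
    rwa [this]
  have hlim : ∀ r, Tendsto (b r) stripInf (𝓝 (c r)) := fun r => by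
    simpa using (hbc r).tendsto_zero.add_const (c r)
  -- The constants form a polynomial invariant under translation, so that only `Y^{2s}` survives.
  have hclt : ∀ r < 2 * s, c r = 0 := by
    set p : Polynomial ℂ := ∑ r ∈ Finset.range (2 * s + 1),
      Polynomial.C (c r) * Polynomial.X ^ (2 * s - r) with hp
    have hpe : ∀ x, p.eval x = ∑ r ∈ Finset.range (2 * s + 1), c r * x ^ (2 * s - r) := by
      intro x; simp [hp, Polynomial.eval_finsetSum]
    have hper : ∀ x : ℂ, p.eval (x + 1) = p.eval x := by
      intro x
      rw [hpe, hpe]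
      refine tendsto_nhds_unique
        (f := fun t : ℝ => ∑ r ∈ Finset.range (2 * s + 1),
          b r (ModularGroup.T • UpperHalfPlane.ofComplex (t * Complex.I)) * (x + 1) ^ (2 * s - r))
        (tendsto_finsetSum _ fun r _ =>
          ((hlim r).comp tendsto_T_ray_stripInf).mul_const _) ?_
      refine (tendsto_finsetSum _ fun r _ =>
          ((hlim r).comp tendsto_ray_stripInf).mul_const (x ^ (2 * s - r))).congr fun t => ?_
      have := hequiv ModularGroup.T (UpperHalfPlane.ofComplex (t * Complex.I)) x 1
      obtain ⟨e1, e2, e3, e4⟩ := T_entries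
      rw [e1, e2, e3, e4] at this
      simpa using this.symm
    have hpc := periodic_polynomial_eq_const hper
    intro r hr
    have h1 := congrArg (fun q : Polynomial ℂ => q.coeff (2 * s - r)) hpc
    simp only [Polynomial.coeff_C, if_neg (show 2 * s - r ≠ 0 by omega)] at h1
    rw [hp, Polynomial.finsetSum_coeff, Finset.sum_eq_single r] at h1
    · simpa using h1
    · intro i hi hir
      rw [Polynomial.coeff_C_mul, Polynomial.coeff_X_pow, if_neg, mul_zero]
      have := Finset.mem_range.1 hi
      omega
    · intro h; exact absurd (Finset.mem_range.2 (by omega)) h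
  have hbD : ∀ r, HasDD (b r) (fun τ => (-(1 / 2) * φ τ) * ((2 * s).choose r * (-(τ : ℂ)) ^ r))
      (fun τ => (-(1 / 2) * conj (ψ τ)) * ((2 * s).choose r * (-conj (τ : ℂ)) ^ r)) := by
    intro r
    have h1 := ((hφt r).regInt (hφh r)).1.hasDD
    have h2 := (regInt_conj (hψh r) (hψt r)).1.hasDD
    refine ((HasDD.const (c r)).add ((h1.add h2).const_mul (1 / 2))).congr (hb r) ?_ ?_ <;>
    intro τ
    · ring
    · simp only [map_mul, map_natCast, map_pow, map_neg]; ring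
  obtain ⟨h1, h2, h3⟩ := equivariant_primitive_eq_zero hs hbD hequiv
    (tendsto_qPoly_coeff hs hbc hclt)
  have h2' : ∀ τ, φ τ = 0 := fun τ => by simpa using h2 τ
  have h3' : ∀ τ, ψ τ = 0 := fun τ => by simpa using h3 τ
  refine ⟨h2', h3', fun r hr => ?_⟩
  rcases hr.lt_or_eq with h | rfl
  · exact hclt r h
  · have hbr : ∀ r τ, b r τ = c r := by
      intro r τ
      rw [hb]
      simp only [h2', h3', zero_mul, map_zero]
      have := regInt_zero τ
      change c r + 1 / 2 * (regInt (fun _ => 0) (fun _ => 0) τ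
        + regInt (fun _ => 0) (fun _ => 0) τ) = c r
      rw [this]; ring
    have h4 : qPoly (2 * s) b UpperHalfPlane.I = 0 := by
      ext r; exact h1 _ r
    have h5 := qPoly_eval (2 * s) b UpperHalfPlane.I 0
    rw [h4, Finset.sum_eq_single (2 * s)] at h5
    · simpa [hbr] using h5.symm
    · intro i hi hi2
      rw [hbr, hclt i (by have := Finset.mem_range.1 hi; omega), zero_mul]
    · simp

/-! ### Transvectants -/

section Transvectants

open MvPolynomial

variable {n : ℕ}

lemma pderiv_comm {σ : Type*} (i j : σ) (p : MvPolynomial σ ℂ) :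
    pderiv i (pderiv j p) = pderiv j (pderiv i p) := by
  classical
  have h : ⁅(pderiv i : Derivation ℂ (MvPolynomial σ ℂ) (MvPolynomial σ ℂ)),
      (pderiv j : Derivation ℂ (MvPolynomial σ ℂ) (MvPolynomial σ ℂ))⁆ = 0 := by
    refine derivation_ext fun k => ?_
    rw [Derivation.commutator_apply, pderiv_X, pderiv_X]
    simp only [Pi.single_apply]
    split_ifs <;> simp
  have := DFunLike.congr_fun h p
  rw [Derivation.commutator_apply] at this
  exact sub_eq_zero.1 this

lemma derivation_aeval {σ τ : Type*} [Fintype σ]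
    (D : Derivation ℂ (MvPolynomial τ ℂ) (MvPolynomial τ ℂ)) (g : σ → MvPolynomial τ ℂ)
    (p : MvPolynomial σ ℂ) :
    D (aeval g p) = ∑ y, aeval g (pderiv y p) * D (g y) := by
  classical
  induction p using MvPolynomial.induction_on with
  | C a => simp
  | add p q hp hq => simp only [map_add, hp, hq, add_mul, Finset.sum_add_distrib]
  | mul_X p i hp =>
    simp only [map_mul, Derivation.leibniz, hp, smul_eq_mul, aeval_X, pderiv_X, map_add, add_mul,
      Finset.sum_add_distrib, Finset.mul_sum]
    congr 1
    · rw [Finset.sum_eq_single i]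
      · simp
      · intro j _ hj; simp [hj.symm]
      · simp
    · exact Finset.sum_congr rfl fun j _ => by ring

/-- The Euler operator `X_a ∂_{X_a} + Y_a ∂_{Y_a}`. -/
def euler (a : Fin n) : BPoly n →ₗ[ℂ] BPoly n :=
  LinearMap.mulLeft ℂ (X (a, 0)) ∘ₗ (pderiv (a, 0)).toLinearMap
    + LinearMap.mulLeft ℂ (X (a, 1)) ∘ₗ (pderiv (a, 1)).toLinearMap

lemma euler_apply (a : Fin n) (p : BPoly n) :
    euler a p = X (a, 0) * pderiv (a, 0) p + X (a, 1) * pderiv (a, 1) p := rfl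

lemma coeff_euler (a : Fin n) (p : BPoly n) (m : Fin n × Fin 2 →₀ ℕ) :
    coeff m (euler a p) = ((m (a, 0) + m (a, 1) : ℕ) : ℂ) * coeff m p := by
  induction p using MvPolynomial.induction_on' with
  | add p q hp hq => rw [map_add, coeff_add, coeff_add, hp, hq, mul_add]
  | monomial u c =>
    rw [euler_apply, X_mul_pderiv_monomial, X_mul_pderiv_monomial, ← add_smul, coeff_smul,
      nsmul_eq_mul, coeff_monomial]
    split_ifs with h
    · rw [h]
    · simp

/-- Multi-homogeneous polynomials are the simultaneous eigenvectors of the Euler operators. -/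
lemma isHom_iff_euler {p : BPoly n} {k : Fin n → EisWt} :
    p.IsHom k ↔ ∀ i, euler i p = (((k i).1 - 2 : ℕ) : ℂ) • p := by
  constructor
  · intro h i
    ext m
    rw [coeff_euler, coeff_smul, smul_eq_mul]
    by_cases hm : m ∈ p.support
    · rw [h m hm]
    · rw [notMem_support_iff.1 hm, mul_zero, mul_zero]
  · intro h m hm i
    have := congrArg (coeff m) (h i)
    rw [coeff_euler, coeff_smul, smul_eq_mul] at this
    exact_mod_cast mul_right_cancel₀ (mem_support_iff.1 hm) this

lemma exists_of_euler_eq {a : Fin n} {p : BPoly n} {α : ℂ} (h : euler a p = α • p) (hp : p ≠ 0) :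
    ∃ N : ℕ, α = N := by
  obtain ⟨m, hm⟩ := exists_coeff_ne_zero hp
  refine ⟨m (a, 0) + m (a, 1), (mul_right_cancel₀ hm ?_).symm⟩
  rw [← coeff_euler, h, coeff_smul, smul_eq_mul]

/-- Cayley's operator `∂_{X_a} ∂_{Y_b} - ∂_{Y_a} ∂_{X_b}`. -/
def omega (a b : Fin n) : BPoly n →ₗ[ℂ] BPoly n :=
  (pderiv (a, 0)).toLinearMap ∘ₗ (pderiv (b, 1)).toLinearMap
    - (pderiv (a, 1)).toLinearMap ∘ₗ (pderiv (b, 0)).toLinearMap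

lemma omega_apply (a b : Fin n) (p : BPoly n) :
    omega a b p = pderiv (a, 0) (pderiv (b, 1) p) - pderiv (a, 1) (pderiv (b, 0) p) := rfl

/-- The polarisation `X_a ∂_{X_b} + Y_a ∂_{Y_b}`. -/
def polar (a b : Fin n) (p : BPoly n) : BPoly n :=
  X (a, 0) * pderiv (b, 0) p + X (a, 1) * pderiv (b, 1) p

/-- The substitution `(X_b, Y_b) → (X_a, Y_a)`. -/
def collapse (a b : Fin n) : BPoly n →ₐ[ℂ] BPoly n :=
  rename (fun i => (if i.1 = b then a else i.1, i.2))

lemma collapse_eq_aeval (a b : Fin n) : collapse a b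
    = aeval (fun i : Fin n × Fin 2 => (X (if i.1 = b then a else i.1, i.2) : BPoly n)) := by
  refine algHom_ext fun i => ?_
  simp [collapse]

lemma transvect_eq (a b : Fin n) (l : ℕ) (p : BPoly n) :
    transvect a b l p = collapse a b ((omega a b)^[l] p) := rfl

lemma euler_pderiv_of_ne {a c : Fin n} (h : c ≠ a) (e : Fin 2) (p : BPoly n) :
    euler a (pderiv (c, e) p) = pderiv (c, e) (euler a p) := by
  have h0 : ∀ e' : Fin 2, ((a, e') : Fin n × Fin 2) ≠ (c, e) := fun e' h' =>
    h (Prod.mk.inj h').1.symm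
  simp only [euler_apply, map_add, pderiv_mul, pderiv_X_of_ne (h0 _), zero_mul, zero_add,
    pderiv_comm (c, e)]

lemma euler_pderiv_self (a : Fin n) (e : Fin 2) (p : BPoly n) :
    euler a (pderiv (a, e) p) = pderiv (a, e) (euler a p) - pderiv (a, e) p := by
  have h01 : ((a, 0) : Fin n × Fin 2) ≠ (a, 1) := by simp
  have h10 : ((a, 1) : Fin n × Fin 2) ≠ (a, 0) := by simp
  fin_cases e
  · simp only [Fin.zero_eta, euler_apply, map_add, pderiv_mul, pderiv_X_of_ne h10, pderiv_X_self,
      pderiv_comm (a, 1) (a, 0) p]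
    ring
  · simp only [Fin.mk_one, euler_apply, map_add, pderiv_mul, pderiv_X_of_ne h01, pderiv_X_self,
      pderiv_comm (a, 1) (a, 0) p]
    ring

lemma euler_omega_left {a b : Fin n} (hab : a ≠ b) {p : BPoly n} {α : ℂ}
    (h : euler a p = α • p) : euler a (omega a b p) = (α - 1) • omega a b p := by
  simp only [omega_apply, map_sub, euler_pderiv_self, euler_pderiv_of_ne hab.symm, h,
    Derivation.map_smul, sub_smul, smul_sub, one_smul]

lemma euler_omega_right {a b : Fin n} (hab : a ≠ b) {p : BPoly n} {β : ℂ}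
    (h : euler b p = β • p) : euler b (omega a b p) = (β - 1) • omega a b p := by
  simp only [omega_apply, map_sub, euler_pderiv_self, euler_pderiv_of_ne hab, h,
    Derivation.map_smul, sub_smul, smul_sub, one_smul]

lemma euler_omega_of_ne {a b c : Fin n} (ha : a ≠ c) (hb : b ≠ c) {p : BPoly n} {β : ℂ}
    (h : euler c p = β • p) : euler c (omega a b p) = β • omega a b p := by
  simp only [omega_apply, map_sub, euler_pderiv_of_ne ha, euler_pderiv_of_ne hb, h,
    Derivation.map_smul, smul_sub]

/-- Capelli's identity. -/
lemma polar_polar_add {a b : Fin n} (hab : a ≠ b) {p : BPoly n} {α β : ℂ}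
    (ha : euler a p = α • p) (hb : euler b p = β • p) :
    polar b a (polar a b p) + (X (a, 0) * X (b, 1) - X (a, 1) * X (b, 0)) * omega a b p
      = ((α + 1) * β) • p := by
  have h1 : ∀ e e' : Fin 2, ((b, e) : Fin n × Fin 2) ≠ (a, e') := fun e e' h' =>
    hab (Prod.mk.inj h').1.symm
  have h01 : ((a, 0) : Fin n × Fin 2) ≠ (a, 1) := by simp
  have h10 : ((a, 1) : Fin n × Fin 2) ≠ (a, 0) := by simp
  have hE : euler a (euler b p) + euler b p = ((α + 1) * β) • p := by
    rw [hb, map_smul, ha, smul_smul, ← add_smul]; ring_nf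
  rw [← hE]
  simp only [polar, omega_apply, euler_apply, map_add, pderiv_mul, pderiv_X_of_ne (h1 _ _),
    pderiv_X_of_ne h01, pderiv_X_of_ne h10, pderiv_X_self]
  ring

lemma omega_polar {a b : Fin n} (hab : a ≠ b) (p : BPoly n) :
    omega a b (polar a b p) = polar a b (omega a b p) := by
  have h1 : ∀ e e' : Fin 2, ((a, e) : Fin n × Fin 2) ≠ (b, e') := fun e e' h' =>
    hab (Prod.mk.inj h').1
  have h01 : ((a, 0) : Fin n × Fin 2) ≠ (a, 1) := by simp
  have h10 : ((a, 1) : Fin n × Fin 2) ≠ (a, 0) := by simp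
  simp only [polar, omega_apply, map_add, map_sub, pderiv_mul, pderiv_X_of_ne (h1 _ _),
    pderiv_X_of_ne h01, pderiv_X_of_ne h10, pderiv_X_self, pderiv_comm (b, _) (a, _) (pderiv _ p),
    pderiv_comm (b, 1) (b, 0) p, map_zero]
  ring

lemma collapse_X_left {a b : Fin n} (hab : a ≠ b) (e : Fin 2) :
    collapse a b (X (a, e)) = X (a, e) := by simp [collapse, hab]

lemma collapse_X_right (a b : Fin n) (e : Fin 2) :
    collapse a b (X (b, e)) = X (a, e) := by simp [collapse]

lemma collapse_X_of_ne {a b c : Fin n} (hc : c ≠ b) (e : Fin 2) :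
    collapse a b (X (c, e)) = X (c, e) := by simp [collapse, hc]

lemma collapse_polar {a b : Fin n} (hab : a ≠ b) (p : BPoly n) :
    collapse a b (polar a b p) = collapse a b (euler b p) := by
  simp only [polar, euler_apply, map_add, map_mul, collapse_X_left hab, collapse_X_right]

lemma euler_polar_left {a b : Fin n} (hab : a ≠ b) {p : BPoly n} {α : ℂ}
    (h : euler a p = α • p) : euler a (polar a b p) = (α + 1) • polar a b p := by
  have h01 : ((a, 0) : Fin n × Fin 2) ≠ (a, 1) := by simp
  have h10 : ((a, 1) : Fin n × Fin 2) ≠ (a, 0) := by simp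
  have e0 : ∀ e, euler a (pderiv (b, e) p) = α • pderiv (b, e) p := fun e => by
    rw [euler_pderiv_of_ne hab.symm, h, Derivation.map_smul]
  have e1 := e0 0
  have e2 := e0 1
  rw [euler_apply] at e1 e2
  rw [euler_apply]
  simp only [polar, map_add, pderiv_mul, pderiv_X_of_ne h01, pderiv_X_of_ne h10, pderiv_X_self]
  rw [add_smul, smul_add, ← mul_smul_comm, ← mul_smul_comm, ← e1, ← e2, one_smul]
  ring

lemma euler_polar_right {a b : Fin n} (hab : a ≠ b) {p : BPoly n} {β : ℂ}
    (h : euler b p = β • p) : euler b (polar a b p) = (β - 1) • polar a b p := by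
  have h1 : ∀ e e' : Fin 2, ((a, e) : Fin n × Fin 2) ≠ (b, e') := fun e e' h' =>
    hab (Prod.mk.inj h').1
  have e0 : ∀ e, euler b (pderiv (b, e) p) = (β - 1) • pderiv (b, e) p := fun e => by
    rw [euler_pderiv_self, h, Derivation.map_smul, sub_smul, one_smul]
  have e1 := e0 0
  have e2 := e0 1
  rw [euler_apply] at e1 e2
  rw [euler_apply]
  simp only [polar, map_add, pderiv_mul, pderiv_X_of_ne (h1 _ _)]
  rw [smul_add, ← mul_smul_comm, ← mul_smul_comm, ← e1, ← e2]
  ring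

lemma collapse_eq_self {a b : Fin n} {p : BPoly n} (hb : euler b p = 0) : collapse a b p = p := by
  have hs : ∀ m ∈ p.support, collapse a b (monomial m (coeff m p)) = monomial m (coeff m p) := by
    intro m hm
    have h0 := coeff_euler b p m
    rw [hb, coeff_zero, zero_eq_mul] at h0
    have h1 : m (b, 0) + m (b, 1) = 0 := by
      exact_mod_cast h0.resolve_right (mem_support_iff.1 hm)
    rw [collapse, rename_monomial]
    suffices h2 : Finsupp.mapDomain (fun i : Fin n × Fin 2 => (if i.1 = b then a else i.1, i.2)) m
        = m by rw [h2]
    refine (Finsupp.mapDomain_congr (g := id) fun i hi => ?_).trans Finsupp.mapDomain_id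
    have hib : i.1 ≠ b := by
      rintro rfl
      obtain ⟨i, e⟩ := i
      have := Finsupp.mem_support_iff.1 hi
      fin_cases e
      · exact this (Nat.eq_zero_of_add_eq_zero_right h1)
      · exact this (Nat.eq_zero_of_add_eq_zero_left h1)
    simp [hib]
  conv_lhs => rw [p.as_sum, map_sum]
  conv_rhs => rw [p.as_sum]
  exact Finset.sum_congr rfl hs

/-- A polynomial killed by Cayley's operator is determined by its restriction to the diagonal
`(X_b, Y_b) = (X_a, Y_a)`. By Capelli's identity it can be recovered from its polarisation, which
has lower degree in `(X_b, Y_b)`. -/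
lemma eq_zero_of_omega_of_collapse {a b : Fin n} (hab : a ≠ b) (β : ℕ) : ∀ {α : ℕ} {p : BPoly n},
    euler a p = (α : ℂ) • p → euler b p = (β : ℂ) • p → omega a b p = 0 → collapse a b p = 0 →
      p = 0 := by
  induction β with
  | zero =>
    intro α p _ hb _ hc
    rwa [collapse_eq_self (by rw [hb]; simp)] at hc
  | succ β ih =>
    intro α p ha hb hΩ hc
    have h0 : polar a b p = 0 := by
      refine ih (α := α + 1) ?_ ?_ ?_ ?_
      · rw [euler_polar_left hab ha]; push_cast; rfl
      · rw [euler_polar_right hab hb]; push_cast; rw [add_sub_cancel_right]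
      · rw [omega_polar hab, hΩ]; simp [polar]
      · rw [collapse_polar hab, hb, map_smul, hc, smul_zero]
    have h1 := polar_polar_add hab ha hb
    rw [h0, hΩ, mul_zero, add_zero] at h1
    have h2 : polar b a (0 : BPoly n) = 0 := by simp [polar]
    rw [h2] at h1
    exact (smul_eq_zero.1 h1.symm).resolve_left
      (mul_ne_zero (Nat.cast_add_one_ne_zero α) (by exact_mod_cast Nat.succ_ne_zero β))

lemma omega_iterate_eq_zero {a b : Fin n} (hab : a ≠ b) {α β : ℕ} {p : BPoly n}
    (ha : euler a p = (α : ℂ) • p) (hb : euler b p = (β : ℂ) • p) {l : ℕ}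
    (hl : α < l ∨ β < l) : (omega a b)^[l] p = 0 := by
  have h1 : ∀ l : ℕ, euler a ((omega a b)^[l] p) = ((α : ℂ) - l) • (omega a b)^[l] p ∧
      euler b ((omega a b)^[l] p) = ((β : ℂ) - l) • (omega a b)^[l] p := by
    intro l
    induction l with
    | zero => simpa using ⟨ha, hb⟩
    | succ l ih =>
      rw [Function.iterate_succ_apply']
      constructor
      · rw [euler_omega_left hab ih.1]; push_cast; ring_nf
      · rw [euler_omega_right hab ih.2]; push_cast; ring_nf
  by_contra h
  rcases hl with hl | hl
  · obtain ⟨N, hN⟩ := exists_of_euler_eq (h1 l).1 h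
    rw [sub_eq_iff_eq_add] at hN
    have : α = N + l := by exact_mod_cast hN
    omega
  · obtain ⟨N, hN⟩ := exists_of_euler_eq (h1 l).2 h
    rw [sub_eq_iff_eq_add] at hN
    have : β = N + l := by exact_mod_cast hN
    omega

/-- The Clebsch–Gordan decomposition: the transvectants are jointly injective on the polynomials
which are homogeneous in both pairs of variables. -/
lemma eq_zero_of_transvect {a b : Fin n} (hab : a ≠ b) (β : ℕ) : ∀ {α : ℕ} {p : BPoly n},
    euler a p = (α : ℂ) • p → euler b p = (β : ℂ) • p → (∀ l, transvect a b l p = 0) → p = 0 := by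
  induction β with
  | zero =>
    intro α p ha hb h
    exact eq_zero_of_omega_of_collapse hab 0 ha hb
      (omega_iterate_eq_zero hab ha hb (l := 1) (Or.inr one_pos)) (h 0)
  | succ β ih =>
    intro α p ha hb h
    refine eq_zero_of_omega_of_collapse hab _ ha hb ?_ (h 0)
    rcases α with _ | α
    · exact omega_iterate_eq_zero hab ha hb (l := 1) (Or.inl one_pos)
    · refine ih (α := α) ?_ ?_ fun l => h (l + 1)
      · rw [euler_omega_left hab ha]; push_cast; rw [add_sub_cancel_right]
      · rw [euler_omega_right hab hb]; push_cast; rw [add_sub_cancel_right]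

lemma pderiv_collapse_left {a b : Fin n} (hab : a ≠ b) (e : Fin 2) (p : BPoly n) :
    pderiv (a, e) (collapse a b p)
      = collapse a b (pderiv (a, e) p) + collapse a b (pderiv (b, e) p) := by
  have h := derivation_aeval (pderiv (a, e))
    (fun i : Fin n × Fin 2 => (X (if i.1 = b then a else i.1, i.2) : BPoly n)) p
  have h2 : ∀ q, aeval (fun i : Fin n × Fin 2 => (X (if i.1 = b then a else i.1, i.2) : BPoly n)) q
      = collapse a b q := fun q => (DFunLike.congr_fun (collapse_eq_aeval a b) q).symm
  simp only [h2] at h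
  rw [h, Finset.sum_eq_add (a, e) (b, e) (by simp [hab])]
  · simp [hab]
  · rintro ⟨c, e'⟩ _ ⟨h3, h4⟩
    rw [pderiv_X_of_ne, mul_zero]
    intro h5
    simp only [Prod.mk.injEq] at h5
    split_ifs at h5 with h6
    · exact h4 (by rw [h6, h5.2])
    · exact h3 (by rw [h5.1, h5.2])
  · simp
  · simp

lemma pderiv_collapse_of_ne {a b c : Fin n} (hca : c ≠ a) (hcb : c ≠ b) (e : Fin 2)
    (p : BPoly n) : pderiv (c, e) (collapse a b p) = collapse a b (pderiv (c, e) p) := by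
  have h := derivation_aeval (pderiv (c, e))
    (fun i : Fin n × Fin 2 => (X (if i.1 = b then a else i.1, i.2) : BPoly n)) p
  have h2 : ∀ q, aeval (fun i : Fin n × Fin 2 => (X (if i.1 = b then a else i.1, i.2) : BPoly n)) q
      = collapse a b q := fun q => (DFunLike.congr_fun (collapse_eq_aeval a b) q).symm
  simp only [h2] at h
  rw [h, Finset.sum_eq_single (c, e)]
  · simp [hcb]
  · rintro ⟨d, e'⟩ _ h3
    rw [pderiv_X_of_ne, mul_zero]
    intro h5
    simp only [Prod.mk.injEq] at h5
    split_ifs at h5 with h6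
    · exact hca h5.1.symm
    · exact h3 (by rw [h5.1, h5.2])
  · simp

lemma pderiv_collapse_right {a b : Fin n} (hab : a ≠ b) (e : Fin 2)
    (p : BPoly n) : pderiv (b, e) (collapse a b p) = 0 := by
  have h := derivation_aeval (pderiv (b, e))
    (fun i : Fin n × Fin 2 => (X (if i.1 = b then a else i.1, i.2) : BPoly n)) p
  have h2 : ∀ q, aeval (fun i : Fin n × Fin 2 => (X (if i.1 = b then a else i.1, i.2) : BPoly n)) q
      = collapse a b q := fun q => (DFunLike.congr_fun (collapse_eq_aeval a b) q).symm
  simp only [h2] at h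
  rw [h]
  refine Finset.sum_eq_zero fun i _ => ?_
  rw [pderiv_X_of_ne, mul_zero]
  intro h5
  simp only [Prod.mk.injEq] at h5
  split_ifs at h5 with h6
  · exact hab h5.1
  · exact h6 h5.1

lemma euler_collapse_left {a b : Fin n} (hab : a ≠ b) (p : BPoly n) :
    euler a (collapse a b p) = collapse a b (euler a p + euler b p) := by
  simp only [euler_apply, pderiv_collapse_left hab, map_add, map_mul, collapse_X_left hab,
    collapse_X_right]
  ring

lemma euler_collapse_of_ne {a b c : Fin n} (hca : c ≠ a) (hcb : c ≠ b) (p : BPoly n) :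
    euler c (collapse a b p) = collapse a b (euler c p) := by
  simp only [euler_apply, pderiv_collapse_of_ne hca hcb, map_add, map_mul, collapse_X_of_ne hcb]

lemma euler_collapse_right {a b : Fin n} (hab : a ≠ b) (p : BPoly n) :
    euler b (collapse a b p) = 0 := by
  simp only [euler_apply, pderiv_collapse_right hab, mul_zero, add_zero]

/-- The degrees of a transvectant in the pairs of variables. -/
lemma euler_transvect {a b : Fin n} (hab : a ≠ b) {p : BPoly n} {α β : ℂ}
    (ha : euler a p = α • p) (hb : euler b p = β • p) (l : ℕ) :
    euler a (transvect a b l p) = (α + β - 2 * l) • transvect a b l p ∧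
    euler b (transvect a b l p) = 0 ∧
    ∀ c ≠ a, c ≠ b → ∀ γ : ℂ, euler c p = γ • p →
      euler c (transvect a b l p) = γ • transvect a b l p := by
  have h1 : euler a ((omega a b)^[l] p) = (α - l) • (omega a b)^[l] p ∧
      euler b ((omega a b)^[l] p) = (β - l) • (omega a b)^[l] p ∧
      ∀ c ≠ a, c ≠ b → ∀ γ : ℂ, euler c p = γ • p →
        euler c ((omega a b)^[l] p) = γ • (omega a b)^[l] p := by
    induction l with
    | zero => exact ⟨by simpa using ha, by simpa using hb, fun _ _ _ _ h => h⟩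
    | succ l ih =>
      rw [Function.iterate_succ_apply']
      refine ⟨?_, ?_, fun c hca hcb γ h => ?_⟩
      · rw [euler_omega_left hab ih.1]; push_cast; ring_nf
      · rw [euler_omega_right hab ih.2.1]; push_cast; ring_nf
      · exact euler_omega_of_ne hca.symm hcb.symm (ih.2.2 c hca hcb γ h)
  simp only [transvect_eq]
  refine ⟨?_, euler_collapse_right hab _, fun c hca hcb γ h => ?_⟩
  · rw [euler_collapse_left hab, h1.1, h1.2.1, ← add_smul, map_smul]; ring_nf
  · rw [euler_collapse_of_ne hca hcb, h1.2.2 c hca hcb γ h, map_smul]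

end Transvectants

/-! ### Families of projections -/

section Projections

open MvPolynomial

variable {n : ℕ}

/-- Linear substitution of all pairs `(X_i, Y_i)`. -/
def act (g : Matrix (Fin 2) (Fin 2) ℂ) : BPoly n →ₐ[ℂ] BPoly n :=
  aeval fun i => C (g i.2 0) * X (i.1, 0) + C (g i.2 1) * X (i.1, 1)

lemma act_X (g : Matrix (Fin 2) (Fin 2) ℂ) (i : Fin n × Fin 2) :
    act g (X i : BPoly n) = C (g i.2 0) * X (i.1, 0) + C (g i.2 1) * X (i.1, 1) := by simp [act]

lemma eval_act (g : Matrix (Fin 2) (Fin 2) ℂ) (p : BPoly n) (v : Fin n × Fin 2 → ℂ) :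
    eval v (act g p) = eval (fun i => g i.2 0 * v (i.1, 0) + g i.2 1 * v (i.1, 1)) p := by
  induction p using MvPolynomial.induction_on with
  | C a => simp [act]
  | add p q hp hq => simp only [map_add, hp, hq]
  | mul_X p i hp => simp only [map_mul, hp, act_X, map_add, eval_C, eval_X]

lemma pderiv_act (g : Matrix (Fin 2) (Fin 2) ℂ) (b : Fin n) (e : Fin 2) (p : BPoly n) :
    pderiv (b, e) (act g p)
      = C (g 0 e) * act g (pderiv (b, 0) p) + C (g 1 e) * act g (pderiv (b, 1) p) := by
  have h := derivation_aeval (pderiv (b, e)) (fun i : Fin n × Fin 2 =>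
    (C (g i.2 0) * X (i.1, 0) + C (g i.2 1) * X (i.1, 1) : BPoly n)) p
  rw [act, h, Fintype.sum_prod_type, Finset.sum_eq_single b]
  · rw [Fin.sum_univ_two]
    fin_cases e <;> simp <;> ring
  · intro c _ hc
    rw [Fin.sum_univ_two]
    have : ∀ e', ((c, e') : Fin n × Fin 2) ≠ (b, e) := fun e' h => hc (Prod.mk.inj h).1
    simp [pderiv_X_of_ne (this _)]
  · simp

lemma omega_act {g : Matrix (Fin 2) (Fin 2) ℂ} (hg : g 0 0 * g 1 1 - g 0 1 * g 1 0 = 1)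
    {a b : Fin n} (p : BPoly n) : omega a b (act g p) = act g (omega a b p) := by
  simp only [omega_apply, pderiv_act, map_add, map_sub, pderiv_C_mul]
  have h1 : (C (g 0 0) * C (g 1 1) - C (g 0 1) * C (g 1 0) : BPoly n) = 1 := by
    rw [← map_mul, ← map_mul, ← map_sub, hg, map_one]
  linear_combination (act g (pderiv (a, 0) (pderiv (b, 1) p))
    - act g (pderiv (a, 1) (pderiv (b, 0) p))) * h1

lemma collapse_act (g : Matrix (Fin 2) (Fin 2) ℂ) (a b : Fin n) (p : BPoly n) :
    collapse a b (act g p) = act g (collapse a b p) := by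
  have : (collapse a b).comp (act g) = (act g).comp (collapse a b) := by
    refine algHom_ext fun i => ?_
    rw [AlgHom.comp_apply, AlgHom.comp_apply, act_X]
    simp [collapse, act_X]
  exact DFunLike.congr_fun this p

lemma transvect_act {g : Matrix (Fin 2) (Fin 2) ℂ} (hg : g 0 0 * g 1 1 - g 0 1 * g 1 0 = 1)
    (a b : Fin n) (l : ℕ) (p : BPoly n) :
    transvect a b l (act g p) = act g (transvect a b l p) := by
  rw [transvect_eq, transvect_eq, ← collapse_act]
  congr 1
  induction l with
  | zero => rfl
  | succ l ih => rw [Function.iterate_succ_apply', Function.iterate_succ_apply', ih, omega_act hg]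

/-- Complex conjugation of the coefficients. -/
def conjPoly : BPoly n →+* BPoly n := map (starRingEnd ℂ)

lemma transvect_conjPoly (a b : Fin n) (l : ℕ) (p : BPoly n) :
    transvect a b l (conjPoly p) = conjPoly (transvect a b l p) := by
  rw [transvect_eq, transvect_eq, collapse, conjPoly, map_rename]
  congr 1
  induction l with
  | zero => rfl
  | succ l ih =>
    rw [Function.iterate_succ_apply', Function.iterate_succ_apply', ih]
    simp only [omega_apply, pderiv_map, map_sub]

lemma conjPoly_smul (c : ℂ) (p : BPoly n) : conjPoly (c • p) = conj c • conjPoly p := by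
  rw [smul_eq_C_mul, smul_eq_C_mul, conjPoly, map_mul, map_C]

lemma conj_at (p : BPoly n) (v : Fin n → Fin 2 → ℝ) : conj (p.at v) = (conjPoly p).at v := by
  rw [BPoly.at, BPoly.at, conjPoly]
  induction p using MvPolynomial.induction_on with
  | C a => simp
  | add p q hp hq => simp only [map_add, hp, hq]
  | mul_X p i hp => simp only [map_mul, hp, map_X, eval_X, Complex.conj_ofReal]

/-- The evaluation at a point as a linear form. -/
def evalAt (v : Fin n × Fin 2 → ℂ) : BPoly n →ₗ[ℂ] ℂ := (aeval v).toLinearMap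

lemma evalAt_apply (v : Fin n × Fin 2 → ℂ) (p : BPoly n) : evalAt v p = eval v p := by
  simp [evalAt]

lemma at_eq_evalAt (p : BPoly n) (v : Fin n → Fin 2 → ℝ) :
    p.at v = evalAt (fun i => ((v i.1 i.2 : ℝ) : ℂ)) p := (evalAt_apply _ _).symm

lemma eq_of_at {p q : BPoly n} (h : ∀ v, p.at v = q.at v) : p = q := by
  refine funext_set (fun _ => Set.range ((↑) : ℝ → ℂ))
    (fun _ => Set.infinite_range_of_injective Complex.ofReal_injective) fun x hx => ?_
  choose y hy using fun i => hx i trivial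
  have := h fun i e => y (i, e)
  simpa [BPoly.at, hy] using this

/-- The entries of an element of `SL(2, ℤ)` as complex numbers. -/
def toMat (γ : SL(2, ℤ)) : Matrix (Fin 2) (Fin 2) ℂ := Matrix.of fun a b => ((γ a b : ℤ) : ℂ)

lemma toMat_apply (γ : SL(2, ℤ)) (a b : Fin 2) : toMat γ a b = ((γ a b : ℤ) : ℂ) := rfl

lemma toMat_det (γ : SL(2, ℤ)) :
    toMat γ 0 0 * toMat γ 1 1 - toMat γ 0 1 * toMat γ 1 0 = 1 := det_complex γ

lemma at_actXY (γ : SL(2, ℤ)) (p : BPoly n) (v : Fin n → Fin 2 → ℝ) :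
    p.at (fun i => actXY γ (v i)) = (act (toMat γ) p).at v := by
  rw [BPoly.at, BPoly.at, eval_act]
  congr 2
  funext ⟨i, e⟩
  fin_cases e <;> simp [actXY, toMat_apply]

/-- The multi-homogeneous polynomials. -/
def homSub (k : Fin n → EisWt) : Submodule ℂ (BPoly n) where
  carrier := {p | p.IsHom k}
  add_mem' {p q} hp hq := by
    rw [Set.mem_ofPred_eq, isHom_iff_euler] at *
    intro i
    rw [map_add, hp, hq, smul_add]
  zero_mem' := by
    rw [Set.mem_ofPred_eq, isHom_iff_euler]
    simp
  smul_mem' c p hp := by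
    rw [Set.mem_ofPred_eq, isHom_iff_euler] at *
    intro i
    rw [map_smul, hp, smul_comm]

lemma mem_homSub {k : Fin n → EisWt} {p : BPoly n} : p ∈ homSub k ↔ p.IsHom k := Iff.rfl

/-- The monomial `X_1^{m-r} Y_1^r`. -/
def bin [NeZero n] (m r : ℕ) : BPoly n := X (0, 0) ^ (m - r) * X (0, 1) ^ r

/-- The coefficient of `X_1^{m-r} Y_1^r`. -/
def binCoeff [NeZero n] (m r : ℕ) : BPoly n →ₗ[ℂ] ℂ :=
  lcoeff ℂ (Finsupp.single (0, 0) (m - r) + Finsupp.single (0, 1) r)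

lemma bin_eq [NeZero n] (m r : ℕ) : (bin m r : BPoly n)
    = monomial (Finsupp.single (0, 0) (m - r) + Finsupp.single (0, 1) r) 1 := by
  rw [bin, X_pow_eq_monomial, X_pow_eq_monomial, monomial_mul, one_mul]

lemma binCoeff_bin [NeZero n] {m r s : ℕ} :
    binCoeff m r (bin m s : BPoly n) = if r = s then 1 else 0 := by
  rw [binCoeff, bin_eq, lcoeff_apply, coeff_monomial]
  by_cases h : r = s
  · simp [h]
  · rw [if_neg h, if_neg]
    intro h'
    have := DFunLike.congr_fun h' (0, 1)
    simp at this
    exact h this.symm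

lemma eval_bin [NeZero n] (m r : ℕ) (v : Fin n × Fin 2 → ℂ) :
    eval v (bin m r : BPoly n) = v (0, 0) ^ (m - r) * v (0, 1) ^ r := by simp [bin]

/-- A polynomial in `X_1`, `Y_1` only, homogeneous of degree `m`. -/
def IsBinary [NeZero n] (m : ℕ) (p : BPoly n) : Prop :=
  euler 0 p = (m : ℂ) • p ∧ ∀ i ≠ 0, euler i p = 0

lemma IsBinary.eq_sum [NeZero n] {m : ℕ} {p : BPoly n} (h : IsBinary m p) :
    p = ∑ r ∈ Finset.range (m + 1), binCoeff m r p • bin m r := by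
  ext u
  simp only [bin_eq, coeff_sum, coeff_smul, coeff_monomial, smul_eq_mul, binCoeff, lcoeff_apply]
  by_cases hu : coeff u p = 0
  · rw [hu, eq_comm]
    refine Finset.sum_eq_zero fun r _ => ?_
    split_ifs with h1
    · rw [h1, hu, zero_mul]
    · rw [mul_zero]
  · have h1 : u (0, 0) + u (0, 1) = m := by
      have := coeff_euler 0 p u
      rw [h.1, coeff_smul, smul_eq_mul] at this
      exact_mod_cast (mul_right_cancel₀ hu this).symm
    have h2 : ∀ i ≠ 0, u (i, 0) + u (i, 1) = 0 := by
      intro i hi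
      have := coeff_euler i p u
      rw [h.2 i hi, coeff_zero, zero_eq_mul] at this
      exact_mod_cast this.resolve_right hu
    have h3 : Finsupp.single (0, 0) (m - u (0, 1)) + Finsupp.single (0, 1) (u (0, 1)) = u := by
      ext ⟨i, e⟩
      by_cases hi : i = 0
      · subst hi
        fin_cases e
        · simp; omega
        · simp
      · have := h2 i hi
        have h4 : ((0, 0) : Fin n × Fin 2) ≠ (i, e) := fun h => hi (Prod.mk.inj h).1.symm
        have h5 : ((0, 1) : Fin n × Fin 2) ≠ (i, e) := fun h => hi (Prod.mk.inj h).1.symm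
        rw [Finsupp.add_apply, Finsupp.single_eq_of_ne' h4, Finsupp.single_eq_of_ne' h5]
        fin_cases e <;> simp <;> omega
    rw [Finset.sum_eq_single (u (0, 1))]
    · rw [h3, if_pos rfl, mul_one]
    · intro r _ hr
      rw [if_neg, mul_zero]
      intro h4
      apply hr
      rw [← h4]
      simp
    · intro h4
      exact absurd (Finset.mem_range.2 (by omega)) h4

lemma highest_eq [NeZero n] (m : ℕ) (τ : ℍ) : (highest m τ : BPoly n)
    = ∑ r ∈ Finset.range (m + 1), ((m.choose r : ℂ) * (-(τ : ℂ)) ^ r) • bin m r := by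
  have := add_pow (-(C (τ : ℂ) * X (0, 1) : BPoly n)) (X (0, 0)) m
  rw [highest, sub_eq_neg_add, this]
  refine Finset.sum_congr rfl fun r _ => ?_
  rw [← neg_mul, mul_pow, ← map_neg, ← map_pow, smul_eq_C_mul, map_mul, bin, map_natCast]
  ring

/-- A finite family of `SL(2)`-equivariant projections onto polynomials in one pair of variables
which is jointly injective on the multi-homogeneous polynomials. -/
structure ProjFamily [NeZero n] (k : Fin n → EisWt) where
  idx : Type
  fin : Fintype idx
  wt : idx → ℕ
  even_wt : ∀ i, Even (wt i)
  proj : idx → BPoly n →ₗ[ℂ] BPoly n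
  inj : ∀ p ∈ homSub k, (∀ i, proj i p = 0) → p = 0
  proj_act : ∀ i (g : Matrix (Fin 2) (Fin 2) ℂ), g 0 0 * g 1 1 - g 0 1 * g 1 0 = 1 →
    ∀ p, proj i (act g p) = act g (proj i p)
  proj_conj : ∀ i p, proj i (conjPoly p) = conjPoly (proj i p)
  binary : ∀ i, ∀ p ∈ homSub k, IsBinary (wt i) (proj i p)

instance [NeZero n] {k : Fin n → EisWt} (F : ProjFamily k) : Fintype F.idx := F.fin

/-- The transvectant as a linear map. -/
def transvectL (a b : Fin n) (l : ℕ) : BPoly n →ₗ[ℂ] BPoly n :=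
  (collapse a b).toLinearMap ∘ₗ (omega a b) ^ l

lemma transvectL_apply (a b : Fin n) (l : ℕ) (p : BPoly n) :
    transvectL a b l p = transvect a b l p := by
  rw [transvectL, LinearMap.comp_apply, Module.End.pow_apply]; rfl

lemma euler_of_mem {k : Fin n → EisWt} {p : BPoly n} (hp : p ∈ homSub k) (i : Fin n) :
    euler i p = (((k i).1 - 2 : ℕ) : ℂ) • p := isHom_iff_euler.1 hp i

lemma transvect_eq_zero {a b : Fin n} (hab : a ≠ b) {α β : ℕ} {p : BPoly n}
    (ha : euler a p = (α : ℂ) • p) (hb : euler b p = (β : ℂ) • p) {l : ℕ} (hl : α + β < 2 * l) :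
    transvect a b l p = 0 := by
  rw [transvect_eq, omega_iterate_eq_zero hab ha hb (by omega), map_zero]

/-- The projections `δ^l` in depth two. -/
def projTwo (k : Fin 2 → EisWt) : ProjFamily k where
  idx := {l : Fin ((k 0).1 + (k 1).1) // 2 * l.1 + 4 ≤ (k 0).1 + (k 1).1}
  fin := inferInstance
  wt l := (k 0).1 + (k 1).1 - 4 - 2 * l.1.1
  even_wt l := by
    obtain ⟨a, ha⟩ := (k 0).2.1
    obtain ⟨b, hb⟩ := (k 1).2.1
    exact ⟨a + b - 2 - l.1.1, by omega⟩
  proj l := transvectL 0 1 l.1.1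
  inj p hp h := by
    have h0 := (k 0).2.2
    have h1 := (k 1).2.2
    refine eq_zero_of_transvect (by decide) _ (euler_of_mem hp 0) (euler_of_mem hp 1) fun l => ?_
    by_cases hl : 2 * l + 4 ≤ (k 0).1 + (k 1).1
    · rw [← transvectL_apply]
      exact h ⟨⟨l, by omega⟩, hl⟩
    · exact transvect_eq_zero (by decide) (euler_of_mem hp 0) (euler_of_mem hp 1) (by omega)
  proj_act l g hg p := by simp only [transvectL_apply, transvect_act hg]
  proj_conj l p := by simp only [transvectL_apply, transvect_conjPoly]
  binary l p hp := by
    have h0 := (k 0).2.2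
    have h1 := (k 1).2.2
    have hl := l.2
    obtain ⟨e1, e2, -⟩ := euler_transvect (a := 0) (b := 1) (by decide) (euler_of_mem hp 0)
      (euler_of_mem hp 1) l.1.1
    rw [transvectL_apply]
    refine ⟨?_, fun i hi => ?_⟩
    · rw [e1]
      congr 1
      have : (k 0).1 - 2 + ((k 1).1 - 2) = ((k 0).1 + (k 1).1 - 4 - 2 * l.1.1) + 2 * l.1.1 := by
        omega
      have h2 := congrArg (Nat.cast : ℕ → ℂ) this
      rw [Nat.cast_add, Nat.cast_add] at h2
      rw [h2]; push_cast; ring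
    · rwa [Fin.eq_one_of_ne_zero i hi]

/-- The projections `δ^{l₁,l₂}` in depth three. -/
def projThree (k : Fin 3 → EisWt) : ProjFamily k where
  idx := {l : Fin ((k 0).1 + (k 1).1 + (k 2).1) × Fin ((k 0).1 + (k 1).1 + (k 2).1) //
    2 * l.1.1 + 2 * l.2.1 + 6 ≤ (k 0).1 + (k 1).1 + (k 2).1}
  fin := inferInstance
  wt l := (k 0).1 + (k 1).1 + (k 2).1 - 6 - 2 * l.1.1.1 - 2 * l.1.2.1
  even_wt l := by
    obtain ⟨a, ha⟩ := (k 0).2.1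
    obtain ⟨b, hb⟩ := (k 1).2.1
    obtain ⟨c, hc⟩ := (k 2).2.1
    exact ⟨a + b + c - 3 - l.1.1.1 - l.1.2.1, by omega⟩
  proj l := transvectL 0 1 l.1.1.1 ∘ₗ transvectL 1 2 l.1.2.1
  inj p hp h := by
    have h0 := (k 0).2.2
    have h1 := (k 1).2.2
    have h2 := (k 2).2.2
    refine eq_zero_of_transvect (by decide) _ (euler_of_mem hp 1) (euler_of_mem hp 2) fun l₂ => ?_
    by_cases hl₂ : (k 1).1 - 2 + ((k 2).1 - 2) < 2 * l₂
    · exact transvect_eq_zero (by decide) (euler_of_mem hp 1) (euler_of_mem hp 2) hl₂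
    obtain ⟨e1, e2, e3⟩ := euler_transvect (a := 1) (b := 2) (by decide) (euler_of_mem hp 1)
      (euler_of_mem hp 2) l₂
    have e0 := e3 0 (by decide) (by decide) _ (euler_of_mem hp 0)
    have hc : ((((k 1).1 - 2 : ℕ) : ℂ) + (((k 2).1 - 2 : ℕ) : ℂ) - 2 * l₂)
        = (((k 1).1 - 2 + ((k 2).1 - 2) - 2 * l₂ : ℕ) : ℂ) := by
      rw [Nat.cast_sub (not_lt.1 hl₂)]; push_cast; ring
    rw [hc] at e1
    refine eq_zero_of_transvect (by decide) _ e0 e1 fun l₁ => ?_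
    by_cases hl : 2 * l₁ + 2 * l₂ + 6 ≤ (k 0).1 + (k 1).1 + (k 2).1
    · rw [← transvectL_apply, ← transvectL_apply]
      exact h ⟨⟨⟨l₁, by omega⟩, ⟨l₂, by omega⟩⟩, hl⟩
    · exact transvect_eq_zero (by decide) e0 e1 (by omega)
  proj_act l g hg p := by simp only [LinearMap.comp_apply, transvectL_apply, transvect_act hg]
  proj_conj l p := by simp only [LinearMap.comp_apply, transvectL_apply, transvect_conjPoly]
  binary l p hp := by
    have h0 := (k 0).2.2
    have h1 := (k 1).2.2
    have h2 := (k 2).2.2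
    have hl := l.2
    obtain ⟨e1, e2, e3⟩ := euler_transvect (a := 1) (b := 2) (by decide) (euler_of_mem hp 1)
      (euler_of_mem hp 2) l.1.2.1
    have e0 := e3 0 (by decide) (by decide) _ (euler_of_mem hp 0)
    obtain ⟨f0, f1, f2⟩ := euler_transvect (a := 0) (b := 1) (by decide) e0 e1 l.1.1.1
    have f2' := f2 2 (by decide) (by decide) 0 (by rw [e2, zero_smul])
    rw [zero_smul] at f2'
    rw [LinearMap.comp_apply, transvectL_apply, transvectL_apply]
    refine ⟨?_, fun i hi => ?_⟩
    · rw [f0]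
      congr 1
      have : (k 0).1 - 2 + ((k 1).1 - 2) + ((k 2).1 - 2)
          = ((k 0).1 + (k 1).1 + (k 2).1 - 6 - 2 * l.1.1.1 - 2 * l.1.2.1)
            + 2 * l.1.1.1 + 2 * l.1.2.1 := by omega
      have h2 := congrArg (Nat.cast : ℕ → ℂ) this
      simp only [Nat.cast_add, Nat.cast_mul, Nat.cast_ofNat] at h2
      linear_combination h2
    · fin_cases i
      · exact absurd rfl hi
      · exact f1
      · exact f2'

end Projections

/-! ### Uniqueness of completions -/

section Uniqueness

open MvPolynomial

variable {n : ℕ}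

/-- A finite combination of fixed polynomials whose coefficients are holomorphic and, up to an
exponentially small error, polynomial at the cusp. -/
def TameForm (f : ℍ → BPoly n) : Prop :=
  ∃ (J : Type) (_ : Fintype J) (a : J → ℍ → ℂ) (p : J → BPoly n),
    (∀ j, Hol (a j) ∧ ∃ P, Tame (a j) P) ∧ ∀ τ, f τ = ∑ j, a j τ • p j

/-- The integral of a polynomial-valued form, in a version compatible with all linear forms. -/
lemma TameForm.exists_integral {f : ℍ → BPoly n} (hf : TameForm f) :
    ∃ F : ℍ → BPoly n, ∀ L : BPoly n →ₗ[ℂ] ℂ,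
      IsRegPrimitive (fun τ => L (f τ)) (fun _ => 0) (fun τ => L (F τ)) := by
  obtain ⟨J, _, a, p, ha, hfp⟩ := hf
  refine ⟨fun τ => ∑ j, regInt (a j) (fun _ => 0) τ • p j, fun L => ?_⟩
  refine (IsRegPrimitive.sum Finset.univ fun j _ =>
    ((ha j).2.choose_spec.regInt (ha j).1).1.const_mul (L (p j))).congr ?_ ?_ ?_ <;> intro τ
  · rw [map_sum]
    exact Finset.sum_congr rfl fun j _ => by rw [map_smul, smul_eq_mul, mul_comm]
  · rw [hfp, map_sum]
    exact Finset.sum_congr rfl fun j _ => by rw [map_smul, smul_eq_mul, mul_comm]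
  · simp

lemma TameForm.exists_conj_integral {f : ℍ → BPoly n} (hf : TameForm f) :
    ∃ F : ℍ → BPoly n, ∀ L : BPoly n →ₗ[ℂ] ℂ,
      IsRegPrimitive (fun _ => 0) (fun τ => L (conjPoly (f τ))) (fun τ => L (F τ)) := by
  obtain ⟨J, _, a, p, ha, hfp⟩ := hf
  refine ⟨fun τ => ∑ j, conj (regInt (a j) (fun _ => 0) τ) • conjPoly (p j), fun L => ?_⟩
  refine (IsRegPrimitive.sum Finset.univ fun j _ =>
    ((ha j).2.choose_spec.regInt (ha j).1).1.conj.const_mul (L (conjPoly (p j)))).congr ?_ ?_ ?_ <;>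
    intro τ
  · rw [map_sum]
    exact Finset.sum_congr rfl fun j _ => by rw [map_smul, smul_eq_mul, mul_comm]
  · simp
  · rw [hfp, map_sum, map_sum]
    exact Finset.sum_congr rfl fun j _ => by
      rw [conjPoly_smul, map_smul, smul_eq_mul, mul_comm]

lemma conjPoly_mem {k : Fin n → EisWt} {p : BPoly n} (hp : p ∈ homSub k) : conjPoly p ∈ homSub k :=
  fun m hm => hp m (support_map_subset _ _ hm)

variable [NeZero n] {k : Fin n → EisWt}

/-- The shape of a completion in terms of a family of projections. -/
structure Completion.IsTypeF (C : Completion n) (F : ProjFamily k) : Prop where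
  hom_c : C.c ∈ homSub k
  hom_f : ∀ τ, C.f τ ∈ homSub k
  hom_g : ∀ τ, C.g τ ∈ homSub k
  cusp_f : ∀ i, ∃ φ : CuspForm 𝒮ℒ ((F.wt i + 2 : ℕ) : ℤ), ∀ τ,
    F.proj i (C.f τ) = φ τ • highest (F.wt i) τ
  modular_g : ∀ i, ∃ φ : ModularForm 𝒮ℒ ((F.wt i + 2 : ℕ) : ℤ), ∀ τ,
    F.proj i (C.g τ) = φ τ • highest (F.wt i) τ

lemma isType2_iff {C : Completion 2} {k₁ k₂ : EisWt} :
    C.IsType2 k₁ k₂ ↔ C.IsTypeF (projTwo ![k₁, k₂]) := by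
  have h0 := k₁.2.2
  have h1 := k₂.2.2
  constructor
  · intro h
    refine ⟨h.hom_c, h.hom_f, h.hom_g, fun l => ?_, fun l => ?_⟩
    · have hl := l.2
      obtain ⟨φ, hφ⟩ := h.cusp_f l.1.1 ((projTwo ![k₁, k₂]).wt l) (by
        simp [projTwo] at hl ⊢; omega)
      exact ⟨φ, fun τ => by rw [smul_eq_C_mul, ← hφ]; exact transvectL_apply _ _ _ _⟩
    · have hl := l.2
      obtain ⟨φ, hφ⟩ := h.modular_g l.1.1 ((projTwo ![k₁, k₂]).wt l) (by
        simp [projTwo] at hl ⊢; omega)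
      exact ⟨φ, fun τ => by rw [smul_eq_C_mul, ← hφ]; exact transvectL_apply _ _ _ _⟩
  · intro h
    refine ⟨h.hom_c, h.hom_f, h.hom_g, fun l m hm => ?_, fun l m hm => ?_⟩
    · have := h.cusp_f ⟨⟨l, by simp; omega⟩, by simp; omega⟩
      have hw : (projTwo ![k₁, k₂]).wt ⟨⟨l, by simp; omega⟩, by simp; omega⟩ = m := by
        simp [projTwo]; omega
      rw [hw] at this
      obtain ⟨φ, hφ⟩ := this
      exact ⟨φ, fun τ => by rw [← smul_eq_C_mul, ← hφ]; exact (transvectL_apply _ _ _ _).symm⟩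
    · have := h.modular_g ⟨⟨l, by simp; omega⟩, by simp; omega⟩
      have hw : (projTwo ![k₁, k₂]).wt ⟨⟨l, by simp; omega⟩, by simp; omega⟩ = m := by
        simp [projTwo]; omega
      rw [hw] at this
      obtain ⟨φ, hφ⟩ := this
      exact ⟨φ, fun τ => by rw [← smul_eq_C_mul, ← hφ]; exact (transvectL_apply _ _ _ _).symm⟩

lemma projThree_apply {k : Fin 3 → EisWt} (l : (projThree k).idx) (p : BPoly 3) :
    (projThree k).proj l p = delta3 l.1.1.1 l.1.2.1 p := by
  change (transvectL 0 1 l.1.1.1 ∘ₗ transvectL 1 2 l.1.2.1) p = _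
  rw [LinearMap.comp_apply, transvectL_apply, transvectL_apply]; rfl

lemma isType3_iff {C : Completion 3} {k : Fin 3 → EisWt} :
    C.IsType3 k ↔ C.IsTypeF (projThree k) := by
  have h0 := (k 0).2.2
  have h1 := (k 1).2.2
  have h2 := (k 2).2.2
  constructor
  · intro h
    refine ⟨h.hom_c, h.hom_f, h.hom_g, fun l => ?_, fun l => ?_⟩
    · have hl := l.2
      obtain ⟨φ, hφ⟩ := h.cusp_f l.1.1.1 l.1.2.1 ((projThree k).wt l) (by
        simp [projThree]; omega)
      exact ⟨φ, fun τ => by rw [smul_eq_C_mul, ← hφ, projThree_apply]⟩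
    · have hl := l.2
      obtain ⟨φ, hφ⟩ := h.modular_g l.1.1.1 l.1.2.1 ((projThree k).wt l) (by
        simp [projThree]; omega)
      exact ⟨φ, fun τ => by rw [smul_eq_C_mul, ← hφ, projThree_apply]⟩
  · intro h
    refine ⟨h.hom_c, h.hom_f, h.hom_g, fun l₁ l₂ m hm => ?_, fun l₁ l₂ m hm => ?_⟩
    · have := h.cusp_f ⟨⟨⟨l₁, by omega⟩, ⟨l₂, by omega⟩⟩, by simp; omega⟩
      have hw : (projThree k).wt ⟨⟨⟨l₁, by omega⟩, ⟨l₂, by omega⟩⟩, by simp; omega⟩ = m := by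
        simp [projThree]; omega
      rw [hw] at this
      obtain ⟨φ, hφ⟩ := this
      exact ⟨φ, fun τ => by rw [← smul_eq_C_mul, ← hφ]; exact (projThree_apply (k := k)
        ⟨⟨⟨l₁, by omega⟩, ⟨l₂, by omega⟩⟩, by simp; omega⟩ _).symm⟩
    · have := h.modular_g ⟨⟨⟨l₁, by omega⟩, ⟨l₂, by omega⟩⟩, by simp; omega⟩
      have hw : (projThree k).wt ⟨⟨⟨l₁, by omega⟩, ⟨l₂, by omega⟩⟩, by simp; omega⟩ = m := by
        simp [projThree]; omega
      rw [hw] at this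
      obtain ⟨φ, hφ⟩ := this
      exact ⟨φ, fun τ => by rw [← smul_eq_C_mul, ← hφ]; exact (projThree_apply (k := k)
        ⟨⟨⟨l₁, by omega⟩, ⟨l₂, by omega⟩⟩, by simp; omega⟩ _).symm⟩

/-- A form is recovered from its projections by a left inverse of the injective linear map given by
the family, so that its coefficients are combinations of modular forms times powers of `τ`. -/
lemma tameForm_of_proj (F : ProjFamily k) {f : ℍ → BPoly n} (hf : ∀ τ, f τ ∈ homSub k)
    {φ : F.idx → ℍ → ℂ} (hφ : ∀ i, Hol (φ i) ∧ ∃ P, Tame (φ i) P)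
    (h : ∀ i τ, F.proj i (f τ) = φ i τ • highest (F.wt i) τ) : TameForm f := by
  classical
  set δ : homSub k →ₗ[ℂ] (F.idx → BPoly n) :=
    LinearMap.pi fun i => F.proj i ∘ₗ (homSub k).subtype with hδ
  have hinj : Function.Injective δ := by
    rw [injective_iff_map_eq_zero]
    intro p hp
    exact Subtype.ext (F.inj p.1 p.2 fun i => congrFun hp i)
  obtain ⟨L, hL⟩ := LinearMap.exists_leftInverse_of_injective δ (LinearMap.ker_eq_bot.2 hinj)
  refine ⟨(i : F.idx) × Fin (F.wt i + 1), inferInstance,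
    fun j τ => φ j.1 τ * (((F.wt j.1).choose j.2.1 : ℂ) * (-(τ : ℂ)) ^ j.2.1),
    fun j => (L (Pi.single j.1 (bin (F.wt j.1) j.2.1)) : BPoly n), fun j => ⟨?_, ?_⟩, fun τ => ?_⟩
  · refine (hφ j.1).1.mul (Hol.const_mul _ ?_)
    have : (fun τ : ℍ => (-(τ : ℂ)) ^ j.2.1) = fun τ : ℍ => (-1) ^ j.2.1 * (τ : ℂ) ^ j.2.1 := by
      funext τ; rw [← mul_pow, neg_one_mul]
    rw [this]
    exact Hol.const_mul _ (hol_pow _)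
  · obtain ⟨P, hP⟩ := (hφ j.1).2
    have : (fun τ : ℍ => ((F.wt j.1).choose j.2.1 : ℂ) * (-(τ : ℂ)) ^ j.2.1)
        = fun τ : ℍ => (((F.wt j.1).choose j.2.1 : ℂ) * (-1) ^ j.2.1) * (τ : ℂ) ^ j.2.1 := by
      funext τ; rw [mul_assoc, ← mul_pow, neg_one_mul]
    exact ⟨_, hP.mul (by rw [this]; exact (tame_pow _).const_mul _)⟩
  · have h1 : (f τ : BPoly n) = L (δ ⟨f τ, hf τ⟩) := by
      have := DFunLike.congr_fun hL ⟨f τ, hf τ⟩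
      rw [LinearMap.comp_apply] at this
      rw [this]; rfl
    have h2 : δ ⟨f τ, hf τ⟩ = ∑ j : (i : F.idx) × Fin (F.wt i + 1),
        (φ j.1 τ * (((F.wt j.1).choose j.2.1 : ℂ) * (-(τ : ℂ)) ^ j.2.1)) •
          (Pi.single j.1 (bin (F.wt j.1) j.2.1) : F.idx → BPoly n) := by
      funext i
      rw [Fintype.sum_sigma, Finset.sum_apply, Finset.sum_eq_single i]
      · rw [Finset.sum_apply]
        simp only [Pi.smul_apply, Pi.single_eq_same]
        change F.proj i (f τ) = _
        rw [h, highest_eq, Finset.smul_sum, ← Fin.sum_univ_eq_sum_range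
          (fun r => φ i τ • (((F.wt i).choose r : ℂ) * (-(τ : ℂ)) ^ r) • bin (F.wt i) r)]
        exact Finset.sum_congr rfl fun r _ => by rw [smul_smul]
      · intro i' _ hi
        rw [Finset.sum_apply]
        exact Finset.sum_eq_zero fun r _ => by
          rw [Pi.smul_apply, Pi.single_eq_of_ne hi.symm, smul_zero]
      · simp
    rw [h1, h2, map_sum]
    push_cast
    exact Finset.sum_congr rfl fun j _ => by rw [map_smul]; rfl

lemma Completion.IsTypeF.tameForm_f {F : ProjFamily k} {C : Completion n} (h : C.IsTypeF F) :
    TameForm C.f := by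
  choose φ hφ using h.cusp_f
  exact tameForm_of_proj F h.hom_f (φ := fun i τ => φ i τ)
    (fun i => ⟨hol_of_modularFormClass (φ i), _, tame_of_cuspForm (φ i)⟩) hφ

lemma Completion.IsTypeF.tameForm_g {F : ProjFamily k} {C : Completion n} (h : C.IsTypeF F) :
    TameForm C.g := by
  choose φ hφ using h.modular_g
  exact tameForm_of_proj F h.hom_g (φ := fun i τ => φ i τ)
    (fun i => ⟨hol_of_modularFormClass (φ i), _, tame_of_modularFormClass (φ i)⟩) hφ

lemma weight_two_eq_zero (φ : ModularForm 𝒮ℒ 2) : φ = 0 :=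
  rank_zero_iff_forall_zero.1 ModularForm.levelOne_weight_two_rank_zero φ

lemma binCoeff_conj (m r : ℕ) (p : BPoly n) :
    binCoeff m r (conjPoly p) = conj (binCoeff m r p) := by
  rw [binCoeff, lcoeff_apply, lcoeff_apply, conjPoly, coeff_map]

/-- The corrections of two completions differ by an equivariant function only if the completions
agree, up to the invariant part of the constants. -/
theorem Completion.IsTypeF.eq_of_isEquivariant {F : ProjFamily k} {C C' : Completion n}
    (h : C.IsTypeF F) (h' : C'.IsTypeF F)
    (hE : IsEquivariant fun v τ => C.corr v τ - C'.corr v τ)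
    (h0 : ∀ i, F.wt i = 0 → F.proj i C.c = F.proj i C'.c) : C = C' := by
  obtain ⟨I, hI⟩ := h.tameForm_f.exists_integral
  obtain ⟨I', hI'⟩ := h'.tameForm_f.exists_integral
  obtain ⟨J, hJ⟩ := h.tameForm_g.exists_conj_integral
  obtain ⟨J', hJ'⟩ := h'.tameForm_g.exists_conj_integral
  set N : ℍ → BPoly n := fun τ => (C.c - C'.c) + (1 / 2 : ℂ) • ((I τ - I' τ) + (J τ - J' τ))
    with hN
  have hcorr : ∀ v τ, C.corr v τ - C'.corr v τ = -(N τ).at v := by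
    intro v τ
    have e1 := (hI (evalAt fun i => ((v i.1 i.2 : ℝ) : ℂ))).regInt_eq
    have e2 := (hI' (evalAt fun i => ((v i.1 i.2 : ℝ) : ℂ))).regInt_eq
    have e3 := (hJ (evalAt fun i => ((v i.1 i.2 : ℝ) : ℂ))).regInt_eq
    have e4 := (hJ' (evalAt fun i => ((v i.1 i.2 : ℝ) : ℂ))).regInt_eq
    simp only [Completion.corr, conj_at]
    simp only [at_eq_evalAt, hN, map_add, map_sub, map_smul, smul_eq_mul]
    change _ - 1 / 2 * (regInt _ (fun _ => 0) τ + regInt (fun _ => 0) _ τ)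
      - (_ - 1 / 2 * (regInt _ (fun _ => 0) τ + regInt (fun _ => 0) _ τ)) = _
    rw [e1, e2, e3, e4]
    ring
  have hequiv : ∀ γ τ, act (toMat γ) (N (γ • τ)) = N τ := by
    intro γ τ
    refine eq_of_at fun v => ?_
    have := hE γ v τ
    simp only [hcorr] at this
    rw [← at_actXY]
    exact neg_injective this
  have key : ∀ i, F.proj i C.c = F.proj i C'.c ∧ (∀ τ, F.proj i (C.f τ) = F.proj i (C'.f τ)) ∧
      ∀ τ, F.proj i (C.g τ) = F.proj i (C'.g τ) := by
    intro i
    have hφ := h.cusp_f i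
    have hφ' := h'.cusp_f i
    have hψ := h.modular_g i
    have hψ' := h'.modular_g i
    have hbin := F.binary i
    have heven := F.even_wt i
    have h0i := h0 i
    generalize F.wt i = m at hφ hφ' hψ hψ' hbin heven h0i
    obtain ⟨φ, hφ⟩ := hφ
    obtain ⟨φ', hφ'⟩ := hφ'
    obtain ⟨ψ, hψ⟩ := hψ
    obtain ⟨ψ', hψ'⟩ := hψ'
    suffices hfin : (∀ τ, (φ - φ') τ = 0) ∧ (∀ τ, (ψ - ψ') τ = 0) ∧
        ∀ r ≤ m, binCoeff m r (F.proj i (C.c - C'.c)) = 0 by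
      obtain ⟨k1, k2, k3⟩ := hfin
      refine ⟨?_, fun τ => ?_, fun τ => ?_⟩
      · rw [← sub_eq_zero, ← map_sub, (hbin _ (sub_mem h.hom_c h'.hom_c)).eq_sum]
        exact Finset.sum_eq_zero fun r hr => by
          rw [k3 r (Nat.lt_succ_iff.1 (Finset.mem_range.1 hr)), zero_smul]
      · rw [hφ, hφ', sub_eq_zero.1 (show φ τ - φ' τ = 0 from k1 τ)]
      · rw [hψ, hψ', sub_eq_zero.1 (show ψ τ - ψ' τ = 0 from k2 τ)]
    obtain ⟨s, hs⟩ := heven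
    rw [← two_mul] at hs
    subst hs
    -- In degree zero there are no modular forms of weight two, and the constants agree by assumption.
    rcases Nat.eq_zero_or_pos s with rfl | hs
    · refine ⟨fun τ => ?_, fun τ => ?_, fun r hr => ?_⟩
      · have := weight_two_eq_zero (ModularFormClass.modularForm (φ - φ'))
        exact DFunLike.congr_fun this τ
      · have := weight_two_eq_zero (ψ - ψ')
        exact DFunLike.congr_fun this τ
      · rw [map_sub, h0i rfl, sub_self, map_zero]
    · set lam : ℕ → BPoly n →ₗ[ℂ] ℂ := fun r => binCoeff (2 * s) r ∘ₗ F.proj i with hlam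
      have hhigh : ∀ (a : ℂ) (τ : ℍ) (r : ℕ),
          binCoeff (2 * s) r (a • (highest (2 * s) τ : BPoly n))
            = a * ((2 * s).choose r * (-(τ : ℂ)) ^ r) := by
        intro a τ r
        rw [highest_eq, map_smul, map_sum, smul_eq_mul]
        simp only [map_smul, binCoeff_bin, smul_eq_mul, mul_ite, mul_one, mul_zero,
          Finset.sum_ite_eq]
        split_ifs with hr
        · rfl
        · rw [Nat.choose_eq_zero_of_lt (by simpa using hr)]; simp
      -- A linear form vanishing on the homogeneous polynomials vanishes on the integrals.
      have hbinary : ∀ τ, F.proj i (N τ) = ∑ r ∈ Finset.range (2 * s + 1),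
          lam r (N τ) • bin (2 * s) r := by
        intro τ
        ext u
        set L : BPoly n →ₗ[ℂ] ℂ := lcoeff ℂ u ∘ₗ F.proj i
          - ∑ r ∈ Finset.range (2 * s + 1), (coeff u (bin (2 * s) r)) • lam r with hL
        have hLa : ∀ p, L p = coeff u (F.proj i p) - ∑ r ∈ Finset.range (2 * s + 1),
            (coeff u (bin (2 * s) r)) * lam r p := by
          intro p
          simp [hL, LinearMap.sum_apply]
        have hL0 : ∀ p ∈ homSub k, L p = 0 := by
          intro p hp
          rw [hLa, sub_eq_zero]
          conv_lhs => rw [(hbin p hp).eq_sum]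
          rw [coeff_sum]
          exact Finset.sum_congr rfl fun r _ => by
            rw [coeff_smul, smul_eq_mul, mul_comm]; rfl
        have hz : ∀ {K a b : ℍ → ℂ}, IsRegPrimitive a b K → (∀ τ, a τ = 0) → (∀ τ, b τ = 0) →
            K τ = 0 := fun hK ha hb => by
          have := (hK.congr (fun _ => rfl) (fun τ => (ha τ).symm)
            (fun τ => (hb τ).symm)).unique IsRegPrimitive.zero
          exact congrFun this τ
        have e0 : L (N τ) = 0 := by
          simp only [hN, map_add, map_sub, map_smul]
          rw [hL0 _ h.hom_c, hL0 _ h'.hom_c,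
            hz (hI L) (fun _ => hL0 _ (h.hom_f _)) fun _ => rfl,
            hz (hI' L) (fun _ => hL0 _ (h'.hom_f _)) fun _ => rfl,
            hz (hJ L) (fun _ => rfl) fun _ => hL0 _ (conjPoly_mem (h.hom_g _)),
            hz (hJ' L) (fun _ => rfl) fun _ => hL0 _ (conjPoly_mem (h'.hom_g _))]
          simp
        rw [hLa, sub_eq_zero] at e0
        rw [e0, coeff_sum]
        exact Finset.sum_congr rfl fun r _ => by rw [coeff_smul, smul_eq_mul, mul_comm]
      refine eichlerShimura_injective hs (φ - φ') (ψ - ψ')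
        (c := fun r => lam r (C.c - C'.c)) (b := fun r τ => lam r (N τ)) ?_ ?_
      · intro r τ
        have e1 := ((hI (lam r)).add ((hI' (lam r)).const_mul (-1))).congr (fun _ => rfl)
          (a' := fun t => (φ - φ') t * ((2 * s).choose r * (-(t : ℂ)) ^ r)) (b' := fun _ => 0)
          (fun t => by
            change _ = binCoeff (2 * s) r (F.proj i _) + -1 * binCoeff (2 * s) r (F.proj i _)
            rw [hφ, hφ', hhigh, hhigh]
            change (φ t - φ' t) * _ = _
            ring) (fun _ => by simp)
        have e2 := ((hJ (lam r)).add ((hJ' (lam r)).const_mul (-1))).congr (fun _ => rfl)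
          (a' := fun _ => 0)
          (b' := fun t => conj ((ψ - ψ') t * ((2 * s).choose r * (-(t : ℂ)) ^ r)))
          (fun _ => by simp)
          (fun t => by
            change _ = binCoeff (2 * s) r (F.proj i _) + -1 * binCoeff (2 * s) r (F.proj i _)
            rw [F.proj_conj, F.proj_conj, binCoeff_conj, binCoeff_conj, hψ, hψ', hhigh, hhigh]
            change conj ((ψ t - ψ' t) * _) = _
            simp only [map_mul, map_sub]
            ring)
        have e3 := congrFun e1.regInt_eq τ
        have e4 := congrFun e2.regInt_eq τ
        change _ = _ + 1 / 2 * (regInt _ (fun _ => 0) τ + regInt (fun _ => 0) _ τ)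
        rw [e3, e4]
        simp only [hN, map_add, map_sub, map_smul, smul_eq_mul]
        ring
      · intro γ τ x y
        have e1 := congrArg (F.proj i) (hequiv γ τ)
        rw [F.proj_act i _ (toMat_det γ), hbinary, hbinary] at e1
        have e2 := congrArg (eval fun j : Fin n × Fin 2 => ![x, y] j.2) e1
        rw [eval_act, map_sum, map_sum] at e2
        simpa [smul_eval, eval_bin, toMat_apply] using e2
  have hc : C.c = C'.c := sub_eq_zero.1 (F.inj _ (sub_mem h.hom_c h'.hom_c) fun i => by
    rw [map_sub, (key i).1, sub_self])
  have hf : C.f = C'.f := funext fun τ => sub_eq_zero.1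
    (F.inj _ (sub_mem (h.hom_f τ) (h'.hom_f τ)) fun i => by
      rw [map_sub, (key i).2.1 τ, sub_self])
  have hg : C.g = C'.g := funext fun τ => sub_eq_zero.1
    (F.inj _ (sub_mem (h.hom_g τ) (h'.hom_g τ)) fun i => by
      rw [map_sub, (key i).2.2 τ, sub_self])
  cases C; cases C'
  simp_all

end Uniqueness

/-! ### Finitely many normalised eigenforms -/

section Eigenforms

/-- The Fourier coefficients of a modular form as a linear map. -/
def coeffL (k : ℤ) : ModularForm 𝒮ℒ k →ₗ[ℂ] (ℕ → ℂ) where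
  toFun f n := (UpperHalfPlane.qExpansion 1 f).coeff n
  map_add' f g := by
    funext n
    have := ModularForm.qExpansion_add one_pos one_mem_strictPeriods_SL f g
    change (UpperHalfPlane.qExpansion 1 (⇑f + ⇑g)).coeff n = _
    rw [this, map_add]; rfl
  map_smul' c f := by
    funext n
    have := ModularForm.qExpansion_smul one_pos one_mem_strictPeriods_SL c f
    change (UpperHalfPlane.qExpansion 1 (c • ⇑f)).coeff n = _
    rw [this, PowerSeries.coeff_smul]; rfl

lemma Eigenform.fourierCoeff_zero (Δ : Eigenform) : fourierCoeff Δ.form 0 = 0 :=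
  CuspFormClass.qExpansion_coeff_zero Δ.form one_pos one_mem_strictPeriods_SL

lemma Eigenform.eq_of_fourierCoeff {Δ Δ' : Eigenform} (hw : Δ.wt = Δ'.wt)
    (h : ∀ n, fourierCoeff Δ.form n = fourierCoeff Δ'.form n) : Δ = Δ' := by
  obtain ⟨k, f, _, _⟩ := Δ
  obtain ⟨k', g, _, _⟩ := Δ'
  obtain rfl : k = k' := hw
  suffices hfg : f = g by subst hfg; rfl
  have h1 : ModularFormClass.modularForm (f - g) = (0 : ModularForm 𝒮ℒ (k : ℤ)) := by
    rw [← ModularForm.qExpansion_eq_zero_iff one_pos one_mem_strictPeriods_SL]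
    have := ModularForm.qExpansion_sub one_pos one_mem_strictPeriods_SL f g
    change UpperHalfPlane.qExpansion 1 (⇑f - ⇑g) = 0
    rw [this, sub_eq_zero]
    exact PowerSeries.ext h
  refine DFunLike.ext _ _ fun τ => sub_eq_zero.1 ?_
  exact DFunLike.congr_fun h1 τ

/-- Hecke multiplicativity, in terms of Fourier coefficients. -/
lemma Eigenform.hecke (Δ : Eigenform) {m n : ℕ} (hm : 1 ≤ m) (hn : 1 ≤ n) :
    ∑ d ∈ (Nat.gcd m n).divisors, (d : ℂ) ^ (Δ.wt - 1) * fourierCoeff Δ.form (m * n / d ^ 2)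
      = fourierCoeff Δ.form n * fourierCoeff Δ.form m := by
  obtain ⟨ev, hev⟩ := Δ.eigen n hn
  have h1 := hev 1 le_rfl
  simp only [Nat.gcd_one_left, Nat.divisors_one, Finset.sum_singleton, Nat.cast_one, one_pow,
    one_mul, Nat.div_one, Δ.normalised, mul_one] at h1
  rw [hev m hm, h1]

/-- Distinct normalised eigenforms of the same weight have different eigenvalues, so that their
sequences of Fourier coefficients are linearly independent. -/
lemma eigenform_independent {K : ℕ} (s : Finset Eigenform) (hs : ∀ Δ ∈ s, Δ.wt = K)
    (c : Eigenform → ℂ) (h : ∀ m, 1 ≤ m → ∑ Δ ∈ s, c Δ * fourierCoeff Δ.form m = 0) :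
    ∀ Δ ∈ s, c Δ = 0 := by
  classical
  induction s using Finset.induction_on generalizing c with
  | empty => simp
  | insert Δ₀ s h0 ih =>
    have hK : ∀ Δ ∈ s, Δ.wt = K := fun Δ hΔ => hs Δ (Finset.mem_insert_of_mem hΔ)
    -- By the Hecke relations, multiplying each `c Δ` by the `n`-th coefficient of `Δ` gives another
    -- linear relation; subtracting the `n`-th coefficient of `Δ₀` times the given one removes `Δ₀`.
    have h1 : ∀ n, 1 ≤ n → ∀ Δ ∈ s,
        c Δ * (fourierCoeff Δ.form n - fourierCoeff Δ₀.form n) = 0 := by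
      intro n hn
      refine ih hK (fun Δ => c Δ * (fourierCoeff Δ.form n - fourierCoeff Δ₀.form n)) ?_
      intro m hm
      have e1 : ∑ Δ ∈ insert Δ₀ s, c Δ * (fourierCoeff Δ.form n * fourierCoeff Δ.form m) = 0 := by
        have : ∀ Δ ∈ insert Δ₀ s, c Δ * (fourierCoeff Δ.form n * fourierCoeff Δ.form m)
            = ∑ d ∈ (Nat.gcd m n).divisors,
              (d : ℂ) ^ (K - 1) * (c Δ * fourierCoeff Δ.form (m * n / d ^ 2)) := by
          intro Δ hΔ
          rw [← Δ.hecke hm hn, ← hs Δ hΔ, Finset.mul_sum]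
          exact Finset.sum_congr rfl fun d _ => by ring
        rw [Finset.sum_congr rfl this, Finset.sum_comm]
        refine Finset.sum_eq_zero fun d hd => ?_
        rw [← Finset.mul_sum, h, mul_zero]
        have hd1 := (Nat.dvd_of_mem_divisors hd).trans (Nat.gcd_dvd_left m n)
        have hd2 := (Nat.dvd_of_mem_divisors hd).trans (Nat.gcd_dvd_right m n)
        have hd0 := Nat.pos_of_mem_divisors hd
        refine Nat.div_pos ?_ (by positivity)
        rw [pow_two]
        exact Nat.mul_le_mul (Nat.le_of_dvd hm hd1) (Nat.le_of_dvd hn hd2)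
      have e2 := h m hm
      rw [Finset.sum_insert h0] at e1 e2
      have e3 : ∑ Δ ∈ s, c Δ * (fourierCoeff Δ.form n - fourierCoeff Δ₀.form n)
          * fourierCoeff Δ.form m = (∑ Δ ∈ s, c Δ * (fourierCoeff Δ.form n * fourierCoeff Δ.form m))
          - fourierCoeff Δ₀.form n * ∑ Δ ∈ s, c Δ * fourierCoeff Δ.form m := by
        rw [Finset.mul_sum, ← Finset.sum_sub_distrib]
        exact Finset.sum_congr rfl fun Δ _ => by ring
      rw [e3]
      linear_combination e1 - fourierCoeff Δ₀.form n * e2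
    have h2 : ∀ Δ ∈ s, c Δ = 0 := by
      intro Δ hΔ
      by_contra hc
      have hne : Δ = Δ₀ := by
        refine Eigenform.eq_of_fourierCoeff ((hK Δ hΔ).trans
          (hs Δ₀ (Finset.mem_insert_self _ _)).symm) fun n => ?_
        rcases Nat.eq_zero_or_pos n with rfl | hn
        · rw [Δ.fourierCoeff_zero, Δ₀.fourierCoeff_zero]
        · exact sub_eq_zero.1 ((mul_eq_zero.1 (h1 n hn Δ hΔ)).resolve_left hc)
      exact h0 (hne ▸ hΔ)
    intro Δ hΔ
    rcases Finset.mem_insert.1 hΔ with rfl | hΔ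
    · have := h 1 le_rfl
      rw [Finset.sum_insert h0, Finset.sum_eq_zero (fun Δ' hΔ' => by rw [h2 Δ' hΔ', zero_mul]),
        Δ.normalised] at this
      simpa using this
    · exact h2 Δ hΔ

/-- Normalised eigenforms are linearly independent in a finite-dimensional space of modular
forms. -/
lemma finite_eigenforms_of_wt (K : ℕ) : {Δ : Eigenform | Δ.wt = K}.Finite := by
  set V := LinearMap.range (coeffL (K : ℤ))
  have hmem : ∀ Δ : {Δ : Eigenform | Δ.wt = K}, fourierCoeff Δ.1.form ∈ V := by
    rintro ⟨Δ, rfl⟩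
    exact ⟨ModularFormClass.modularForm Δ.form, rfl⟩
  have hli : LinearIndependent ℂ
      (fun Δ : {Δ : Eigenform | Δ.wt = K} => (⟨fourierCoeff Δ.1.form, hmem Δ⟩ : V)) := by
    classical
    rw [linearIndependent_iff']
    intro s c hc Δ hΔ
    have hc' : ∀ m, ∑ Δ ∈ s, c Δ * fourierCoeff Δ.1.form m = 0 := by
      intro m
      have := congrFun (congrArg Subtype.val hc) m
      simpa using this
    have := eigenform_independent (K := K) (s.map (Function.Embedding.subtype _))
      (by
        intro Δ hΔ
        obtain ⟨Δ', _, rfl⟩ := Finset.mem_map.1 hΔ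
        exact Δ'.2)
      (fun Δ => if h : Δ.wt = K then c ⟨Δ, h⟩ else 0) (fun m _ => by
        rw [Finset.sum_map, ← hc' m]
        refine Finset.sum_congr rfl fun Δ' _ => ?_
        have : Δ'.1.wt = K := Δ'.2
        simp [this]) Δ.1 (Finset.mem_map_of_mem _ hΔ)
    have h2 : Δ.1.wt = K := Δ.2
    simpa [h2] using this
  have := hli.finite
  exact Set.toFinite _

lemma finite_eigenforms (B : ℕ) : {Δ : Eigenform | Δ.wt ≤ B}.Finite := by
  refine ((Set.finite_Iic B).biUnion fun K _ => finite_eigenforms_of_wt K).subset ?_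
  intro Δ hΔ
  exact Set.mem_biUnion (Set.mem_Iic.2 hΔ) rfl

end Eigenforms

/-! ### The action of `sl(2)` on series -/

section SL2

variable {R : Type} [CommRing R]

/-- The previous letter `e_k^{(j-1)}`. -/
abbrev Letter.down (a : Letter) : Letter :=
  ⟨a.1, ⟨a.2.1 - 1, lt_of_le_of_lt (Nat.sub_le _ _) a.2.2⟩⟩

lemma adE0_nil (S : Series R) : adE0 S [] = 0 := by rw [adE0]

lemma adE0_cons (S : Series R) (a : Letter) (w : List Letter) :
    adE0 S (a :: w) = (if 0 < a.2.1 then S (a.down :: w) else 0)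
      + adE0 (fun u => S (a :: u)) w := by rw [adE0]

lemma adE0v_nil (S : Series R) : adE0v S [] = 0 := by rw [adE0v]

lemma adE0v_cons (S : Series R) (a : Letter) (w : List Letter) :
    adE0v S (a :: w) = (if h : a.2.1 + 1 < a.1.1 - 1 then
        ((a.2.1 + 1 : ℕ) : R) * ((a.1.1 - 2 - a.2.1 : ℕ) : R) * S (⟨a.1, ⟨a.2.1 + 1, h⟩⟩ :: w)
      else 0) + adE0v (fun u => S (a :: u)) w := by rw [adE0v]

/-- The derivation with `e_x ↦ c(a) e_a` whenever `x = src a`, on coefficients. Both `ad_{e_0}` and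
`ad_{e_0^∨}` are of this form. -/
def der (c : Letter → R) (src : Letter → Letter) : Series R → Series R
  | _, [] => 0
  | S, a :: w => c a * S (src a :: w) + der c src (fun u => S (a :: u)) w

lemma der_nil (c : Letter → R) (src : Letter → Letter) (S : Series R) : der c src S [] = 0 := by
  rw [der]

lemma der_cons (c : Letter → R) (src : Letter → Letter) (S : Series R) (a : Letter)
    (w : List Letter) : der c src S (a :: w)
      = c a * S (src a :: w) + der c src (fun u => S (a :: u)) w := by rw [der]

/-- The next letter `e_k^{(j+1)}`, or the letter itself when there is none. -/
def Letter.up (a : Letter) : Letter :=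
  if h : a.2.1 + 1 < a.1.1 - 1 then ⟨a.1, ⟨a.2.1 + 1, h⟩⟩ else a

/-- The structure constants of `ad_{e_0}`. -/
def coeffUp (R : Type) [CommRing R] (a : Letter) : R := if 0 < a.2.1 then 1 else 0

/-- The structure constants of `ad_{e_0^∨}`. -/
def coeffDown (R : Type) [CommRing R] (a : Letter) : R :=
  if a.2.1 + 1 < a.1.1 - 1 then ((a.2.1 + 1 : ℕ) : R) * ((a.1.1 - 2 - a.2.1 : ℕ) : R) else 0

lemma adE0_eq_der (S : Series R) : adE0 S = der (coeffUp R) Letter.down S := by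
  funext w
  induction w generalizing S with
  | nil => rw [adE0_nil, der_nil]
  | cons a w ih => rw [adE0_cons, der_cons, ih, coeffUp]; split_ifs <;> simp

lemma adE0v_eq_der (S : Series R) : adE0v S = der (coeffDown R) Letter.up S := by
  funext w
  induction w generalizing S with
  | nil => rw [adE0v_nil, der_nil]
  | cons a w ih => rw [adE0v_cons, der_cons, ih, coeffDown, Letter.up]; split_ifs <;> simp

lemma der_add (c : Letter → R) (src : Letter → Letter) (S T : Series R) (w : List Letter) :
    der c src (fun u => S u + T u) w = der c src S w + der c src T w := by
  induction w generalizing S T with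
  | nil => simp [der_nil]
  | cons a w ih => rw [der_cons, der_cons, der_cons, ih]; ring

lemma der_smul (c : Letter → R) (src : Letter → Letter) (r : R) (S : Series R)
    (w : List Letter) : der c src (fun u => r * S u) w = r * der c src S w := by
  induction w generalizing S with
  | nil => simp [der_nil]
  | cons a w ih => rw [der_cons, der_cons, ih]; ring

lemma adE0_add (S T : Series R) (w : List Letter) :
    adE0 (fun u => S u + T u) w = adE0 S w + adE0 T w := by
  simp only [adE0_eq_der, der_add]

lemma adE0_smul (c : R) (S : Series R) (w : List Letter) :
    adE0 (fun u => c * S u) w = c * adE0 S w := by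
  simp only [adE0_eq_der, der_smul]

lemma adE0v_add (S T : Series R) (w : List Letter) :
    adE0v (fun u => S u + T u) w = adE0v S w + adE0v T w := by
  simp only [adE0v_eq_der, der_add]

lemma adE0v_smul (c : R) (S : Series R) (w : List Letter) :
    adE0v (fun u => c * S u) w = c * adE0v S w := by
  simp only [adE0v_eq_der, der_smul]

lemma adE0_zero (w : List Letter) : adE0 (fun _ => (0 : R)) w = 0 := by
  simpa using adE0_smul (0 : R) (fun _ => 0) w

lemma adE0v_zero (w : List Letter) : adE0v (fun _ => (0 : R)) w = 0 := by
  simpa using adE0v_smul (0 : R) (fun _ => 0) w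

/-- The weight `∑ (k_i - 2 - 2 j_i)` of a word under the torus. -/
def torusWt (w : List Letter) : ℤ := (w.map fun a => (a.1.1 : ℤ) - 2 - 2 * a.2.1).sum

/-- The sum of the superscripts of a word. -/
def degSum (w : List Letter) : ℕ := (w.map fun a => a.2.1).sum

lemma adE0v_ite (p : Prop) [Decidable p] (S : Series R) (w : List Letter) :
    adE0v (fun u => if p then S u else 0) w = if p then adE0v S w else 0 := by
  split_ifs
  · rfl
  · exact adE0v_zero w

/-- The commutator of `ad_{e_0^∨}` and `ad_{e_0}` acts on words by the weight under the torus. -/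
lemma commutator_word (S : Series R) (w : List Letter) :
    adE0v (adE0 S) w - adE0 (adE0v S) w = (torusWt w : R) * S w := by
  induction w generalizing S with
  | nil => simp [adE0_nil, adE0v_nil, torusWt]
  | cons a w ih =>
    obtain ⟨k, j, hj⟩ := a
    have hk := k.2.2
    have h1 : (fun u => adE0 S (⟨k, j, hj⟩ :: u)) = fun u =>
        (if 0 < j then S (Letter.down ⟨k, j, hj⟩ :: u) else 0)
          + adE0 (fun u => S (⟨k, j, hj⟩ :: u)) u := funext fun u => adE0_cons _ _ _
    have h2 : (fun u => adE0v S (⟨k, j, hj⟩ :: u)) = fun u =>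
        (if h : j + 1 < k.1 - 1 then
        ((j + 1 : ℕ) : R) * ((k.1 - 2 - j : ℕ) : R) * S (⟨k, ⟨j + 1, h⟩⟩ :: u) else 0)
          + adE0v (fun u => S (⟨k, j, hj⟩ :: u)) u := funext fun u => adE0v_cons _ _ _
    have h3 := ih fun u => S (⟨k, j, hj⟩ :: u)
    have hw : torusWt (⟨k, j, hj⟩ :: w) = ((k.1 : ℤ) - 2 - 2 * j) + torusWt w := by
      simp [torusWt]
    rw [adE0v_cons, adE0_cons, h1, h2, adE0v_add, adE0_add, hw]
    simp only [adE0v_ite]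
    have e1 : (((k.1 : ℤ) - 2 - 2 * j : ℤ) : R)
        = ((j + 1 : ℕ) : R) * ((k.1 - 2 - j : ℕ) : R) - (j : R) * ((k.1 - 1 - j : ℕ) : R) := by
      rw [Nat.cast_sub (show j ≤ k.1 - 2 by omega), Nat.cast_sub (show j ≤ k.1 - 1 by omega),
        Nat.cast_sub (show 2 ≤ k.1 by omega), Nat.cast_sub (show 1 ≤ k.1 by omega)]
      push_cast
      ring
    rw [Int.cast_add, e1]
    have e2 : (if 0 < j then adE0v S (Letter.down ⟨k, j, hj⟩ :: w) else 0)
        = (j : R) * ((k.1 - 1 - j : ℕ) : R) * S (⟨k, j, hj⟩ :: w)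
          + if 0 < j then adE0v (fun u => S (Letter.down ⟨k, j, hj⟩ :: u)) w else 0 := by
      rcases j with _ | j
      · simp
      · rw [if_pos (Nat.succ_pos j), if_pos (Nat.succ_pos j), adE0v_cons]
        simp only [Nat.add_sub_cancel]
        rw [dif_pos hj, show k.1 - 2 - j = k.1 - 1 - (j + 1) by omega]
    rw [e2]
    by_cases h : j + 1 < k.1 - 1
    · simp only [dif_pos h]
      rw [adE0_cons, adE0_smul]
      have e3 : Letter.down ⟨k, ⟨j + 1, h⟩⟩ = ⟨k, ⟨j, hj⟩⟩ := rfl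
      simp only [Nat.succ_pos, if_true, e3]
      linear_combination h3
    · simp only [dif_neg h]
      rw [adE0_zero, show k.1 - 2 - j = 0 by omega]
      push_cast
      linear_combination h3

/-- A sequence of series transforming under `sl(2)` like `e_k^{(0)}, e_k^{(1)}, …` with `k = K`. -/
structure Multiplet (K : ℕ) (E : ℕ → Series R) : Prop where
  up : ∀ j, adE0 (E j) = E (j + 1)
  down : ∀ j w, adE0v (E j) w = (j : R) * ((K : R) - 1 - j) * E (j - 1) w
  top : ∀ j, K - 1 ≤ j → E j = 0

/-- The `j`-th series of a multiplet consists of words of weight `K - 2 - 2j`. -/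
lemma Multiplet.torusWt_mul {K : ℕ} {E : ℕ → Series R} (h : Multiplet K E) (j : ℕ)
    (w : List Letter) : ((torusWt w : R) - ((K : R) - 2 - 2 * j)) * E j w = 0 := by
  have h1 := commutator_word (E j) w
  have h2 : adE0v (E j) = fun w => (j : R) * ((K : R) - 1 - j) * E (j - 1) w :=
    funext fun w => h.down j w
  rw [h.up, h.down, h2, adE0_smul, h.up] at h1
  rcases j with _ | j
  · simp only [Nat.cast_zero, zero_mul, Nat.zero_add, Nat.sub_self] at h1 ⊢
    push_cast at h1 ⊢
    linear_combination -h1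
  · simp only [Nat.add_sub_cancel] at h1 ⊢
    push_cast at h1 ⊢
    linear_combination -h1

/-- `ad_{e_0}` raises the sum of the superscripts by one. -/
lemma adE0_eq_zero_of_degSum {p : ℕ} {S : Series R} (h : ∀ w, degSum w < p → S w = 0)
    (w : List Letter) (hw : degSum w < p + 1) : adE0 S w = 0 := by
  induction w generalizing S p with
  | nil => exact adE0_nil S
  | cons a w ih =>
    rw [adE0_cons]
    have hc : ∀ (b : Letter) u, degSum (b :: u) = b.2.1 + degSum u := fun b u => by simp [degSum]
    rw [hc] at hw
    have h1 : (if 0 < a.2.1 then S (a.down :: w) else 0) = 0 := by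
      split_ifs with h0
      · refine h _ ?_
        rw [hc]
        change a.2.1 - 1 + degSum w < p
        omega
      · rfl
    rw [h1, zero_add]
    exact ih (p := p - a.2.1) (fun u hu => h _ (by rw [hc]; omega)) (by omega)

lemma Multiplet.eq_zero_of_degSum {K : ℕ} {E : ℕ → Series R} (h : Multiplet K E) (j : ℕ) :
    ∀ w, degSum w < j → E j w = 0 := by
  induction j with
  | zero => simp
  | succ j ih =>
    intro w hw
    rw [← h.up]
    exact adE0_eq_zero_of_degSum ih w hw

end SL2

/-! ### Finiteness of the coefficients -/

section Finiteness

variable (D : SeriesData)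

/-- The images under `ψ̂` of the letters of weight `k`, continued by zero. -/
def SeriesData.psiSeq (k : EisWt) (j : ℕ) : Series ℝ :=
  if h : j < k.1 - 1 then D.psi ⟨k, ⟨j, h⟩⟩ else 0

lemma SeriesData.psiSeq_of_lt (k : EisWt) (j : Fin (k.1 - 1)) :
    D.psiSeq k j.1 = D.psi ⟨k, j⟩ := by rw [SeriesData.psiSeq, dif_pos j.2]

lemma SeriesData.psi_multiplet (k : EisWt) : Multiplet k.1 (D.psiSeq k) where
  up j := by
    by_cases h : j < k.1 - 1
    · rw [SeriesData.psiSeq, dif_pos h, D.psi_adE0]; rfl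
    · rw [SeriesData.psiSeq, dif_neg h, SeriesData.psiSeq, dif_neg (by omega)]
      exact funext adE0_zero
  down j w := by
    have hk := k.2.2
    by_cases h : j < k.1 - 1
    · rw [SeriesData.psiSeq, dif_pos h, D.psi_adE0v, SeriesData.psiSeq, dif_pos (by omega)]; rfl
    · rw [SeriesData.psiSeq, dif_neg h]
      have h1 : adE0v (0 : Series ℝ) w = 0 := adE0v_zero w
      rw [h1]
      rcases (not_lt.1 h).eq_or_lt with h2 | h2
      · rw [← h2, Nat.cast_sub (by omega)]; simp
      · rw [SeriesData.psiSeq, dif_neg (by omega)]; simp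
  top j h := by rw [SeriesData.psiSeq, dif_neg (by omega)]

/-- Series of words of length at least two which transform under `sl(2)` like the letters
`e_Δ^{(0)}`. -/
structure IsCuspSeries (e : Eigenform → Series ℝ) : Prop where
  short : ∀ Δ w, w.length ≤ 1 → e Δ w = 0
  mult : ∀ Δ, Multiplet Δ.wt fun j => (adE0 (R := ℝ))^[j] (e Δ)

lemma adE0_iterate_zero {R : Type} [CommRing R] (i : ℕ) : (adE0 (R := R))^[i] 0 = 0 := by
  induction i with
  | zero => rfl
  | succ i ih => rw [Function.iterate_succ_apply', ih]; exact funext adE0_zero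

lemma SeriesData.isCuspSeries_ePlus : IsCuspSeries D.ePlus where
  short := D.ePlus_short
  mult Δ :=
    { up := fun j => (Function.iterate_succ_apply' _ _ _).symm
      down := fun j w => by rw [D.ePlus_adE0v]; rfl
      top := fun j hj => by
        obtain ⟨i, rfl⟩ := Nat.exists_eq_add_of_le' hj
        rw [Function.iterate_add_apply, D.ePlus_top, adE0_iterate_zero] }

lemma SeriesData.isCuspSeries_eMinus : IsCuspSeries D.eMinus where
  short := D.eMinus_short
  mult Δ :=
    { up := fun j => (Function.iterate_succ_apply' _ _ _).symm
      down := fun j w => by rw [D.eMinus_adE0v]; rfl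
      top := fun j hj => by
        obtain ⟨i, rfl⟩ := Nat.exists_eq_add_of_le' hj
        rw [Function.iterate_add_apply, D.eMinus_top, adE0_iterate_zero] }

/-- A word in the `j`-th series of a multiplet bounds both `K` and `j`. -/
lemma Multiplet.le_of_ne {K : ℕ} {E : ℕ → Series ℝ} (h : Multiplet K E) {j : ℕ}
    {w : List Letter} (hw : E j w ≠ 0) :
    (K : ℤ) - 2 - 2 * j = torusWt w ∧ j ≤ degSum w := by
  refine ⟨?_, not_lt.1 fun h' => hw (h.eq_zero_of_degSum j w h')⟩
  have := (mul_eq_zero.1 (h.torusWt_mul j w)).resolve_right hw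
  have h2 : (torusWt w : ℝ) = ((K : ℤ) - 2 - 2 * j : ℤ) := by push_cast; linarith
  exact (Int.cast_injective h2).symm

lemma SeriesData.finite_psi (w : List Letter) : {a | D.psi a w ≠ 0}.Finite := by
  have : {a | D.psi a w ≠ 0} ⊆ {a : Letter | a.1.1 ≤ (torusWt w + 2 + 2 * degSum w).toNat} := by
    rintro ⟨k, j⟩ h
    rw [Set.mem_ofPred_eq, ← D.psiSeq_of_lt] at h
    obtain ⟨h1, h2⟩ := (D.psi_multiplet k).le_of_ne h
    change k.1 ≤ _
    omega
  refine Set.Finite.subset ?_ this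
  set B := (torusWt w + 2 + 2 * degSum w).toNat
  -- Only finitely many letters have bounded weight.
  refine Set.Finite.of_injOn (f := fun a : Letter => (a.1.1, a.2.1))
    (t := Set.Iic B ×ˢ Set.Iic B) ?_ ?_ ((Set.finite_Iic B).prod (Set.finite_Iic B))
  · rintro ⟨k, j⟩ h
    have h1 : k.1 ≤ B := h
    have h2 := j.2
    exact ⟨h1, by change j.1 ≤ B; omega⟩
  · rintro ⟨⟨k, hk⟩, ⟨j, hj⟩⟩ _ ⟨⟨k', hk'⟩, ⟨j', hj'⟩⟩ _ h
    simp only [Prod.mk.injEq] at h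
    obtain ⟨rfl, rfl⟩ := h
    rfl

lemma IsCuspSeries.finite {e : Eigenform → Series ℝ} (he : IsCuspSeries e) (w : List Letter) :
    {d : CuspLetter | (adE0 (R := ℝ))^[d.2.1] (e d.1) w ≠ 0}.Finite := by
  set B := (torusWt w + 2 + 2 * degSum w).toNat with hB
  refine Set.Finite.of_injOn (f := fun d : CuspLetter => (d.1, d.2.1))
    (t := {Δ | Δ.wt ≤ B} ×ˢ Set.Iic B) ?_ ?_ ((finite_eigenforms B).prod (Set.finite_Iic B))
  · rintro ⟨Δ, j⟩ h
    obtain ⟨h1, h2⟩ := (he.mult Δ).le_of_ne h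
    have h3 := j.2
    have h4 : Δ.wt ≤ B := by omega
    exact ⟨h4, by change j.1 ≤ B; omega⟩
  · rintro ⟨Δ, ⟨j, hj⟩⟩ _ ⟨Δ', ⟨j', hj'⟩⟩ _ h
    simp only [Prod.mk.injEq] at h
    obtain ⟨rfl, rfl⟩ := h
    rfl

lemma SeriesData.finite_coeffs (w : List Letter) :
    {a | D.chi a w ≠ 0}.Finite ∧ {d | D.xi d w ≠ 0}.Finite ∧ {d | D.eta d w ≠ 0}.Finite := by
  refine ⟨(D.finite_psi w).subset fun a ha h => ha ?_,
    (D.isCuspSeries_ePlus.finite w).subset fun a ha h => ha ?_,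
    (D.isCuspSeries_eMinus.finite w).subset fun a ha h => ha ?_⟩
  · rw [SeriesData.chi, h]; simp
  · rw [SeriesData.xi, h]; simp
  · rw [SeriesData.eta, h]; simp

end Finiteness

/-! ### Products of series and substitutions -/

section Conc

variable {R : Type} [CommRing R]

/-- The concatenation product over an arbitrary alphabet. -/
def cauchy {A : Type} (S T : List A → R) (w : List A) : R :=
  ∑ i ∈ Finset.range (w.length + 1), S (w.take i) * T (w.drop i)

lemma conc_eq_cauchy (S T : Series R) : conc S T = cauchy S T := rfl

lemma cauchy_nil {A : Type} (S T : List A → R) : cauchy S T [] = S [] * T [] := by simp [cauchy]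

lemma cauchy_cons {A : Type} (S T : List A → R) (a : A) (w : List A) :
    cauchy S T (a :: w) = S [] * T (a :: w) + cauchy (fun u => S (a :: u)) T w := by
  rw [cauchy, List.length_cons, Finset.sum_range_succ', add_comm]
  simp [cauchy]

lemma conc_nil (S T : Series R) : conc S T [] = S [] * T [] := cauchy_nil S T

lemma conc_cons (S T : Series R) (a : Letter) (w : List Letter) :
    conc S T (a :: w) = S [] * T (a :: w) + conc (fun u => S (a :: u)) T w := cauchy_cons S T a w

lemma conc_add_left (S S' T : Series R) (w : List Letter) :
    conc (fun u => S u + S' u) T w = conc S T w + conc S' T w := by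
  simp only [conc, add_mul, Finset.sum_add_distrib]

lemma conc_add_right (S T T' : Series R) (w : List Letter) :
    conc S (fun u => T u + T' u) w = conc S T w + conc S T' w := by
  simp only [conc, mul_add, Finset.sum_add_distrib]

lemma conc_smul_left (c : R) (S T : Series R) (w : List Letter) :
    conc (fun u => c * S u) T w = c * conc S T w := by
  simp only [conc, mul_assoc, Finset.mul_sum]

lemma conc_smul_right (c : R) (S T : Series R) (w : List Letter) :
    conc S (fun u => c * T u) w = c * conc S T w := by
  simp only [conc, mul_left_comm _ c, Finset.mul_sum]

lemma conc_assoc (S T U : Series R) : conc (conc S T) U = conc S (conc T U) := by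
  funext w
  induction w generalizing S with
  | nil => simp only [conc_nil, mul_assoc]
  | cons a w ih =>
    have h : (fun u => conc S T (a :: u))
        = fun u => S [] * T (a :: u) + conc (fun u => S (a :: u)) T u :=
      funext fun u => conc_cons _ _ _ _
    rw [conc_cons, conc_cons, h, conc_add_left, conc_smul_left, ih, conc_nil, conc_cons]
    ring

lemma unit_conc (S : Series R) : conc (unit R) S = S := by
  funext w
  rw [conc, Finset.sum_eq_single 0]
  · simp [unit]
  · intro i hi h0
    have : w.take i ≠ [] := by
      intro h
      have := congrArg List.length h
      simp at this
      simp only [Finset.mem_range] at hi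
      rcases this with h1 | h1
      · exact h0 h1
      · subst h1; simp at hi; omega
    rw [unit, if_neg this, zero_mul]
  · simp

lemma der_conc (c : Letter → R) (src : Letter → Letter) (S T : Series R) (w : List Letter) :
    der c src (conc S T) w = conc (der c src S) T w + conc S (der c src T) w := by
  induction w generalizing S T with
  | nil => simp [der_nil, conc_nil]
  | cons a w ih =>
    have h : (fun u => conc S T (a :: u))
        = fun u => S [] * T (a :: u) + conc (fun u => S (a :: u)) T u :=
      funext fun u => conc_cons _ _ _ _
    have h2 : (fun u => der c src S (a :: u))
        = fun u => c a * S (src a :: u) + der c src (fun u => S (a :: u)) u :=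
      funext fun u => der_cons _ _ _ _ _
    rw [der_cons, h, der_add, der_smul, ih, conc_cons, conc_cons, conc_cons, h2, conc_add_left,
      conc_smul_left, der_nil, der_cons]
    ring

variable {A : Type}

/-- The product of the series `σ x` along a word. -/
def prodS (σ : A → Series R) (u : List A) : Series R := (u.map σ).foldr conc (unit R)

lemma prodS_nil (σ : A → Series R) : prodS σ [] = unit R := rfl

lemma prodS_cons (σ : A → Series R) (x : A) (u : List A) :
    prodS σ (x :: u) = conc (σ x) (prodS σ u) := rfl

lemma subst_apply (σ : A → Series R) (T : List A → R) (w : List Letter) :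
    subst σ T w = ∑ᶠ u : List A, T u * prodS σ u w := rfl

/-- A substitution by series without constant term, finitely many of which contain a given word. -/
structure IsSubst (σ : A → Series R) : Prop where
  nil : ∀ x, σ x [] = 0
  fin : ∀ w, {x | σ x w ≠ 0}.Finite

lemma IsSubst.finite {σ : A → Series R} (h : IsSubst σ) (w : List Letter) :
    {u | prodS σ u w ≠ 0}.Finite := by
  induction hn : w.length using Nat.strong_induction_on generalizing w with
  | _ n ih =>
    subst hn
    have hsub : {u | prodS σ u w ≠ 0} ⊆ {[]} ∪ ⋃ i ∈ Finset.Icc 1 w.length,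
        Set.image2 List.cons {x | σ x (w.take i) ≠ 0} {u | prodS σ u (w.drop i) ≠ 0} := by
      rintro (_ | ⟨x, u⟩) hu
      · left; rfl
      · right
        rw [Set.mem_ofPred_eq, prodS_cons, conc] at hu
        obtain ⟨i, hi, hne⟩ := Finset.exists_ne_zero_of_sum_ne_zero hu
        have h0 : i ≠ 0 := by
          rintro rfl
          rw [List.take_zero, h.nil, zero_mul] at hne
          exact hne rfl
        simp only [Set.mem_iUnion]
        refine ⟨i, Finset.mem_Icc.2 ⟨Nat.pos_of_ne_zero h0, by
          have := Finset.mem_range.1 hi; omega⟩, x, left_ne_zero_of_mul hne, u,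
          right_ne_zero_of_mul hne, rfl⟩
    refine Set.Finite.subset ((Set.finite_singleton _).union
      (Set.Finite.biUnion (Finset.finite_toSet _) fun i hi => ?_)) hsub
    have hi' := Finset.mem_Icc.1 (Finset.mem_coe.1 hi)
    refine Set.Finite.image2 _ (h.fin _) (ih _ ?_ (w.drop i) rfl)
    rw [List.length_drop]
    omega

lemma IsSubst.subst_eq_sum {σ : A → Series R} (h : IsSubst σ) (T : List A → R)
    {w : List Letter} {s : Finset (List A)} (hs : (h.finite w).toFinset ⊆ s) :
    subst σ T w = ∑ u ∈ s, T u * prodS σ u w := by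
  rw [subst_apply]
  refine finsum_eq_sum_of_support_subset _ fun u hu => hs ?_
  rw [Set.Finite.mem_toFinset]
  exact right_ne_zero_of_mul hu

/-- A family of series, finitely many of which contain a given word. -/
def LocFin {X : Type} (F : X → Series R) : Prop := ∀ w, {x | F x w ≠ 0}.Finite

lemma LocFin.finite_supp {X : Type} {F : X → Series R} (hF : LocFin F) (w : List Letter) :
    (Function.support fun x => F x w).Finite := hF w

lemma LocFin.conc_right {X : Type} {F : X → Series R} (hF : LocFin F) (G : X → Series R) :
    LocFin fun x => conc (F x) (G x) := fun w => by
  refine ((Finset.finite_toSet (Finset.range (w.length + 1))).biUnion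
    fun i _ => hF (w.take i)).subset fun x hx => ?_
  obtain ⟨i, hi, hne⟩ := Finset.exists_ne_zero_of_sum_ne_zero hx
  exact Set.mem_biUnion (Finset.mem_coe.2 hi) (left_ne_zero_of_mul hne)

lemma LocFin.smul {X : Type} {F : X → Series R} (hF : LocFin F) (c : X → R) :
    LocFin fun x w => c x * F x w :=
  fun w => (hF w).subset fun _ hx => right_ne_zero_of_mul hx

lemma LocFin.finsum_conc {X : Type} {F : X → Series R} (hF : LocFin F) (T : Series R)
    (w : List Letter) :
    conc (fun u => ∑ᶠ x, F x u) T w = ∑ᶠ x, conc (F x) T w := by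
  simp only [conc]
  rw [finsum_sum_comm _ _ fun i _ => (hF (w.take i)).subset fun x hx => left_ne_zero_of_mul hx]
  exact Finset.sum_congr rfl fun i _ => finsum_mul' _ _ (hF (w.take i))

lemma LocFin.conc_finsum {X : Type} {F : X → Series R} (hF : LocFin F) (S : Series R)
    (w : List Letter) :
    conc S (fun u => ∑ᶠ x, F x u) w = ∑ᶠ x, conc S (F x) w := by
  simp only [conc]
  rw [finsum_sum_comm _ _ fun i _ => (hF (w.drop i)).subset fun x hx => right_ne_zero_of_mul hx]
  exact Finset.sum_congr rfl fun i _ => mul_finsum' _ _ (hF (w.drop i))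

lemma LocFin.cons {X : Type} {F : X → Series R} (hF : LocFin F) (a : Letter) :
    LocFin fun x u => F x (a :: u) := fun w => hF (a :: w)

lemma LocFin.der {X : Type} {F : X → Series R} (hF : LocFin F) (c : Letter → R)
    (src : Letter → Letter) : LocFin fun x => der c src (F x) := fun w => by
  induction w generalizing F with
  | nil => simp [der_nil]
  | cons a w ih =>
    refine ((hF (src a :: w)).union (ih (hF.cons a))).subset fun x hx => ?_
    by_contra h
    rw [Set.mem_union, not_or] at h
    refine hx ?_
    change EqvInt.der c src (F x) (a :: w) = 0
    rw [der_cons, not_not.1 h.1, mul_zero, zero_add]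
    exact not_not.1 h.2

lemma LocFin.der_finsum {X : Type} {F : X → Series R} (hF : LocFin F) (c : Letter → R)
    (src : Letter → Letter) (w : List Letter) :
    EqvInt.der c src (fun u => ∑ᶠ x, F x u) w = ∑ᶠ x, EqvInt.der c src (F x) w := by
  induction w generalizing F with
  | nil => simp [der_nil]
  | cons a w ih =>
    simp only [der_cons]
    rw [ih (hF.cons a), mul_finsum' _ _ (hF (src a :: w)), finsum_add_distrib]
    · exact (hF (src a :: w)).subset fun x hx => right_ne_zero_of_mul hx
    · exact (hF.cons a).der c src w

lemma finsum_list {f : List A → R} (hf : (Function.support f).Finite) :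
    ∑ᶠ u, f u = f [] + ∑ᶠ x, ∑ᶠ v, f (x :: v) := by
  have hinj : Function.Injective fun p : A × List A => p.1 :: p.2 := by
    rintro ⟨x, u⟩ ⟨y, v⟩ h
    simpa using h
  have hfin : (Function.support fun p : A × List A => f (p.1 :: p.2)).Finite :=
    Set.Finite.preimage hinj.injOn hf
  rw [← finsum_curry (fun p : A × List A => f (p.1 :: p.2)) hfin]
  have hr : ∑ᶠ p : A × List A, f (p.1 :: p.2) = ∑ᶠ u ∈ ({[]}ᶜ : Set (List A)), f u := by
    rw [← finsum_mem_range (f := f) hinj]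
    have : ({[]}ᶜ : Set (List A)) = Set.range fun p : A × List A => p.1 :: p.2 := by
      ext u
      rcases u with _ | ⟨x, u⟩ <;> simp
    rw [this]
  rw [hr, ← finsum_mem_singleton (f := f) (a := []), ← finsum_mem_univ f,
    ← Set.union_compl_self ({[]} : Set (List A)),
    finsum_mem_union' disjoint_compl_right (hf.subset Set.inter_subset_right)
      (hf.subset Set.inter_subset_right)]

lemma IsSubst.locFin_prodS {σ : A → Series R} (h : IsSubst σ) : LocFin (prodS σ) := h.finite

lemma IsSubst.locFin {σ : A → Series R} (h : IsSubst σ) : LocFin σ := h.fin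

/-- Sorting the words of the source by their first letter. -/
lemma IsSubst.subst_peel {σ : A → Series R} (h : IsSubst σ) (T : List A → R) (w : List Letter) :
    subst σ T w = T [] * unit R w + ∑ᶠ x, conc (σ x) (subst σ fun u => T (x :: u)) w := by
  have hfin := (h.locFin_prodS.smul T).finite_supp w
  rw [subst_apply, finsum_list hfin]
  congr 1
  refine finsum_congr fun x => ?_
  have h2 : subst σ (fun u => T (x :: u)) = fun w => ∑ᶠ u, T (x :: u) * prodS σ u w := rfl
  rw [h2, (h.locFin_prodS.smul fun u => T (x :: u)).conc_finsum]
  refine finsum_congr fun v => ?_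
  rw [prodS_cons, conc_smul_right]

lemma IsSubst.subst_nil {σ : A → Series R} (h : IsSubst σ) (T : List A → R) :
    subst σ T [] = T [] := by
  rw [h.subst_peel]
  simp [conc_nil, h.nil, unit]

lemma IsSubst.subst_add {σ : A → Series R} (h : IsSubst σ) (T T' : List A → R)
    (w : List Letter) :
    subst σ (fun u => T u + T' u) w = subst σ T w + subst σ T' w := by
  simp only [subst_apply, add_mul]
  exact finsum_add_distrib ((h.locFin_prodS.smul T).finite_supp w)
    ((h.locFin_prodS.smul T').finite_supp w)

lemma IsSubst.subst_smul {σ : A → Series R} (h : IsSubst σ) (c : R) (T : List A → R)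
    (w : List Letter) : subst σ (fun u => c * T u) w = c * subst σ T w := by
  simp only [subst_apply, mul_assoc]
  exact (mul_finsum' _ _ ((h.locFin_prodS.smul T).finite_supp w)).symm

/-- In a product with a series without constant term, the second factor only matters on shorter
words. -/
lemma conc_congr_right {S T T' : Series R} (hS : S [] = 0) {w : List Letter}
    (h : ∀ u, u.length < w.length → T u = T' u) : conc S T w = conc S T' w := by
  refine Finset.sum_congr rfl fun i hi => ?_
  rcases Nat.eq_zero_or_pos i with rfl | h0
  · rw [List.take_zero, hS, zero_mul, zero_mul]
  · rw [h]
    have := Finset.mem_range.1 hi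
    rw [List.length_drop]
    omega

/-- Substitution is multiplicative. -/
lemma IsSubst.subst_cauchy {σ : A → Series R} (h : IsSubst σ) (T T' : List A → R) :
    subst σ (cauchy T T') = conc (subst σ T) (subst σ T') := by
  funext w
  induction hn : w.length using Nat.strong_induction_on generalizing T w with
  | _ n ih =>
    subst hn
    have h1 : ∀ x, conc (σ x) (subst σ fun u => cauchy T T' (x :: u)) w
        = T [] * conc (σ x) (subst σ fun u => T' (x :: u)) w
          + conc (conc (σ x) (subst σ fun u => T (x :: u))) (subst σ T') w := by
      intro x
      rw [conc_assoc, ← conc_smul_right, ← conc_add_right]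
      refine conc_congr_right (h.nil x) fun u hu => ?_
      rw [← ih u.length hu (fun u => T (x :: u)) u rfl, ← h.subst_smul, ← h.subst_add]
      congr 1
      funext u
      exact cauchy_cons T T' x u
    have hf := h.locFin.conc_right fun x => subst σ fun u => T' (x :: u)
    have hf2 := h.locFin.conc_right fun x => subst σ fun u => T (x :: u)
    rw [h.subst_peel, finsum_congr h1, finsum_add_distrib
      ((hf.smul fun _ => T []).finite_supp w)
      ((hf2.conc_right fun _ => subst σ T').finite_supp w), ← hf2.finsum_conc,
      ← mul_finsum' _ _ (hf w), cauchy_nil]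
    have h3 : subst σ T = fun w => T [] * unit R w
        + ∑ᶠ x, conc (σ x) (subst σ fun u => T (x :: u)) w := funext fun w => h.subst_peel T w
    rw [h3, conc_add_left, conc_smul_left, unit_conc, h.subst_peel T' w]
    ring

/-- A substitution compatible with a derivation on the letters commutes with the derivation. -/
lemma IsSubst.der_subst {σ : Letter → Series R} (h : IsSubst σ) (c : Letter → R)
    (src : Letter → Letter)
    (hσ : ∀ (F : Letter → Series R) (w : List Letter), ∑ᶠ x, conc (der c src (σ x)) (F x) w
      = ∑ᶠ x, c x * conc (σ x) (F (src x)) w)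
    (T : Series R) : der c src (subst σ T) = subst σ (der c src T) := by
  funext w
  induction hn : w.length using Nat.strong_induction_on generalizing T w with
  | _ n ih =>
    subst hn
    have h1 : ∀ x, conc (σ x) (subst σ fun u => der c src T (x :: u)) w
        = c x * conc (σ x) (subst σ fun u => T (src x :: u)) w
          + conc (σ x) (der c src (subst σ fun u => T (x :: u))) w := by
      intro x
      rw [← conc_smul_right, ← conc_add_right]
      refine conc_congr_right (h.nil x) fun u hu => ?_
      rw [ih u.length hu (fun u => T (x :: u)) u rfl, ← h.subst_smul, ← h.subst_add]
      rfl
    have hf := h.locFin.conc_right fun x => subst σ fun u => T (src x :: u)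
    have hf1 := h.locFin.conc_right fun x => subst σ fun u => T (x :: u)
    have hf2 := h.locFin.conc_right fun x => der c src (subst σ fun u => T (x :: u))
    have hf3 := (h.locFin.der c src).conc_right fun x => subst σ fun u => T (x :: u)
    have h0 : der c src (unit R) w = 0 := by
      rcases w with _ | ⟨a, w⟩
      · exact der_nil c src _
      · rw [der_cons]
        have : ∀ w, der c src (fun _ => (0 : R)) w = 0 := fun w => by
          simpa using der_smul c src (0 : R) (fun _ => 0) w
        simp [unit, this]
    have h3 : subst σ T = fun w => T [] * unit R w
        + ∑ᶠ x, conc (σ x) (subst σ fun u => T (x :: u)) w := funext fun w => h.subst_peel T w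
    rw [h.subst_peel, finsum_congr h1, finsum_add_distrib ((hf.smul c).finite_supp w)
      (hf2.finite_supp w), h3, der_add, der_smul, hf1.der_finsum, der_nil, h0,
      finsum_congr fun x => der_conc c src _ _ w, finsum_add_distrib (hf3.finite_supp w)
      (hf2.finite_supp w), hσ fun x => subst σ fun u => T (x :: u)]
    simp

end Conc

/-! ### The constant term at the cusp -/

section CuspVal

/-- On the imaginary axis `K` is a polynomial up to an exponentially small error, and `c` is the
constant term of that polynomial. -/
def CuspVal (K : ℍ → ℂ) (c : ℂ) : Prop := ∃ P : Polynomial ℂ, RayTame K P ∧ P.eval 0 = c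

lemma CuspVal.congr {K K' : ℍ → ℂ} {c c' : ℂ} (h : CuspVal K c) (hK : ∀ τ, K' τ = K τ)
    (hc : c' = c) : CuspVal K' c' := by rwa [funext hK, hc]

lemma CuspVal.const (a : ℂ) : CuspVal (fun _ => a) a := ⟨_, RayTame.const a, by simp⟩

lemma CuspVal.add {K L : ℍ → ℂ} {c d : ℂ} (h : CuspVal K c) (h' : CuspVal L d) :
    CuspVal (fun τ => K τ + L τ) (c + d) := by
  obtain ⟨P, hP, rfl⟩ := h
  obtain ⟨Q, hQ, rfl⟩ := h'
  exact ⟨_, hP.add hQ, by simp⟩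

lemma CuspVal.mul {K L : ℍ → ℂ} {c d : ℂ} (h : CuspVal K c) (h' : CuspVal L d) :
    CuspVal (fun τ => K τ * L τ) (c * d) := by
  obtain ⟨P, hP, rfl⟩ := h
  obtain ⟨Q, hQ, rfl⟩ := h'
  exact ⟨_, hP.mul hQ, by simp⟩

lemma CuspVal.const_mul {K : ℍ → ℂ} {c : ℂ} (a : ℂ) (h : CuspVal K c) :
    CuspVal (fun τ => a * K τ) (a * c) := (CuspVal.const a).mul h

lemma CuspVal.conj {K : ℍ → ℂ} {c : ℂ} (h : CuspVal K c) :
    CuspVal (fun τ => conj (K τ)) (conj c) := by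
  obtain ⟨P, hP, rfl⟩ := h
  exact ⟨_, hP.conj, by simp⟩

lemma CuspVal.sum {ι : Type*} (s : Finset ι) {K : ι → ℍ → ℂ} {c : ι → ℂ}
    (h : ∀ i ∈ s, CuspVal (K i) (c i)) :
    CuspVal (fun τ => ∑ i ∈ s, K i τ) (∑ i ∈ s, c i) := by
  classical
  induction s using Finset.induction_on with
  | empty => simpa using CuspVal.const 0
  | insert i s hi ih =>
    simp only [Finset.sum_insert hi]
    exact (h i (Finset.mem_insert_self i s)).add
      (ih fun j hj => h j (Finset.mem_insert_of_mem hj))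

lemma CuspVal.isReg {K a b : ℍ → ℂ} (h : CuspVal K 0)
    (hK : HasDD K (fun τ => -a τ) (fun τ => -b τ)) : IsRegPrimitive a b K := by
  obtain ⟨P, hP, h0⟩ := h
  exact hP.isReg h0 hK

/-- A primitive with constant term `c` at the cusp is the regularised integral plus `c`. -/
lemma IsRegPrimitive.add_const_eq {a b K K' : ℍ → ℂ} {c : ℂ} (h : IsRegPrimitive a b K)
    (hK' : HasDD K' (fun τ => -a τ) (fun τ => -b τ)) (hc : CuspVal K' c) (τ : ℍ) :
    K' τ = K τ + c := by
  have h1 : IsRegPrimitive a b fun τ => K' τ + -c :=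
    CuspVal.isReg ((hc.add (CuspVal.const (-c))).congr (fun _ => rfl) (by simp))
      ((hK'.add (HasDD.const (-c))).congr (fun _ => rfl) (fun _ => by simp) (fun _ => by simp))
  have := congrFun (h1.unique h) τ
  linear_combination this

end CuspVal

/-! ### The substitutions in the generating series -/

section Substitutions

lemma adE0_toC (S : Series ℝ) (w : List Letter) : adE0 (toC S) w = ((adE0 S w : ℝ) : ℂ) := by
  induction w generalizing S with
  | nil => simp [adE0_nil]
  | cons a w ih =>
    have h : (fun u => toC S (a :: u)) = toC fun u => S (a :: u) := rfl
    rw [adE0_cons, adE0_cons, h, ih]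
    split_ifs <;> simp [toC]

lemma adE0v_toC (S : Series ℝ) (w : List Letter) : adE0v (toC S) w = ((adE0v S w : ℝ) : ℂ) := by
  induction w generalizing S with
  | nil => simp [adE0v_nil]
  | cons a w ih =>
    have h : (fun u => toC S (a :: u)) = toC fun u => S (a :: u) := rfl
    rw [adE0v_cons, adE0v_cons, h, ih]
    split_ifs <;> simp [toC]

lemma Multiplet.toC {K : ℕ} {E : ℕ → Series ℝ} (h : Multiplet K E) :
    Multiplet K fun j => EqvInt.toC (E j) where
  up j := funext fun w => by rw [adE0_toC, h.up]; rfl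
  down j w := by
    rw [adE0v_toC, h.down]
    simp [EqvInt.toC]
  top j hj := by rw [h.top j hj]; funext w; simp [EqvInt.toC]

lemma single_nil {R : Type} [CommRing R] (a : Letter) : single R a [] = 0 := by simp [single]

/-- The series `e_{Δ^±}^{(j)}` contain no words of length at most one. -/
lemma IsCuspSeries.nil {e : Eigenform → Series ℝ} (he : IsCuspSeries e) (Δ : Eigenform) (j : ℕ)
    (w : List Letter) (hw : w.length ≤ 1) : (adE0 (R := ℝ))^[j] (e Δ) w = 0 := by
  have h0 : ∀ j, (adE0 (R := ℝ))^[j] (e Δ) [] = 0 := by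
    intro j
    rcases j with _ | j
    · exact he.short Δ [] (by simp)
    · rw [Function.iterate_succ_apply']; exact adE0_nil _
  have h1 : ∀ j a, (adE0 (R := ℝ))^[j] (e Δ) [a] = 0 := by
    intro j
    induction j with
    | zero => exact fun a => he.short Δ [a] (by simp)
    | succ j ih =>
      intro a
      rw [Function.iterate_succ_apply', adE0_cons, adE0_nil, ih]
      simp
  rcases w with _ | ⟨a, _ | ⟨b, w⟩⟩
  · exact h0 j
  · exact h1 j a
  · simp at hw

lemma isSubst_cuspSubst {e : Eigenform → Series ℝ} (he : IsCuspSeries e) :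
    IsSubst (SeriesData.cuspSubst e) where
  nil x := by
    rcases x with a | d
    · exact single_nil a
    · simp [SeriesData.cuspSubst, toC, he.nil]
  fin w := by
    have h1 : {a : Letter | single ℂ a w ≠ 0}.Finite := by
      refine Set.Subsingleton.finite fun a ha b hb => ?_
      have ha' : w = [a] := by by_contra h; exact ha (if_neg h)
      have hb' : w = [b] := by by_contra h; exact hb (if_neg h)
      simpa using ha'.symm.trans hb'
    refine ((h1.image Sum.inl).union ((he.finite w).image Sum.inr)).subset ?_
    rintro (a | d) hx
    · exact Or.inl ⟨a, hx, rfl⟩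
    · refine Or.inr ⟨d, fun h => hx ?_, rfl⟩
      simp [SeriesData.cuspSubst, toC, h]

variable (D : SeriesData)

lemma SeriesData.isSubst_psi : IsSubst fun a => toC (D.psi a) where
  nil a := by simp [toC, D.psi_nil]
  fin w := (D.finite_psi w).subset fun a ha h => ha (by simp [toC, h])

lemma Letter.down_up {a : Letter} (h : a.2.1 + 1 < a.1.1 - 1) : a.up.down = a := by
  rw [Letter.up, dif_pos h]; rfl

lemma Letter.up_down {a : Letter} (h : 0 < a.2.1) : a.down.up = a := by
  obtain ⟨k, j, hj⟩ := a
  have h' : 0 < j := h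
  have e : j - 1 + 1 = j := by omega
  rw [Letter.up, dif_pos (by change j - 1 + 1 < k.1 - 1; omega)]
  simp [e]

/-- Summation over letters may be shifted by one superscript, when the ends do not contribute. -/
lemma finsum_eq_of_shift {f g : Letter → ℂ} (hf : ∀ a : Letter, a.2.1 + 1 < a.1.1 - 1 → f a = g a.up)
    (hf0 : ∀ a : Letter, ¬ a.2.1 + 1 < a.1.1 - 1 → f a = 0)
    (hg0 : ∀ a : Letter, ¬ 0 < a.2.1 → g a = 0) : ∑ᶠ a, f a = ∑ᶠ a, g a := by
  have h1 : ∑ᶠ a, f a = ∑ᶠ a ∈ {a : Letter | a.2.1 + 1 < a.1.1 - 1}, f a := by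
    refine finsum_congr fun a => ?_
    by_cases h : a.2.1 + 1 < a.1.1 - 1
    · exact (finsum_eq_if.trans (if_pos h)).symm
    · exact (hf0 a h).trans (finsum_eq_if.trans (if_neg h)).symm
  have h2 : ∑ᶠ a, g a = ∑ᶠ a ∈ {a : Letter | 0 < a.2.1}, g a := by
    refine finsum_congr fun a => ?_
    by_cases h : 0 < a.2.1
    · exact (finsum_eq_if.trans (if_pos h)).symm
    · exact (hg0 a h).trans (finsum_eq_if.trans (if_neg h)).symm
  rw [h1, h2]
  refine finsum_mem_eq_of_bijOn Letter.up ⟨?_, ?_, ?_⟩ fun a ha => hf a ha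
  · intro a ha
    have ha' : a.2.1 + 1 < a.1.1 - 1 := ha
    change 0 < a.up.2.1
    rw [Letter.up, dif_pos ha']
    exact Nat.succ_pos _
  · intro a ha b hb h
    rw [← Letter.down_up ha, ← Letter.down_up hb, h]
  · intro a ha
    have ha' : 0 < a.2.1 := ha
    refine ⟨a.down, ?_, Letter.up_down ha⟩
    change a.2.1 - 1 + 1 < a.1.1 - 1
    have := a.2.2
    omega

lemma SeriesData.adE0_subst_psi (T : Series ℂ) :
    adE0 (subst (fun a => toC (D.psi a)) T) = subst (fun a => toC (D.psi a)) (adE0 T) := by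
  rw [adE0_eq_der, adE0_eq_der]
  refine D.isSubst_psi.der_subst _ _ (fun F w => ?_) T
  have h0 : ∀ (F : Series ℂ) w, conc (fun _ => 0) F w = 0 := fun F w => by simp [conc]
  refine finsum_eq_of_shift (fun a ha => ?_) (fun a ha => ?_) (fun a ha => ?_)
  · have : der (coeffUp ℂ) Letter.down (toC (D.psi a)) = toC (D.psi a.up) := by
      funext u
      rw [← adE0_eq_der, adE0_toC]
      have := D.psi_adE0 a.1 a.2
      rw [dif_pos ha] at this
      rw [Letter.up, dif_pos ha, this, toC]
    have h1 : 0 < a.up.2.1 := by rw [Letter.up, dif_pos ha]; exact Nat.succ_pos _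
    rw [this, Letter.down_up ha, coeffUp, if_pos h1, one_mul]
  · have : der (coeffUp ℂ) Letter.down (toC (D.psi a)) = fun _ => 0 := by
      funext u
      rw [← adE0_eq_der, adE0_toC]
      have := D.psi_adE0 a.1 a.2
      rw [dif_neg ha] at this
      rw [this]; simp
    rw [this, h0]
  · rw [coeffUp, if_neg ha, zero_mul]

lemma SeriesData.adE0v_subst_psi (T : Series ℂ) :
    adE0v (subst (fun a => toC (D.psi a)) T) = subst (fun a => toC (D.psi a)) (adE0v T) := by
  rw [adE0v_eq_der, adE0v_eq_der]
  refine D.isSubst_psi.der_subst _ _ (fun F w => ?_) T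
  have h1 : ∀ a : Letter, der (coeffDown ℂ) Letter.up (toC (D.psi a))
      = fun u => ((a.2.1 : ℂ) * ((a.1.1 : ℂ) - 1 - a.2.1)) * toC (D.psi a.down) u := by
    intro a
    funext u
    have := congrFun (D.psi_adE0v a.1 a.2) u
    rw [← adE0v_eq_der, adE0v_toC, this]
    simp [toC]
  simp only [h1, conc_smul_left]
  symm
  refine finsum_eq_of_shift (fun a ha => ?_) (fun a ha => ?_) (fun a ha => ?_)
  · rw [Letter.down_up ha, coeffDown, if_pos ha]
    congr 1
    rw [Letter.up, dif_pos ha]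
    have e : ((a.1.1 - 2 - a.2.1 : ℕ) : ℂ) = (a.1.1 : ℂ) - 2 - a.2.1 := by
      rw [Nat.cast_sub (by omega), Nat.cast_sub (by omega)]; simp
    rw [e]
    push_cast
    ring
  · rw [coeffDown, if_neg ha, zero_mul]
  · rw [Nat.eq_zero_of_not_pos ha]; simp

/-- `ψ̂` maps multiplets to multiplets. -/
lemma SeriesData.subst_psi_multiplet {K : ℕ} {E : ℕ → Series ℂ} (h : Multiplet K E) :
    Multiplet K fun j => subst (fun a => toC (D.psi a)) (E j) where
  up j := by rw [D.adE0_subst_psi, h.up]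
  down j w := by
    rw [D.adE0v_subst_psi, ← D.isSubst_psi.subst_smul]
    congr 1
    exact funext fun w => h.down j w
  top j hj := by
    rw [h.top j hj]
    funext w
    change subst _ (fun _ => (0 : ℂ)) w = 0
    simpa using D.isSubst_psi.subst_smul 0 (fun _ => 0) w

end Substitutions

/-! ### Differential equations of the generating series -/

section Differential

variable (D : SeriesData)

/-- `W`-normalised holomorphic kernel of a letter. -/
def kernelW (x : XLetter) (τ : ℍ) : ℂ := (wfac x : ℂ) * kernel x τ

/-- `W`-normalised antiholomorphic kernel of a letter. -/
def kernelWTilde (x : XLetter) (τ : ℍ) : ℂ := (wfac x : ℂ) * ((-1) ^ x.idx * conj (kernel x τ))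

/-- The `dτ`-connection of `𝕀_+`. -/
def SeriesData.omegaPlus (τ : ℍ) : Series ℂ :=
  fun w => ∑ᶠ x, kernelW x τ * SeriesData.cuspSubst D.ePlus x w

/-- The `dτ̄`-connection of `𝕀̃_-`. -/
def SeriesData.omegaMinus (τ : ℍ) : Series ℂ :=
  fun w => ∑ᶠ x, kernelWTilde x τ * SeriesData.cuspSubst D.eMinus x w

/-- The `dτ̄`-connection of `ψ̂(𝕀̃_-)`. -/
def SeriesData.omegaPsi (τ : ℍ) : Series ℂ := subst (fun a => toC (D.psi a)) (D.omegaMinus τ)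

open Classical in
/-- The function on words which is `κ x` on the letter `x` and vanishes on all other words. -/
def ofLetters {A : Type} (κ : A → ℂ) : List A → ℂ
  | [x] => κ x
  | _ => 0

lemma conc_unit (S : Series ℂ) : conc S (unit ℂ) = S := by
  funext w
  rw [conc, Finset.sum_range_succ, Finset.sum_eq_zero]
  · simp [unit]
  · intro i hi
    have : w.drop i ≠ [] := by
      have := Finset.mem_range.1 hi
      simp only [ne_eq, List.drop_eq_nil_iff]
      omega
    rw [unit, if_neg this, mul_zero]

lemma IsSubst.subst_ofLetters {A : Type} {σ : A → Series ℂ} (h : IsSubst σ) (κ : A → ℂ) :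
    subst σ (ofLetters κ) = fun w => ∑ᶠ x, κ x * σ x w := by
  funext w
  rw [h.subst_peel]
  have h1 : ∀ x, conc (σ x) (subst σ fun u => ofLetters κ (x :: u)) w = κ x * σ x w := by
    intro x
    have : (subst σ fun u => ofLetters κ (x :: u)) = fun w => κ x * unit ℂ w := by
      funext w
      rw [subst_apply, finsum_eq_single _ []]
      · rfl
      · intro u hu
        obtain ⟨a, u, rfl⟩ := List.exists_cons_of_ne_nil hu
        simp [ofLetters]
    rw [this, conc_smul_right, conc_unit]
  rw [finsum_congr h1]
  simp [ofLetters]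

lemma cauchy_ofLetters_left {A : Type} (κ : A → ℂ) (T : List A → ℂ) (x : A) (u : List A) :
    cauchy (ofLetters κ) T (x :: u) = κ x * T u := by
  rw [cauchy_cons]
  rcases u with _ | ⟨y, u⟩
  · simp [cauchy_nil, ofLetters]
  · rw [cauchy_cons]
    have : cauchy (fun u => ofLetters κ (x :: y :: u)) T u = 0 :=
      Finset.sum_eq_zero fun i _ => by simp [ofLetters]
    rw [this]
    simp [ofLetters]

lemma cauchy_ofLetters_right {A : Type} (κ : A → ℂ) (T : List A → ℂ) (x : A) (u : List A) :
    cauchy T (ofLetters κ) (u ++ [x]) = T u * κ x := by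
  induction u generalizing T with
  | nil => rw [List.nil_append, cauchy_cons, cauchy_nil]; simp [ofLetters]
  | cons y u ih =>
    rw [List.cons_append, cauchy_cons, ih]
    rcases u with _ | ⟨z, u⟩ <;> simp [ofLetters]

lemma cauchy_ofLetters_nil {A : Type} (κ : A → ℂ) (T : List A → ℂ) :
    cauchy T (ofLetters κ) [] = 0 ∧ cauchy (ofLetters κ) T [] = 0 := by
  simp [cauchy_nil, ofLetters]

/-- Differentiation of a substitution in a family of functions on words. -/
lemma IsSubst.hasDD {A : Type} {σ : A → Series ℂ} (h : IsSubst σ) {T a b : ℍ → List A → ℂ}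
    (hT : ∀ u, HasDD (fun τ => T τ u) (fun τ => a τ u) (fun τ => b τ u)) (w : List Letter) :
    HasDD (fun τ => subst σ (T τ) w) (fun τ => subst σ (a τ) w) (fun τ => subst σ (b τ) w) := by
  refine (HasDD.sum (h.finite w).toFinset fun u _ => (hT u).const_mul (prodS σ u w)).congr
    ?_ ?_ ?_ <;> intro τ <;>
  · rw [h.subst_eq_sum _ (subset_refl _)]
    exact Finset.sum_congr rfl fun u _ => mul_comm _ _

lemma IsSubst.cuspVal {A : Type} {σ : A → Series ℂ} (h : IsSubst σ) {T : ℍ → List A → ℂ}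
    {t : List A → ℂ} (hT : ∀ u, CuspVal (fun τ => T τ u) (t u)) (w : List Letter) :
    CuspVal (fun τ => subst σ (T τ) w) (subst σ t w) := by
  refine (CuspVal.sum (h.finite w).toFinset fun u _ => (hT u).const_mul (prodS σ u w)).congr
    (fun τ => ?_) ?_ <;>
  · rw [h.subst_eq_sum _ (subset_refl _)]
    exact Finset.sum_congr rfl fun u _ => mul_comm _ _

lemma hasDD_conc {S a b S' a' b' : ℍ → Series ℂ}
    (h : ∀ u, HasDD (fun τ => S τ u) (fun τ => a τ u) (fun τ => b τ u))
    (h' : ∀ u, HasDD (fun τ => S' τ u) (fun τ => a' τ u) (fun τ => b' τ u)) (w : List Letter) :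
    HasDD (fun τ => conc (S τ) (S' τ) w)
      (fun τ => conc (a τ) (S' τ) w + conc (S τ) (a' τ) w)
      (fun τ => conc (b τ) (S' τ) w + conc (S τ) (b' τ) w) :=
  (HasDD.sum (Finset.range (w.length + 1)) fun i _ => (h (w.take i)).mul (h' (w.drop i))).congr
    (fun _ => rfl) (fun _ => Finset.sum_add_distrib.symm) (fun _ => Finset.sum_add_distrib.symm)

lemma cuspVal_conc {S S' : ℍ → Series ℂ} {s s' : Series ℂ}
    (h : ∀ u, CuspVal (fun τ => S τ u) (s u)) (h' : ∀ u, CuspVal (fun τ => S' τ u) (s' u))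
    (w : List Letter) : CuspVal (fun τ => conc (S τ) (S' τ) w) (conc s s' w) :=
  CuspVal.sum (Finset.range (w.length + 1)) fun i _ => (h (w.take i)).mul (h' (w.drop i))

lemma subst_unit {A : Type} {σ : A → Series ℂ} {t : List A → ℂ}
    (h1 : t [] = 1) (h0 : ∀ u, u ≠ [] → t u = 0) : subst σ t = unit ℂ := by
  funext w
  rw [subst_apply, finsum_eq_single _ [] fun u hu => by rw [h0 u hu, zero_mul], h1, one_mul,
    prodS_nil]

lemma SeriesData.hasDD_iPlus (w : List Letter) :
    HasDD (fun τ => D.iPlus τ w) (fun τ => -conc (D.iPlus τ) (D.omegaPlus τ) w)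
      (fun _ => 0) := by
  have hσ := isSubst_cuspSubst D.isCuspSeries_ePlus
  have h1 : ∀ u, HasDD (fun τ => (((u.map wfac).prod : ℝ) : ℂ) * iterInt u τ)
      (fun τ => -1 * cauchy (fun u => (((u.map wfac).prod : ℝ) : ℂ) * iterInt u τ)
        (ofLetters fun x => kernelW x τ) u) (fun _ => 0) := by
    intro u
    rcases List.eq_nil_or_concat u with rfl | ⟨u, x, rfl⟩
    · exact (HasDD.const 1).congr (fun τ => by simp [iterInt_nil])
        (fun τ => by rw [(cauchy_ofLetters_nil _ _).1]; simp) (fun _ => rfl)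
    · rw [List.concat_eq_append]
      refine ((iterInt_concat_hasDD u x).const_mul _).congr (fun _ => rfl) (fun τ => ?_)
        (fun τ => by simp)
      rw [cauchy_ofLetters_right, kernelW, List.map_append, List.prod_append]
      simp only [List.map_cons, List.map_nil, List.prod_cons, List.prod_nil, mul_one]
      push_cast
      ring
  refine (hσ.hasDD h1 w).congr (fun _ => rfl) (fun τ => ?_) (fun τ => ?_)
  · rw [hσ.subst_smul, hσ.subst_cauchy, hσ.subst_ofLetters, neg_one_mul]
    rfl
  · simpa using (hσ.subst_smul 0 (fun _ => 0) w).symm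

lemma SeriesData.cuspVal_iPlus (w : List Letter) : CuspVal (fun τ => D.iPlus τ w) (unit ℂ w) := by
  have hσ := isSubst_cuspSubst D.isCuspSeries_ePlus
  rw [← subst_unit (t := fun u => if u = [] then 1 else 0) (if_pos rfl) fun u hu => if_neg hu]
  refine hσ.cuspVal (fun u => ?_) w
  obtain ⟨P, hP, h0, h1⟩ := iterInt_rayTame u
  refine CuspVal.congr (CuspVal.const_mul _ ⟨P, hP, rfl⟩) (fun _ => rfl) ?_
  split_ifs with h
  · rw [h1 h, h]; simp
  · rw [h0 h, mul_zero]

lemma SeriesData.hasDD_iMinus (w : List Letter) :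
    HasDD (fun τ => D.iMinus τ w) (fun _ => 0)
      (fun τ => -conc (D.omegaMinus τ) (D.iMinus τ) w) := by
  have hσ := isSubst_cuspSubst D.isCuspSeries_eMinus
  have h1 : ∀ u, HasDD (fun τ => (((u.map wfac).prod : ℝ) : ℂ) * iterIntTilde u.reverse τ)
      (fun _ => 0) (fun τ => -1 * cauchy (ofLetters fun x => kernelWTilde x τ)
        (fun u => (((u.map wfac).prod : ℝ) : ℂ) * iterIntTilde u.reverse τ) u) := by
    intro u
    rcases u with _ | ⟨x, u⟩
    · exact (HasDD.const 1).congr (fun τ => by simp [iterIntTilde, iterInt_nil])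
        (fun _ => rfl) (fun τ => by rw [(cauchy_ofLetters_nil _ _).2]; simp)
    · rw [List.reverse_cons]
      refine (((iterInt_concat_hasDD u.reverse x).conj.const_mul
        ((-1) ^ ((u.reverse ++ [x]).map XLetter.idx).sum)).const_mul _).congr (fun _ => rfl)
        (fun τ => by simp) (fun τ => ?_)
      rw [cauchy_ofLetters_left, kernelWTilde, iterIntTilde, List.map_append, List.sum_append]
      simp only [List.map_cons, List.map_nil, List.prod_cons, List.sum_cons, List.sum_nil,
        map_neg, map_mul, pow_add, add_zero]
      push_cast
      ring
  refine (hσ.hasDD h1 w).congr (fun _ => rfl) (fun τ => ?_) (fun τ => ?_)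
  · simpa using (hσ.subst_smul 0 (fun _ => 0) w).symm
  · rw [hσ.subst_smul, hσ.subst_cauchy, hσ.subst_ofLetters, neg_one_mul]
    rfl

lemma SeriesData.cuspVal_iMinus (w : List Letter) :
    CuspVal (fun τ => D.iMinus τ w) (unit ℂ w) := by
  have hσ := isSubst_cuspSubst D.isCuspSeries_eMinus
  rw [← subst_unit (t := fun u => if u = [] then 1 else 0) (if_pos rfl) fun u hu => if_neg hu]
  refine hσ.cuspVal (fun u => ?_) w
  obtain ⟨P, hP, h0, h1⟩ := iterInt_rayTame u.reverse
  refine CuspVal.congr (CuspVal.const_mul _ (CuspVal.const_mul _ (CuspVal.conj ⟨P, hP, rfl⟩)))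
    (fun _ => rfl) ?_
  split_ifs with h
  · rw [h1 (by rw [h]; rfl), h]; simp
  · rw [h0 (by simpa using h)]; simp

/-- The differential equation of `𝕀^eqv`: the holomorphic connection `ω₊` acts from the right,
the antiholomorphic connection `ω_ψ` from the left. -/
lemma SeriesData.hasDD_iEqv (w : List Letter) :
    HasDD (fun τ => D.iEqv τ w) (fun τ => -conc (D.iEqv τ) (D.omegaPlus τ) w)
      (fun τ => -conc (D.omegaPsi τ) (D.iEqv τ) w) := by
  have hψ := D.isSubst_psi
  have hz : ∀ u, subst (fun a => toC (D.psi a)) (fun _ => 0) u = 0 := fun u => by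
    simpa using hψ.subst_smul 0 (fun _ => 0) u
  have h1 : ∀ u, HasDD (fun τ => subst (fun a => toC (D.psi a)) (D.iMinus τ) u) (fun _ => 0)
      (fun τ => -1 * conc (D.omegaPsi τ) (subst (fun a => toC (D.psi a)) (D.iMinus τ)) u) := by
    intro u
    refine (hψ.hasDD D.hasDD_iMinus u).congr (fun _ => rfl) (fun _ => (hz u).symm) fun τ => ?_
    rw [SeriesData.omegaPsi, ← hψ.subst_cauchy, ← hψ.subst_smul]
    congr 1
    funext u
    rw [neg_one_mul, conc_eq_cauchy]
  have h2 := hasDD_conc h1 (S' := fun _ => D.cSeries) (a' := fun _ _ => 0) (b' := fun _ _ => 0)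
    fun u => HasDD.const _
  have h3 := hasDD_conc h2 D.hasDD_iPlus w
  have e1 : ∀ S T : Series ℂ, conc (fun _ => 0) S + conc T (fun _ => 0) = fun _ => 0 := by
    intro S T; funext u; simp [conc]
  refine h3.congr (fun _ => rfl) (fun τ => ?_) (fun τ => ?_)
  · have e2 : (fun u => conc (fun _ => 0) D.cSeries u
        + conc (subst (fun a => toC (D.psi a)) (D.iMinus τ)) (fun _ => 0) u) = fun _ => (0 : ℂ) :=
      e1 _ _
    have e3 : conc (fun _ => 0) (D.iPlus τ) w = 0 := by simp [conc]
    have e4 : (fun u => -conc (D.iPlus τ) (D.omegaPlus τ) u)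
        = fun u => -1 * conc (D.iPlus τ) (D.omegaPlus τ) u := funext fun u => by ring
    rw [e2, e3, e4, conc_smul_right, ← conc_assoc, SeriesData.iEqv]
    ring
  · have e2 : ∀ u, conc (fun _ => 0) (D.iPlus τ) u = 0 := fun u => by simp [conc]
    have e5 : ∀ S : Series ℂ, conc S (fun _ => 0) w = 0 := fun S => by simp [conc]
    have e3 : (fun u => conc (fun v => -1 * conc (D.omegaPsi τ)
        (subst (fun a => toC (D.psi a)) (D.iMinus τ)) v) D.cSeries u
        + conc (subst (fun a => toC (D.psi a)) (D.iMinus τ)) (fun _ => 0) u)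
        = fun u => -1 * conc (conc (D.omegaPsi τ)
        (subst (fun a => toC (D.psi a)) (D.iMinus τ))) D.cSeries u := by
      funext u
      rw [conc_smul_left]
      have : conc (subst (fun a => toC (D.psi a)) (D.iMinus τ)) (fun _ => 0) u = 0 := by
        simp [conc]
      rw [this, add_zero]
    rw [e3, e5, conc_smul_left, conc_assoc, conc_assoc, SeriesData.iEqv, conc_assoc]
    ring

/-- The constant term of `𝕀^eqv` at the cusp is `ℂ^sv`, since the integrals have constant term
zero. -/
lemma SeriesData.cuspVal_iEqv (w : List Letter) :
    CuspVal (fun τ => D.iEqv τ w) (D.cSeries w) := by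
  have hψ := D.isSubst_psi
  have h1 : ∀ u, CuspVal (fun τ => subst (fun a => toC (D.psi a)) (D.iMinus τ) u) (unit ℂ u) := by
    intro u
    refine (hψ.cuspVal D.cuspVal_iMinus u).congr (fun _ => rfl) ?_
    rw [subst_unit (by simp [unit]) fun u hu => by simp [unit, hu]]
  have h2 := cuspVal_conc (cuspVal_conc h1 fun u => CuspVal.const (D.cSeries u)) D.cuspVal_iPlus w
  refine h2.congr (fun _ => rfl) ?_
  rw [unit_conc, conc_unit]

end Differential

/-! ### From series to polynomials in the bookkeeping variables -/

section Dictionary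

lemma twoPiI_ne_zero : twoPiI ≠ 0 := Complex.two_pi_I_ne_zero

variable {A : Type} [CommRing A] [Algebra ℂ A]

/-- The monomial `(k-2)!²/(k-2-j)! (Y/2πi)^j X^{k-2-j}` attached to the letter `e_k^{(j)}`, for
`x = (k, X, Y)`. -/
def slot (x : EisWt × A × A) (j : ℕ) : A :=
  algebraMap ℂ A (((x.1.1 - 2).factorial : ℂ) ^ 2 / ((x.1.1 - 2 - j).factorial : ℂ) / twoPiI ^ j)
    * x.2.2 ^ j * x.2.1 ^ (x.1.1 - 2 - j)

/-- The part of a series with weights `k_1, …, k_ℓ`, the letter `e_{k_i}^{(j)}` being replaced by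
`(k_i-2)!²/(k_i-2-j)! (Y_i/2πi)^j X_i^{k_i-2-j}`. -/
def Psi : List (EisWt × A × A) → Series ℂ →ₗ[ℂ] A
  | [] => Algebra.linearMap ℂ A ∘ₗ LinearMap.proj []
  | x :: L => ∑ j : Fin (x.1.1 - 1),
      LinearMap.mulLeft ℂ (slot x j) ∘ₗ Psi L ∘ₗ LinearMap.funLeft ℂ ℂ (List.cons ⟨x.1, j⟩)

lemma Psi_nil (S : Series ℂ) : Psi ([] : List (EisWt × A × A)) S = algebraMap ℂ A (S []) := rfl

lemma Psi_cons (x : EisWt × A × A) (L : List (EisWt × A × A)) (S : Series ℂ) :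
    Psi (x :: L) S = ∑ j : Fin (x.1.1 - 1), slot x j * Psi L fun u => S (⟨x.1, j⟩ :: u) := by
  rw [Psi, LinearMap.sum_apply]
  rfl

lemma Psi_congr {L : List (EisWt × A × A)} {S S' : Series ℂ}
    (h : ∀ w : List Letter, w.map Sigma.fst = L.map Prod.fst → S w = S' w) :
    Psi L S = Psi L S' := by
  induction L generalizing S S' with
  | nil => rw [Psi_nil, Psi_nil, h [] rfl]
  | cons x L ih =>
    rw [Psi_cons, Psi_cons]
    refine Finset.sum_congr rfl fun j _ => ?_
    rw [ih fun w hw => h _ (by simp [hw])]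

/-- Functoriality in the algebra of values. -/
lemma map_Psi {B : Type} [CommRing B] [Algebra ℂ B] (f : A →ₐ[ℂ] B)
    (L : List (EisWt × A × A)) (S : Series ℂ) :
    f (Psi L S) = Psi (L.map fun x => (x.1, f x.2.1, f x.2.2)) S := by
  induction L generalizing S with
  | nil => rw [Psi_nil, List.map_nil, Psi_nil, AlgHom.commutes]
  | cons x L ih =>
    rw [Psi_cons, List.map_cons, Psi_cons, map_sum]
    refine Finset.sum_congr rfl fun j _ => ?_
    rw [map_mul, ih]
    congr 1
    simp [slot, AlgHom.commutes]

lemma Psi_conc (L : List (EisWt × A × A)) (S T : Series ℂ) :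
    Psi L (conc S T)
      = ∑ i ∈ Finset.range (L.length + 1), Psi (L.take i) S * Psi (L.drop i) T := by
  induction L generalizing S with
  | nil => simp [Psi_nil, conc_nil]
  | cons x L ih =>
    have h : ∀ j : Fin (x.1.1 - 1), (fun u => conc S T (⟨x.1, j⟩ :: u))
        = S [] • (fun u => T (⟨x.1, j⟩ :: u)) + conc (fun u => S (⟨x.1, j⟩ :: u)) T :=
      fun j => funext fun u => conc_cons _ _ _ _
    rw [List.length_cons, Finset.sum_range_succ', List.take_zero, List.drop_zero, Psi_nil,
      Psi_cons]
    simp only [h, map_add, map_smul, ih, mul_add, Finset.sum_add_distrib]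
    rw [add_comm]
    congr 1
    · simp only [Finset.mul_sum, List.take_succ_cons, List.drop_succ_cons, Psi_cons x (L.take _),
        Finset.sum_mul]
      rw [Finset.sum_comm]
      exact Finset.sum_congr rfl fun i _ => Finset.sum_congr rfl fun j _ => by ring
    · rw [Psi_cons, Finset.mul_sum]
      exact Finset.sum_congr rfl fun j _ => by rw [Algebra.smul_def]; ring

lemma sum_fin_shift {B : Type} [CommRing B] {n : ℕ} (f g : ℕ → B) (h0 : g 0 = 0)
    (hn : 0 < n → f (n - 1) = 0) (h : ∀ j, j + 1 < n → f j = g (j + 1)) :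
    ∑ j : Fin n, f j = ∑ j : Fin n, g j := by
  rw [Fin.sum_univ_eq_sum_range, Fin.sum_univ_eq_sum_range]
  rcases n with _ | n
  · simp
  · rw [Finset.sum_range_succ, Finset.sum_range_succ' g, h0]
    have : f n = 0 := hn n.succ_pos
    rw [this]
    congr 1
    exact Finset.sum_congr rfl fun j hj => h j (by simpa using hj)

lemma factorial_ne (n : ℕ) : (n.factorial : ℂ) ≠ 0 := Nat.cast_ne_zero.2 n.factorial_ne_zero

/-- A function on the letters of weight `k`, continued by zero. -/
def extZero {B : Type} [CommRing B] (k : EisWt) (F : Letter → B) (j : ℕ) : B :=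
  if h : j < k.1 - 1 then F ⟨k, ⟨j, h⟩⟩ else 0

lemma extZero_coe {B : Type} [CommRing B] (k : EisWt) (F : Letter → B) (j : Fin (k.1 - 1)) :
    extZero k F j = F ⟨k, j⟩ := dif_pos j.2

/-- A derivation with `X ↦ Y/2πi`, `Y ↦ 0` acts as `ad_{e_0}`. -/
lemma derivation_Psi_adE0 (d : Derivation ℂ A A) {L : List (EisWt × A × A)}
    (hL : ∀ x ∈ L, d x.2.1 = algebraMap ℂ A twoPiI⁻¹ * x.2.2 ∧ d x.2.2 = 0) (S : Series ℂ) :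
    d (Psi L S) = Psi L (adE0 S) := by
  induction L generalizing S with
  | nil => rw [Psi_nil, Psi_nil, adE0_nil]; simp
  | cons x L ih =>
    obtain ⟨h1, h2⟩ := hL x (by simp)
    have ih' := fun S => ih (fun x hx => hL x (by simp [hx])) S
    have hk := x.1.2.2
    have h3 : ∀ j : Fin (x.1.1 - 1), (fun u => adE0 S (⟨x.1, j⟩ :: u))
        = (if 0 < j.1 then (1 : ℂ) else 0) • (fun u => S (Letter.down ⟨x.1, j⟩ :: u))
          + adE0 (fun u => S (⟨x.1, j⟩ :: u)) := by
      intro j; funext u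
      rw [adE0_cons]
      simp only [Pi.add_apply, Pi.smul_apply, smul_eq_mul, ite_mul, one_mul, zero_mul]
    rw [Psi_cons, Psi_cons, map_sum]
    simp only [h3, map_add, map_smul, Derivation.leibniz, ih', smul_eq_mul, mul_add,
      Finset.sum_add_distrib]
    rw [add_comm]
    congr 1
    set F : Letter → A := fun a => Psi L fun u => S (a :: u)
    have hs : ∀ j, j + 1 ≤ x.1.1 - 2 → d (slot x j) = slot x (j + 1) := by
      intro j hj
      obtain ⟨n, hn⟩ := Nat.exists_eq_add_of_le hj
      have e1 : x.1.1 - 2 - j = n + 1 := by omega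
      have e2 : x.1.1 - 2 - (j + 1) = n := by omega
      have hc : ((x.1.1 - 2).factorial : ℂ) ^ 2 / ((n + 1).factorial : ℂ) / twoPiI ^ j
          * ((n + 1 : ℕ) : ℂ) * twoPiI⁻¹
          = ((x.1.1 - 2).factorial : ℂ) ^ 2 / (n.factorial : ℂ) / twoPiI ^ (j + 1) := by
        rw [Nat.factorial_succ]
        have := factorial_ne n
        have := twoPiI_ne_zero
        have : ((n + 1 : ℕ) : ℂ) ≠ 0 := Nat.cast_ne_zero.2 n.succ_ne_zero
        push_cast at this ⊢
        field_simp
        ring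
      rw [slot, slot, e1, e2, ← hc]
      simp only [Derivation.leibniz, Derivation.map_algebraMap, Derivation.leibniz_pow, h1, h2,
        smul_eq_mul, map_mul, nsmul_eq_mul, map_natCast, Nat.add_sub_cancel]
      ring
    have hs0 : ∀ j, x.1.1 - 2 - j = 0 → d (slot x j) = 0 := by
      intro j hj
      rw [slot, hj]
      simp [Derivation.leibniz, Derivation.leibniz_pow, h2]
    have e1 : ∀ j : Fin (x.1.1 - 1), F ⟨x.1, j⟩ * d (slot x j)
        = (fun j => extZero x.1 F j * d (slot x j)) j.1 := fun j => by
      simp only [extZero_coe]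
    have e2 : ∀ j : Fin (x.1.1 - 1), slot x j
        * ((if 0 < j.1 then (1 : ℂ) else 0) • F (Letter.down ⟨x.1, j⟩))
        = (fun j => if 0 < j then slot x j * extZero x.1 F (j - 1) else 0) j.1 := fun j => by
      have h4 : extZero x.1 F (j.1 - 1) = F (Letter.down ⟨x.1, j⟩) :=
        dif_pos (lt_of_le_of_lt (Nat.sub_le _ _) j.2)
      simp only [h4]
      split_ifs <;> simp
    refine (Finset.sum_congr rfl fun j _ => e1 j).trans
      (Eq.trans ?_ (Finset.sum_congr rfl fun j _ => (e2 j).symm))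
    refine sum_fin_shift (fun j => extZero x.1 F j * d (slot x j))
      (fun j => if 0 < j then slot x j * extZero x.1 F (j - 1) else 0) (by simp) (fun _ => ?_)
      fun j hj => ?_
    · simp only [hs0 (x.1.1 - 1 - 1) (by omega), mul_zero]
    · simp only [hs j (by omega), Nat.succ_pos, if_true, Nat.add_sub_cancel]
      ring

/-- A derivation with `X ↦ 0`, `Y ↦ 2πi X` acts as `ad_{e_0^∨}`. -/
lemma derivation_Psi_adE0v (d : Derivation ℂ A A) {L : List (EisWt × A × A)}
    (hL : ∀ x ∈ L, d x.2.1 = 0 ∧ d x.2.2 = algebraMap ℂ A twoPiI * x.2.1) (S : Series ℂ) :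
    d (Psi L S) = Psi L (adE0v S) := by
  induction L generalizing S with
  | nil => rw [Psi_nil, Psi_nil, adE0v_nil]; simp
  | cons x L ih =>
    obtain ⟨h1, h2⟩ := hL x (by simp)
    have ih' := fun S => ih (fun x hx => hL x (by simp [hx])) S
    have hk := x.1.2.2
    have h3 : ∀ j : Fin (x.1.1 - 1), (fun u => adE0v S (⟨x.1, j⟩ :: u))
        = coeffDown ℂ ⟨x.1, j⟩ • (fun u => S (Letter.up ⟨x.1, j⟩ :: u))
          + adE0v (fun u => S (⟨x.1, j⟩ :: u)) := by
      intro j; funext u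
      rw [adE0v_eq_der, der_cons, ← adE0v_eq_der]
      rfl
    rw [Psi_cons, Psi_cons, map_sum]
    simp only [h3, map_add, map_smul, Derivation.leibniz, ih', smul_eq_mul, mul_add,
      Finset.sum_add_distrib]
    rw [add_comm]
    congr 1
    set F : Letter → A := fun a => Psi L fun u => S (a :: u)
    have hs : ∀ j, j + 1 ≤ x.1.1 - 2 → d (slot x (j + 1))
        = algebraMap ℂ A (((j + 1 : ℕ) : ℂ) * ((x.1.1 - 2 - j : ℕ) : ℂ)) * slot x j := by
      intro j hj
      obtain ⟨n, hn⟩ := Nat.exists_eq_add_of_le hj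
      have e1 : x.1.1 - 2 - j = n + 1 := by omega
      have e2 : x.1.1 - 2 - (j + 1) = n := by omega
      have hc : ((x.1.1 - 2).factorial : ℂ) ^ 2 / (n.factorial : ℂ) / twoPiI ^ (j + 1)
          * ((j + 1 : ℕ) : ℂ) * twoPiI = ((j + 1 : ℕ) : ℂ) * ((n + 1 : ℕ) : ℂ) *
          (((x.1.1 - 2).factorial : ℂ) ^ 2 / ((n + 1).factorial : ℂ) / twoPiI ^ j) := by
        rw [Nat.factorial_succ]
        have := factorial_ne n
        have := twoPiI_ne_zero
        have : ((n + 1 : ℕ) : ℂ) ≠ 0 := Nat.cast_ne_zero.2 n.succ_ne_zero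
        push_cast at this ⊢
        field_simp
        ring
      have hc' := congrArg (algebraMap ℂ A) hc
      rw [slot, slot, e1, e2]
      simp only [Derivation.leibniz, Derivation.map_algebraMap, Derivation.leibniz_pow, h1, h2,
        smul_eq_mul, nsmul_eq_mul, Nat.add_sub_cancel]
      simp only [map_mul, map_natCast] at hc' ⊢
      linear_combination x.2.2 ^ j * x.2.1 ^ (n + 1) * hc'
    have e1 : ∀ j : Fin (x.1.1 - 1), F ⟨x.1, j⟩ * d (slot x j)
        = (fun j => extZero x.1 F j * d (slot x j)) j.1 := fun j => by
      simp only [extZero_coe]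
    have e2 : ∀ j : Fin (x.1.1 - 1), slot x j
        * (coeffDown ℂ ⟨x.1, j⟩ • F (Letter.up ⟨x.1, j⟩))
        = (fun j => slot x j * (algebraMap ℂ A (((j + 1 : ℕ) : ℂ) * ((x.1.1 - 2 - j : ℕ) : ℂ))
          * extZero x.1 F (j + 1))) j.1 := fun j => by
      rw [coeffDown, Letter.up]
      by_cases h : j.1 + 1 < x.1.1 - 1
      · simp only [h, if_true, dif_pos, extZero, Algebra.smul_def]
      · simp only [h, if_false, extZero, dif_neg, not_false_eq_true]
        simp
    refine (Finset.sum_congr rfl fun j _ => e1 j).trans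
      (Eq.trans ?_ (Finset.sum_congr rfl fun j _ => (e2 j).symm))
    symm
    refine sum_fin_shift (fun j => slot x j * (algebraMap ℂ A
      (((j + 1 : ℕ) : ℂ) * ((x.1.1 - 2 - j : ℕ) : ℂ)) * extZero x.1 F (j + 1)))
      (fun j => extZero x.1 F j * d (slot x j)) ?_ (fun _ => ?_) fun j hj => ?_
    · simp [slot, Derivation.leibniz, Derivation.leibniz_pow, h1]
    · have : ¬ x.1.1 - 1 - 1 + 1 < x.1.1 - 1 := by omega
      simp [extZero, this]
    · simp only [hs j (by omega)]
      ring

/-- The derivative of `Psi` along a line, expanded by Taylor's formula. -/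
lemma taylor_Psi {ad : Series ℂ → Series ℂ} {L : List (EisWt × ℂ × ℂ)}
    {Ls : List (EisWt × Polynomial ℂ × Polynomial ℂ)}
    (hL : Ls.map (fun x => (x.1, x.2.1.eval 0, x.2.2.eval 0)) = L)
    (hd : ∀ S, Polynomial.derivative (Psi Ls S) = Psi Ls (ad S)) {N : ℕ} (S : Series ℂ)
    (hN : ∀ q, N ≤ q → Psi L (ad^[q] S) = 0) (s : ℂ) :
    ∑ q ∈ Finset.range N, s ^ q / (q.factorial : ℂ) * Psi L (ad^[q] S)
      = Psi (Ls.map fun x => (x.1, x.2.1.eval s, x.2.2.eval s)) S := by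
  have hev : ∀ (t : ℂ) S, (Psi Ls S).eval t
      = Psi (Ls.map fun x => (x.1, x.2.1.eval t, x.2.2.eval t)) S := by
    intro t S
    have := map_Psi (Polynomial.aeval t) Ls S
    simpa only [Polynomial.coe_aeval_eq_eval] using this
  have hit : ∀ q, Polynomial.derivative^[q] (Psi Ls S) = Psi Ls (ad^[q] S) := by
    intro q
    induction q with
    | zero => rfl
    | succ q ih => rw [Function.iterate_succ_apply', ih, hd, Function.iterate_succ_apply']
  have hc : ∀ q, (Psi Ls S).coeff q = Psi L (ad^[q] S) / (q.factorial : ℂ) := by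
    intro q
    have h1 := Polynomial.coeff_iterate_derivative (p := Psi Ls S) (k := q) 0
    rw [hit, Polynomial.coeff_zero_eq_eval_zero, hev, hL, zero_add, Nat.descFactorial_self,
      nsmul_eq_mul] at h1
    rw [h1, mul_div_cancel_left₀ _ (factorial_ne q)]
  rw [← hev, Polynomial.eval_eq_sum_range' (n := N + 1)]
  · rw [Finset.sum_range_succ, hc N, hN N le_rfl]
    simp only [zero_div, zero_mul, add_zero]
    exact Finset.sum_congr rfl fun q _ => by rw [hc]; ring
  · refine Nat.lt_succ_of_le (Polynomial.natDegree_le_iff_coeff_eq_zero.2 fun q hq => ?_)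
    rw [hc, hN q hq.le, zero_div]

end Dictionary

/-! ### Nilpotency -/

section Nilpotency

/-- The sum `∑ (k_i - 2)` over a list of weights. -/
def wtSum (l : List EisWt) : ℕ := (l.map fun k => k.1 - 2).sum

lemma degSum_le (w : List Letter) : degSum w ≤ wtSum (w.map Sigma.fst) := by
  induction w with
  | nil => simp [degSum, wtSum]
  | cons a w ih =>
    have := a.2.2
    simp only [degSum, wtSum, List.map_cons, List.sum_cons] at ih ⊢
    omega

lemma adE0_iterate_eq_zero (S : Series ℂ) (q : ℕ) :
    ∀ w, degSum w < q → (adE0 (R := ℂ))^[q] S w = 0 := by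
  induction q with
  | zero => simp
  | succ q ih =>
    intro w hw
    rw [Function.iterate_succ_apply']
    exact adE0_eq_zero_of_degSum ih w hw

/-- The sum `∑ (k_i - 2 - j_i)` of a word. -/
def codegSum (w : List Letter) : ℕ := (w.map fun a => a.1.1 - 2 - a.2.1).sum

lemma codegSum_le (w : List Letter) : codegSum w ≤ wtSum (w.map Sigma.fst) := by
  induction w with
  | nil => simp [codegSum, wtSum]
  | cons a w ih =>
    simp only [codegSum, wtSum, List.map_cons, List.sum_cons] at ih ⊢
    omega

lemma adE0v_eq_zero_of_codegSum {p : ℕ} {S : Series ℂ} (h : ∀ w, codegSum w < p → S w = 0)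
    (w : List Letter) (hw : codegSum w < p + 1) : adE0v S w = 0 := by
  induction w generalizing S p with
  | nil => exact adE0v_nil S
  | cons a w ih =>
    rw [adE0v_cons]
    have hc : ∀ (b : Letter) u, codegSum (b :: u) = b.1.1 - 2 - b.2.1 + codegSum u :=
      fun b u => by simp [codegSum]
    rw [hc] at hw
    have h2 : adE0v (fun u => S (a :: u)) w = 0 :=
      ih (p := p - (a.1.1 - 2 - a.2.1)) (fun u hu => h _ (by rw [hc]; omega)) (by omega)
    rw [h2, add_zero]
    split_ifs with h0
    · rw [h _ (by rw [hc]; change a.1.1 - 2 - (a.2.1 + 1) + codegSum w < p; omega), mul_zero]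
    · rfl

lemma adE0v_iterate_eq_zero (S : Series ℂ) (q : ℕ) :
    ∀ w, codegSum w < q → (adE0v (R := ℂ))^[q] S w = 0 := by
  induction q with
  | zero => simp
  | succ q ih =>
    intro w hw
    rw [Function.iterate_succ_apply']
    exact adE0v_eq_zero_of_codegSum ih w hw

lemma adE0v_eq_zero_of_wt {S : Series ℂ} {l : List EisWt}
    (h : ∀ w : List Letter, w.map Sigma.fst = l → S w = 0) (w : List Letter)
    (hw : w.map Sigma.fst = l) : adE0v S w = 0 := by
  induction w generalizing S l with
  | nil => exact adE0v_nil S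
  | cons a w ih =>
    subst hw
    rw [adE0v_cons, ih (l := w.map Sigma.fst) (fun u hu => h _ (by simp [hu])) rfl, add_zero]
    split_ifs
    · rw [h _ (by simp), mul_zero]
    · rfl

lemma adE0v_iterate_eq_zero_of_wt {S : Series ℂ} {l : List EisWt}
    (h : ∀ w : List Letter, w.map Sigma.fst = l → S w = 0) (p : ℕ) :
    ∀ w : List Letter, w.map Sigma.fst = l → (adE0v (R := ℂ))^[p] S w = 0 := by
  induction p with
  | zero => exact h
  | succ p ih =>
    intro w hw
    rw [Function.iterate_succ_apply']
    exact adE0v_eq_zero_of_wt ih w hw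

/-- The double sum over powers of the derivations is finite on each word. -/
lemma SeriesData.uConj_eq_sum (D : SeriesData) (τ : ℍ) (w : List Letter) {N : ℕ}
    (hN : wtSum (w.map Sigma.fst) < N) :
    D.uConj τ w = ∑ p ∈ Finset.range N, ∑ q ∈ Finset.range N,
      (-1 / (4 * Real.pi * τ.im : ℂ)) ^ p / (p.factorial : ℂ)
        * ((twoPiI * conj (τ : ℂ)) ^ q / (q.factorial : ℂ)
        * (adE0v (R := ℂ))^[p] ((adE0 (R := ℂ))^[q] (D.iEqv τ)) w) := by
  rw [SeriesData.uConj, finsum_eq_sum_of_support_subset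
    (s := Finset.range N ×ˢ Finset.range N), Finset.sum_product]
  · refine Finset.sum_congr rfl fun p _ => Finset.sum_congr rfl fun q _ => ?_
    rw [mul_div_mul_comm, mul_assoc]
  · intro p hp
    have h := right_ne_zero_of_mul (Function.mem_support.1 hp)
    rw [Finset.coe_product, Finset.coe_range, Set.mem_prod]
    constructor
    · by_contra h'
      exact h (adE0v_iterate_eq_zero _ _ w ((codegSum_le w).trans_lt (hN.trans_le
        (not_lt.1 h'))))
    · by_contra h'
      refine h (adE0v_iterate_eq_zero_of_wt (l := w.map Sigma.fst) (fun u hu => ?_) _ w rfl)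
      exact adE0_iterate_eq_zero _ _ u ((degSum_le u).trans_lt (hu ▸ hN.trans_le (not_lt.1 h')))

lemma Psi_adE0_eq_zero {A : Type} [CommRing A] [Algebra ℂ A] (L : List (EisWt × A × A))
    (S : Series ℂ) {q : ℕ} (hq : wtSum (L.map Prod.fst) < q) :
    Psi L ((adE0 (R := ℂ))^[q] S) = 0 := by
  rw [Psi_congr (S' := 0) fun w hw => adE0_iterate_eq_zero S q w ((degSum_le w).trans_lt
    (hw ▸ hq)), map_zero]

lemma Psi_adE0v_eq_zero {A : Type} [CommRing A] [Algebra ℂ A] (L : List (EisWt × A × A))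
    (S : Series ℂ) {q : ℕ} (hq : wtSum (L.map Prod.fst) < q) :
    Psi L ((adE0v (R := ℂ))^[q] S) = 0 := by
  rw [Psi_congr (S' := 0) fun w hw => adE0v_iterate_eq_zero S q w ((codegSum_le w).trans_lt
    (hw ▸ hq)), map_zero]

/-- The exponential of `ad_{e_0}` is the shift `X ↦ X + sY/2πi`. -/
lemma exp_adE0_Psi (L : List (EisWt × ℂ × ℂ)) (S : Series ℂ) {N : ℕ}
    (hN : wtSum (L.map Prod.fst) < N) (s : ℂ) :
    ∑ q ∈ Finset.range N, s ^ q / (q.factorial : ℂ) * Psi L ((adE0 (R := ℂ))^[q] S)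
      = Psi (L.map fun x => (x.1, x.2.1 + s * (twoPiI⁻¹ * x.2.2), x.2.2)) S := by
  rw [taylor_Psi (Ls := L.map fun x => (x.1, Polynomial.C x.2.1
    + Polynomial.X * Polynomial.C (twoPiI⁻¹ * x.2.2), Polynomial.C x.2.2)) (by
      rw [List.map_map]
      exact (List.map_congr_left fun x _ => by simp).trans (List.map_id _))
    (fun S => ?_) S (fun q hq => Psi_adE0_eq_zero L S (hN.trans_le hq)) s]
  · rw [List.map_map]
    exact congrArg (fun l => Psi l S) (List.map_congr_left fun x _ => by simp)
  · refine derivation_Psi_adE0 Polynomial.derivative' (fun x hx => ?_) S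
    obtain ⟨y, _, rfl⟩ := List.mem_map.1 hx
    simp [Polynomial.derivative'_apply]

/-- The exponential of `ad_{e_0^∨}` is the shift `Y ↦ Y + 2πi sX`. -/
lemma exp_adE0v_Psi (L : List (EisWt × ℂ × ℂ)) (S : Series ℂ) {N : ℕ}
    (hN : wtSum (L.map Prod.fst) < N) (s : ℂ) :
    ∑ q ∈ Finset.range N, s ^ q / (q.factorial : ℂ) * Psi L ((adE0v (R := ℂ))^[q] S)
      = Psi (L.map fun x => (x.1, x.2.1, x.2.2 + s * (twoPiI * x.2.1))) S := by
  rw [taylor_Psi (Ls := L.map fun x => (x.1, Polynomial.C x.2.1,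
    Polynomial.C x.2.2 + Polynomial.X * Polynomial.C (twoPiI * x.2.1))) (by
      rw [List.map_map]
      exact (List.map_congr_left fun x _ => by simp).trans (List.map_id _))
    (fun S => ?_) S (fun q hq => Psi_adE0v_eq_zero L S (hN.trans_le hq)) s]
  · rw [List.map_map]
    exact congrArg (fun l => Psi l S) (List.map_congr_left fun x _ => by simp)
  · refine derivation_Psi_adE0v Polynomial.derivative' (fun x hx => ?_) S
    obtain ⟨y, _, rfl⟩ := List.mem_map.1 hx
    simp [Polynomial.derivative'_apply]

/-- The arguments `(X - τ̄Y, 2πi(X - τY)/(4y))` at which the conjugated series is evaluated. -/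
def modularArg (τ : ℍ) (x : EisWt × ℂ × ℂ) : EisWt × ℂ × ℂ :=
  (x.1, x.2.1 - conj (τ : ℂ) * x.2.2,
    twoPiI * (x.2.1 - τ * x.2.2) / (4 * Real.pi * τ.im : ℂ))

/-- Applying the two exponentials to `𝕀^eqv` amounts to changing the variables at which `𝕀^eqv`
is evaluated. -/
lemma SeriesData.Psi_uConj (D : SeriesData) (τ : ℍ) (L : List (EisWt × ℂ × ℂ)) :
    Psi (L.map (modularArg τ)) (D.uConj τ) = Psi L (D.iEqv τ) := by
  set L' := L.map (modularArg τ) with hL'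
  set N := wtSum (L.map Prod.fst) + 1
  have hl : L'.map Prod.fst = L.map Prod.fst := by
    rw [hL', List.map_map]; rfl
  have hN : wtSum (L'.map Prod.fst) < N := by rw [hl]; exact Nat.lt_succ_self _
  set a : ℂ := -1 / (4 * Real.pi * τ.im : ℂ) with ha
  set b : ℂ := twoPiI * conj (τ : ℂ) with hb
  have h1 : Psi L' (D.uConj τ) = Psi L' (∑ p ∈ Finset.range N, ∑ q ∈ Finset.range N,
      (a ^ p / (p.factorial : ℂ)) • ((b ^ q / (q.factorial : ℂ))
        • (adE0v (R := ℂ))^[p] ((adE0 (R := ℂ))^[q] (D.iEqv τ)))) := by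
    refine Psi_congr fun w hw => ?_
    rw [D.uConj_eq_sum τ w (hw ▸ hN)]
    simp only [Finset.sum_apply, Pi.smul_apply, smul_eq_mul]
    rfl
  rw [h1]
  simp only [map_sum, map_smul, smul_eq_mul]
  rw [Finset.sum_comm]
  have h2 : ∀ q ∈ Finset.range N, ∑ p ∈ Finset.range N, a ^ p / (p.factorial : ℂ)
      * (b ^ q / (q.factorial : ℂ)
        * Psi L' ((adE0v (R := ℂ))^[p] ((adE0 (R := ℂ))^[q] (D.iEqv τ))))
      = b ^ q / (q.factorial : ℂ) * Psi (L'.map fun x => (x.1, x.2.1, x.2.2 + a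
        * (twoPiI * x.2.1))) ((adE0 (R := ℂ))^[q] (D.iEqv τ)) := by
    intro q _
    rw [← exp_adE0v_Psi L' _ hN, Finset.mul_sum]
    exact Finset.sum_congr rfl fun p _ => by ring
  rw [Finset.sum_congr rfl h2, exp_adE0_Psi]
  · rw [hL', List.map_map, List.map_map]
    have h0 : (τ.im : ℂ) ≠ 0 := Complex.ofReal_ne_zero.2 τ.im_ne_zero
    have hpi : (Real.pi : ℂ) ≠ 0 := Complex.ofReal_ne_zero.2 Real.pi_ne_zero
    have e1 : (τ : ℂ) - conj (τ : ℂ) = 2 * τ.im * Complex.I := by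
      rw [Complex.sub_conj]; push_cast; rfl
    have e2 : ∀ X Y : ℂ, twoPiI * (X - τ * Y) / (4 * Real.pi * τ.im : ℂ)
        + a * (twoPiI * (X - conj (τ : ℂ) * Y)) = Y := by
      intro X Y
      rw [ha, twoPiI]
      field_simp
      linear_combination (-2 * Complex.I * Y) * e1 - 4 * Y * τ.im * Complex.I_sq
    refine congrArg (fun l => Psi l (D.iEqv τ))
      ((List.map_congr_left fun x _ => ?_).trans (List.map_id L))
    simp only [Function.comp, modularArg, e2, id, hb]
    refine Prod.ext rfl (Prod.ext ?_ rfl)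
    have := twoPiI_ne_zero
    simp only
    field_simp
    ring
  · rw [List.map_map]
    have : (Prod.fst ∘ fun x : EisWt × ℂ × ℂ => (x.1, x.2.1, x.2.2 + a * (twoPiI * x.2.1)))
      = Prod.fst := rfl
    rw [this]
    exact hN

end Nilpotency

/-! ### Expansions in words -/

section Expansion

variable {A : Type} [CommRing A] [Algebra ℂ A]

/-- The triples `(k_n, X_n, Y_n), …, (k_1, X_1, Y_1)`. -/
def argList {B : Type} {n : ℕ} (k : Fin n → EisWt) (X Y : Fin n → B) : List (EisWt × B × B) :=
  (List.ofFn fun i => (k i, X i, Y i)).reverse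

lemma argList_succ {B : Type} {n : ℕ} (k : Fin (n + 1) → EisWt) (X Y : Fin (n + 1) → B) :
    argList k X Y = (k (Fin.last n), X (Fin.last n), Y (Fin.last n)) ::
      argList (fun i => k i.castSucc) (fun i => X i.castSucc) (fun i => Y i.castSucc) := by
  rw [argList, List.ofFn_succ', List.concat_eq_append, List.reverse_concat']
  rfl

lemma argList_length {B : Type} {n : ℕ} (k : Fin n → EisWt) (X Y : Fin n → B) :
    (argList k X Y).length = n := by simp [argList]

/-- The sum over all words with letters of weights `k_n, …, k_1`, in the reverse order of the
variables. -/
lemma sum_revWord {n : ℕ} (k : Fin n → EisWt) (X Y : Fin n → A) (S : Series ℂ) :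
    ∑ j : ∀ i, Fin ((k i).1 - 1), (∏ i, slot (k i, X i, Y i) (j i)) * algebraMap ℂ A
      (S (revWord k j)) = Psi (argList k X Y) S := by
  induction n generalizing S with
  | zero => simp [argList, Psi_nil, revWord]
  | succ n ih =>
    rw [argList_succ, Psi_cons, ← Equiv.sum_comp (Fin.snocEquiv fun i => Fin ((k i).1 - 1)),
      Fintype.sum_prod_type]
    refine Finset.sum_congr rfl fun jl _ => ?_
    rw [← ih, Finset.mul_sum]
    refine Finset.sum_congr rfl fun j _ => ?_
    have h1 : revWord k (Fin.snocEquiv (fun i => Fin ((k i).1 - 1)) (jl, j))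
        = ⟨k (Fin.last n), jl⟩ :: revWord (fun i => k i.castSucc) j := by
      rw [revWord, List.ofFn_succ', List.concat_eq_append, List.reverse_concat']
      simp [revWord, Fin.snocEquiv]
    rw [h1, Fin.prod_univ_castSucc]
    simp only [Fin.snocEquiv, Equiv.coe_fn_mk, Fin.snoc_castSucc, Fin.snoc_last]
    ring

lemma wfac_ne_zero (a : Letter) : wfac (.inl a) ≠ 0 := by
  have hk := a.1.2.2
  have : ((a.1.1 : ℝ) - 1) ≠ 0 := by
    have : (4 : ℝ) ≤ a.1.1 := by exact_mod_cast hk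
    linarith
  rw [wfac]
  exact div_ne_zero (mul_ne_zero (pow_ne_zero _ (by norm_num)) this)
    (Nat.cast_ne_zero.2 (Nat.factorial_ne_zero _))

lemma wordFac_ne_zero (w : List Letter) : wordFac w ≠ 0 := by
  rw [wordFac]
  refine List.prod_ne_zero fun h => ?_
  obtain ⟨a, _, ha⟩ := List.mem_map.1 h
  exact wfac_ne_zero a ha

lemma wordFac_revWord {n : ℕ} (k : Fin n → EisWt) (j : ∀ i, Fin ((k i).1 - 1)) :
    wordFac (revWord k j) = ∏ i, wfac (.inl ⟨k i, j i⟩) := by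
  rw [wordFac, revWord, List.map_reverse, List.prod_reverse, List.map_ofFn, List.prod_ofFn]
  rfl

/-- The normalisation of `W[j; k]` turns the factors of `slot` into binomial coefficients. -/
lemma wfac_mul_slot_coeff (k : EisWt) (j : Fin (k.1 - 1)) (t : ℂ) :
    ((wfac (.inl ⟨k, j⟩) : ℝ) : ℂ)
      * (((k.1 - 2).factorial : ℂ) ^ 2 / ((k.1 - 2 - j.1).factorial : ℂ) / t)
      = ((k.1 - 1).factorial : ℂ) * (-1) ^ j.1 * ((k.1 - 2).choose j.1 : ℂ) / t := by
  have hk := k.2.2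
  have hj := j.2
  have h1 : ((k.1 - 2).choose j.1 : ℂ)
      = ((k.1 - 2).factorial : ℂ) / (j.1.factorial * (k.1 - 2 - j.1).factorial) :=
    Nat.cast_choose ℂ (by omega)
  have h2 : ((k.1 - 1).factorial : ℂ) = ((k.1 : ℂ) - 1) * ((k.1 - 2).factorial : ℂ) := by
    obtain ⟨n, hn⟩ := Nat.exists_eq_add_of_le' hk
    rw [hn, show n + 4 - 1 = n + 3 by omega, show n + 4 - 2 = n + 2 by omega,
      Nat.factorial_succ]
    push_cast
    ring
  have h3 := factorial_ne j.1
  have h4 := factorial_ne (k.1 - 2 - j.1)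
  have h5 : ((wfac (.inl ⟨k, j⟩) : ℝ) : ℂ)
      = (-1) ^ j.1 * ((k.1 : ℂ) - 1) / (j.1.factorial : ℂ) := by
    rw [wfac]; push_cast; rfl
  rw [h5, h1, h2]
  by_cases ht : t = 0
  · simp [ht]
  · field_simp

lemma basisPoly_eq {n : ℕ} (k : Fin n → EisWt) (j : ∀ i, Fin ((k i).1 - 1)) :
    basisPoly k j = algebraMap ℂ (BPoly n) (wordFac (revWord k j) : ℂ)
      * ∏ i, slot (k i, MvPolynomial.X (i, 0), MvPolynomial.X (i, 1)) (j i) := by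
  rw [wordFac_revWord, basisPoly, Complex.ofReal_prod, map_prod, ← Finset.prod_mul_distrib]
  refine Finset.prod_congr rfl fun i _ => ?_
  rw [slot, ← wfac_mul_slot_coeff, MvPolynomial.algebraMap_eq, map_mul]
  ring

/-- The variables `(k_n, X_n, Y_n), …, (k_1, X_1, Y_1)`. -/
def polyArg {n : ℕ} (k : Fin n → EisWt) : List (EisWt × BPoly n × BPoly n) :=
  argList k (fun i => MvPolynomial.X (i, 0)) fun i => MvPolynomial.X (i, 1)

/-- The triples `(k_n, X_n, Y_n), …, (k_1, X_1, Y_1)` for real values of the variables. -/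
def realArg {n : ℕ} (k : Fin n → EisWt) (v : Fin n → Fin 2 → ℝ) : List (EisWt × ℂ × ℂ) :=
  argList k (fun i => (v i 0 : ℂ)) fun i => (v i 1 : ℂ)

lemma map_argList {B C : Type} (f : B → C) {n : ℕ} (k : Fin n → EisWt) (X Y : Fin n → B) :
    (argList k X Y).map (fun x => (x.1, f x.2.1, f x.2.2))
      = argList k (fun i => f (X i)) fun i => f (Y i) := by
  rw [argList, List.map_reverse, List.map_ofFn]; rfl

lemma eval_Psi_polyArg {n : ℕ} (k : Fin n → EisWt) (S : Series ℂ) (x : Fin n × Fin 2 → ℂ) :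
    MvPolynomial.eval x (Psi (polyArg k) S)
      = Psi (argList k (fun i => x (i, 0)) fun i => x (i, 1)) S := by
  have := map_Psi (MvPolynomial.aeval x) (polyArg k) S
  have h : ∀ p : BPoly n, MvPolynomial.aeval x p = MvPolynomial.eval x p := fun p => by
    rw [← MvPolynomial.coe_aeval_eq_eval]; rfl
  rw [← h, this, polyArg, map_argList]
  simp

lemma Psi_polyArg_at {n : ℕ} (k : Fin n → EisWt) (S : Series ℂ) (v : Fin n → Fin 2 → ℝ) :
    (Psi (polyArg k) S).at v = Psi (realArg k v) S := eval_Psi_polyArg k S _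

/-- A sum over words against the polynomials `ℬ_j`. -/
lemma sum_basisPoly {n : ℕ} (k : Fin n → EisWt) (S : Series ℂ) :
    ∑ j : ∀ i, Fin ((k i).1 - 1), MvPolynomial.C (S (revWord k j)) * basisPoly k j
      = Psi (polyArg k) fun w => (wordFac w : ℂ) * S w := by
  rw [polyArg, ← sum_revWord]
  refine Finset.sum_congr rfl fun j _ => ?_
  rw [basisPoly_eq, MvPolynomial.algebraMap_eq, map_mul]
  ring

lemma sum_basisPoly_at {n : ℕ} (k : Fin n → EisWt) (S : Series ℂ) (v : Fin n → Fin 2 → ℝ) :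
    ∑ j : ∀ i, Fin ((k i).1 - 1), (basisPoly k j).at v * S (revWord k j)
      = Psi (realArg k v) fun w => (wordFac w : ℂ) * S w := by
  rw [← Psi_polyArg_at, ← sum_basisPoly, BPoly.at, map_sum]
  refine Finset.sum_congr rfl fun j _ => ?_
  rw [map_mul, MvPolynomial.eval_C, BPoly.at, mul_comm]

lemma SeriesData.csvPoly_eq (D : SeriesData) (r : ℂ) {n : ℕ} (k : Fin n → EisWt) :
    D.csvPoly r k = MvPolynomial.C r * Psi (polyArg k) D.cSeries := by
  rw [SeriesData.csvPoly, sum_basisPoly]; rfl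

lemma SeriesData.csvPoly_at (D : SeriesData) (r : ℂ) {n : ℕ} (k : Fin n → EisWt)
    (v : Fin n → Fin 2 → ℝ) : (D.csvPoly r k).at v = r * Psi (realArg k v) D.cSeries := by
  rw [D.csvPoly_eq, BPoly.at, map_mul, MvPolynomial.eval_C, ← Psi_polyArg_at, BPoly.at]

/-- Homogeneity of the polynomials attached to series. -/
lemma Psi_polyArg_isHom {n : ℕ} (k : Fin n → EisWt) (S : Series ℂ) :
    (Psi (polyArg k) S).IsHom k := by
  rw [← mem_homSub, polyArg, ← sum_revWord]
  refine Submodule.sum_mem _ fun j _ => ?_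
  rw [mul_comm, ← Algebra.smul_def]
  refine Submodule.smul_mem _ _ ?_
  have h : ∏ i, slot (k i, (MvPolynomial.X (i, 0) : BPoly n), MvPolynomial.X (i, 1)) (j i)
      = MvPolynomial.monomial (∑ i, (Finsupp.single (i, 0) ((k i).1 - 2 - (j i).1)
        + Finsupp.single (i, 1) (j i).1)) (∏ i, (((k i).1 - 2).factorial : ℂ) ^ 2
        / (((k i).1 - 2 - (j i).1).factorial : ℂ) / twoPiI ^ (j i).1) := by
    rw [MvPolynomial.monomial_sum_index, map_prod, ← Finset.prod_mul_distrib]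
    refine Finset.prod_congr rfl fun i _ => ?_
    rw [slot, MvPolynomial.algebraMap_eq, MvPolynomial.X_pow_eq_monomial,
      MvPolynomial.X_pow_eq_monomial, mul_assoc, MvPolynomial.monomial_mul, add_comm, one_mul]
  rw [h, mem_homSub]
  intro m hm i
  have hm' := Finset.mem_singleton.1 (MvPolynomial.support_monomial_subset hm)
  rw [hm']
  have hj := (j i).2
  simp only [Finsupp.coe_finsetSum, Finset.sum_apply, Finsupp.coe_add, Pi.add_apply,
    Finsupp.single_apply, Prod.mk.injEq]
  simp
  omega

lemma SeriesData.hasDD_Psi_iEqv (D : SeriesData) (L : List (EisWt × ℂ × ℂ)) :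
    HasDD (fun τ => Psi L (D.iEqv τ)) (fun τ => -Psi L (conc (D.iEqv τ) (D.omegaPlus τ)))
      (fun τ => -Psi L (conc (D.omegaPsi τ) (D.iEqv τ))) := by
  have key : ∀ (L : List (EisWt × ℂ × ℂ)) (S a b : ℍ → Series ℂ),
      (∀ w, HasDD (fun τ => S τ w) (fun τ => a τ w) (fun τ => b τ w)) →
      HasDD (fun τ => Psi L (S τ)) (fun τ => Psi L (a τ)) (fun τ => Psi L (b τ)) := by
    intro L
    induction L with
    | nil => exact fun S a b h => h []
    | cons x L ih =>
      intro S a b h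
      refine (HasDD.sum Finset.univ fun j _ => (ih (fun τ u => S τ (⟨x.1, j⟩ :: u))
        (fun τ u => a τ (⟨x.1, j⟩ :: u)) (fun τ u => b τ (⟨x.1, j⟩ :: u))
        fun w => h _).const_mul (slot x j)).congr ?_ ?_ ?_ <;>
      exact fun τ => Psi_cons x L _
  refine (key L D.iEqv _ _ D.hasDD_iEqv).congr (fun _ => rfl) (fun τ => ?_) (fun τ => ?_)
  · rw [← map_neg]; rfl
  · rw [← map_neg]; rfl

lemma SeriesData.cuspVal_Psi_iEqv (D : SeriesData) (L : List (EisWt × ℂ × ℂ)) :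
    CuspVal (fun τ => Psi L (D.iEqv τ)) (Psi L D.cSeries) := by
  have key : ∀ (L : List (EisWt × ℂ × ℂ)) (S : ℍ → Series ℂ) (s : Series ℂ),
      (∀ w, CuspVal (fun τ => S τ w) (s w)) →
      CuspVal (fun τ => Psi L (S τ)) (Psi L s) := by
    intro L
    induction L with
    | nil => exact fun S s h => h []
    | cons x L ih =>
      intro S s h
      refine (CuspVal.sum Finset.univ fun j _ => (ih (fun τ u => S τ (⟨x.1, j⟩ :: u))
        (fun u => s (⟨x.1, j⟩ :: u)) fun w => h _).const_mul (slot x j)).congr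
        (fun τ => Psi_cons x L _) (Psi_cons x L _)
  exact key L D.iEqv _ D.cuspVal_iEqv

end Expansion

/-! ### Equivariance of the generating series -/

section EquivariantSeries

variable {D : SeriesData}

lemma Letter.flip_flip (a : Letter) : a.flip.flip = a := by
  obtain ⟨k, j⟩ := a
  simp [Letter.flip]

lemma flipWord_flipWord (w : List Letter) : flipWord (flipWord w) = w := by
  rw [flipWord, flipWord, List.map_reverse, List.reverse_reverse, List.map_map]
  refine (List.map_congr_left fun a _ => ?_).trans (List.map_id _)
  exact a.flip_flip

/-- The reversal `R` in `𝕁^eqv` and the one in the definition of `β^eqv` cancel. -/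
lemma SeriesData.betaEqv_eq (P : List Letter) (τ : ℍ) :
    D.betaEqv P τ = D.uConj τ P / (wordFac P : ℂ) := by
  rw [SeriesData.betaEqv, SeriesData.jEqv, reversal, flipWord_flipWord]
  have h : ((wordFac P : ℝ) : ℂ) * (P.map fun a =>
      ((a.2.1.factorial : ℂ) / ((a.1.1 - a.2.1 - 2).factorial : ℂ))).prod
      = (P.map fun a => (-1 : ℂ) ^ a.2.1 * ((a.1.1 : ℂ) - 1)
      / ((a.1.1 - a.2.1 - 2).factorial : ℂ)).prod := by
    have e : ((wordFac P : ℝ) : ℂ) = (P.map fun a => ((wfac (.inl a) : ℝ) : ℂ)).prod := by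
      rw [wordFac, ← Complex.ofRealHom_eq_coe, map_list_prod, List.map_map]
      rfl
    rw [e, ← List.prod_map_mul]
    congr 1
    refine List.map_congr_left fun a _ => ?_
    have := factorial_ne a.2.1
    simp only [wfac, XLetter.idx, XLetter.wt]
    push_cast
    field_simp
  have hne : (P.map fun a =>
      ((a.2.1.factorial : ℂ) / ((a.1.1 - a.2.1 - 2).factorial : ℂ))).prod ≠ 0 := by
    refine List.prod_ne_zero ?_
    simp [Nat.factorial_ne_zero]
  have hw : ((wordFac P : ℝ) : ℂ) ≠ 0 := Complex.ofReal_ne_zero.2 (wordFac_ne_zero P)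
  rw [← h]
  field_simp

/-- The torus acts on words by their weights. -/
lemma Psi_scale {u : ℂ} (hu : u ≠ 0) (L : List (EisWt × ℂ × ℂ)) {S S' : Series ℂ}
    (h : ∀ w : List Letter, w.length = L.length →
      S' w = (w.map fun a => u ^ ((a.1.1 : ℤ) - 2 * (a.2.1 : ℤ) - 2)).prod * S w) :
    Psi (L.map fun x => (x.1, x.2.1 / u, x.2.2 * u)) S' = Psi L S := by
  induction L generalizing S S' with
  | nil => rw [List.map_nil, Psi_nil, Psi_nil, h [] rfl]; simp
  | cons x L ih =>
    rw [List.map_cons, Psi_cons, Psi_cons]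
    refine Finset.sum_congr rfl fun j _ => ?_
    have hS := ih (S := u ^ ((x.1.1 : ℤ) - 2 * (j.1 : ℤ) - 2) • fun w => S (⟨x.1, j⟩ :: w))
      (S' := fun w => S' (⟨x.1, j⟩ :: w)) fun w hw => by
        rw [h _ (by simp [hw])]
        simp only [List.map_cons, List.prod_cons, Pi.smul_apply, smul_eq_mul]
        ring
    rw [hS, map_smul, smul_eq_mul, ← mul_assoc]
    congr 1
    have hj : j.1 < x.1.1 - 1 := j.2
    have hk := x.1.2.2
    have e : u ^ ((x.1.1 : ℤ) - 2 * (j.1 : ℤ) - 2) * u ^ j.1 = u ^ (x.1.1 - 2 - j.1) := by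
      rw [← zpow_natCast, ← zpow_natCast, ← zpow_add₀ hu]
      congr 1
      omega
    simp only [slot, div_pow, mul_pow]
    rw [← e]
    have h1 := pow_ne_zero j.1 hu
    have h2 := zpow_ne_zero ((x.1.1 : ℤ) - 2 * (j.1 : ℤ) - 2) hu
    field_simp

/-- The action of `SL(2, ℤ)` on the arguments `(X, Y)`. -/
def actArg (γ : SL(2, ℤ)) (x : EisWt × ℂ × ℂ) : EisWt × ℂ × ℂ :=
  (x.1, ((γ 0 0 : ℤ) : ℂ) * x.2.1 + ((γ 0 1 : ℤ) : ℂ) * x.2.2,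
    ((γ 1 0 : ℤ) : ℂ) * x.2.1 + ((γ 1 1 : ℤ) : ℂ) * x.2.2)

/-- The change of variables in `Psi_uConj` intertwines the modular action with the torus element
given by `c τ̄ + d`, from which the automorphy factor arises for `β^eqv`. -/
lemma modularArg_actArg (γ : SL(2, ℤ)) (τ : ℍ) (x : EisWt × ℂ × ℂ) :
    modularArg (γ • τ) (actArg γ x) = ((modularArg τ x).1,
      (modularArg τ x).2.1 / (((γ 1 0 : ℤ) : ℂ) * conj (τ : ℂ) + ((γ 1 1 : ℤ) : ℂ)),
      (modularArg τ x).2.2 * (((γ 1 0 : ℤ) : ℂ) * conj (τ : ℂ) + ((γ 1 1 : ℤ) : ℂ))) := by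
  have h1 := smul_mul_denom γ τ
  have h2 := smul_conj_mul_denom γ τ
  have h3 := det_complex γ
  have h4 := eta_smul γ τ
  rw [eta_eq, eta_eq] at h4
  have h5 := denom_ne γ τ
  have h6 := denom_conj_ne γ τ
  obtain ⟨k, X, Y⟩ := x
  simp only [modularArg, actArg]
  set a := ((γ 0 0 : ℤ) : ℂ)
  set b := ((γ 0 1 : ℤ) : ℂ)
  set c := ((γ 1 0 : ℤ) : ℂ)
  set d := ((γ 1 1 : ℤ) : ℂ)
  have h7 : ((γ • τ : ℍ).im : ℂ) ≠ 0 := Complex.ofReal_ne_zero.2 (γ • τ).im_ne_zero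
  have h8 : (τ.im : ℂ) ≠ 0 := Complex.ofReal_ne_zero.2 τ.im_ne_zero
  have hpi : (Real.pi : ℂ) ≠ 0 := Complex.ofReal_ne_zero.2 Real.pi_ne_zero
  have h9 : ((γ • τ : ℍ).im : ℂ) * ((c * τ + d) * (c * conj (τ : ℂ) + d)) = τ.im := by
    have := mul_ne_zero (two_ne_zero (α := ℂ)) Complex.I_ne_zero
    apply mul_left_cancel₀ this
    linear_combination h4
  refine Prod.ext rfl (Prod.ext ?_ ?_)
  · simp only
    rw [eq_div_iff h6]
    linear_combination (-(c * X + d * Y)) * h2 + (X - conj (τ : ℂ) * Y) * h3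
  · simp only
    have h10 : (a * X + b * Y - ((γ • τ : ℍ) : ℂ) * (c * X + d * Y)) * (c * τ + d)
        = X - τ * Y := by
      linear_combination (-(c * X + d * Y)) * h1 + (X - (τ : ℂ) * Y) * h3
    rw [← h10, ← h9]
    field_simp

/-- Equivariance of the generating series, in the bookkeeping variables. -/
lemma SeriesData.Equivariant.Psi_iEqv (hD : D.Equivariant) (L : List (EisWt × ℂ × ℂ))
    (hL : L.length ≤ 3) (γ : SL(2, ℤ)) (τ : ℍ) :
    Psi (L.map (actArg γ)) (D.iEqv (γ • τ)) = Psi L (D.iEqv τ) := by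
  rw [← D.Psi_uConj, ← D.Psi_uConj, List.map_map]
  have h := Psi_scale (denom_conj_ne γ τ) (L.map (modularArg τ)) (S := D.uConj τ)
    (S' := D.uConj (γ • τ)) fun w hw => by
      have h1 := hD w (by rw [hw, List.length_map]; exact hL) γ τ
      have h0 : ((wordFac w : ℝ) : ℂ) ≠ 0 := Complex.ofReal_ne_zero.2 (wordFac_ne_zero w)
      rw [D.betaEqv_eq, D.betaEqv_eq] at h1
      field_simp at h1
      linear_combination h1
  rw [← h, List.map_map]
  congr 2
  exact List.map_congr_left fun x _ => modularArg_actArg γ τ x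

lemma realArg_actXY {n : ℕ} (k : Fin n → EisWt) (γ : SL(2, ℤ)) (v : Fin n → Fin 2 → ℝ) :
    realArg k (fun i => actXY γ (v i)) = (realArg k v).map (actArg γ) := by
  rw [realArg, realArg, argList, argList, List.map_reverse, List.map_ofFn]
  congr 2
  funext i
  simp [actArg, actXY]

/-- In depth at most three the generating series gives equivariant functions. -/
lemma SeriesData.Equivariant.isEquivariant (hD : D.Equivariant) {n : ℕ} (hn : n ≤ 3)
    (k : Fin n → EisWt) : IsEquivariant fun v τ => Psi (realArg k v) (D.iEqv τ) := by
  intro γ v τ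
  simp only [realArg_actXY]
  exact hD.Psi_iEqv _ (by rw [realArg, argList_length]; exact hn) γ τ

/-- The expansion in `β^eqv` is the generating series itself. -/
lemma SeriesData.betaExpansion_eq (k : Fin 3 → EisWt) (v : Fin 3 → Fin 2 → ℝ) (τ : ℍ) :
    D.betaExpansion k v τ = -(1 / 64) * Psi (realArg k v) (D.iEqv τ) := by
  rw [SeriesData.betaExpansion, ← D.Psi_uConj, mul_assoc, Finset.mul_sum]
  congr 1
  have h : (realArg k v).map (modularArg τ)
      = argList k (fun i => (v i 0 : ℂ) - conj (τ : ℂ) * (v i 1 : ℂ))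
        fun i => twoPiI * ((v i 0 : ℂ) - τ * (v i 1 : ℂ)) / (4 * Real.pi * τ.im : ℂ) := by
    rw [realArg, argList, List.map_reverse, List.map_ofFn]; rfl
  rw [h, ← sum_revWord]
  refine Finset.sum_congr rfl fun j _ => ?_
  have hw : ((wordFac (revWord k j) : ℝ) : ℂ) ≠ 0 :=
    Complex.ofReal_ne_zero.2 (wordFac_ne_zero _)
  rw [D.betaEqv_eq, ← mul_assoc, ← Finset.prod_mul_distrib]
  have h2 : (∏ i, (((k i).1 - 1).factorial : ℂ) * ((((k i).1 - 2).choose (j i).1 : ℂ)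
        / (-4 * (Real.pi * τ.im : ℂ)) ^ (j i).1
        * ((v i 0 : ℂ) - τ * (v i 1 : ℂ)) ^ (j i).1
        * ((v i 0 : ℂ) - conj (τ : ℂ) * (v i 1 : ℂ)) ^ ((k i).1 - 2 - (j i).1)))
      = (wordFac (revWord k j) : ℂ) * ∏ i, slot (k i, (v i 0 : ℂ) - conj (τ : ℂ) * (v i 1 : ℂ),
        twoPiI * ((v i 0 : ℂ) - τ * (v i 1 : ℂ)) / (4 * Real.pi * τ.im : ℂ)) (j i) := by
    rw [wordFac_revWord, Complex.ofReal_prod, ← Finset.prod_mul_distrib]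
    refine Finset.prod_congr rfl fun i _ => ?_
    have h3 := wfac_mul_slot_coeff (k i) (j i) (twoPiI ^ (j i).1)
    have h0 := pow_ne_zero (j i).1 twoPiI_ne_zero
    simp only [slot, Algebra.algebraMap_self_apply]
    rw [← mul_assoc, ← mul_assoc, ← mul_assoc, ← mul_assoc, ← mul_assoc, h3,
      show (-4 * Real.pi * τ.im : ℂ) = (-1) * (4 * Real.pi * τ.im) by ring, mul_pow, div_pow,
      mul_pow twoPiI]
    have h1 : ((-1 : ℂ) ^ (j i).1) ^ 2 = 1 := by rw [← pow_mul, mul_comm, pow_mul]; simp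
    have h4 : ((-1 : ℂ) ^ (j i).1) ≠ 0 := pow_ne_zero _ (by norm_num)
    have h5 : (τ.im : ℂ) ≠ 0 := Complex.ofReal_ne_zero.2 τ.im_ne_zero
    have hpi : (Real.pi : ℂ) ≠ 0 := Complex.ofReal_ne_zero.2 Real.pi_ne_zero
    field_simp
    rw [h1, mul_one]
  rw [h2, Algebra.algebraMap_self_apply, mul_comm ((wordFac _ : ℝ) : ℂ), mul_assoc,
    ← mul_div_assoc, mul_div_cancel_left₀ _ hw]

end EquivariantSeries

/-! ### Eichler integrals of the Eisenstein series -/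

section Eichler

open scoped ArithmeticFunction.sigma

variable (k : EisWt)

/-- The coefficient of `q^n` in `G_k`. -/
def eisCoeff (n : ℕ) : ℂ :=
  2 * ((-2 * Real.pi * Complex.I) ^ k.1 / ((k.1 - 1).factorial : ℂ)) * (σ (k.1 - 1) n : ℂ)

/-- The `r`-fold primitive of `G_k` without its constant term. -/
def eisTail (r : ℕ) (τ : ℍ) : ℂ :=
  ∑' n : ℕ+, eisCoeff k n / (twoPiI * n) ^ r * Complex.exp (twoPiI * n * τ)

lemma eisG_eq_tail (τ : ℍ) : eisG k.1 τ = 2 * riemannZeta k.1 + eisTail k 0 τ := by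
  have hk := k.2.2
  rw [eisG, tsum_eisSummand_eq_tsum_sigma_mul_cexp_pow (by omega) k.2.1,
    eisTail, ← tsum_mul_left]
  congr 1
  refine tsum_congr fun n => ?_
  rw [← Complex.exp_nat_mul, eisCoeff, pow_zero, div_one, mul_assoc]
  rw [show ((n : ℕ) : ℂ) * (2 * Real.pi * Complex.I * τ) = twoPiI * (n : ℕ) * τ by
    rw [twoPiI]; ring]
  ring

lemma norm_exp_twoPiI (n : ℕ) (z : ℂ) :
    ‖Complex.exp (twoPiI * n * z)‖ = Real.exp (-(2 * Real.pi * z.im)) ^ n := by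
  rw [Complex.norm_exp, ← Real.exp_nat_mul, twoPiI]
  congr 1
  simp
  ring

lemma summable_eisCoeff {ρ : ℝ} (h0 : 0 ≤ ρ) (h1 : ρ < 1) :
    Summable fun n : ℕ+ => ‖eisCoeff k n‖ * ρ ^ (n : ℕ) := by
  have hk := k.2.2
  have h := summable_pow_mul_geometric_of_norm_lt_one k.1 (r := ρ) (by
    rwa [Real.norm_of_nonneg h0])
  have h2 := (h.comp_injective PNat.coe_injective).mul_left
    ‖2 * ((-2 * Real.pi * Complex.I) ^ k.1 / ((k.1 - 1).factorial : ℂ))‖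
  refine Summable.of_nonneg_of_le (fun n => by positivity) (fun n => ?_) h2
  rw [eisCoeff, norm_mul, mul_assoc]
  refine mul_le_mul_of_nonneg_left ?_ (norm_nonneg _)
  refine mul_le_mul_of_nonneg_right ?_ (pow_nonneg h0 _)
  rw [Complex.norm_natCast]
  exact_mod_cast (ArithmeticFunction.sigma_le_pow_succ (k.1 - 1) n).trans_eq (by
    congr 1; omega)

lemma norm_coeff_div_le (r : ℕ) (n : ℕ+) :
    ‖eisCoeff k n / (twoPiI * n) ^ r‖ ≤ ‖eisCoeff k n‖ := by
  rw [norm_div, norm_pow]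
  refine div_le_self (norm_nonneg _) (one_le_pow₀ ?_)
  rw [norm_mul, Complex.norm_natCast]
  have h1 : 1 ≤ ‖twoPiI‖ := by
    rw [twoPiI]
    simp only [norm_mul, Complex.norm_ofNat, Complex.norm_real, Complex.norm_I, mul_one]
    rw [Real.norm_of_nonneg Real.pi_pos.le]
    linarith [Real.pi_gt_three]
  have h2 : (1 : ℝ) ≤ (n : ℕ) := by exact_mod_cast n.pos
  nlinarith

lemma summable_eisTail (r : ℕ) {z : ℂ} (hz : 0 < z.im) :
    Summable fun n : ℕ+ => eisCoeff k n / (twoPiI * n) ^ r * Complex.exp (twoPiI * n * z) := by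
  refine Summable.of_norm_bounded (summable_eisCoeff k (Real.exp_pos (-(2 * Real.pi * z.im))).le
    (Real.exp_lt_one_iff.2 (by have := Real.pi_pos; simp; positivity))) fun n => ?_
  rw [norm_mul, norm_exp_twoPiI]
  exact mul_le_mul_of_nonneg_right (norm_coeff_div_le k r n) (by positivity)

lemma hasDD_eisTail (r : ℕ) : HasDD (eisTail k (r + 1)) (eisTail k r) (fun _ => 0) := by
  refine HasDD.of_hasDerivAt fun τ => ?_
  set δ : ℝ := τ.im / 2 with hδ
  have hδ0 : 0 < δ := half_pos τ.im_pos
  have hopen : IsOpen {z : ℂ | δ < z.im} := isOpen_lt continuous_const Complex.continuous_im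
  have hmem : (τ : ℂ) ∈ {z : ℂ | δ < z.im} := half_lt_self τ.im_pos
  have h := hasDerivAt_tsum_of_isPreconnected (t := {z : ℂ | δ < z.im})
    (g := fun (n : ℕ+) (z : ℂ) => eisCoeff k n / (twoPiI * n) ^ (r + 1)
      * Complex.exp (twoPiI * n * z))
    (g' := fun n z => eisCoeff k n / (twoPiI * n) ^ r * Complex.exp (twoPiI * n * z))
    (summable_eisCoeff k (Real.exp_pos (-(2 * Real.pi * δ))).le
      (Real.exp_lt_one_iff.2 (by have := Real.pi_pos; simp; positivity))) hopen
    (convex_halfSpace_im_gt δ).isPreconnected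
    (fun n z _ => by
      have h1 : HasDerivAt (fun z : ℂ => twoPiI * n * z) (twoPiI * n) z := by
        simpa using (hasDerivAt_id z).const_mul (twoPiI * n)
      refine (h1.cexp.const_mul _).congr_deriv ?_
      have : twoPiI * ((n : ℕ) : ℂ) ≠ 0 := mul_ne_zero twoPiI_ne_zero
        (Nat.cast_ne_zero.2 n.ne_zero)
      rw [pow_succ]
      field_simp
      exact mul_div_cancel_right₀ _ twoPiI_ne_zero)
    (fun n z hz => by
      rw [norm_mul, norm_exp_twoPiI]
      refine mul_le_mul (norm_coeff_div_le k r n) ?_ (by positivity) (norm_nonneg _)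
      refine pow_le_pow_left₀ (Real.exp_pos _).le (Real.exp_le_exp.2 ?_) _
      have hz' : δ < z.im := hz
      nlinarith [Real.pi_pos])
    hmem (summable_eisTail k (r + 1) τ.im_pos) hmem
  refine h.congr_of_eventuallyEq ?_
  filter_upwards [UpperHalfPlane.isOpen_upperHalfPlaneSet.mem_nhds τ.2] with z hz
  rw [ofComplex_im_pos hz]
  rfl

lemma rayTame_eisTail (r : ℕ) : RayTame (eisTail k r) 0 := by
  have hs := summable_eisCoeff k (Real.exp_pos (-(2 * Real.pi * (1 / 2)))).le
    (Real.exp_lt_one_iff.2 (by have := Real.pi_pos; simp; positivity))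
  refine ⟨Real.pi, Real.pi_pos, IsBigO.of_bound
    (∑' n : ℕ+, ‖eisCoeff k n‖ * Real.exp (-(2 * Real.pi * (1 / 2))) ^ (n : ℕ)) ?_⟩
  filter_upwards [eventually_ge_atTop 1] with t ht
  have him : 0 < ((t : ℂ) * Complex.I).im := by simp; linarith
  rw [ofComplex_im_pos him, Polynomial.eval_zero, sub_zero, Real.norm_of_nonneg
    (Real.exp_pos _).le, ← tsum_mul_right]
  have hs' := hs.mul_right (Real.exp (-Real.pi * t))
  refine tsum_of_norm_bounded hs'.hasSum fun n => ?_
  rw [norm_mul, norm_exp_twoPiI]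
  refine (mul_le_mul (norm_coeff_div_le k r n) ?_ (by positivity) (norm_nonneg _)).trans_eq
    (mul_assoc _ _ _).symm
  rw [← Real.exp_nat_mul, ← Real.exp_nat_mul, ← Real.exp_add]
  refine Real.exp_le_exp.2 ?_
  have h2 : (1 : ℝ) ≤ (n : ℕ) := by exact_mod_cast n.pos
  have h3 : ((⟨(t : ℂ) * Complex.I, him⟩ : ℍ) : ℂ).im = t := by simp
  rw [h3]
  nlinarith [Real.pi_pos, mul_nonneg (sub_nonneg.2 h2) (sub_nonneg.2 ht)]

/-- `∫_τ^{i∞} τ^j G_k dτ`. -/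
def eisMoment (j : ℕ) : ℍ → ℂ := regInt (fun τ => (τ : ℂ) ^ j * eisG k.1 τ) (fun _ => 0)

lemma eisMoment_isReg (j : ℕ) :
    IsRegPrimitive (fun τ => (τ : ℂ) ^ j * eisG k.1 τ) (fun _ => 0) (eisMoment k j) :=
  (((tame_pow j).mul (tame_eisG k)).regInt ((hol_pow j).mul (hol_eisG k))).1

/-- `∫_τ^{i∞} (X - τ Y)^{k-2} G_k dτ`. -/
def eichler (X Y : ℂ) (τ : ℍ) : ℂ := ∑ j ∈ Finset.range (k.1 - 2 + 1),
  X ^ (k.1 - 2 - j) * (-Y) ^ j * ((k.1 - 2).choose j : ℂ) * eisMoment k j τ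

lemma sub_pow_expand (X Y τ : ℂ) (m : ℕ) : (X - τ * Y) ^ m
    = ∑ j ∈ Finset.range (m + 1), X ^ (m - j) * (-Y) ^ j * (m.choose j : ℂ) * τ ^ j := by
  rw [sub_eq_add_neg, add_comm, add_pow]
  refine Finset.sum_congr rfl fun j _ => ?_
  rw [← mul_neg, mul_pow]
  ring

lemma eichler_isReg (X Y : ℂ) :
    IsRegPrimitive (fun τ => (X - τ * Y) ^ (k.1 - 2) * eisG k.1 τ) (fun _ => 0)
      (eichler k X Y) := by
  refine (IsRegPrimitive.sum (Finset.range (k.1 - 2 + 1)) fun j _ =>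
    (eisMoment_isReg k j).const_mul (X ^ (k.1 - 2 - j) * (-Y) ^ j
      * ((k.1 - 2).choose j : ℂ))).congr (fun _ => rfl) (fun τ => ?_) (fun τ => by simp)
  rw [sub_pow_expand, Finset.sum_mul]
  exact Finset.sum_congr rfl fun j _ => by ring

lemma eichler_mul (c X Y : ℂ) (τ : ℍ) :
    eichler k (c * X) (c * Y) τ = c ^ (k.1 - 2) * eichler k X Y τ := by
  rw [eichler, eichler, Finset.mul_sum]
  refine Finset.sum_congr rfl fun j hj => ?_
  have : j ≤ k.1 - 2 := by have := Finset.mem_range.1 hj; omega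
  rw [← mul_neg, mul_pow, mul_pow, ← pow_sub_mul_pow c this]
  ring

/-- The Eichler integral through the iterated primitives of `G_k`. -/
lemma eichler_eq_tail {m : ℕ} (hm : k.1 = m + 2) (X : ℂ) (τ : ℍ) : eichler k X 1 τ
    = (2 * riemannZeta k.1 / ((m + 1 : ℕ) : ℂ)) * ((X - τ) ^ (m + 1) - X ^ (m + 1))
      - ∑ r ∈ Finset.range (m + 1), (m.descFactorial r : ℂ) * ((X - τ) ^ (m - r)
        * eisTail k (r + 1) τ) := by
  have hm0 : ((m + 1 : ℕ) : ℂ) ≠ 0 := Nat.cast_ne_zero.2 m.succ_ne_zero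
  have key : ∀ X : ℂ, IsRegPrimitive (fun τ => (X - τ * 1) ^ m * eisG k.1 τ) (fun _ => 0)
      (fun τ => (2 * riemannZeta k.1 / ((m + 1 : ℕ) : ℂ)) * ((X - τ * 1) ^ (m + 1) - X ^ (m + 1))
        - ∑ r ∈ Finset.range (m + 1), (m.descFactorial r : ℂ) * ((X - τ * 1) ^ (m - r)
          * eisTail k (r + 1) τ)) := by
    intro X
    have hX : HasDD (fun τ => X - (τ : ℂ) * 1) (fun _ => -1) (fun _ => 0) :=
      ((HasDD.const X).sub HasDD.coe).congr (fun _ => by ring) (fun _ => by ring)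
        (fun _ => by ring)
    have h1 := (((hX.pow (m + 1)).sub (HasDD.const (X ^ (m + 1)))).const_mul
      (2 * riemannZeta k.1 / ((m + 1 : ℕ) : ℂ))).sub
      (HasDD.sum (Finset.range (m + 1)) fun r _ =>
        ((hX.pow (m - r)).mul (hasDD_eisTail k r)).const_mul (m.descFactorial r : ℂ))
    have hXr : ∃ P : Polynomial ℂ, RayTame (fun τ => X - (τ : ℂ) * 1) P ∧ P.eval 0 = X := by
      refine ⟨Polynomial.C X - Polynomial.C Complex.I * Polynomial.X, ?_, by simp⟩
      refine ⟨1, one_pos, (isBigO_zero _ _).congr' ?_ EventuallyEq.rfl⟩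
      filter_upwards [eventually_gt_atTop 0] with t ht
      rw [ofComplex_im_pos (show 0 < ((t : ℂ) * Complex.I).im by simpa using ht)]
      simp
      ring
    have hpow : ∀ n : ℕ, CuspVal (fun τ => (X - (τ : ℂ) * 1) ^ n) (X ^ n) := by
      intro n
      induction n with
      | zero => exact (CuspVal.const 1).congr (fun _ => by simp) (by simp)
      | succ n ih => exact (ih.mul hXr).congr (fun _ => pow_succ _ _) (pow_succ _ _)
    have h2 : CuspVal (fun τ => (2 * riemannZeta k.1 / ((m + 1 : ℕ) : ℂ))
        * ((X - (τ : ℂ) * 1) ^ (m + 1) + -X ^ (m + 1))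
        + ∑ r ∈ Finset.range (m + 1), (-(m.descFactorial r : ℂ)) * ((X - (τ : ℂ) * 1) ^ (m - r)
          * eisTail k (r + 1) τ)) _ :=
      (((hpow (m + 1)).add (CuspVal.const (-X ^ (m + 1)))).const_mul _).add
        (CuspVal.sum _ fun r _ => ((hpow (m - r)).mul
          ⟨0, rayTame_eisTail k (r + 1), Polynomial.eval_zero⟩).const_mul _)
    refine CuspVal.isReg (h2.congr (fun τ => ?_) (by simp)) (h1.congr (fun _ => rfl)
      (fun τ => ?_) (fun τ => by simp))
    · rw [sub_eq_add_neg _ (∑ r ∈ _, _), ← Finset.sum_neg_distrib, sub_eq_add_neg _ (X ^ _)]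
      simp only [neg_mul]
    · -- the sum telescopes
      have e1 : ∑ r ∈ Finset.range (m + 1), (m.descFactorial r : ℂ) *
          (((m - r : ℕ) : ℂ) * (X - τ * 1) ^ (m - r - 1) * -1 * eisTail k (r + 1) τ
            + (X - τ * 1) ^ (m - r) * eisTail k r τ)
          = ∑ r ∈ Finset.range (m + 1), ((m.descFactorial r : ℂ) * ((X - τ * 1) ^ (m - r)
            * eisTail k r τ) - (m.descFactorial (r + 1) : ℂ) * ((X - τ * 1) ^ (m - (r + 1))
            * eisTail k (r + 1) τ)) := by
        refine Finset.sum_congr rfl fun r _ => ?_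
        rw [Nat.descFactorial_succ, Nat.sub_sub]
        push_cast
        ring
      rw [e1, Finset.sum_range_sub', eisG_eq_tail, Nat.descFactorial_eq_zero_iff_lt.2 m.lt_succ_self,
        Nat.descFactorial_zero, Nat.add_sub_cancel]
      simp only [Nat.cast_zero, Nat.cast_one, sub_zero, tsub_zero, zero_mul]
      field_simp
      ring
  have h1 := eichler_isReg k X 1
  rw [show k.1 - 2 = m by omega] at h1
  simpa only [mul_one] using congrFun (h1.unique (key X)) τ

/-- At `X = τ` the Eichler integral is the `(k-1)`-fold primitive of `G_k`. -/
lemma eichler_diag {m : ℕ} (hm : k.1 = m + 2) (τ : ℍ) : eichler k τ 1 τ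
    = -(2 * riemannZeta k.1) * (τ : ℂ) ^ (m + 1) / ((m + 1 : ℕ) : ℂ)
      - (m.factorial : ℂ) * eisTail k (m + 1) τ := by
  rw [eichler_eq_tail k hm, Finset.sum_range_succ, Finset.sum_eq_zero]
  · simp [Nat.descFactorial_self]
    ring
  · intro r hr
    have : m - r ≠ 0 := by have := Finset.mem_range.1 hr; omega
    simp [this]

end Eichler

/-! ### Behaviour of the Eichler integral at `0` -/

section Lambert

open scoped ArithmeticFunction.sigma

lemma tsum_tsum_eq_tsum_divisors {F : ℕ → ℕ → ℂ}
    (hF : Summable fun c : ℕ+ × ℕ+ => F c.1 c.2) :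
    ∑' d : ℕ+, ∑' e : ℕ+, F d e
      = ∑' n : ℕ+, ∑ x ∈ (n : ℕ).divisorsAntidiagonal, F x.1 x.2 := by
  rw [← hF.tsum_prod, ← sigmaAntidiagonalEquivProd.tsum_eq]
  refine (Summable.tsum_sigma (sigmaAntidiagonalEquivProd.summable_iff.2 hF)).trans
    (tsum_congr fun n => ?_)
  rw [tsum_fintype]
  exact Finset.sum_attach _ fun x : ℕ × ℕ => F x.1 x.2

/-- `Σ_n σ_r(n) n^{-r} q^n` as a Lambert series. -/
lemma tsum_sigma_div_eq {r : ℕ} {q : ℝ} (h0 : 0 ≤ q) (h1 : q < 1) :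
    ∑' n : ℕ+, (σ r n : ℂ) / (n : ℂ) ^ r * (q : ℂ) ^ (n : ℕ)
      = ∑' d : ℕ+, 1 / (d : ℂ) ^ r * ((q : ℂ) ^ (d : ℕ) / (1 - (q : ℂ) ^ (d : ℕ))) := by
  have hq : ‖(q : ℂ)‖ < 1 := by rwa [Complex.norm_real, Real.norm_of_nonneg h0]
  have hF : Summable fun c : ℕ+ × ℕ+ =>
      1 / ((c.1 : ℕ) : ℂ) ^ r * (q : ℂ) ^ ((c.1 : ℕ) * (c.2 : ℕ)) := by
    refine Summable.of_norm_bounded (summable_prod_mul_pow 0 hq).norm fun c => ?_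
    rw [pow_zero, one_mul, norm_mul]
    refine mul_le_of_le_one_left (norm_nonneg _) ?_
    rw [norm_div, norm_one, norm_pow, Complex.norm_natCast]
    refine div_le_one_of_le₀ (one_le_pow₀ ?_) (by positivity)
    exact_mod_cast c.1.pos
  have h2 : ∑' d : ℕ+, ∑' e : ℕ+, 1 / ((d : ℕ) : ℂ) ^ r * (q : ℂ) ^ ((d : ℕ) * (e : ℕ))
      = ∑' n : ℕ+, ∑ x ∈ (n : ℕ).divisorsAntidiagonal, 1 / (x.1 : ℂ) ^ r
        * (q : ℂ) ^ (x.1 * x.2) :=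
    tsum_tsum_eq_tsum_divisors (F := fun d e => 1 / (d : ℂ) ^ r * (q : ℂ) ^ (d * e)) hF
  have h3 : ∀ n : ℕ+, ∑ x ∈ (n : ℕ).divisorsAntidiagonal, 1 / (x.1 : ℂ) ^ r
      * (q : ℂ) ^ (x.1 * x.2) = (σ r n : ℂ) / (n : ℂ) ^ r * (q : ℂ) ^ (n : ℕ) := by
    intro n
    rw [ArithmeticFunction.sigma_apply, Nat.cast_sum, Finset.sum_div, Finset.sum_mul,
      ← Nat.sum_divisorsAntidiagonal' (fun _ e => ((e ^ r : ℕ) : ℂ) / (n : ℂ) ^ r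
        * (q : ℂ) ^ (n : ℕ))]
    refine Finset.sum_congr rfl fun x hx => ?_
    obtain ⟨hx1, hx2⟩ := Nat.mem_divisorsAntidiagonal.1 hx
    have ha : (x.1 : ℂ) ≠ 0 := Nat.cast_ne_zero.2 fun h => hx2 (by rw [← hx1, h, zero_mul])
    have hb : (x.2 : ℂ) ≠ 0 := Nat.cast_ne_zero.2 fun h => hx2 (by rw [← hx1, h, mul_zero])
    rw [hx1, ← hx1]
    push_cast
    field_simp
    ring
  have h4 : ∀ d : ℕ+, ∑' e : ℕ+, 1 / ((d : ℕ) : ℂ) ^ r * (q : ℂ) ^ ((d : ℕ) * (e : ℕ))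
      = 1 / ((d : ℕ) : ℂ) ^ r * ((q : ℂ) ^ (d : ℕ) / (1 - (q : ℂ) ^ (d : ℕ))) := by
    intro d
    have hd : ‖(q : ℂ) ^ (d : ℕ)‖ < 1 := by
      rw [norm_pow]; exact pow_lt_one₀ (norm_nonneg _) hq d.ne_zero
    have h5 := tsum_pnat_eq_tsum_succ (f := fun e => ((q : ℂ) ^ (d : ℕ)) ^ e)
    rw [tsum_mul_left]
    simp only [pow_mul]
    rw [h5]
    simp only [pow_succ]
    rw [tsum_mul_right, tsum_geometric_of_norm_lt_one hd]
    congr 1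
    rw [div_eq_inv_mul]
  rw [tsum_congr h3, tsum_congr h4] at h2
  exact h2.symm

variable (k : EisWt)

/-- The `(k-1)`-fold primitive of the non-constant part of `G_k` is, on the imaginary axis, a
Lambert series. -/
lemma eisTail_lambert {t : ℝ} (ht : 0 < t) (τ : ℍ) (hτ : (τ : ℂ) = t * Complex.I) :
    ((k.1 - 2).factorial : ℂ) * eisTail k (k.1 - 1) τ
      = 4 * Real.pi * Complex.I / ((k.1 - 1 : ℕ) : ℂ)
        * ∑' d : ℕ+, 1 / (d : ℂ) ^ (k.1 - 1)
          * ((1 / (Real.exp (2 * Real.pi * t * d) - 1) : ℝ) : ℂ) := by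
  have hk := k.2.2
  obtain ⟨m, hm⟩ : ∃ m, k.1 = m + 2 := ⟨k.1 - 2, by omega⟩
  have hm1 : k.1 - 1 = m + 1 := by omega
  have hm2 : k.1 - 2 = m := by omega
  have hpt : 0 < 2 * Real.pi * t := by have := Real.pi_pos; positivity
  have h := tsum_sigma_div_eq (r := k.1 - 1) (Real.exp_pos (-(2 * Real.pi * t))).le
    (Real.exp_lt_one_iff.2 (by linarith))
  have e1 : ∀ n : ℕ+, ((k.1 - 2).factorial : ℂ) * (eisCoeff k n / (twoPiI * n) ^ (k.1 - 1)
      * Complex.exp (twoPiI * n * τ)) = 4 * Real.pi * Complex.I / ((k.1 - 1 : ℕ) : ℂ)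
      * ((σ (k.1 - 1) n : ℂ) / (n : ℂ) ^ (k.1 - 1)
        * ((Real.exp (-(2 * Real.pi * t)) : ℝ) : ℂ) ^ (n : ℕ)) := by
    intro n
    have e2 : Complex.exp (twoPiI * n * τ)
        = ((Real.exp (-(2 * Real.pi * t)) : ℝ) : ℂ) ^ (n : ℕ) := by
      rw [Complex.ofReal_exp, ← Complex.exp_nat_mul, hτ, twoPiI]
      congr 1
      push_cast
      linear_combination (2 * Real.pi * n * t : ℂ) * Complex.I_mul_I
    have e3 : (-2 * Real.pi * Complex.I) ^ k.1 = twoPiI ^ (m + 2) := by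
      rw [← hm, ← k.2.1.neg_pow, twoPiI]; congr 1; ring
    have hn : ((n : ℕ) : ℂ) ≠ 0 := Nat.cast_ne_zero.2 n.ne_zero
    have hf := factorial_ne m
    have h0 := twoPiI_ne_zero
    have hc : ((m + 1 : ℕ) : ℂ) ≠ 0 := Nat.cast_ne_zero.2 m.succ_ne_zero
    rw [e2, eisCoeff, e3, hm1, hm2, Nat.factorial_succ, mul_pow]
    push_cast at hc ⊢
    field_simp
    rw [twoPiI]
    ring
  rw [eisTail, ← tsum_mul_left, tsum_congr e1, tsum_mul_left, h]
  congr 1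
  refine tsum_congr fun d => ?_
  congr 1
  rw [← Complex.ofReal_pow, ← Complex.ofReal_one, ← Complex.ofReal_sub, ← Complex.ofReal_div]
  congr 1
  have hd : (0 : ℝ) < (d : ℕ) := by exact_mod_cast d.pos
  have h1 : Real.exp (-(2 * Real.pi * t)) ^ (d : ℕ) = (Real.exp (2 * Real.pi * t * d))⁻¹ := by
    rw [← Real.exp_nat_mul, ← Real.exp_neg]; congr 1; ring
  rw [h1]
  have h2 := Real.exp_pos (2 * Real.pi * t * d)
  have h3 : 1 < Real.exp (2 * Real.pi * t * d) := Real.one_lt_exp_iff.2 (by positivity)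
  have h4 : Real.exp (2 * Real.pi * t * d) - 1 ≠ 0 := by linarith
  field_simp

/-- `1/(e^x - 1) = 1/x - 1/2 + o(1)`. -/
lemma tendsto_inv_exp_sub_one :
    Tendsto (fun x : ℝ => 1 / (Real.exp x - 1) - 1 / x) (𝓝[>] 0) (𝓝 (-(1 / 2))) := by
  have h2 := (Real.exp_sub_sum_range_succ_isLittleO_pow 2).tendsto_div_nhds_zero
  have h1 := (Real.exp_sub_sum_range_succ_isLittleO_pow 1).tendsto_div_nhds_zero
  have hne : ∀ᶠ x in 𝓝[>] (0 : ℝ), x ≠ 0 ∧ Real.exp x - 1 ≠ 0 := by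
    filter_upwards [self_mem_nhdsWithin] with x hx
    have hx' : (0 : ℝ) < x := hx
    exact ⟨hx'.ne', by linarith [Real.one_lt_exp_iff.2 hx']⟩
  have h := ((h2.add_const (1 / 2 : ℝ)).mono_left (nhdsWithin_le_nhds (s := Set.Ioi 0))).neg.div
    ((h1.add_const 1).mono_left nhdsWithin_le_nhds) (by norm_num)
  refine (h.congr' ?_).trans (by norm_num)
  filter_upwards [hne] with x hx
  obtain ⟨hx, hx'⟩ := hx
  simp only [Finset.sum_range_succ, Finset.sum_range_zero, Nat.factorial, pow_zero, pow_one]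
  have h3 : (Real.exp x - (0 + 1 / ((1 : ℕ) : ℝ) + x / ((0 + 1) * 1 : ℕ))) / x + 1
      = (Real.exp x - 1) / x := by
    push_cast; field_simp; ring
  simp only [Pi.div_apply]
  rw [h3]
  push_cast
  field_simp
  ring

lemma abs_inv_exp_sub_one_le {x : ℝ} (hx : 0 < x) : |1 / (Real.exp x - 1) - 1 / x| ≤ 1 := by
  have h1 : x + 1 ≤ Real.exp x := Real.add_one_le_exp x
  have h2 : 1 - x ≤ Real.exp (-x) := by linarith [Real.add_one_le_exp (-x)]
  have h3 : 0 < Real.exp x - 1 := by linarith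
  have h4 : (1 - x) * Real.exp x ≤ 1 := by
    calc (1 - x) * Real.exp x ≤ Real.exp (-x) * Real.exp x :=
          mul_le_mul_of_nonneg_right h2 (Real.exp_pos x).le
      _ = 1 := by rw [← Real.exp_add]; simp
  rw [abs_le]
  constructor
  · -- `1/x ≤ 1 + 1/(e^x - 1)` amounts to `(1 - x) e^x ≤ 1`
    have : 1 / x ≤ 1 + 1 / (Real.exp x - 1) := by
      rw [show 1 + 1 / (Real.exp x - 1) = Real.exp x / (Real.exp x - 1) by field_simp; ring,
        div_le_div_iff₀ hx h3]
      nlinarith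
    linarith
  · have : 1 / (Real.exp x - 1) ≤ 1 / x := one_div_le_one_div_of_le hx (by linarith)
    linarith

end Lambert

section PeriodS

lemma zeta_eq_tsum_pnat {r : ℕ} (hr : 1 < r) :
    riemannZeta r = ∑' d : ℕ+, 1 / ((d : ℕ) : ℂ) ^ r := by
  rw [zeta_nat_eq_tsum_of_gt_one hr]
  refine (tsum_subtype_eq_of_support_subset (s := {n : ℕ | 0 < n}) fun n hn => ?_).symm
  rcases Nat.eq_zero_or_pos n with rfl | h
  · simp [show r ≠ 0 by omega] at hn
  · exact h

lemma summable_pnat_inv_pow {r : ℕ} (hr : 1 < r) :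
    Summable fun d : ℕ+ => 1 / ((d : ℕ) : ℝ) ^ r :=
  (Real.summable_one_div_nat_pow.2 hr).comp_injective PNat.coe_injective

/-- Behaviour of the Lambert series at `0`. -/
lemma tendsto_lambert {r : ℕ} (hr : 1 < r) :
    Tendsto (fun t : ℝ => ∑' d : ℕ+, 1 / ((d : ℕ) : ℂ) ^ r
      * ((1 / (Real.exp (2 * Real.pi * t * d) - 1) : ℝ) : ℂ)
        - riemannZeta ((r + 1 : ℕ) : ℂ) / (2 * Real.pi * t)) (𝓝[>] 0)
      (𝓝 (-(1 / 2) * riemannZeta r)) := by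
  have hb : ∀ (d : ℕ+) (x : ℝ), 0 < x →
      ‖1 / ((d : ℕ) : ℂ) ^ r * ((1 / (Real.exp x - 1) - 1 / x : ℝ) : ℂ)‖
        ≤ 1 / ((d : ℕ) : ℝ) ^ r := by
    intro d x hx
    rw [norm_mul, norm_div, norm_one, norm_pow, Complex.norm_natCast, Complex.norm_real]
    exact mul_le_of_le_one_right (by positivity) (abs_inv_exp_sub_one_le hx)
  have hpos : ∀ t : ℝ, 0 < t → ∀ d : ℕ+, 0 < 2 * Real.pi * t * (d : ℕ) := fun t ht d => by
    have := Real.pi_pos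
    have : (0 : ℝ) < (d : ℕ) := by exact_mod_cast d.pos
    positivity
  have h := tendsto_tsum_of_dominated_convergence (𝓕 := 𝓝[>] (0 : ℝ))
    (f := fun t (d : ℕ+) => 1 / ((d : ℕ) : ℂ) ^ r * ((1 / (Real.exp (2 * Real.pi * t * d) - 1)
      - 1 / (2 * Real.pi * t * d) : ℝ) : ℂ))
    (g := fun d : ℕ+ => 1 / ((d : ℕ) : ℂ) ^ r * ((-(1 / 2) : ℝ) : ℂ))
    (summable_pnat_inv_pow hr) (fun d => by
      refine Tendsto.const_mul _ ((Complex.continuous_ofReal.tendsto _).comp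
        (tendsto_inv_exp_sub_one.comp ?_))
      refine tendsto_nhdsWithin_iff.2 ⟨?_, ?_⟩
      · have : Continuous fun t : ℝ => 2 * Real.pi * t * ((d : ℕ) : ℝ) := by fun_prop
        exact (this.tendsto' 0 0 (by simp)).mono_left nhdsWithin_le_nhds
      · filter_upwards [self_mem_nhdsWithin] with t ht using hpos t ht d)
    (by filter_upwards [self_mem_nhdsWithin] with t ht d using hb d _ (hpos t ht d))
  have hl : ∑' d : ℕ+, 1 / ((d : ℕ) : ℂ) ^ r * ((-(1 / 2) : ℝ) : ℂ)
      = -(1 / 2) * riemannZeta r := by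
    rw [tsum_mul_right, ← zeta_eq_tsum_pnat hr]
    push_cast
    ring
  rw [hl] at h
  refine h.congr' ?_
  filter_upwards [self_mem_nhdsWithin] with t ht
  have hs1 : Summable fun d : ℕ+ => 1 / ((d : ℕ) : ℂ) ^ r * ((1 / (Real.exp (2 * Real.pi * t * d)
      - 1) - 1 / (2 * Real.pi * t * d) : ℝ) : ℂ) :=
    Summable.of_norm_bounded (summable_pnat_inv_pow hr) fun d => hb d _ (hpos t ht d)
  have hs2 : Summable fun d : ℕ+ => 1 / ((d : ℕ) : ℂ) ^ (r + 1) := by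
    refine Summable.of_norm_bounded (summable_pnat_inv_pow (r := r + 1) (by omega)) fun d => ?_
    rw [norm_div, norm_one, norm_pow, Complex.norm_natCast]
  have ht' : (t : ℂ) ≠ 0 := Complex.ofReal_ne_zero.2 (ne_of_gt ht)
  have hpi : (Real.pi : ℂ) ≠ 0 := Complex.ofReal_ne_zero.2 Real.pi_ne_zero
  have e1 : ∀ d : ℕ+, 1 / ((d : ℕ) : ℂ) ^ r * ((1 / (Real.exp (2 * Real.pi * t * d) - 1) : ℝ) : ℂ)
      = 1 / ((d : ℕ) : ℂ) ^ r * ((1 / (Real.exp (2 * Real.pi * t * d) - 1)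
        - 1 / (2 * Real.pi * t * d) : ℝ) : ℂ)
        + 1 / ((d : ℕ) : ℂ) ^ (r + 1) * (1 / (2 * Real.pi * t)) := by
    intro d
    have hd : ((d : ℕ) : ℂ) ≠ 0 := Nat.cast_ne_zero.2 d.ne_zero
    rw [Complex.ofReal_sub, mul_sub, pow_succ]
    push_cast
    field_simp
    ring
  rw [tsum_congr e1, hs1.tsum_add (hs2.mul_right _), tsum_mul_right,
    ← zeta_eq_tsum_pnat (by omega)]
  ring

variable (k : EisWt)

lemma coe_S_smul (τ : ℍ) : ((ModularGroup.S • τ : ℍ) : ℂ) = -1 / τ := by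
  rw [UpperHalfPlane.modular_S_smul]
  change (-(τ : ℂ))⁻¹ = _
  rw [neg_div, one_div, inv_neg]

lemma eisG_S_smul (τ : ℍ) : eisG k.1 (ModularGroup.S • τ) = (τ : ℂ) ^ k.1 * eisG k.1 τ := by
  have h := SlashInvariantForm.slash_action_eqn'' (eisForm k)
    (show Matrix.SpecialLinearGroup.mapGL ℝ ModularGroup.S ∈ 𝒮ℒ from ⟨_, rfl⟩) τ
  have hd : UpperHalfPlane.denom (Matrix.SpecialLinearGroup.mapGL ℝ ModularGroup.S) τ = τ := by
    exact ModularGroup.denom_S τ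
  rw [hd, zpow_natCast, eisForm_apply, eisForm_apply] at h
  exact h

/-- The period polynomial of the Eichler integral with respect to `S`; it does not depend on `τ`. -/
def eichlerS (X Y : ℂ) (τ : ℍ) : ℂ := eichler k (-Y) X (ModularGroup.S • τ) - eichler k X Y τ

lemma hasDD_eichler (X Y : ℂ) :
    HasDD (eichler k X Y) (fun τ => -((X - τ * Y) ^ (k.1 - 2) * eisG k.1 τ)) (fun _ => 0) :=
  (eichler_isReg k X Y).hasDD.congr (fun _ => rfl) (fun _ => rfl) (fun _ => by simp)

/-- Both terms of `eichlerS` have the same differential, by the modularity of `G_k`. -/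
lemma eichlerS_eq (X Y : ℂ) (τ σ : ℍ) : eichlerS k X Y τ = eichlerS k X Y σ := by
  have hk := k.2.2
  have h1 : HasDD (fun τ => eichler k (-Y) X (ModularGroup.S • τ))
      (fun τ => -((X - τ * Y) ^ (k.1 - 2) * eisG k.1 τ)) (fun _ => 0) := by
    refine HasDD.of_hasDerivAt fun τ => ?_
    have hτ := τ.ne_zero
    have h2 := (hasDD_eichler k (-Y) X).hasDerivAt (ModularGroup.S • τ)
    simp only [coe_S_smul] at h2
    have h3 : HasDerivAt (fun z : ℂ => -1 / z) (1 / (τ : ℂ) ^ 2) τ := by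
      refine ((hasDerivAt_inv hτ).const_mul (-1 : ℂ)).congr_deriv ?_ |>.congr_of_eventuallyEq ?_
      · field_simp
      · exact Eventually.of_forall fun z => div_eq_mul_inv _ _
    have h4 := HasDerivAt.comp (τ : ℂ) (h₂ := fun z : ℂ => eichler k (-Y) X (UpperHalfPlane.ofComplex z))
      (h := fun z : ℂ => -1 / z) h2 h3
    refine (h4.congr_deriv ?_).congr_of_eventuallyEq ?_
    · rw [eisG_S_smul]
      have e : (X - τ * Y) ^ (k.1 - 2) = (-Y - -1 / (τ : ℂ) * X) ^ (k.1 - 2)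
          * (τ : ℂ) ^ (k.1 - 2) := by
        rw [← mul_pow]
        congr 1
        field_simp
        ring
      rw [e]
      have e2 : (τ : ℂ) ^ k.1 = (τ : ℂ) ^ (k.1 - 2) * (τ : ℂ) ^ 2 := by
        rw [← pow_add]; congr 1; omega
      rw [e2]
      field_simp
    · filter_upwards [UpperHalfPlane.isOpen_upperHalfPlaneSet.mem_nhds τ.2] with z hz
      rw [ofComplex_im_pos hz, Function.comp]
      congr 1
      rw [← UpperHalfPlane.ofComplex_apply (ModularGroup.S • _), coe_S_smul]
  exact ((h1.sub (hasDD_eichler k X Y)).congr (fun _ => rfl) (fun _ => by ring)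
    (fun _ => by ring)).eq_const τ σ

lemma continuous_eichler (τ : ℍ) : Continuous fun p : ℂ × ℂ => eichler k p.1 p.2 τ := by
  unfold eichler
  fun_prop

/-- The value at `(0, 1)` is found by letting `τ` tend to `0`, where the poles of the Lambert series
cancel. -/
lemma eichlerS_zero_one (τ : ℍ) : eichlerS k 0 1 τ
    = -(2 * Real.pi * Complex.I) * riemannZeta ((k.1 - 1 : ℕ) : ℂ) / ((k.1 - 1 : ℕ) : ℂ) := by
  obtain ⟨m, hm⟩ : ∃ m, k.1 = m + 2 := ⟨k.1 - 2, by have := k.2.2; omega⟩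
  have hm2 : 2 ≤ m := by have := k.2.2; omega
  have hm1 : k.1 - 1 = m + 1 := by omega
  have hmz : ((m + 1 : ℕ) : ℂ) ≠ 0 := Nat.cast_ne_zero.2 m.succ_ne_zero
  have hpi : (Real.pi : ℂ) ≠ 0 := Complex.ofReal_ne_zero.2 Real.pi_ne_zero
  -- the value on the imaginary axis
  have hval : ∀ t : ℝ, 0 < t → eichlerS k (t * Complex.I) 1 τ
      = 4 * Real.pi * Complex.I / ((m + 1 : ℕ) : ℂ) * (∑' d : ℕ+, 1 / ((d : ℕ) : ℂ) ^ (m + 1)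
        * ((1 / (Real.exp (2 * Real.pi * t * d) - 1) : ℝ) : ℂ)
          - riemannZeta ((m + 1 + 1 : ℕ) : ℂ) / (2 * Real.pi * t))
        + (2 * riemannZeta k.1 / ((m + 1 : ℕ) : ℂ)) * ((t : ℂ) * Complex.I) ^ (m + 1)
        - (m.factorial : ℂ) * ((t : ℂ) * Complex.I) ^ m
          * eisTail k (m + 1) (UpperHalfPlane.ofComplex ((t⁻¹ : ℝ) * Complex.I)) := by
    intro t ht
    have htz : (t : ℂ) ≠ 0 := Complex.ofReal_ne_zero.2 ht.ne'
    set σ : ℍ := ⟨t * Complex.I, by simpa using ht⟩ with hσ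
    have hσc : (σ : ℂ) = t * Complex.I := rfl
    have hS : ((ModularGroup.S • σ : ℍ) : ℂ) = ((t⁻¹ : ℝ) : ℂ) * Complex.I := by
      rw [coe_S_smul, hσc]
      push_cast
      field_simp
      simp
    have hS' : UpperHalfPlane.ofComplex ((t⁻¹ : ℝ) * Complex.I) = ModularGroup.S • σ := by
      rw [← hS, UpperHalfPlane.ofComplex_apply]
    have hL := eisTail_lambert k ht σ hσc
    rw [hm1, show k.1 - 2 = m by omega] at hL
    have h1 : eichler k (-1) (t * Complex.I) (ModularGroup.S • σ)
        = ((t : ℂ) * Complex.I) ^ m * eichler k (ModularGroup.S • σ : ℍ) 1 (ModularGroup.S • σ) := by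
      have := eichler_mul k (t * Complex.I) (ModularGroup.S • σ : ℍ) 1 (ModularGroup.S • σ)
      rw [show k.1 - 2 = m by omega] at this
      rw [← this, mul_one, hS]
      congr 1
      push_cast
      field_simp
      simp
    have h2 : eichler k (t * Complex.I) 1 σ = eichler k σ 1 σ := rfl
    have hI : Complex.I ^ m * Complex.I ^ m = 1 := by
      obtain ⟨s, hs⟩ : Even m := by
        have := k.2.1; rw [hm] at this
        simpa [Nat.even_add] using this
      rw [← pow_add, hs, show s + s + (s + s) = 4 * s by ring, pow_mul, Complex.I_pow_four, one_pow]
    rw [eichlerS_eq k _ _ τ σ, eichlerS, h1, h2, eichler_diag k hm, eichler_diag k hm, hS', hL,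
      hS, hσc, hm]
    push_cast
    rw [show (m : ℂ) + 1 + 1 = m + 2 by ring]
    simp only [mul_pow, inv_pow, pow_succ]
    generalize (∑' d : ℕ+, 1 / ((d : ℕ) : ℂ) ^ (m + 1) * _ : ℂ) = L
    push_cast at hmz
    field_simp
    linear_combination (-(4 * riemannZeta (m + 2) * Complex.I)) * hI
  have hlim : Tendsto (fun t : ℝ => eichlerS k (t * Complex.I) 1 τ) (𝓝[>] 0)
      (𝓝 (4 * Real.pi * Complex.I / ((m + 1 : ℕ) : ℂ)
        * (-(1 / 2) * riemannZeta ((m + 1 : ℕ) : ℂ))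
        + (2 * riemannZeta k.1 / ((m + 1 : ℕ) : ℂ)) * 0 - (m.factorial : ℂ) * 0 * 0)) := by
    have hpow : ∀ n : ℕ, n ≠ 0 →
        Tendsto (fun t : ℝ => ((t : ℂ) * Complex.I) ^ n) (𝓝[>] 0) (𝓝 0) := fun n hn => by
      have : Continuous fun t : ℝ => ((t : ℂ) * Complex.I) ^ n := by fun_prop
      exact (this.tendsto' 0 0 (by simp [hn])).mono_left nhdsWithin_le_nhds
    have htail := (rayTame_eisTail k (m + 1)).cusp
    simp only [Polynomial.eval_zero, sub_zero] at htail
    refine Tendsto.congr' ?_ ((((tendsto_lambert (r := m + 1) (by omega)).const_mul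
      (4 * Real.pi * Complex.I / ((m + 1 : ℕ) : ℂ))).add ((hpow (m + 1) (by omega)).const_mul
        (2 * riemannZeta k.1 / ((m + 1 : ℕ) : ℂ)))).sub (((hpow m (by omega)).const_mul
        (m.factorial : ℂ)).mul (htail.comp
          tendsto_inv_nhdsGT_zero)))
    filter_upwards [self_mem_nhdsWithin] with t ht
    exact (hval t ht).symm
  have hlim2 : Tendsto (fun t : ℝ => eichlerS k (t * Complex.I) 1 τ) (𝓝[>] 0)
      (𝓝 (eichlerS k 0 1 τ)) := by
    have hc : Continuous fun t : ℝ => eichlerS k (t * Complex.I) 1 τ := by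
      unfold eichlerS
      exact ((continuous_eichler k (ModularGroup.S • τ)).comp
        (f := fun t : ℝ => ((-1 : ℂ), (t : ℂ) * Complex.I)) (by fun_prop)).sub
        ((continuous_eichler k τ).comp (f := fun t : ℝ => ((t : ℂ) * Complex.I, (1 : ℂ)))
          (by fun_prop))
    exact (hc.tendsto' 0 _ (by simp)).mono_left nhdsWithin_le_nhds
  rw [tendsto_nhds_unique hlim2 hlim, hm1]
  ring

end PeriodS

/-! ### Depth one -/

section DepthOne

lemma conj_riemannZeta {r : ℕ} (hr : 1 < r) : conj (riemannZeta r) = riemannZeta r := by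
  rw [zeta_nat_eq_tsum_of_gt_one hr, Complex.conj_tsum]
  refine tsum_congr fun n => ?_
  simp

section Eichler

variable (k : EisWt)

lemma eisTail_T_smul (r : ℕ) (τ : ℍ) : eisTail k r (ModularGroup.T • τ) = eisTail k r τ := by
  refine tsum_congr fun n => ?_
  rw [coe_T_smul, mul_add, Complex.exp_add, mul_one]
  have : Complex.exp (twoPiI * n) = 1 := by
    rw [twoPiI, mul_comm]; exact Complex.exp_nat_mul_two_pi_mul_I n
  rw [this, mul_one]

lemma eichler_T_smul {m : ℕ} (hm : k.1 = m + 2) (X : ℂ) (τ : ℍ) :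
    eichler k (X + 1) 1 (ModularGroup.T • τ) - eichler k X 1 τ
      = (2 * riemannZeta k.1 / ((m + 1 : ℕ) : ℂ)) * (X ^ (m + 1) - (X + 1) ^ (m + 1)) := by
  rw [eichler_eq_tail k hm, eichler_eq_tail k hm, coe_T_smul]
  simp only [eisTail_T_smul, add_sub_add_right_eq_sub]
  ring

/-- `∫_{τ̄}^{-i∞} (X - τ̄ Y)^{k-2} Ḡ_k dτ̄`. -/
def eichlerBar (X Y : ℂ) (τ : ℍ) : ℂ := conj (eichler k (conj X) (conj Y) τ)

lemma eichlerBar_isReg (X Y : ℂ) :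
    IsRegPrimitive (fun _ => 0) (fun τ => (X - conj (τ : ℂ) * Y) ^ (k.1 - 2) * conj (eisG k.1 τ))
      (eichlerBar k X Y) :=
  (eichler_isReg k (conj X) (conj Y)).conj.congr (fun _ => rfl) (fun _ => by simp)
    (fun _ => by simp)

/-- `(k-1)!/(2πi)^{k-1}`. -/
def eisB : ℂ := ((k.1 - 1).factorial : ℂ) / twoPiI ^ (k.1 - 1)

lemma conj_twoPiI : conj twoPiI = -twoPiI := by
  simp [twoPiI, map_ofNat]

lemma conj_eisB : conj (eisB k) = -eisB k := by
  have hk : Odd (k.1 - 1) := by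
    have := k.2.2
    exact Nat.Even.sub_odd (by omega) k.2.1 odd_one
  rw [eisB, map_div₀, map_pow, conj_twoPiI, hk.neg_pow, Complex.conj_natCast, div_neg]

lemma formG_eq (v : Fin 2 → ℝ) (τ : ℍ) : formG k v τ
    = eisB k / 2 * ((((v 0 : ℝ) : ℂ) - τ * ((v 1 : ℝ) : ℂ)) ^ (k.1 - 2) * eisG k.1 τ) := by
  rw [formG, eisB]
  have := pow_ne_zero (k.1 - 1) twoPiI_ne_zero
  field_simp

end Eichler

variable (D : SeriesData)

lemma SeriesData.iEqv_nil (τ : ℍ) : D.iEqv τ [] = 1 := by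
  rw [SeriesData.iEqv, conc_nil, conc_nil, D.isSubst_psi.subst_nil, SeriesData.iMinus,
    (isSubst_cuspSubst D.isCuspSeries_eMinus).subst_nil, SeriesData.iPlus,
    (isSubst_cuspSubst D.isCuspSeries_ePlus).subst_nil, SeriesData.cSeries, D.csv_nil]
  simp [iterIntTilde, iterInt_nil, wordFac]

lemma cuspSubst_nil {e : Eigenform → Series ℝ} (he : IsCuspSeries e) (x : XLetter) :
    SeriesData.cuspSubst e x [] = 0 := (isSubst_cuspSubst he).nil x

lemma SeriesData.omegaPlus_nil (τ : ℍ) : D.omegaPlus τ [] = 0 := by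
  rw [SeriesData.omegaPlus]
  simp [cuspSubst_nil D.isCuspSeries_ePlus]

lemma SeriesData.omegaMinus_nil (τ : ℍ) : D.omegaMinus τ [] = 0 := by
  rw [SeriesData.omegaMinus]
  simp [cuspSubst_nil D.isCuspSeries_eMinus]

lemma SeriesData.omegaPsi_nil (τ : ℍ) : D.omegaPsi τ [] = 0 := by
  rw [SeriesData.omegaPsi, D.isSubst_psi.subst_nil, D.omegaMinus_nil]

/-- A sum over the letters of the extended alphabet on a word: only the word itself and the cuspidal
letters contribute. -/
lemma finsum_cuspSubst_singleton {e : Eigenform → Series ℝ} (he : IsCuspSeries e)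
    (κ : XLetter → ℂ) (a : Letter) :
    ∑ᶠ x, κ x * SeriesData.cuspSubst e x [a] = κ (.inl a) := by
  rw [finsum_eq_single _ (Sum.inl a)]
  · simp [SeriesData.cuspSubst, single]
  · rintro (b | d) h
    · have : [a] ≠ [b] := fun h' => h (by simp_all)
      simp [SeriesData.cuspSubst, single, this]
    · simp [SeriesData.cuspSubst, toC, he.nil]

/-- In words of length at least two only the cuspidal letters contribute. -/
lemma finsum_cuspSubst_long {e : Eigenform → Series ℝ} (κ : XLetter → ℂ) (w : List Letter)
    (hw : 2 ≤ w.length) :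
    ∑ᶠ x, κ x * SeriesData.cuspSubst e x w
      = ∑ᶠ d : CuspLetter, κ (.inr d) * toC ((adE0 (R := ℝ))^[d.2.1] (e d.1)) w := by
  have h := finsum_mem_range (f := fun x => κ x * SeriesData.cuspSubst e x w)
    (Sum.inr_injective (α := Letter) (β := CuspLetter))
  refine Eq.trans ?_ h
  rw [finsum_mem_def]
  refine finsum_congr fun x => ?_
  rcases x with a | d
  · have : w ≠ [a] := fun h' => by simp [h'] at hw
    simp [SeriesData.cuspSubst, single, this]
  · simp

lemma SeriesData.omegaPlus_singleton (τ : ℍ) (a : Letter) :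
    D.omegaPlus τ [a] = kernelW (.inl a) τ :=
  finsum_cuspSubst_singleton D.isCuspSeries_ePlus _ a

lemma SeriesData.omegaMinus_singleton (τ : ℍ) (a : Letter) :
    D.omegaMinus τ [a] = kernelWTilde (.inl a) τ :=
  finsum_cuspSubst_singleton D.isCuspSeries_eMinus _ a

lemma SeriesData.subst_psi_singleton (T : Series ℂ) (a : Letter) :
    subst (fun a => toC (D.psi a)) T [a] = T [a] := by
  rw [D.isSubst_psi.subst_peel, finsum_eq_single _ a]
  · simp [conc_cons, conc_nil, unit, toC, D.psi_nil, D.psi_self, D.isSubst_psi.subst_nil]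
  · intro b hb
    simp [conc_cons, conc_nil, toC, D.psi_nil, D.psi_ne b a hb.symm]

lemma SeriesData.omegaPsi_singleton (τ : ℍ) (a : Letter) :
    D.omegaPsi τ [a] = kernelWTilde (.inl a) τ := by
  rw [SeriesData.omegaPsi, D.subst_psi_singleton, D.omegaMinus_singleton]

section Values

variable (k : EisWt) (X Y : ℂ)

lemma Psi_singleton (S : Series ℂ) : Psi [(k, X, Y)] S
    = ∑ j : Fin (k.1 - 1), slot (k, X, Y) j * S [⟨k, j⟩] := by
  rw [Psi_cons]; rfl

lemma slot_mul_wfac (j : Fin (k.1 - 1)) : slot (k, X, Y) j * ((wfac (.inl ⟨k, j⟩) : ℝ) : ℂ)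
    = ((k.1 - 1).factorial : ℂ) * (-1) ^ j.1 * ((k.1 - 2).choose j.1 : ℂ) / twoPiI ^ j.1
      * (Y ^ j.1 * X ^ (k.1 - 2 - j.1)) := by
  rw [← wfac_mul_slot_coeff, slot, Algebra.algebraMap_self_apply]
  ring

lemma twoPiI_zpow (j : Fin (k.1 - 1)) :
    twoPiI ^ (1 + (j.1 : ℤ) - (k.1 : ℤ)) = twoPiI ^ j.1 / twoPiI ^ (k.1 - 1) := by
  have hk := k.2.2
  rw [← zpow_natCast, ← zpow_natCast, ← zpow_sub₀ twoPiI_ne_zero]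
  congr 1
  omega

lemma SeriesData.Psi_singleton_omegaPlus (τ : ℍ) : Psi [(k, X, Y)] (D.omegaPlus τ)
    = eisB k * ((X - τ * Y) ^ (k.1 - 2) * eisG k.1 τ) := by
  have hk := k.2.2
  have h1 : ∀ j : Fin (k.1 - 1), slot (k, X, Y) j * D.omegaPlus τ [⟨k, j⟩]
      = (fun j : ℕ => eisB k * ((X ^ (k.1 - 2 - j) * (-Y) ^ j * ((k.1 - 2).choose j : ℂ)
        * (τ : ℂ) ^ j) * eisG k.1 τ)) j.1 := by
    intro j
    have h2 := pow_ne_zero j.1 twoPiI_ne_zero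
    have h3 := pow_ne_zero (k.1 - 1) twoPiI_ne_zero
    rw [D.omegaPlus_singleton, kernelW, ← mul_assoc, slot_mul_wfac, kernel, twoPiI_zpow, eisB]
    dsimp only
    rw [neg_pow Y]
    field_simp
  rw [Psi_singleton, Finset.sum_congr rfl fun j _ => h1 j, Fin.sum_univ_eq_sum_range
    (fun j : ℕ => eisB k * ((X ^ (k.1 - 2 - j) * (-Y) ^ j * ((k.1 - 2).choose j : ℂ)
        * (τ : ℂ) ^ j) * eisG k.1 τ)), ← Finset.mul_sum, ← Finset.sum_mul, sub_pow_expand,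
    show k.1 - 2 + 1 = k.1 - 1 by omega]

lemma SeriesData.Psi_singleton_omegaPsi (τ : ℍ) : Psi [(k, X, Y)] (D.omegaPsi τ)
    = -(eisB k * ((X - conj (τ : ℂ) * Y) ^ (k.1 - 2) * conj (eisG k.1 τ))) := by
  have h := D.Psi_singleton_omegaPlus k (conj X) (conj Y) τ
  have h1 : Psi [(k, X, Y)] (D.omegaPsi τ)
      = conj (Psi [(k, conj X, conj Y)] (D.omegaPlus τ)) := by
    rw [Psi_singleton, Psi_singleton, map_sum]
    refine Finset.sum_congr rfl fun j _ => ?_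
    rw [D.omegaPsi_singleton, D.omegaPlus_singleton, kernelW, kernelWTilde,
      ← mul_assoc (slot _ _), ← mul_assoc (slot _ _), slot_mul_wfac, slot_mul_wfac]
    simp only [map_mul, map_div₀, map_pow, conj_twoPiI, Complex.conj_natCast, Complex.conj_conj,
      map_neg, map_one, XLetter.idx]
    rw [neg_pow twoPiI]
    have h2 := pow_ne_zero j.1 twoPiI_ne_zero
    have h3 : ((-1 : ℂ) ^ j.1) ≠ 0 := pow_ne_zero _ (by norm_num)
    have h4 : ((-1 : ℂ) ^ j.1) ^ 2 = 1 := by rw [← pow_mul, mul_comm, pow_mul]; simp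
    field_simp
    rw [h4]
    ring
  rw [h1, h]
  simp only [map_mul, map_pow, map_sub, conj_eisB, Complex.conj_conj]
  ring

/-- In depth one `𝕀^eqv` is the sum of `ℂ^sv` and an Eichler integral together with its complex
conjugate. -/
lemma SeriesData.Psi_singleton_iEqv (τ : ℍ) : Psi [(k, X, Y)] (D.iEqv τ)
    = eisB k * (eichler k X Y τ - eichlerBar k X Y τ) + Psi [(k, X, Y)] D.cSeries := by
  have h1 := D.hasDD_Psi_iEqv [(k, X, Y)]
  have h2 := D.cuspVal_Psi_iEqv [(k, X, Y)]
  have h3 := ((eichler_isReg k X Y).const_mul (eisB k)).add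
    ((eichlerBar_isReg k X Y).const_mul (-eisB k))
  have e1 : ∀ τ, Psi [(k, X, Y)] (conc (D.iEqv τ) (D.omegaPlus τ))
      = Psi [(k, X, Y)] (D.omegaPlus τ) := fun τ => by
    simp [Psi_conc, Finset.sum_range_succ, Psi_nil, D.iEqv_nil, D.omegaPlus_nil]
  have e2 : ∀ τ, Psi [(k, X, Y)] (conc (D.omegaPsi τ) (D.iEqv τ))
      = Psi [(k, X, Y)] (D.omegaPsi τ) := fun τ => by
    simp [Psi_conc, Finset.sum_range_succ, Psi_nil, D.iEqv_nil, D.omegaPsi_nil]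
  rw [h3.add_const_eq (h1.congr (fun _ => rfl) (fun τ => ?_) (fun τ => ?_)) h2 τ]
  · ring
  · rw [e1, D.Psi_singleton_omegaPlus]; ring
  · rw [e2, D.Psi_singleton_omegaPsi]; ring

variable {D}

lemma continuous_Psi_singleton (S : Series ℂ) :
    Continuous fun p : ℂ × ℂ => Psi [(k, p.1, p.2)] S := by
  simp only [Psi_singleton, slot]
  fun_prop

lemma Psi_singleton_mul (c : ℂ) (S : Series ℂ) :
    Psi [(k, c * X, c * Y)] S = c ^ (k.1 - 2) * Psi [(k, X, Y)] S := by
  rw [Psi_singleton, Psi_singleton, Finset.mul_sum]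
  refine Finset.sum_congr rfl fun j _ => ?_
  have hj : j.1 ≤ k.1 - 2 := by have := j.2; omega
  simp only [slot, mul_pow]
  rw [← pow_sub_mul_pow c hj]
  ring

lemma S_entries : ((ModularGroup.S 0 0 : ℤ) : ℂ) = 0 ∧ ((ModularGroup.S 0 1 : ℤ) : ℂ) = -1 ∧
    ((ModularGroup.S 1 0 : ℤ) : ℂ) = 1 ∧ ((ModularGroup.S 1 1 : ℤ) : ℂ) = 0 := by
  simp [ModularGroup.S]

/-- Equivariance at depth one forces the constant of `𝕀^eqv` in depth one to be the zeta value
occurring in `M_k`. -/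
theorem SeriesData.Equivariant.Psi_singleton_cSeries (hD : D.Equivariant) :
    Psi [(k, X, Y)] D.cSeries
      = -(2 * ((k.1 - 2).factorial : ℂ) * riemannZeta ((k.1 - 1 : ℕ) : ℂ) / twoPiI ^ (k.1 - 2))
        * Y ^ (k.1 - 2) := by
  obtain ⟨m, hm⟩ : ∃ m, k.1 = m + 2 := ⟨k.1 - 2, by have := k.2.2; omega⟩
  have hm2 : 2 ≤ m := by have := k.2.2; omega
  have hm' : k.1 - 2 = m := by omega
  have hm1 : k.1 - 1 = m + 1 := by omega
  -- under `T` the constant is periodic in `X`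
  have hT : ∀ X : ℂ, Psi [(k, X + 1, 1)] D.cSeries = Psi [(k, X, 1)] D.cSeries := by
    intro X
    have h1 := hD.Psi_iEqv [(k, X, 1)] (by simp) ModularGroup.T UpperHalfPlane.I
    obtain ⟨t1, t2, t3, t4⟩ := T_entries
    simp only [List.map_cons, List.map_nil, actArg, t1, t2, t3, t4, one_mul, zero_mul, mul_one,
      zero_add] at h1
    rw [D.Psi_singleton_iEqv, D.Psi_singleton_iEqv] at h1
    have h2 := eichler_T_smul k hm X UpperHalfPlane.I
    have h3 := congrArg conj (eichler_T_smul k hm (conj X) UpperHalfPlane.I)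
    rw [map_sub] at h3
    have h4 : conj ((2 * riemannZeta k.1 / ((m + 1 : ℕ) : ℂ))
        * ((conj X) ^ (m + 1) - (conj X + 1) ^ (m + 1)))
        = (2 * riemannZeta k.1 / ((m + 1 : ℕ) : ℂ)) * (X ^ (m + 1) - (X + 1) ^ (m + 1)) := by
      simp only [map_mul, map_div₀, map_sub, map_pow, map_add, map_one, Complex.conj_conj,
        Complex.conj_natCast, conj_riemannZeta (show 1 < k.1 by omega), Complex.conj_ofNat]
    rw [h4] at h3
    simp only [eichlerBar, map_add, map_one] at h1
    linear_combination h1 - eisB k * h2 + eisB k * h3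
  have hconst : ∀ X : ℂ, Psi [(k, X, 1)] D.cSeries = Psi [(k, 0, 1)] D.cSeries := by
    set P : Polynomial ℂ := Psi [(k, Polynomial.X, 1)] D.cSeries with hP
    have hPe : ∀ x : ℂ, P.eval x = Psi [(k, x, 1)] D.cSeries := fun x => by
      have := map_Psi (Polynomial.aeval x) [(k, (Polynomial.X : Polynomial ℂ), 1)] D.cSeries
      rw [← hP] at this
      simpa [Polynomial.coe_aeval_eq_eval] using this
    intro X
    have h1 := periodic_polynomial_eq_const (p := P) fun x => by rw [hPe, hPe, hT]
    rw [← hPe, h1, Polynomial.eval_C, hPe]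
  -- By homogeneity, and by continuity at `Y = 0`.
  have hY : ∀ X Y : ℂ, Psi [(k, X, Y)] D.cSeries = Psi [(k, 0, 1)] D.cSeries * Y ^ m := by
    intro X Y
    have h1 : Continuous fun Y => Psi [(k, X, Y)] D.cSeries :=
      (continuous_Psi_singleton k D.cSeries).comp (f := fun Y => (X, Y)) (by fun_prop)
    have h2 : Continuous fun Y : ℂ => Psi [(k, (0 : ℂ), (1 : ℂ))] D.cSeries * Y ^ m := by fun_prop
    refine congrFun (h1.ext_on (dense_compl_singleton (0 : ℂ)) h2 fun Y hY => ?_) Y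
    have hY' : Y ≠ 0 := hY
    have := Psi_singleton_mul k (X / Y) 1 Y D.cSeries
    rw [mul_one, mul_div_cancel₀ _ hY', hconst, hm'] at this
    simp only [this, mul_comm]
  -- Under `S` the multiple of `Y^m` is compared with the period polynomial of the Eichler integral.
  have h1 := hD.Psi_iEqv [(k, 0, 1)] (by simp) ModularGroup.S UpperHalfPlane.I
  obtain ⟨t1, t2, t3, t4⟩ := S_entries
  simp only [List.map_cons, List.map_nil, actArg, t1, t2, t3, t4, mul_one, mul_zero,
    zero_add, add_zero] at h1
  rw [D.Psi_singleton_iEqv, D.Psi_singleton_iEqv, hY (-1) 0] at h1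
  have h2 := eichlerS_zero_one k UpperHalfPlane.I
  have h3 := congrArg conj h2
  rw [eichlerS] at h2 h3
  rw [hm1] at h2 h3
  simp only [map_sub, map_mul, map_div₀, map_neg, Complex.conj_natCast, Complex.conj_ofReal,
    Complex.conj_I, Complex.conj_ofNat, conj_riemannZeta (show 1 < m + 1 by omega)] at h3
  simp only [eichlerBar, map_neg, map_one, map_zero, zero_pow (show m ≠ 0 by omega)] at h1
  have hmz : ((m + 1 : ℕ) : ℂ) ≠ 0 := Nat.cast_ne_zero.2 m.succ_ne_zero
  have hB : eisB k = ((m + 1 : ℕ) : ℂ) * (m.factorial : ℂ) / (twoPiI ^ m * twoPiI) := by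
    rw [eisB, hm1, pow_succ, Nat.factorial_succ]; push_cast; rfl
  have hpi := twoPiI_ne_zero
  have h5 : Psi [(k, 0, 1)] D.cSeries = -(2 * (m.factorial : ℂ)
      * riemannZeta ((m + 1 : ℕ) : ℂ) / twoPiI ^ m) := by
    have h6 : Psi [(k, 0, 1)] D.cSeries
        = eisB k * (-(2 * twoPiI * riemannZeta ((m + 1 : ℕ) : ℂ) / ((m + 1 : ℕ) : ℂ))) := by
      rw [twoPiI]
      linear_combination (-1) * h1 + eisB k * h2 - eisB k * h3
    rw [h6, hB]
    field_simp
  rw [hY, h5, hm', hm1]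

/-- In depth one the function `M_k` is a multiple of the generating series. -/
lemma SeriesData.Equivariant.intM1_eq (hD : D.Equivariant) (v : Fin 2 → ℝ) (τ : ℍ) :
    intM1 k v τ = -(1 / 4) * Psi [(k, ((v 0 : ℝ) : ℂ), ((v 1 : ℝ) : ℂ))] (D.iEqv τ) := by
  have hk := k.2.2
  have h1 : IsRegPrimitive (formG k v) 0
      (fun τ => eisB k / 2 * eichler k ((v 0 : ℝ) : ℂ) ((v 1 : ℝ) : ℂ) τ) :=
    ((eichler_isReg k _ _).const_mul (eisB k / 2)).congr (fun _ => rfl)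
      (fun τ => formG_eq k v τ) (fun _ => by simp)
  have h2 : IsRegPrimitive 0 (fun t => conj (formG k v t))
      (fun τ => -(eisB k / 2) * eichlerBar k ((v 0 : ℝ) : ℂ) ((v 1 : ℝ) : ℂ) τ) :=
    ((eichlerBar_isReg k _ _).const_mul (-(eisB k / 2))).congr (fun _ => rfl)
      (fun _ => by simp) (fun τ => by
        rw [formG_eq]
        simp only [map_mul, map_div₀, map_pow, map_sub, Complex.conj_ofReal, conj_eisB,
          Complex.conj_ofNat]
        ring)
  have e : ((k.1 : ℂ) - 1) = ((k.1 - 1 : ℕ) : ℂ) := by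
    rw [Nat.cast_sub (by omega)]; simp
  rw [intM1, h1.regInt_eq, h2.regInt_eq, D.Psi_singleton_iEqv, hD.Psi_singleton_cSeries, const1, e]
  ring

end Values

end DepthOne

/-! ### Projections of multiplets -/

section MultipletShape

open MvPolynomial

variable {n : ℕ} (k : Fin n → EisWt) {K : ℕ} {E : ℕ → Series ℂ}

lemma Multiplet.iterate_up (h : Multiplet K E) (q : ℕ) : (adE0 (R := ℂ))^[q] (E 0) = E q := by
  induction q with
  | zero => rfl
  | succ q ih => rw [Function.iterate_succ_apply', ih, h.up]

/-- The unipotent orbit of the lowest vector of a multiplet. -/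
lemma Multiplet.sum_eq_act (h : Multiplet K E) (z : ℂ) :
    ∑ j ∈ Finset.range (K - 1), ((-(twoPiI * z)) ^ j / (j.factorial : ℂ)) • Psi (polyArg k) (E j)
      = act !![1, -z; 0, 1] (Psi (polyArg k) (E 0)) := by
  refine MvPolynomial.funext fun x => ?_
  rw [eval_act, eval_Psi_polyArg, map_sum]
  set L := argList k (fun i => x (i, 0)) fun i => x (i, 1) with hL
  have h1 := exp_adE0_Psi L (E 0) (N := wtSum (L.map Prod.fst) + 1 + (K - 1)) (by omega)
    (-(twoPiI * z))
  have h2 : L.map (fun y => (y.1, y.2.1 + -(twoPiI * z) * (twoPiI⁻¹ * y.2.2), y.2.2))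
      = argList k
        (fun i => (!![1, -z; 0, 1] : Matrix (Fin 2) (Fin 2) ℂ) (i, (0 : Fin 2)).2 0 * x (i, 0)
          + (!![1, -z; 0, 1] : Matrix (Fin 2) (Fin 2) ℂ) (i, (0 : Fin 2)).2 1 * x (i, 1))
        fun i => (!![1, -z; 0, 1] : Matrix (Fin 2) (Fin 2) ℂ) (i, (1 : Fin 2)).2 0 * x (i, 0)
          + (!![1, -z; 0, 1] : Matrix (Fin 2) (Fin 2) ℂ) (i, (1 : Fin 2)).2 1 * x (i, 1) := by
    have := twoPiI_ne_zero
    rw [hL, argList, argList, List.map_reverse, List.map_ofFn]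
    congr 2
    funext i
    simp
    field_simp
  rw [← h2, ← h1, Finset.sum_subset (Finset.range_mono (show K - 1 ≤ _ from Nat.le_add_left _ _))]
  · refine Finset.sum_congr rfl fun j _ => ?_
    rw [smul_eval, eval_Psi_polyArg, h.iterate_up]
  · intro j _ hj
    rw [h.top j (by simpa using hj), map_zero, smul_zero, map_zero]

/-- Invariance under `Y ↦ Y + sX`, since `ad_{e_0^∨}` annihilates the lowest vector. -/
lemma Multiplet.act_lower (h : Multiplet K E) (s : ℂ) :
    act !![1, 0; s, 1] (Psi (polyArg k) (E 0)) = Psi (polyArg k) (E 0) := by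
  refine MvPolynomial.funext fun x => ?_
  rw [eval_act, eval_Psi_polyArg, eval_Psi_polyArg]
  set L := argList k (fun i => x (i, 0)) fun i => x (i, 1) with hL
  have h1 := exp_adE0v_Psi L (E 0) (N := wtSum (L.map Prod.fst) + 1) (by omega) (s / twoPiI)
  have h2 : L.map (fun y => (y.1, y.2.1, y.2.2 + s / twoPiI * (twoPiI * y.2.1)))
      = argList k
        (fun i => (!![1, 0; s, 1] : Matrix (Fin 2) (Fin 2) ℂ) (i, (0 : Fin 2)).2 0 * x (i, 0)
          + (!![1, 0; s, 1] : Matrix (Fin 2) (Fin 2) ℂ) (i, (0 : Fin 2)).2 1 * x (i, 1))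
        fun i => (!![1, 0; s, 1] : Matrix (Fin 2) (Fin 2) ℂ) (i, (1 : Fin 2)).2 0 * x (i, 0)
          + (!![1, 0; s, 1] : Matrix (Fin 2) (Fin 2) ℂ) (i, (1 : Fin 2)).2 1 * x (i, 1) := by
    have := twoPiI_ne_zero
    rw [hL, argList, argList, List.map_reverse, List.map_ofFn]
    congr 2
    funext i
    simp
    field_simp
    ring
  have h0 : adE0v (E 0) = 0 := funext fun w => by rw [h.down]; simp
  have h3 : ∀ q, (adE0v (R := ℂ))^[q + 1] (E 0) = 0 := by
    intro q
    induction q with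
    | zero => exact h0
    | succ q ih => rw [Function.iterate_succ_apply', ih]; exact funext adE0v_zero
  rw [← h2, ← h1, Finset.sum_range_succ', Finset.sum_eq_zero]
  · simp
  · intro q _
    rw [h3, map_zero, mul_zero]

lemma prod_zpow_torusWt {u : ℂ} (hu : u ≠ 0) (w : List Letter) :
    (w.map fun a => u ^ ((a.1.1 : ℤ) - 2 * (a.2.1 : ℤ) - 2)).prod = u ^ torusWt w := by
  induction w with
  | nil => simp [torusWt]
  | cons a w ih =>
    rw [List.map_cons, List.prod_cons, ih, ← zpow_add₀ hu]
    congr 1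
    simp only [torusWt, List.map_cons, List.sum_cons]
    ring

/-- The lowest vector of a multiplet of weight `K` is an eigenvector of the torus. -/
lemma Multiplet.act_torus (h : Multiplet K E) {t : ℂ} (ht : t ≠ 0) :
    act !![t, 0; 0, t⁻¹] (Psi (polyArg k) (E 0)) = (t ^ ((K : ℤ) - 2)) • Psi (polyArg k) (E 0) := by
  refine MvPolynomial.funext fun x => ?_
  rw [eval_act, smul_eval, eval_Psi_polyArg, eval_Psi_polyArg]
  set L := argList k (fun i => x (i, 0)) fun i => x (i, 1) with hL
  have h1 := Psi_scale (inv_ne_zero ht) L (S := E 0) (S' := (t⁻¹ ^ ((K : ℤ) - 2)) • E 0)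
    fun w _ => by
      rw [prod_zpow_torusWt (inv_ne_zero ht), Pi.smul_apply, smul_eq_mul]
      by_cases hw : E 0 w = 0
      · simp [hw]
      · have h2 := (mul_eq_zero.1 (h.torusWt_mul 0 w)).resolve_right hw
        have h3 : ((torusWt w : ℤ) : ℂ) = (((K : ℤ) - 2 : ℤ) : ℂ) := by
          push_cast at h2 ⊢; linear_combination h2
        rw [Int.cast_injective h3]
  have h2 : L.map (fun y => (y.1, y.2.1 / t⁻¹, y.2.2 * t⁻¹))
      = argList k
        (fun i => (!![t, 0; 0, t⁻¹] : Matrix (Fin 2) (Fin 2) ℂ) (i, (0 : Fin 2)).2 0 * x (i, 0)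
          + (!![t, 0; 0, t⁻¹] : Matrix (Fin 2) (Fin 2) ℂ) (i, (0 : Fin 2)).2 1 * x (i, 1))
        fun i => (!![t, 0; 0, t⁻¹] : Matrix (Fin 2) (Fin 2) ℂ) (i, (1 : Fin 2)).2 0 * x (i, 0)
          + (!![t, 0; 0, t⁻¹] : Matrix (Fin 2) (Fin 2) ℂ) (i, (1 : Fin 2)).2 1 * x (i, 1) := by
    rw [hL, argList, argList, List.map_reverse, List.map_ofFn]
    congr 2
    funext i
    simp
    constructor <;> ring
  rw [← h2, ← h1, map_smul, smul_eq_mul, ← mul_assoc, ← mul_zpow, mul_inv_cancel₀ ht, one_zpow,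
    one_mul]

variable [NeZero n] {k} (F : ProjFamily k)

/-- The projections of the lowest vector of a multiplet are highest weight vectors, and vanish
unless the weights match. -/
lemma Multiplet.proj_lowest (h : Multiplet K E) (i : F.idx) :
    ∃ c : ℂ, F.proj i (Psi (polyArg k) (E 0)) = c • bin (F.wt i) 0 ∧ (c ≠ 0 → F.wt i + 2 = K) := by
  set q := F.proj i (Psi (polyArg k) (E 0)) with hq
  have hbin := (F.binary i _ (mem_homSub.2 (Psi_polyArg_isHom k (E 0)))).eq_sum
  rw [← hq] at hbin
  set m := F.wt i
  set c : ℕ → ℂ := fun r => binCoeff m r q with hc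
  have heval : ∀ x y : ℂ, eval (fun i : Fin n × Fin 2 => ![x, y] i.2) q
      = ∑ r ∈ Finset.range (m + 1), c r * (x ^ (m - r) * y ^ r) := by
    intro x y
    rw [hbin, map_sum]
    exact Finset.sum_congr rfl fun r _ => by
      rw [smul_eval, eval_bin]; rfl
  have hlow : ∀ s : ℂ, act !![1, 0; s, 1] q = q := fun s => by
    rw [hq, ← F.proj_act i _ (by simp), h.act_lower]
  -- The invariance under `Y ↦ Y + sX`, at `(X, Y) = (1, 0)`, leaves only the power `X^m`.
  have hpoly : ∑ r ∈ Finset.range (m + 1), Polynomial.C (c r) * Polynomial.X ^ r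
      = Polynomial.C (c 0) := by
    refine Polynomial.funext fun s => ?_
    have h1 := congrArg (eval fun i : Fin n × Fin 2 => ![(1 : ℂ), 0] i.2) (hlow s)
    rw [eval_act] at h1
    have h2 : (fun i : Fin n × Fin 2 => (!![1, 0; s, 1] : Matrix (Fin 2) (Fin 2) ℂ) i.2 0
        * (fun i : Fin n × Fin 2 => ![(1 : ℂ), 0] i.2) (i.1, 0)
        + (!![1, 0; s, 1] : Matrix (Fin 2) (Fin 2) ℂ) i.2 1
        * (fun i : Fin n × Fin 2 => ![(1 : ℂ), 0] i.2) (i.1, 1))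
        = fun i : Fin n × Fin 2 => ![(1 : ℂ), s] i.2 := by
      funext ⟨a, e⟩
      fin_cases e <;> simp
    have h3 : ∑ r ∈ Finset.range m, c (r + 1) * ((1 : ℂ) ^ (m - (r + 1)) * 0 ^ (r + 1)) = 0 :=
      Finset.sum_eq_zero fun r _ => by simp
    rw [h2, heval, heval, Finset.sum_range_succ' (fun r => c r * ((1 : ℂ) ^ (m - r) * 0 ^ r)),
      h3] at h1
    simp only [Polynomial.eval_finsetSum, Polynomial.eval_mul, Polynomial.eval_C,
      Polynomial.eval_pow, Polynomial.eval_X]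
    simpa using h1
  have hc0 : ∀ r, r ≠ 0 → r ∈ Finset.range (m + 1) → c r = 0 := by
    intro r hr hr'
    have h1 := congrArg (fun p => Polynomial.coeff p r) hpoly
    simp only [Polynomial.finsetSum_coeff, Polynomial.coeff_C_mul, Polynomial.coeff_X_pow,
      Polynomial.coeff_C, if_neg hr, mul_ite, mul_one, mul_zero, Finset.sum_ite_eq, if_pos hr']
      at h1
    exact h1
  have hq0 : q = c 0 • bin m 0 := by
    rw [hbin]
    exact Finset.sum_eq_single 0 (fun r hr hr0 => by
      rw [show binCoeff m r q = 0 from hc0 r hr0 hr, zero_smul])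
      (by simp)
  refine ⟨c 0, hq0, fun hne => ?_⟩
  -- The torus element `diag (2, 1/2)` compares the weights.
  have h1 : act !![2, 0; 0, 2⁻¹] q = ((2 : ℂ) ^ ((K : ℤ) - 2)) • q := by
    rw [hq, ← F.proj_act i _ (by simp), h.act_torus k two_ne_zero, map_smul]
  have h2 := congrArg (eval fun i : Fin n × Fin 2 => ![(1 : ℂ), 0] i.2) h1
  rw [eval_act, smul_eval, hq0, smul_eval, smul_eval, eval_bin, eval_bin] at h2
  simp at h2
  have h3 : (2 : ℂ) ^ m = 2 ^ ((K : ℤ) - 2) := by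
    have : c 0 * (2 : ℂ) ^ m = c 0 * 2 ^ ((K : ℤ) - 2) := by linear_combination h2
    exact mul_left_cancel₀ hne this
  have h4 : (2 : ℝ) ^ (m : ℤ) = 2 ^ ((K : ℤ) - 2) := by
    simpa [norm_zpow] using congrArg norm h3
  have := zpow_right_injective₀ (by norm_num : (0 : ℝ) < 2) (by norm_num) h4
  omega

lemma act_upper_bin (m : ℕ) (τ : ℍ) :
    act !![1, -(τ : ℂ); 0, 1] (bin m 0 : BPoly n) = highest m τ := by
  rw [bin, highest]
  simp [act_X, sub_eq_add_neg]

lemma conjPoly_act_upper_bin (m : ℕ) (τ : ℍ) :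
    act !![1, -conj (τ : ℂ); 0, 1] (bin m 0 : BPoly n) = conjPoly (highest m τ) := by
  rw [bin, highest, conjPoly]
  simp [act_X, sub_eq_add_neg]

/-- The unipotent translate of the lowest vector projects to the translate of `X_1^m`. -/
lemma Multiplet.proj_sum (h : Multiplet K E) (i : F.idx) {c : ℂ}
    (hc : F.proj i (Psi (polyArg k) (E 0)) = c • bin (F.wt i) 0) (z : ℂ) :
    F.proj i (∑ j ∈ Finset.range (K - 1), ((-(twoPiI * z)) ^ j / (j.factorial : ℂ)) •
      Psi (polyArg k) (E j)) = c • act !![1, -z; 0, 1] (bin (F.wt i) 0 : BPoly n) := by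
  rw [h.sum_eq_act, F.proj_act i _ (by simp), hc, map_smul]

lemma exists_cuspForm_smul {m K : ℕ} {c : ℂ} (hc : c ≠ 0 → m = K) (φ : CuspForm 𝒮ℒ (K : ℤ)) :
    ∃ Φ : CuspForm 𝒮ℒ (m : ℤ), ∀ τ, Φ τ = c * φ τ := by
  by_cases h : c = 0
  · exact ⟨0, fun τ => by simp [h]⟩
  · obtain rfl := hc h
    exact ⟨c • φ, fun τ => rfl⟩

lemma exists_modularForm_smul {m K : ℕ} {c : ℂ} (hc : c ≠ 0 → m = K)
    (φ : ModularForm 𝒮ℒ (K : ℤ)) : ∃ Φ : ModularForm 𝒮ℒ (m : ℤ), ∀ τ, Φ τ = c * φ τ := by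
  by_cases h : c = 0
  · exact ⟨0, fun τ => by simp [h]⟩
  · obtain rfl := hc h
    exact ⟨c • φ, fun τ => rfl⟩

end MultipletShape

/-! ### The forms of the generating series -/

section Families

lemma finite_words (L : List EisWt) : {w : List Letter | w.map Sigma.fst = L}.Finite := by
  induction L with
  | nil => exact (Set.finite_singleton []).subset fun w hw => by simpa using hw
  | cons k L ih =>
    refine ((Set.finite_univ (α := Fin (k.1 - 1))).image2
      (fun j w => (⟨k, j⟩ : Letter) :: w) ih).subset fun w hw => ?_
    rcases w with _ | ⟨⟨k', j⟩, w⟩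
    · simp at hw
    · simp only [Set.mem_ofPred_eq, List.map_cons, List.cons.injEq] at hw
      obtain ⟨rfl, hw⟩ := hw
      exact ⟨j, trivial, w, hw, rfl⟩

lemma LocFin.exists_finset {X : Type} {F : X → Series ℂ} (hF : LocFin F) (L : List EisWt) :
    ∃ s : Finset X, ∀ x ∉ s, ∀ w : List Letter, w.map Sigma.fst = L → F x w = 0 := by
  refine ⟨((finite_words L).biUnion fun w _ => hF w).toFinset, fun x hx w hw => ?_⟩
  by_contra h
  exact hx ((Set.Finite.mem_toFinset _).2 (Set.mem_biUnion (x := w) hw h))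

/-- For words of fixed weights, a locally finite sum over multiplets reduces to a finite set of
complete multiplets. -/
lemma LocFin.exists_finset_sigma {ι : Type} {K : ι → ℕ} {E : ι → ℕ → Series ℂ}
    (hE : LocFin fun x : (a : ι) × Fin (K a - 1) => E x.1 x.2) (L : List EisWt) :
    ∃ s : Finset ι, ∀ (c : ι → ℕ → ℂ) (w : List Letter), w.map Sigma.fst = L →
      ∑ᶠ x : (a : ι) × Fin (K a - 1), c x.1 x.2 * E x.1 x.2 w
        = ∑ a ∈ s, ∑ j ∈ Finset.range (K a - 1), c a j * E a j w := by
  classical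
  obtain ⟨s, hs⟩ := hE.exists_finset L
  refine ⟨s.image Sigma.fst, fun c w hw => ?_⟩
  rw [finsum_eq_sum_of_support_subset (s := (s.image Sigma.fst).sigma fun _ => Finset.univ),
    Finset.sum_sigma]
  · refine Finset.sum_congr rfl fun a _ => ?_
    exact Fin.sum_univ_eq_sum_range (fun j => c a j * E a j w) _
  · intro x hx
    have : x ∈ s := by
      by_contra h
      exact hx (by simp [hs x h w hw])
    exact Finset.mem_coe.2 (Finset.mem_sigma.2 ⟨Finset.mem_image_of_mem _ this, Finset.mem_univ _⟩)

lemma finsum_sumType {α β : Type} {f : α ⊕ β → ℂ} (hf : (Function.support f).Finite) :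
    ∑ᶠ x, f x = ∑ᶠ a, f (.inl a) + ∑ᶠ b, f (.inr b) := by
  have h1 : (Function.support fun a => f (.inl a)).Finite :=
    hf.preimage Sum.inl_injective.injOn
  have h2 : (Function.support fun b => f (.inr b)).Finite :=
    hf.preimage Sum.inr_injective.injOn
  rw [finsum_eq_sum_of_support_subset (s := h1.toFinset.disjSum h2.toFinset), Finset.sum_disjSum,
    finsum_eq_sum_of_support_subset (s := h1.toFinset) _ (by simp),
    finsum_eq_sum_of_support_subset (s := h2.toFinset) _ (by simp)]
  rintro (a | b) hx <;> simpa using hx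

variable {A X : Type} {σ : A → Series ℂ}

lemma IsSubst.locFin_subst (h : IsSubst σ) {F : X → List A → ℂ}
    (hF : ∀ u, {x | F x u ≠ 0}.Finite) : LocFin fun x => subst σ (F x) := fun w => by
  refine ((h.finite w).biUnion fun u _ => hF u).subset fun x hx => ?_
  by_contra hx'
  refine hx ?_
  change subst σ (F x) w = 0
  rw [subst_apply]
  refine (finsum_congr fun u => ?_).trans finsum_zero
  by_cases hu : prodS σ u w = 0
  · rw [hu, mul_zero]
  · rw [show F x u = 0 by
      by_contra h'; exact hx' (Set.mem_biUnion (x := u) hu h'), zero_mul]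

lemma IsSubst.subst_finsum (h : IsSubst σ) {F : X → List A → ℂ}
    (hF : ∀ u, {x | F x u ≠ 0}.Finite) (c : X → ℂ) (w : List Letter) :
    subst σ (fun u => ∑ᶠ x, c x * F x u) w = ∑ᶠ x, c x * subst σ (F x) w := by
  rw [h.subst_eq_sum _ (Finset.Subset.refl _)]
  have h1 : ∀ u, (Function.support fun x => c x * F x u * prodS σ u w).Finite := fun u =>
    (hF u).subset fun x hx => right_ne_zero_of_mul (left_ne_zero_of_mul hx)
  have h2 : ∀ u, (∑ᶠ x, c x * F x u) * prodS σ u w = ∑ᶠ x, c x * F x u * prodS σ u w := fun u =>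
    finsum_mul' _ _ ((hF u).subset fun x hx => right_ne_zero_of_mul hx)
  rw [Finset.sum_congr rfl fun u _ => h2 u, ← finsum_sum_comm _ _ fun u _ => h1 u]
  refine finsum_congr fun x => ?_
  rw [h.subst_eq_sum _ (Finset.Subset.refl _), Finset.mul_sum]
  exact Finset.sum_congr rfl fun u _ => mul_assoc _ _ _

end Families

section Forms

variable (D : SeriesData)

/-- The image under `ψ̂` of the letter `x` of the extended alphabet, cuspidal letters being
replaced by the `e_{Δ⁻}^{(j)}`. -/
def SeriesData.psiLetter (x : XLetter) : Series ℂ :=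
  subst (fun a => toC (D.psi a)) (SeriesData.cuspSubst D.eMinus x)

lemma SeriesData.locFin_psiLetter : LocFin D.psiLetter :=
  D.isSubst_psi.locFin_subst (isSubst_cuspSubst D.isCuspSeries_eMinus).fin

/-- The connection `ω_ψ` in terms of the images of the letters. -/
lemma SeriesData.omegaPsi_eq (τ : ℍ) (w : List Letter) :
    D.omegaPsi τ w = ∑ᶠ x, kernelWTilde x τ * D.psiLetter x w :=
  D.isSubst_psi.subst_finsum (isSubst_cuspSubst D.isCuspSeries_eMinus).fin _ w

lemma SeriesData.psiLetter_inl (a : Letter) : D.psiLetter (.inl a) = toC (D.psi a) := by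
  funext w
  rw [SeriesData.psiLetter, subst_apply, finsum_eq_single _ [a]]
  · simp only [SeriesData.cuspSubst, single, if_true, one_mul]
    exact congrFun (conc_unit _) w
  · intro u hu
    simp [SeriesData.cuspSubst, single, hu]

/-- The multiplets occurring in `ψ̂(𝕀̃_-)`. -/
def SeriesData.psiCusp (Δ : Eigenform) (j : ℕ) : Series ℂ :=
  subst (fun a => toC (D.psi a)) (toC ((adE0 (R := ℝ))^[j] (D.eMinus Δ)))

lemma SeriesData.psiCusp_multiplet (Δ : Eigenform) : Multiplet Δ.wt (D.psiCusp Δ) :=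
  D.subst_psi_multiplet (D.isCuspSeries_eMinus.mult Δ).toC

lemma kernelW_inr (d : CuspLetter) (τ : ℍ) : kernelW (.inr d) τ
    = (twoPiI * ((d.1.wt : ℂ) - 1) * d.1.form τ)
      * ((-(twoPiI * τ)) ^ d.2.1 / (d.2.1.factorial : ℂ)) := by
  simp only [kernelW, wfac, kernel, XLetter.idx, XLetter.wt]
  push_cast
  rw [neg_pow (twoPiI * _), mul_pow twoPiI, pow_add, pow_one]
  ring

lemma kernelWTilde_inr (d : CuspLetter) (τ : ℍ) : kernelWTilde (.inr d) τ
    = (-twoPiI * ((d.1.wt : ℂ) - 1) * conj (d.1.form τ))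
      * ((-(twoPiI * conj (τ : ℂ))) ^ d.2.1 / (d.2.1.factorial : ℂ)) := by
  simp only [kernelWTilde, wfac, kernel, XLetter.idx, XLetter.wt]
  simp only [map_mul, map_pow, conj_twoPiI]
  push_cast
  rw [neg_pow (twoPiI * _), mul_pow twoPiI, pow_add, neg_pow twoPiI d.2.1, pow_one]
  have h4 : ((-1 : ℂ) ^ d.2.1) * ((-1 : ℂ) ^ d.2.1) = 1 := by
    rw [← mul_pow]; simp
  linear_combination (-1 : ℂ) ^ d.2.1 * ((d.1.wt : ℂ) - 1) / (d.2.1.factorial : ℂ) *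
    (-twoPiI * twoPiI ^ d.2.1 * conj (τ : ℂ) ^ d.2.1 * conj (d.1.form τ)) * h4

lemma kernelWTilde_inl (a : Letter) (τ : ℍ) : kernelWTilde (.inl a) τ
    = (-(((a.1.1 : ℂ) - 1) / twoPiI ^ (a.1.1 - 1)) * conj (eisG a.1.1 τ))
      * ((-(twoPiI * conj (τ : ℂ))) ^ a.2.1 / (a.2.1.factorial : ℂ)) := by
  obtain ⟨k, j⟩ := a
  have hk : Odd (k.1 - 1) := by
    have := k.2.2
    exact Nat.Even.sub_odd (by omega) k.2.1 odd_one
  simp only [kernelWTilde, wfac, kernel, XLetter.idx, XLetter.wt, twoPiI_zpow]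
  simp only [map_mul, map_pow, map_div₀, conj_twoPiI, hk.neg_pow]
  push_cast
  rw [neg_pow (twoPiI * _), mul_pow twoPiI, neg_pow twoPiI j.1]
  have h4 : ((-1 : ℂ) ^ j.1) * ((-1 : ℂ) ^ j.1) = 1 := by
    rw [← mul_pow]; simp
  have h5 := pow_ne_zero (k.1 - 1) twoPiI_ne_zero
  field_simp
  linear_combination (-((k.1 : ℂ) - 1) * conj (τ : ℂ) ^ j.1 * conj (eisG k.1 τ)
    * twoPiI ^ j.1 / (j.1.factorial : ℂ)) * h4

end Forms

/-! ### Modularity of the projected forms -/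

section Shapes

variable {n : ℕ} [NeZero n] {k : Fin n → EisWt}

/-- A combination of multiplets with the coefficients `(-2πi z)^j/j!` projects to multiples of
`(X_1 - z Y_1)^m`; only the multiplets of weight `m + 2` contribute. -/
lemma proj_Psi_multiplets (F : ProjFamily k) {ι : Type} {K : ι → ℕ} {E : ι → ℕ → Series ℂ}
    (hE : ∀ a, Multiplet (K a) (E a))
    (hfin : LocFin fun x : (a : ι) × Fin (K a - 1) => E x.1 x.2) :
    ∃ (s : Finset ι) (d : F.idx → ι → ℂ), (∀ i a, d i a ≠ 0 → F.wt i + 2 = K a) ∧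
      ∀ (c : ι → ℂ) (z : ℂ) (S : Series ℂ),
        (∀ w, w.length = n → S w = ∑ᶠ x : (a : ι) × Fin (K a - 1),
          (c x.1 * ((-(twoPiI * z)) ^ x.2.1 / (x.2.1.factorial : ℂ))) * E x.1 x.2 w) →
        ∀ i, F.proj i (Psi (polyArg k) S)
          = (∑ a ∈ s, d i a * c a) • act !![1, -z; 0, 1] (bin (F.wt i) 0) := by
  obtain ⟨s, hs⟩ := hfin.exists_finset_sigma ((polyArg k).map Prod.fst)
  choose d hd hd' using fun i a => (hE a).proj_lowest F i
  refine ⟨s, d, hd', fun c z S hS i => ?_⟩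
  have h : Psi (polyArg k) S = ∑ a ∈ s, c a • ∑ j ∈ Finset.range (K a - 1),
      ((-(twoPiI * z)) ^ j / (j.factorial : ℂ)) • Psi (polyArg k) (E a j) := by
    rw [Psi_congr (S' := ∑ a ∈ s, c a • ∑ j ∈ Finset.range (K a - 1),
      ((-(twoPiI * z)) ^ j / (j.factorial : ℂ)) • E a j)]
    · simp only [map_sum, map_smul]
    · intro w hw
      have hl : w.length = n := by
        have := congrArg List.length hw
        rwa [List.length_map, List.length_map, polyArg, argList_length] at this
      rw [hS w hl, hs (fun a j => c a * ((-(twoPiI * z)) ^ j / (j.factorial : ℂ))) w hw]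
      simp only [Finset.sum_apply, Pi.smul_apply, smul_eq_mul, Finset.mul_sum, mul_assoc]
  rw [h, map_sum, Finset.sum_smul]
  refine Finset.sum_congr rfl fun a _ => ?_
  rw [map_smul, (hE a).proj_sum F i (hd i a), smul_smul, mul_comm]

omit [NeZero n] in
lemma conjPoly_conjPoly (p : BPoly n) : conjPoly (conjPoly p) = p := by
  rw [conjPoly, MvPolynomial.map_map]
  convert MvPolynomial.map_id p
  exact RingHom.ext Complex.conj_conj

lemma exists_cuspForm_sum {m : ℕ} {ι : Type} (s : Finset ι) {f : ι → ℍ → ℂ}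
    (h : ∀ a, ∃ Φ : CuspForm 𝒮ℒ (m : ℤ), ∀ τ, Φ τ = f a τ) :
    ∃ Φ : CuspForm 𝒮ℒ (m : ℤ), ∀ τ, Φ τ = ∑ a ∈ s, f a τ := by
  classical
  induction s using Finset.induction_on with
  | empty => exact ⟨0, fun τ => by simp⟩
  | insert a s ha ih =>
    obtain ⟨Φ, hΦ⟩ := ih
    obtain ⟨φ, hφ⟩ := h a
    exact ⟨φ + Φ, fun τ => by rw [Finset.sum_insert ha, ← hΦ, ← hφ]; rfl⟩

lemma exists_modularForm_sum {m : ℕ} {ι : Type} (s : Finset ι) {f : ι → ℍ → ℂ}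
    (h : ∀ a, ∃ Φ : ModularForm 𝒮ℒ (m : ℤ), ∀ τ, Φ τ = f a τ) :
    ∃ Φ : ModularForm 𝒮ℒ (m : ℤ), ∀ τ, Φ τ = ∑ a ∈ s, f a τ := by
  classical
  induction s using Finset.induction_on with
  | empty => exact ⟨0, fun τ => by simp⟩
  | insert a s ha ih =>
    obtain ⟨Φ, hΦ⟩ := ih
    obtain ⟨φ, hφ⟩ := h a
    exact ⟨φ + Φ, fun τ => by rw [Finset.sum_insert ha, ← hΦ, ← hφ]; rfl⟩

variable (D : SeriesData)

/-- The completion read off from the generating series, up to rational factors: the constant is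
given by `c^sv`, the forms by the connection of `𝕀^eqv` in words of length at least two. -/
def SeriesData.completion (r s : ℝ) (k : Fin n → EisWt) : Completion n where
  c := D.csvPoly r k
  f τ := (s : ℂ) • Psi (polyArg k) (D.omegaPlus τ)
  g τ := (s : ℂ) • conjPoly (Psi (polyArg k) (D.omegaPsi τ))

lemma SeriesData.completion_cusp (r s : ℝ) (hn : 2 ≤ n) (F : ProjFamily k) (i : F.idx) :
    ∃ φ : CuspForm 𝒮ℒ ((F.wt i + 2 : ℕ) : ℤ), ∀ τ,
      F.proj i ((D.completion r s k).f τ) = φ τ • highest (F.wt i) τ := by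
  obtain ⟨t, d, hd, h⟩ := proj_Psi_multiplets F
    (fun Δ => (D.isCuspSeries_ePlus.mult Δ).toC)
    (fun w => (D.isCuspSeries_ePlus.finite w).subset fun x hx h => hx (by simp [toC, h]))
  obtain ⟨φ, hφ⟩ := exists_cuspForm_sum t (m := F.wt i + 2)
    (f := fun Δ τ => (s * d i Δ * (twoPiI * ((Δ.wt : ℂ) - 1))) * Δ.form τ) fun Δ =>
    exists_cuspForm_smul (fun h => hd i Δ (right_ne_zero_of_mul (left_ne_zero_of_mul h))) _
  refine ⟨φ, fun τ => ?_⟩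
  rw [hφ, ← act_upper_bin, SeriesData.completion, map_smul,
    h (fun Δ => twoPiI * ((Δ.wt : ℂ) - 1) * Δ.form τ) τ (D.omegaPlus τ) ?_ i, smul_smul,
    Finset.mul_sum]
  · congr 1
    exact Finset.sum_congr rfl fun Δ _ => by ring
  · intro w hw
    rw [SeriesData.omegaPlus, finsum_cuspSubst_long _ _ (hw ▸ hn)]
    exact finsum_congr fun x => by rw [kernelW_inr]

lemma SeriesData.completion_modular (r s : ℝ) (F : ProjFamily k) (i : F.idx) :
    ∃ φ : ModularForm 𝒮ℒ ((F.wt i + 2 : ℕ) : ℤ), ∀ τ,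
      F.proj i ((D.completion r s k).g τ) = φ τ • highest (F.wt i) τ := by
  obtain ⟨t, d, hd, h⟩ := proj_Psi_multiplets F
    (fun k => (D.psi_multiplet k).toC)
    (fun w => (D.finite_psi w).subset fun x hx h => hx (by
      simp only [toC, D.psiSeq_of_lt]
      exact_mod_cast h))
  obtain ⟨t', d', hd', h'⟩ := proj_Psi_multiplets F D.psiCusp_multiplet
    (fun w => (D.locFin_psiLetter w).preimage Sum.inr_injective.injOn)
  obtain ⟨φ, hφ⟩ := exists_modularForm_sum t (m := F.wt i + 2)
    (f := fun k τ => (s * conj (d i k) * (-(((k.1 : ℂ) - 1) / (-twoPiI) ^ (k.1 - 1))))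
      * eisForm k τ) fun Δ =>
    exists_modularForm_smul (fun h => hd i Δ fun h0 => h (by simp [h0])) _
  obtain ⟨φ', hφ'⟩ := exists_modularForm_sum t' (m := F.wt i + 2)
    (f := fun Δ τ => (s * conj (d' i Δ) * (twoPiI * ((Δ.wt : ℂ) - 1))) * Δ.form τ) fun Δ =>
    exists_modularForm_smul (fun h => hd' i Δ fun h0 => h (by simp [h0]))
      (ModularFormClass.modularForm Δ.form)
  refine ⟨φ + φ', fun τ => ?_⟩
  have hs : ∀ w : List Letter, D.omegaPsi τ w = (fun w => ∑ᶠ a : Letter,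
      kernelWTilde (.inl a) τ * D.psiLetter (.inl a) w) w
      + (fun w => ∑ᶠ d : CuspLetter, kernelWTilde (.inr d) τ * D.psiLetter (.inr d) w) w :=
    fun w => (D.omegaPsi_eq τ w).trans (finsum_sumType
      ((D.locFin_psiLetter w).subset fun x hx => right_ne_zero_of_mul hx))
  rw [SeriesData.completion, map_smul, F.proj_conj, show D.omegaPsi τ = _ + _ from funext hs,
    map_add, map_add,
    h (fun k => -(((k.1 : ℂ) - 1) / twoPiI ^ (k.1 - 1)) * conj (eisG k.1 τ)) (conj (τ : ℂ)) _ ?_ i,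
    h' (fun Δ => -twoPiI * ((Δ.wt : ℂ) - 1) * conj (Δ.form τ)) (conj (τ : ℂ)) _ ?_ i,
    conjPoly_act_upper_bin, ← add_smul, conjPoly_smul, conjPoly_conjPoly, smul_smul]
  · congr 1
    rw [show (φ + φ') τ = φ τ + φ' τ from rfl, hφ, hφ', map_add, mul_add, map_sum, map_sum, Finset.mul_sum,
      Finset.mul_sum]
    congr 1
    · refine Finset.sum_congr rfl fun a _ => ?_
      simp only [map_mul, map_neg, map_div₀, map_sub, map_pow, conj_twoPiI, Complex.conj_natCast,
        Complex.conj_conj, map_one, eisForm_apply]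
      ring
    · refine Finset.sum_congr rfl fun a _ => ?_
      simp only [map_mul, map_neg, map_sub, conj_twoPiI, Complex.conj_natCast,
        Complex.conj_conj, map_one]
      ring
  · intro w _
    exact finsum_congr fun x => by rw [kernelWTilde_inr]; rfl
  · intro w _
    exact finsum_congr fun x => by
      rw [kernelWTilde_inl, D.psiLetter_inl, ← D.psiSeq_of_lt]

lemma SeriesData.completion_isTypeF (r s : ℝ) (hn : 2 ≤ n) (F : ProjFamily k) :
    (D.completion r s k).IsTypeF F where
  hom_c := by
    rw [SeriesData.completion, D.csvPoly_eq, ← MvPolynomial.smul_eq_C_mul]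
    exact Submodule.smul_mem _ _ (mem_homSub.2 (Psi_polyArg_isHom _ _))
  hom_f τ := Submodule.smul_mem _ _ (mem_homSub.2 (Psi_polyArg_isHom _ _))
  hom_g τ := Submodule.smul_mem _ _ (conjPoly_mem (mem_homSub.2 (Psi_polyArg_isHom _ _)))
  cusp_f := D.completion_cusp r s hn F
  modular_g := D.completion_modular r s F

end Shapes

/-! ### The completed integrals in depth two and three -/

section Completed

variable {n : ℕ} [NeZero n] {k : Fin n → EisWt}

lemma Completion.IsTypeF.isReg_f {F : ProjFamily k} {C : Completion n} (h : C.IsTypeF F)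
    (v : Fin n → Fin 2 → ℝ) :
    IsRegPrimitive (fun t => (C.f t).at v) 0 (regInt (fun t => (C.f t).at v) 0) := by
  obtain ⟨I, hI⟩ := h.tameForm_f.exists_integral
  exact ((hI (evalAt fun i => (v i.1 i.2 : ℂ))).congr (fun _ => rfl) (fun _ => at_eq_evalAt _ _) fun _ => rfl).regInt

lemma Completion.IsTypeF.isReg_g {F : ProjFamily k} {C : Completion n} (h : C.IsTypeF F)
    (v : Fin n → Fin 2 → ℝ) :
    IsRegPrimitive 0 (fun t => conj ((C.g t).at v)) (regInt 0 fun t => conj ((C.g t).at v)) := by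
  obtain ⟨I, hI⟩ := h.tameForm_g.exists_conj_integral
  exact ((hI (evalAt fun i => (v i.1 i.2 : ℂ))).congr (fun _ => rfl) (fun _ => rfl)
    fun _ => by rw [conj_at]; exact at_eq_evalAt _ _).regInt

/-- The part of the correction that is an integral. -/
def Completion.intPart (C : Completion n) (v : Fin n → Fin 2 → ℝ) (τ : ℍ) : ℂ :=
  (1 / 2) * (regInt (fun t => (C.f t).at v) 0 τ + regInt 0 (fun t => conj ((C.g t).at v)) τ)

lemma Completion.IsTypeF.isReg_intPart {F : ProjFamily k} {C : Completion n} (h : C.IsTypeF F)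
    (v : Fin n → Fin 2 → ℝ) :
    IsRegPrimitive (fun t => (1 / 2) * (C.f t).at v) (fun t => (1 / 2) * conj ((C.g t).at v))
      (C.intPart v) :=
  (((h.isReg_f v).add (h.isReg_g v)).const_mul (1 / 2)).congr (fun _ => rfl)
    (fun _ => by simp) (fun _ => by simp)

/-- A completion is determined by its correction: the constant is the value at the cusp, the
forms are the derivatives. -/
lemma Completion.IsTypeF.eq_of_corr {F : ProjFamily k} {C C' : Completion n} (h : C.IsTypeF F)
    (h' : C'.IsTypeF F) (he : ∀ v τ, C.corr v τ = C'.corr v τ) : C = C' := by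
  refine h.eq_of_isEquivariant h' (fun γ v τ => by simp [he]) fun i _ => congrArg _ ?_
  refine eq_of_at fun v => ?_
  have h1 := (h.isReg_intPart v).add ((h'.isReg_intPart v).const_mul (-1))
  obtain ⟨P, hP, hl⟩ := (isRegPrimitive_iff.1 h1).2
  have h2 : ∀ τ, C.intPart v τ + -1 * C'.intPart v τ = C'.c.at v - C.c.at v := fun τ => by
    have := he v τ
    simp only [Completion.corr] at this
    simp only [Completion.intPart]
    linear_combination -this
  simp only [h2] at hl
  have h3 : Tendsto (fun t : ℝ => P.eval (t : ℂ)) atTop (𝓝 (C'.c.at v - C.c.at v)) := by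
    have := hl.const_sub (C'.c.at v - C.c.at v)
    simpa using this
  have h4 := eval_limit_eq_zero hP h3
  simp only [h4, Polynomial.eval_zero, sub_zero] at hl
  have h5 := tendsto_nhds_unique hl tendsto_const_nhds
  linear_combination h5

variable (D : SeriesData)

omit [NeZero n] in
lemma SeriesData.completion_f_at (r s : ℝ) (v : Fin n → Fin 2 → ℝ) (τ : ℍ) :
    ((D.completion r s k).f τ).at v = s * Psi (realArg k v) (D.omegaPlus τ) := by
  rw [← Psi_polyArg_at, SeriesData.completion, BPoly.at, MvPolynomial.smul_eval]; rfl

omit [NeZero n] in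
lemma SeriesData.completion_g_at (r s : ℝ) (v : Fin n → Fin 2 → ℝ) (τ : ℍ) :
    conj (((D.completion r s k).g τ).at v) = s * Psi (realArg k v) (D.omegaPsi τ) := by
  rw [conj_at, SeriesData.completion, conjPoly_smul, conjPoly_conjPoly, ← Psi_polyArg_at, BPoly.at,
    MvPolynomial.smul_eval, Complex.conj_ofReal]; rfl

/-- If `a dτ + b dτ̄` is the differential of `r Ψ(𝕀^eqv)` without the coefficients of the connection
in words of full length, its integral exists and is completed to `-r Ψ(𝕀^eqv)` by the completion read
off from the generating series. -/
lemma SeriesData.isReg_of_connection (r : ℝ) (hn : 2 ≤ n) (F : ProjFamily k)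
    (v : Fin n → Fin 2 → ℝ) {a b : ℍ → ℂ}
    (ha : ∀ τ, a τ = -r * (Psi (realArg k v) (conc (D.iEqv τ) (D.omegaPlus τ))
      - Psi (realArg k v) (D.omegaPlus τ)))
    (hb : ∀ τ, b τ = -r * (Psi (realArg k v) (conc (D.omegaPsi τ) (D.iEqv τ))
      - Psi (realArg k v) (D.omegaPsi τ))) :
    IsRegPrimitive a b (regInt a b) ∧ ∀ τ,
      regInt a b τ + (D.completion r (2 * r) k).corr v τ
        = -r * Psi (realArg k v) (D.iEqv τ) := by
  have hC := D.completion_isTypeF r (2 * r) hn F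
  have h1 := (D.hasDD_Psi_iEqv (realArg k v)).const_mul (-r)
  have h2 := ((D.cuspVal_Psi_iEqv (realArg k v)).const_mul (-r)).add
    (CuspVal.const ((D.completion r (2 * r) k).c.at v))
  have h3 : IsRegPrimitive (fun τ => a τ - (1 / 2) * ((D.completion r (2 * r) k).f τ).at v)
      (fun τ => b τ - (1 / 2) * conj (((D.completion r (2 * r) k).g τ).at v))
      (fun τ => -r * Psi (realArg k v) (D.iEqv τ) + (D.completion r (2 * r) k).c.at v) := by
    refine CuspVal.isReg (h2.congr (fun _ => rfl) ?_) ((h1.add (HasDD.const _)).congr (fun _ => rfl)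
      (fun τ => ?_) fun τ => ?_)
    · rw [SeriesData.completion, D.csvPoly_at]; ring
    · rw [ha, D.completion_f_at]; push_cast; ring
    · rw [hb, D.completion_g_at]; push_cast; ring
  have h4 := (h3.add (hC.isReg_intPart v)).congr (fun _ => rfl)
    (a' := a) (b' := b) (fun τ => by ring) (fun τ => by ring)
  refine ⟨h4.regInt, fun τ => ?_⟩
  rw [h4.regInt_eq]
  simp only [Completion.corr, Completion.intPart]
  ring

lemma SeriesData.Psi_omegaPlus_eq_formG (k : EisWt) (v : Fin 2 → ℝ) (τ : ℍ) :
    Psi [(k, (v 0 : ℂ), (v 1 : ℂ))] (D.omegaPlus τ) = 2 * formG k v τ := by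
  rw [D.Psi_singleton_omegaPlus, formG_eq]
  ring

lemma SeriesData.Psi_omegaPsi_eq_formG (k : EisWt) (v : Fin 2 → ℝ) (τ : ℍ) :
    Psi [(k, (v 0 : ℂ), (v 1 : ℂ))] (D.omegaPsi τ) = 2 * conj (formG k v τ) := by
  rw [D.Psi_singleton_omegaPsi, formG_eq]
  simp only [map_mul, map_div₀, map_pow, map_sub, conj_eisB, Complex.conj_ofReal, map_ofNat]
  ring

variable {D} (hD : D.Equivariant)
include hD

/-- In depth two the completed integral is a multiple of the generating series. -/
lemma SeriesData.Equivariant.depthTwo (k₁ k₂ : EisWt) (v : Fin 2 → Fin 2 → ℝ) (τ : ℍ) :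
    intM2 k₁ k₂ (D.completion (-(1 / 16)) (2 * -(1 / 16)) ![k₁, k₂]) v τ
      = (1 / 16) * Psi (realArg ![k₁, k₂] v) (D.iEqv τ) := by
  have hl : realArg ![k₁, k₂] v = [(k₂, (v 1 0 : ℂ), (v 1 1 : ℂ)), (k₁, (v 0 0 : ℂ), (v 0 1 : ℂ))] :=
    rfl
  have h := (D.isReg_of_connection (-(1 / 16)) le_rfl (projTwo ![k₁, k₂]) v
    (a := fun τ => -(1 / 2) * (formG k₁ (v 0) τ * intM1 k₂ (v 1) τ))
    (b := fun τ => -(1 / 2) * (intM1 k₁ (v 0) τ * conj (formG k₂ (v 1) τ)))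
    (fun τ => ?_) (fun τ => ?_)).2 τ
  · rw [intM2, intK2, h]; push_cast; ring
  · rw [hD.intM1_eq, hl, Psi_conc]
    simp only [List.length_cons, List.length_nil, Finset.sum_range_succ, Finset.range_zero,
      Finset.sum_empty, List.take, List.drop, Psi_nil, D.iEqv_nil, D.omegaPlus_nil, map_one,
      map_zero, D.Psi_omegaPlus_eq_formG]
    push_cast
    ring
  · rw [hD.intM1_eq, hl, Psi_conc]
    simp only [List.length_cons, List.length_nil, Finset.sum_range_succ, Finset.range_zero,
      Finset.sum_empty, List.take, List.drop, Psi_nil, D.iEqv_nil, D.omegaPsi_nil, map_one,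
      map_zero, D.Psi_omegaPsi_eq_formG]
    push_cast
    ring

/-- The completions of the double integrals are those read off from the generating series. -/
lemma SeriesData.Equivariant.isDepthTwo_iff (C2 : EisWt → EisWt → Completion 2) :
    D.IsDepthTwo C2 ↔
      C2 = fun k₁ k₂ => D.completion (-(1 / 16)) (2 * -(1 / 16)) ![k₁, k₂] := by
  have hC : ∀ k₁ k₂, (D.completion (-(1 / 16)) (2 * -(1 / 16)) ![k₁, k₂]).IsTypeF
      (projTwo ![k₁, k₂]) := fun k₁ k₂ => D.completion_isTypeF _ _ le_rfl _
  have hE : ∀ k₁ k₂, IsEquivariant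
      (intM2 k₁ k₂ (D.completion (-(1 / 16)) (2 * -(1 / 16)) ![k₁, k₂])) := fun k₁ k₂ γ v τ => by
    rw [hD.depthTwo, hD.depthTwo]
    exact congrArg _ (hD.isEquivariant (by norm_num) ![k₁, k₂] γ v τ)
  have hc : ∀ k₁ k₂, (D.completion (-(1 / 16)) (2 * -(1 / 16)) ![k₁, k₂]).c
      = D.csvPoly (-(1 / 16)) ![k₁, k₂] := fun k₁ k₂ => by
    rw [SeriesData.completion]; push_cast; rfl
  constructor
  · intro h
    funext k₁ k₂
    obtain ⟨h1, h2, h3⟩ := h k₁ k₂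
    refine (isType2_iff.1 h1).eq_of_isEquivariant (hC k₁ k₂) (fun γ v τ => ?_) fun l hl => ?_
    · have e1 := h2 γ v τ
      have e2 := hE k₁ k₂ γ v τ
      simp only [intM2] at e1 e2
      linear_combination e1 - e2
    · have h4 := h3 l.1.1 (by
        have h5 := l.2
        have h6 := k₁.2.2
        have h7 := k₂.2.2
        simp [projTwo] at hl h5
        omega)
      rw [hc]
      exact (transvectL_apply _ _ _ _).trans (h4.trans (transvectL_apply _ _ _ _).symm)
  · rintro rfl k₁ k₂
    exact ⟨isType2_iff.2 (hC k₁ k₂), hE k₁ k₂, fun l _ => by rw [hc]⟩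

/-- The triple integral exists, and it is completed by the generating series. -/
lemma SeriesData.Equivariant.depthThree {C2 : EisWt → EisWt → Completion 2}
    (hC2 : D.IsDepthTwo C2) (k : Fin 3 → EisWt) (v : Fin 3 → Fin 2 → ℝ) :
    IsRegPrimitive (formD3 C2 k v) (formD3bar C2 k v) (intK3 C2 k v) ∧ ∀ τ,
      intM3 C2 k (D.completion (1 / 64) (2 * (1 / 64)) k) v τ = D.betaExpansion k v τ := by
  have hC : ∀ k₁ k₂, C2 k₁ k₂ = D.completion (-(1 / 16)) (2 * -(1 / 16)) ![k₁, k₂] :=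
    fun k₁ k₂ => by rw [(hD.isDepthTwo_iff C2).1 hC2]
  have hl : realArg k v = [(k 2, (v 2 0 : ℂ), (v 2 1 : ℂ)), (k 1, (v 1 0 : ℂ), (v 1 1 : ℂ)),
    (k 0, (v 0 0 : ℂ), (v 0 1 : ℂ))] := rfl
  have hl2 : ∀ i j : Fin 3, realArg ![k i, k j] ![v i, v j]
      = [(k j, (v j 0 : ℂ), (v j 1 : ℂ)), (k i, (v i 0 : ℂ), (v i 1 : ℂ))] := fun i j => rfl
  have h := D.isReg_of_connection (1 / 64) (by norm_num) (projThree k) v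
    (a := formD3 C2 k v) (b := formD3bar C2 k v) (fun τ => ?_) (fun τ => ?_)
  · refine ⟨h.1, fun τ => ?_⟩
    rw [intM3, intK3, h.2, D.betaExpansion_eq]; push_cast; ring
  · rw [formD3, hC, hC, hD.depthTwo, hD.intM1_eq, D.completion_f_at, hl2, hl2, hl, Psi_conc]
    simp only [List.length_cons, List.length_nil, Finset.sum_range_succ, Finset.range_zero,
      Finset.sum_empty, List.take, List.drop, Psi_nil, D.iEqv_nil, D.omegaPlus_nil, map_one,
      map_zero, D.Psi_omegaPlus_eq_formG]
    push_cast
    ring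
  · rw [formD3bar, hC, hC, hD.depthTwo, hD.intM1_eq, D.completion_g_at, hl2, hl2, hl, Psi_conc]
    simp only [List.length_cons, List.length_nil, Finset.sum_range_succ, Finset.range_zero,
      Finset.sum_empty, List.take, List.drop, Psi_nil, D.iEqv_nil, D.omegaPsi_nil, map_one,
      map_zero, D.Psi_omegaPsi_eq_formG]
    push_cast
    ring

end Completed

/-! ### The integrals of the forms in depth three -/

section Explicit

variable (D : SeriesData)

lemma SeriesData.finite_psi_toC (w : List Letter) :
    (Function.support fun b => toC (D.psi b) w).Finite :=
  (D.finite_psi w).subset fun x hx h => hx (by simp [toC, h])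

lemma SeriesData.subst_psi_pair {T : Series ℂ} (hT : T [] = 0) (y z : Letter) :
    subst (fun a => toC (D.psi a)) T [y, z]
      = T [y, z] + ∑ᶠ b, toC (D.psi b) [y, z] * T [b] := by
  have h : ∀ b, conc (toC (D.psi b)) (subst (fun a => toC (D.psi a)) fun u => T (b :: u)) [y, z]
      = toC (D.psi b) [y] * T [b, z] + toC (D.psi b) [y, z] * T [b] := fun b => by
    simp [conc_cons, conc_nil, D.isSubst_psi.nil, D.subst_psi_singleton,
      D.isSubst_psi.subst_nil]
  rw [D.isSubst_psi.subst_peel, hT, zero_mul, zero_add, finsum_congr h, finsum_add_distrib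
    ((D.finite_psi_toC [y]).subset (Function.support_mul_subset_left _ _))
    ((D.finite_psi_toC [y, z]).subset (Function.support_mul_subset_left _ _)),
    finsum_eq_single _ y fun b hb => by simp [toC, D.psi_ne b y hb.symm]]
  simp [toC, D.psi_self]

/-- In words of length three `ψ̂` acts on series without words of length at most one by expanding
a single letter. -/
lemma SeriesData.subst_psi_triple {T : Series ℂ} (hT : ∀ w : List Letter, w.length ≤ 1 → T w = 0)
    (x y z : Letter) :
    subst (fun a => toC (D.psi a)) T [x, y, z] = T [x, y, z]
      + ∑ᶠ b, (toC (D.psi b) [x, y] * T [b, z] + toC (D.psi b) [y, z] * T [x, b]) := by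
  have h : ∀ b, conc (toC (D.psi b)) (subst (fun a => toC (D.psi a)) fun u => T (b :: u)) [x, y, z]
      = toC (D.psi b) [x] * subst (fun a => toC (D.psi a)) (fun u => T (b :: u)) [y, z]
        + toC (D.psi b) [x, y] * T [b, z] := fun b => by
    simp [conc_cons, conc_nil, D.isSubst_psi.nil, D.subst_psi_singleton,
      D.isSubst_psi.subst_nil, hT [b] (by simp)]
  have hs := fun (w : List Letter) (f : Letter → ℂ) => (D.finite_psi_toC w).subset
    (Function.support_mul_subset_left (fun b => toC (D.psi b) w) f)
  rw [D.isSubst_psi.subst_peel, hT [] (by simp), zero_mul, zero_add, finsum_congr h,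
    finsum_add_distrib (hs [x] _) (hs [x, y] _), finsum_add_distrib (hs [x, y] _) (hs [y, z] _),
    finsum_eq_single _ x fun b hb => by simp [toC, D.psi_ne b x hb.symm],
    D.subst_psi_pair (hT [x] (by simp))]
  simp only [toC, D.psi_self, Complex.ofReal_one]
  ring

lemma SeriesData.toC_eMinus_short (d : CuspLetter) (w : List Letter) (hw : w.length ≤ 1) :
    toC ((adE0 (R := ℝ))^[d.2.1] (D.eMinus d.1)) w = 0 := by
  rw [toC, D.isCuspSeries_eMinus.nil d.1 _ w hw, Complex.ofReal_zero]

/-- The coefficient of `W[w]` in the image of `W[x]` under `ψ̂`. -/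
def SeriesData.zeta (w : List Letter) (x : XLetter) : ℂ :=
  (wfac x : ℂ) * D.psiLetter x w / (wordFac w : ℂ)

lemma SeriesData.zeta_inl (w : List Letter) (a : Letter) : D.zeta w (.inl a) = D.chi a w := by
  rw [SeriesData.zeta, D.psiLetter_inl, SeriesData.chi, toC]
  push_cast
  rfl

/-- The coefficients of cuspidal letters in `ψ̂(𝕀̃_-)` are the expression in `η` and `χ` of the
formula for `g`. -/
lemma SeriesData.zeta_inr (x y z : Letter) (d : CuspLetter) :
    D.zeta [x, y, z] (.inr d) = (D.eta d [x, y, z] : ℂ) + ∑ᶠ b : Letter,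
      ((D.eta d [b, z] : ℂ) * (D.chi b [x, y] : ℂ)
        + (D.eta d [x, b] : ℂ) * (D.chi b [y, z] : ℂ)) := by
  have hs := fun (w : List Letter) (f : Letter → ℂ) => (D.finite_psi_toC w).subset
    (Function.support_mul_subset_left (fun b => toC (D.psi b) w) f)
  have hw : ∀ a : Letter, (wfac (.inl a) : ℂ) ≠ 0 := fun a => by exact_mod_cast wfac_ne_zero a
  rw [SeriesData.zeta, SeriesData.psiLetter, SeriesData.cuspSubst,
    D.subst_psi_triple (D.toC_eMinus_short d), mul_add, add_div, mul_div_right_comm,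
    mul_div_right_comm _ (finsum _), mul_finsum' _ _ (((hs [x, y] _).union (hs [y, z] _)).subset
      (Function.support_add _ _))]
  congr 1
  · simp only [SeriesData.eta, toC]
    push_cast
    ring
  · refine finsum_congr fun b => ?_
    have := hw x
    have := hw y
    have := hw z
    have := hw b
    simp only [SeriesData.eta, SeriesData.chi, toC, wordFac, List.map_cons, List.map_nil,
      List.prod_cons, List.prod_nil]
    push_cast
    field_simp

lemma iterIntTilde_singleton_isReg (x : XLetter) :
    IsRegPrimitive (fun _ => 0) (fun τ => (-1) ^ x.idx * conj (kernel x τ)) (iterIntTilde [x]) :=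
  ((iterInt_singleton_isReg x).conj.const_mul ((-1) ^ x.idx)).congr
    (fun τ => by simp [iterIntTilde]) (fun _ => by simp) (fun _ => rfl)

lemma SeriesData.antiholPart_eq (x y z : Letter) (τ : ℍ) :
    D.antiholPart x y z τ = ∑ᶠ a, D.zeta [x, y, z] a * iterIntTilde [a] τ := by
  rw [finsum_sumType]
  · simp only [D.zeta_inl, D.zeta_inr, SeriesData.antiholPart]
    congr 1
    exact finsum_congr fun d => mul_comm _ _
  · exact (D.locFin_psiLetter [x, y, z]).subset fun a ha h => ha (by simp [SeriesData.zeta, h])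

/-- The antiholomorphic part is the integral of `ω_ψ` in words of length three. -/
lemma SeriesData.antiholPart_isReg (x y z : Letter) :
    IsRegPrimitive (fun _ => 0) (fun τ => D.omegaPsi τ [x, y, z] / (wordFac [x, y, z] : ℂ))
      (D.antiholPart x y z) := by
  refine (IsRegPrimitive.finsum (c := D.zeta [x, y, z]) ?_
    iterIntTilde_singleton_isReg).congr (D.antiholPart_eq x y z) (fun _ => by simp) fun τ => ?_
  · exact (D.locFin_psiLetter [x, y, z]).subset fun a ha h => ha (by simp [SeriesData.zeta, h])
  · rw [D.omegaPsi_eq, div_eq_mul_inv, finsum_mul' _ _ ((D.locFin_psiLetter [x, y, z]).subset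
      fun x hx => right_ne_zero_of_mul hx)]
    exact finsum_congr fun a => by rw [SeriesData.zeta, kernelWTilde]; ring

/-- The holomorphic part is the integral of `ω₊`. -/
lemma SeriesData.holPart_isReg {w : List Letter} (hw : 2 ≤ w.length) :
    IsRegPrimitive (fun τ => D.omegaPlus τ w / (wordFac w : ℂ)) (fun _ => 0) (D.holPart w) := by
  have hf := (D.finite_coeffs w).2.1
  refine (IsRegPrimitive.finsum (c := fun d => (D.xi d w : ℂ)) ?_
    fun d => iterInt_singleton_isReg (.inr d)).congr (fun _ => rfl) (fun τ => ?_) fun _ => by simp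
  · exact hf.subset fun d hd h => hd (by simp [h])
  · rw [SeriesData.omegaPlus, finsum_cuspSubst_long _ _ hw, div_eq_mul_inv, finsum_mul']
    · exact finsum_congr fun d => by
        rw [SeriesData.xi, kernelW, toC]; push_cast; ring
    · exact (D.isCuspSeries_ePlus.finite w).subset fun d hd h => hd (by simp [toC, h])

variable (k : Fin 3 → EisWt) (v : Fin 3 → Fin 2 → ℝ)

lemma revWord_three (j : ∀ i, Fin ((k i).1 - 1)) :
    revWord k j = [⟨k 2, j 2⟩, ⟨k 1, j 1⟩, ⟨k 0, j 0⟩] := rfl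

lemma SeriesData.sum_basisPoly_div (S : Series ℂ) :
    ∑ j : ∀ i, Fin ((k i).1 - 1), (basisPoly k j).at v * (S (revWord k j)
      / (wordFac (revWord k j) : ℂ)) = Psi (realArg k v) S := by
  rw [sum_basisPoly_at k (fun w => S w / (wordFac w : ℂ))]
  congr 1
  funext w
  exact mul_div_cancel₀ _ (by exact_mod_cast wordFac_ne_zero w)

lemma SeriesData.regInt_completion_f (r s : ℝ) (τ : ℍ) :
    regInt (fun t => ((D.completion r s k).f t).at v) 0 τ
      = s * ∑ j : ∀ i, Fin ((k i).1 - 1), (basisPoly k j).at v *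
        D.holPart [⟨k 2, j 2⟩, ⟨k 1, j 1⟩, ⟨k 0, j 0⟩] τ := by
  have h := ((IsRegPrimitive.sum Finset.univ fun j _ => (D.holPart_isReg
    (w := revWord k j) (by simp [revWord_three])).const_mul ((basisPoly k j).at v)).const_mul
      (s : ℂ)).congr (a' := fun t => ((D.completion r s k).f t).at v) (b' := 0) (fun _ => rfl)
    (fun τ => by rw [D.completion_f_at, SeriesData.sum_basisPoly_div]) (fun _ => by simp)
  rw [h.regInt_eq]
  rfl

lemma SeriesData.regInt_completion_g (r s : ℝ) (τ : ℍ) :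
    regInt 0 (fun t => conj (((D.completion r s k).g t).at v)) τ
      = s * ∑ j : ∀ i, Fin ((k i).1 - 1), (basisPoly k j).at v *
        D.antiholPart ⟨k 2, j 2⟩ ⟨k 1, j 1⟩ ⟨k 0, j 0⟩ τ := by
  have h := ((IsRegPrimitive.sum Finset.univ fun j _ => (D.antiholPart_isReg
    ⟨k 2, j 2⟩ ⟨k 1, j 1⟩ ⟨k 0, j 0⟩).const_mul ((basisPoly k j).at v)).const_mul
      (s : ℂ)).congr (a' := 0) (b' := fun t => conj (((D.completion r s k).g t).at v))
    (fun _ => rfl) (fun _ => by simp)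
    (fun τ => by rw [D.completion_g_at, ← SeriesData.sum_basisPoly_div]; rfl)
  rw [h.regInt_eq]

end Explicit

/-! ### Characterisations of the completion in depth three -/

section Final

variable {D : SeriesData} (hD : D.Equivariant) {C2 : EisWt → EisWt → Completion 2}
  (hC2 : D.IsDepthTwo C2) (k : Fin 3 → EisWt)
include hD hC2

/-- The integral `K_{k₁,k₂,k₃}` is common to all completions, so that equality with the expansion
fixes the correction. -/
lemma SeriesData.Equivariant.eq_completion_of_betaExpansion {C : Completion 3}
    (hC : C.IsTypeF (projThree k)) (h : ∀ v τ, intM3 C2 k C v τ = D.betaExpansion k v τ) :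
    C = D.completion (1 / 64) (2 * (1 / 64)) k := by
  refine hC.eq_of_corr (D.completion_isTypeF _ _ (by norm_num) _) fun v τ => ?_
  have e := (h v τ).trans ((hD.depthThree hC2 k v).2 τ).symm
  exact add_left_cancel e

/-- The preferred completion in depth three is the one read off from the generating series. -/
lemma SeriesData.Equivariant.isDepthThree_iff {C : Completion 3}
    (hC : C.IsTypeF (projThree k)) :
    D.IsDepthThree C2 k C ↔ C = D.completion (1 / 64) (2 * (1 / 64)) k := by
  have hE : IsEquivariant (intM3 C2 k (D.completion (1 / 64) (2 * (1 / 64)) k)) := fun γ v τ => by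
    rw [(hD.depthThree hC2 k _).2, (hD.depthThree hC2 k _).2, D.betaExpansion_eq,
      D.betaExpansion_eq]
    exact congrArg _ (hD.isEquivariant le_rfl k γ v τ)
  have hc : (D.completion (1 / 64) (2 * (1 / 64)) k).c = D.csvPoly (1 / 64) k := by
    rw [SeriesData.completion]; push_cast; rfl
  constructor
  · rintro ⟨h1, h2⟩
    refine hC.eq_of_isEquivariant (D.completion_isTypeF _ _ (by norm_num) _) (fun γ v τ => ?_)
      fun l hl => ?_
    · have e1 := h1 γ v τ
      have e2 := hE γ v τ
      simp only [intM3] at e1 e2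
      linear_combination e1 - e2
    · have h4 := h2 l.1.1.1 l.1.2.1 (by
        have h5 := (k 0).2.2
        have h6 := (k 1).2.2
        have h7 := (k 2).2.2
        have h8 := l.1.1.2
        have h9 := l.1.2.2
        have h10 := l.2
        simp [projThree] at hl
        omega)
      rw [hc, projThree_apply, projThree_apply, h4]
  · rintro rfl
    exact ⟨hE, fun _ _ _ => by rw [hc]⟩

end Final

end EqvInt

end

open EqvInt in
theorem mainTheorem5 (D : SeriesData) (hD : D.Equivariant) :
    (∀ w : List Letter, {a | D.chi a w ≠ 0}.Finite ∧ {d | D.xi d w ≠ 0}.Finite ∧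
      {d | D.eta d w ≠ 0}.Finite) ∧
    (∃ C2, D.IsDepthTwo C2) ∧
    ∀ C2 : EisWt → EisWt → Completion 2, D.IsDepthTwo C2 → ∀ k : Fin 3 → EisWt,
      (∀ v, IsRegPrimitive (formD3 C2 k v) (formD3bar C2 k v) (intK3 C2 k v)) ∧
      (∃! C : Completion 3, C.IsType3 k ∧ D.IsDepthThree C2 k C) ∧
      ∀ C : Completion 3, C.IsType3 k →
        (D.IsDepthThree C2 k C ↔ ∀ v τ, intM3 C2 k C v τ = D.betaExpansion k v τ) ∧
        ((∀ v τ, intM3 C2 k C v τ = D.betaExpansion k v τ) ↔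
          C.c = D.csvPoly (1 / 64) k ∧
          (∀ v τ, regInt 0 (fun t => conj ((C.g t).at v)) τ =
            (1 / 32) * ∑ j : ∀ i, Fin ((k i).1 - 1), (basisPoly k j).at v *
              D.antiholPart ⟨k 2, j 2⟩ ⟨k 1, j 1⟩ ⟨k 0, j 0⟩ τ) ∧
          (∀ v τ, regInt (fun t => (C.f t).at v) 0 τ =
            (1 / 32) * ∑ j : ∀ i, Fin ((k i).1 - 1), (basisPoly k j).at v *
              D.holPart [⟨k 2, j 2⟩, ⟨k 1, j 1⟩, ⟨k 0, j 0⟩] τ)) := by 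
  refine ⟨D.finite_coeffs, ⟨_, (hD.isDepthTwo_iff _).2 rfl⟩, fun C2 hC2 k => ?_⟩
  have hT := D.completion_isTypeF (1 / 64) (2 * (1 / 64)) (k := k) (by norm_num) (projThree k)
  have hB := fun v => (hD.depthThree hC2 k v).2
  refine ⟨fun v => (hD.depthThree hC2 k v).1,
    ⟨_, ⟨isType3_iff.2 hT, (hD.isDepthThree_iff hC2 k hT).2 rfl⟩,
      fun C h => (hD.isDepthThree_iff hC2 k (isType3_iff.1 h.1)).1 h.2⟩, fun C hC => ?_⟩
  have hC' := isType3_iff.1 hC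
  have hβ : (∀ v τ, intM3 C2 k C v τ = D.betaExpansion k v τ) ↔
      C = D.completion (1 / 64) (2 * (1 / 64)) k :=
    ⟨hD.eq_completion_of_betaExpansion hC2 k hC', fun h => h ▸ hB⟩
  have hc : (D.completion (1 / 64) (2 * (1 / 64)) k).c = D.csvPoly (1 / 64) k := by
    rw [SeriesData.completion]; push_cast; rfl
  have h32 : ((2 * (1 / 64) : ℝ) : ℂ) = 1 / 32 := by push_cast; norm_num
  refine ⟨(hD.isDepthThree_iff hC2 k hC').trans hβ.symm, hβ.trans ⟨?_, fun ⟨h1, h2, h3⟩ => ?_⟩⟩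
  · rintro rfl
    exact ⟨hc, fun v τ => by rw [D.regInt_completion_g, h32],
      fun v τ => by rw [D.regInt_completion_f, h32]⟩
  · refine hC'.eq_of_corr hT fun v τ => ?_
    simp only [Completion.corr]
    rw [h1, hc, h2, h3, D.regInt_completion_g, D.regInt_completion_f, h32]
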